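/- **Theorem 4.4.** Let $q$ be a positive integer and let $\alpha,\beta$ be real numbers with $\beta-\alpha>\frac12$. Let $f:\mathbb{Z}_{>0}\to\mathbb{C}$ be a multiplicative function such that $f(p)=p^{-\alpha}+O(p^{-\beta})$ for all primes $p$ coprime to $q$. Here $p$ always denotes a prime, $O^*(B)$ denotes a quantity of absolute value at most $B$, $\mu$ is the Möbius function, $\gamma$ is Euler's constant, $\varphi$ is Euler's function, and for real $s$ and integers $n\ge 1$ $$\varphi_s(n)=n^s\prod_{p\mid n}\Bigl(1-\frac1{p^s}\Bigr),\qquad \kappa_s(n)=n^s\prod_{p\mid n}\Bigl(1+\frac1{p^s}\Bigr),\qquad \kappa=\kappa_1 .$$ Put $$\mathrm p_\alpha(q)=\prod_{p\mid q}\Bigl(1+\frac{1-|f(p)p^\alpha-1|}{\sqrt p-1+|f(p)p^\alpha-1|}\Bigr),\qquad \mathrm P_\alpha=\prod_{p}\Bigl(1+\frac{|f(p)p^\alpha-1|}{\sqrt p-1}\Bigr).$$ For $v\in\{1,2\}$ let $\mathrm D_1=0.43$, $\mathrm D_2=0.12$, $\mathrm E_1^{(1)}=1.044$, $\mathrm E_1^{(2)}=0.232$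 and, for $a>\frac12$, $a\ne1$, $$\mathrm E_a^{(v)}=\max\Bigl\{\mathrm D_v\Bigl(1+\tfrac{|a-1|}{a-\frac12}\Bigr),\ \tfrac{\varphi_{1/2}(v)}{\sqrt v}\Bigl|\tfrac{v^a}{\kappa_a(v)}\tfrac{\zeta(a)}{\zeta(2a)}-\tfrac{v}{\kappa(v)}\tfrac{6}{(a-1)\pi^2}\Bigr|,\ \tfrac{\varphi_{1/2}(v)}{\sqrt v}\tfrac{|a-1|}{a-\frac12}\Bigl(\tfrac{3\kappa_a(v)\zeta(2a)}{(a-\frac12)v^{a-1}\kappa(v)\pi^2|\zeta(a)(a-1)|}\Bigr)^{\frac{2}{a-1}}\Bigr\}.$$ For $a>\frac12$ let $\mathrm w(a)=\mathrm E_a^{(2)}$ if $2\mid q$, and, if $2\nmid q$, $$\mathrm w(a)=\frac{\sqrt2-1}{\sqrt2-1+|2^\alpha f(2)-1|}\Bigl(\mathrm E_a^{(1)}+\frac{|2^\alpha f(2)-1|\,\mathrm E_a^{(2)}}{\varphi_{1/2}(2)}\Bigr).$$ Let $h$ be the multiplicative function with $h(p)=f(p)p^\alpha-1$, $h(p^2)=-f(p)p^\alpha$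 for $p\nmid q$, and $h(p^k)=0$ if $k>2$ or $p\mid q$. The product $\mathrm P_\alpha$ converges, and so do all the other products and series below, in the cases in which they are used. Moreover: **(A)** If $\alpha>\frac12$, then for all $X>0$ $$\sum_{\substack{\ell\le X\\(\ell,q)=1}}\mu^2(\ell)f(\ell)=F_\alpha^q(X)+O^*\Bigl(\mathrm p_\alpha(q)\,\frac{\mathrm w(\alpha)\,\mathrm P_\alpha}{X^{\alpha-\frac12}}\Bigr),$$ where, with $H(s)=\prod_{p\nmid q}\bigl(1-\frac{1-f(p)p^\alpha}{p^{s+\alpha}}-\frac{f(p)}{p^{2s+\alpha}}\bigr)$, $$F_\alpha^q(X)=\frac{H(0)\zeta(\alpha)\varphi_\alpha(q)}{q^\alpha}-\frac{H(1-\alpha)\varphi(q)}{(\alpha-1)q}\frac1{X^{\alpha-1}}\qquad(\alpha\ne1),$$ $$F_1^q(X)=\frac{H(0)\varphi(q)}{q}\Bigl(\log X+\sum_{p\nmid q}\frac{\log p\,(1-(p-2)f(p))}{(f(p)+1)(p-1)}+\gamma+\sum_{p\mid q}\frac{\log p}{p-1}\Bigr)$$ if $f(p)\ne-1$ for every $p\nmid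 q$, and $F_1^q(X)=-\frac{\varphi(q)}{q}\sum_{d\ge1}\frac{h(d)\log d}{d}$ if $f(p)=-1$ for some $p\nmid q$. **(B)** If $\alpha<\frac12$, then for all $X>0$ $$\sum_{\substack{\ell\le X\\(\ell,q)=1}}\mu^2(\ell)f(\ell)=\frac{H'\varphi(q)}{(1-\alpha)q}X^{1-\alpha}+O^*\Bigl(\mathrm p_\alpha(q)\Bigl(1+\frac{2-2\alpha}{1-2\alpha}\Bigr)\mathrm w(1)\,\mathrm P_\alpha\,X^{\frac12-\alpha}\Bigr),$$ where, for $\alpha\le\frac12$, $H'=\prod_{p\nmid q}\bigl(1-\frac{p^{1-\alpha}-f(p)p+f(p)}{p^{2-\alpha}}\bigr)$. **(C)** If $\alpha=\frac12$, then for all $X\ge1$ $$\sum_{\substack{\ell\le X\\(\ell,q)=1}}\mu^2(\ell)f(\ell)=\frac{H'\varphi(q)}{(1-\alpha)q}X^{1-\alpha}+O^*\Bigl(\mathrm C+\mathrm p_\alpha(q)\,\mathrm w(1)\,\mathrm P_\alpha\bigl(1+\tfrac12\log X\bigr)\Bigr),$$ where $$\mathrm C=\Bigl|\frac{H'\varphi(q)}{q}\Bigl(\sum_{p\nmid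 q}\frac{\log p\,(\sqrt p-(p-2)f(p))}{(f(p)+\sqrt p)(p-1)}+\gamma+\sum_{p\mid q}\frac{\log p}{p-1}-2\Bigr)\Bigr|$$ if $f(p)\neq-\sqrt p$ for every $p\nmid q$, and $\mathrm C=\bigl|\frac{\varphi(q)}{q}\sum_{d\ge1}\frac{h(d)\log d}{d}\bigr|$ otherwise. -/

import Mathlib

namespace SquarefreeAverage

noncomputable section

/-- The primes that do not divide `q`. -/
abbrev PrimesNotDvd (q : ℕ) : Type := {p : ℕ // p.Prime ∧ ¬ p ∣ q}

/-- The sum of `μ²(ℓ) f(ℓ)` over the positive integers `ℓ ≤ X` coprime to `q`. -/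
def sqfreeSum (f : ArithmeticFunction ℂ) (q : ℕ) (X : ℝ) : ℂ :=
  ∑ ℓ ∈ (Finset.Icc 1 ⌊X⌋₊).filter (fun ℓ => ℓ.Coprime q),
    ((ArithmeticFunction.moebius ℓ : ℤ) : ℂ) ^ 2 * f ℓ

/-- The generalized Euler function `φ_s(q) = q ^ s ∏_{p ∣ q} (1 - p ^ (-s))`. -/
def phiGen (s : ℝ) (q : ℕ) : ℝ :=
  (q : ℝ) ^ s * ∏ p ∈ q.primeFactors, (1 - 1 / (p : ℝ) ^ s)

/-- The Kappa function `κ_s(q) = q ^ s ∏_{p ∣ q} (1 + p ^ (-s))`. -/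
def kappaGen (s : ℝ) (q : ℕ) : ℝ :=
  (q : ℝ) ^ s * ∏ p ∈ q.primeFactors, (1 + 1 / (p : ℝ) ^ s)

/-- The Riemann zeta function at a real point `s ≠ 1`, where its value is real. -/
def zetaReal (s : ℝ) : ℝ := (riemannZeta (s : ℂ)).re

/-- The deviation `|f(p) p ^ α - 1|`. -/
def dev (f : ArithmeticFunction ℂ) (α : ℝ) (p : ℕ) : ℝ :=
  ‖f p * (((p : ℝ) ^ α : ℝ) : ℂ) - 1‖

/-- The numerical constants `D_1 = 0.43` and `D_2 = 0.12`. -/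
def constD (v : ℕ) : ℝ := if v = 1 then 0.43 else 0.12

/-- The constants `E_α^{(v)}`, for `v ∈ {1, 2}`, including
`E_1^{(1)} = 1.044` and `E_1^{(2)} = 0.232`. -/
def constE (α : ℝ) (v : ℕ) : ℝ :=
  if α = 1 then (if v = 1 then 1.044 else 0.232)
  else
    max (constD v * (1 + |α - 1| / (α - 1 / 2)))
      (max
        (phiGen (1 / 2) v / √(v : ℝ) *
          |(v : ℝ) ^ α / kappaGen α v * (zetaReal α / zetaReal (2 * α))
            - (v : ℝ) / kappaGen 1 v * (6 / ((α - 1) * Real.pi ^ 2))|)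
        (phiGen (1 / 2) v / √(v : ℝ) * (|α - 1| / (α - 1 / 2)) *
          (3 * kappaGen α v * zetaReal (2 * α) /
            ((α - 1 / 2) * (v : ℝ) ^ (α - 1) * kappaGen 1 v * Real.pi ^ 2
              * |zetaReal α * (α - 1)|)) ^ (2 / (α - 1))))

/-- The factors, at the primes `p ∤ q`, of the Euler product `H_f^q(s)`. -/
def eulerFactorH (f : ArithmeticFunction ℂ) (α : ℝ) (q : ℕ) (s : ℝ) (p : PrimesNotDvd q) : ℂ :=
  1 - (1 - f p.1 * (((p.1 : ℝ) ^ α : ℝ) : ℂ)) / (((p.1 : ℝ) ^ (s + α) : ℝ) : ℂ)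
    - f p.1 / (((p.1 : ℝ) ^ (2 * s + α) : ℝ) : ℂ)

/-- The Euler product `H_f^q(s)`. -/
def eulerH (f : ArithmeticFunction ℂ) (α : ℝ) (q : ℕ) (s : ℝ) : ℂ :=
  ∏' p : PrimesNotDvd q, eulerFactorH f α q s p

/-- The multiplicative function `h_f^q`, supported on cube-free integers coprime to `q`, with
`h(p) = f(p) p ^ α - 1` and `h(p ^ 2) = - f(p) p ^ α`. -/
def hCoeff (f : ArithmeticFunction ℂ) (α : ℝ) (q d : ℕ) : ℂ :=
  if d.Coprime q then
    d.factorization.prod (fun p k =>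
      if k = 1 then f p * (((p : ℝ) ^ α : ℝ) : ℂ) - 1
      else if k = 2 then -(f p * (((p : ℝ) ^ α : ℝ) : ℂ))
      else 0)
  else 0

/-- The terms `h_f^q(d) log d / d` (the term at `d = 0` is `0`). -/
def logTerm (f : ArithmeticFunction ℂ) (α : ℝ) (q d : ℕ) : ℂ :=
  hCoeff f α q d * (Real.log d : ℂ) / (d : ℂ)

/-- The terms of the series `T_f^q`. -/
def termT (f : ArithmeticFunction ℂ) (q : ℕ) (p : PrimesNotDvd q) : ℂ :=
  (Real.log p.1 : ℂ) * (1 - ((p.1 : ℂ) - 2) * f p.1) / ((f p.1 + 1) * ((p.1 : ℂ) - 1))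

/-- The sum of `log p / (p - 1)` over the primes `p ∣ q`. -/
def logSumDvd (q : ℕ) : ℝ := ∑ p ∈ q.primeFactors, Real.log p / ((p : ℝ) - 1)

open Classical in
/-- The main term `F_α^q(X)` for `α > 1/2`. -/
def mainTerm (f : ArithmeticFunction ℂ) (α : ℝ) (q : ℕ) (X : ℝ) : ℂ :=
  if α = 1 then
    if ∃ p : PrimesNotDvd q, f p.1 = -1 then
      -((q.totient : ℂ) / (q : ℂ)) * ∑' d : ℕ, logTerm f 1 q d
    else
      eulerH f 1 q 0 * (q.totient : ℂ) / (q : ℂ) *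
        ((Real.log X : ℂ) + (∑' p : PrimesNotDvd q, termT f q p)
          + (Real.eulerMascheroniConstant : ℂ) + (logSumDvd q : ℂ))
  else
    eulerH f α q 0 * riemannZeta (α : ℂ) * (phiGen α q : ℂ) / (((q : ℝ) ^ α : ℝ) : ℂ)
      - eulerH f α q (1 - α) * (q.totient : ℂ) / (((α : ℂ) - 1) * (q : ℂ))
        * (1 / ((X ^ (α - 1) : ℝ) : ℂ))

/-- The finite product `p_α(q)`. -/
def prodDvd (f : ArithmeticFunction ℂ) (α : ℝ) (q : ℕ) : ℝ :=
  ∏ p ∈ q.primeFactors, (1 + (1 - dev f α p) / (√(p : ℝ) - 1 + dev f α p))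

/-- The factors, at all primes, of the product `P_α`. -/
def factorP (f : ArithmeticFunction ℂ) (α : ℝ) (p : Nat.Primes) : ℝ :=
  1 + dev f α (p : ℕ) / (√((p : ℕ) : ℝ) - 1)

/-- The infinite product `P_α`. -/
def prodP (f : ArithmeticFunction ℂ) (α : ℝ) : ℝ := ∏' p : Nat.Primes, factorP f α p

/-- The weight built from `|2 ^ α f(2) - 1|` and the constants `E_a^{(1)}`, `E_a^{(2)}`: it is
`w_α^q` for `a = α`, and `w'_α^q` for `a = 1`. -/
def weight (a : ℝ) (f : ArithmeticFunction ℂ) (α : ℝ) (q : ℕ) : ℝ :=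
  if 2 ∣ q then constE a 2
  else
    (√2 - 1) / (√2 - 1 + dev f α 2) *
      (constE a 1 + dev f α 2 * constE a 2 / phiGen (1 / 2) 2)

/-- The factors of the Euler product `H_{f'}^q(0)`. -/
def eulerFactorH' (f : ArithmeticFunction ℂ) (α : ℝ) (q : ℕ) (p : PrimesNotDvd q) : ℂ :=
  1 - ((((p.1 : ℝ) ^ (1 - α) : ℝ) : ℂ) - f p.1 * (p.1 : ℂ) + f p.1)
    / (((p.1 : ℝ) ^ (2 - α) : ℝ) : ℂ)

/-- The Euler product `H_{f'}^q(0)`. -/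
def eulerH' (f : ArithmeticFunction ℂ) (α : ℝ) (q : ℕ) : ℂ :=
  ∏' p : PrimesNotDvd q, eulerFactorH' f α q p

/-- The main term `H_{f'}^q(0) φ(q) / ((1 - α) q) X ^ (1 - α)` for `α ≤ 1/2`. -/
def mainTerm' (f : ArithmeticFunction ℂ) (α : ℝ) (q : ℕ) (X : ℝ) : ℂ :=
  eulerH' f α q * (q.totient : ℂ) / ((1 - (α : ℂ)) * (q : ℂ)) * ((X ^ (1 - α) : ℝ) : ℂ)

/-- The terms of the series over `p ∤ q` in the constant `C`. -/
def termC (f : ArithmeticFunction ℂ) (q : ℕ) (p : PrimesNotDvd q) : ℂ :=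
  (Real.log p.1 : ℂ) * ((√(p.1 : ℝ) : ℂ) - ((p.1 : ℂ) - 2) * f p.1)
    / ((f p.1 + (√(p.1 : ℝ) : ℂ)) * ((p.1 : ℂ) - 1))

open Classical in
/-- The constant `C` for `α = 1/2`. If `f(p) = -√p` for some prime `p ∤ q`, the product
`H_{f'}^q(0)` vanishes and the series is undefined; the value is then the constant term of the
average of `f'(p) = f(p) / √p`, as in the corresponding case of `mainTerm` (the functions `h`
attached to `f'` with exponent `1` and to `f` with exponent `1/2` are the same). -/
def constC (f : ArithmeticFunction ℂ) (q : ℕ) : ℝ :=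
  if ∃ p : PrimesNotDvd q, f p.1 = -(√(p.1 : ℝ) : ℂ) then
    ‖(q.totient : ℂ) / (q : ℂ) * ∑' d : ℕ, logTerm f (1 / 2) q d‖
  else
    ‖eulerH' f (1 / 2) q * (q.totient : ℂ) / (q : ℂ) *
      ((∑' p : PrimesNotDvd q, termC f q p) + (Real.eulerMascheroniConstant : ℂ)
        + (logSumDvd q : ℂ) - 2)‖

end

end SquarefreeAverage

open SquarefreeAverage

/-!
The theorem compares `μ ^ 2 f`, on the integers coprime to `q`, with the indicator function of the
squarefree integers. Write `F(p) = f(p) p ^ α` for `p ∤ q` and `F(p) = 0` for `p ∣ q` (`liftF`). The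
hypothesis gives `∑ |F(p) - 1| / √p < ∞` (`summable_dev`, `summable_liftF`), so everything that
measures the difference between `μ ^ 2 F` and `μ ^ 2` converges absolutely at the exponent `1 / 2`.

*The base case.* For `v ∈ {1, 2}` the sum of `ℓ ^ (-a)` over the squarefree `ℓ ≤ X` coprime to `v` has
an error term of size at most `baseW a v * X ^ (1 / 2 - a)`, for all `X > 0` (`abs_powErr_le`,
`abs_sqErr_le_baseW`). The explicit constants are the hard part. Everything comes down to `a = 1`,
namely to `√X |E(X)| ≤ 0.43` for `v = 1`, `X ≥ 2`, and `√X |E(X)| ≤ 0.4097` for `v = 2`, `X ≥ 1`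
(`sqErr_one_le`, `sqErr_two_le`). Opening `μ ^ 2(ℓ)` as the sum of `μ(d)` over `d ^ 2 ∣ ℓ`, one is left
with the errors in harmonic sums, which are elementary, and with the tail beyond `y = √X` of a series
`∑ μ(d) (c + 2 log (y / d)) / d ^ 2` (`abs_sqErr_le`). For `y < 5000` the tail is evaluated by a
fixed-point computation in the kernel of Lean, verified in `exists_of_scan`. For larger `y` one uses
an integer combination `e` of dilations of the constant function (or of the indicator function of the
odd integers) that has bounded partial sums and for which `μ ∗ e` has finite support. It turns the
tail into a sum of `μ(d) / d ^ 2` times a kernel at `y / d` that decays like `(y / d) ^ (-2)`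
(`tailT_eq_neg_sum`, `abs_tailKer_le`), and this is small enough. For general `a > 1 / 2`, partial
summation from infinity expresses the error term by `E`. The main term is identified with values of
the zeta function by continuing `∑ μ ^ 2(ℓ) ℓ ^ (-s)` to `Re s > 1 / 2` with the integral of
`E(t) t ^ (-s)` (`sqPoly_mul`). The range of small `X`, where the sum has at most one term, is treated
by calculus.

*The general case.* Let `u` be the function with the value `F(2)` at `2` and equal to `μ ^ 2` at the
powers of odd primes. Then `μ ^ 2 F = g ∗ u`, where `g(p ^ k) = ± (F(p) - 1)` for odd `p`
(`mulArith_sqPow_eq`). The error term for `u` is a combination of the ones for `v = 1` and `v = 2`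
(`norm_twist_le`), and the convolution multiplies it by `∑ |g(d)| d ^ (-1 / 2)`
(`norm_sumPow_mul_sub_le`). This sum is an Euler product, and the result is the constant in the theorem
(`errW_mul_tsum`). The main terms for `u`, summed against `g`, are values of `G(s) U(s)`, where `G` and
`(s - 1)⁻¹ U` are the Dirichlet series of `g` and `u`. Since this is also `(s - 1) ζ(s)` times the
series of `h` and the Euler factors at the primes `p ∣ q` (`lseries_gPow_mul_poly`), they take the
form in the theorem. For `α = 1` the constant term contains a derivative at `s = 1`; it is the
logarithmic derivative of an Euler product, unless a factor vanishes, in which case it is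
a multiple of `∑ h(d) log d / d` (`kConst_of_ne`, `kConst_of_eq`). The case `α ≤ 1 / 2` follows from the estimate
with exponent `1` by partial summation (`norm_sum_mul_rpow_sub_le`, `norm_sum_mul_sqrt_sub_le`).
-/

namespace SquarefreeAverage

noncomputable section

open Finset Filter Topology

/-! ### Harmonic sums over the integers coprime to `v ∈ {1, 2}` -/

/-- The trapezoidal rule for `1 / t` on `[x, x + 1]` overestimates the integral, by convexity. -/
lemma log_one_add_inv_le {x : ℝ} (hx : 0 < x) :
    Real.log (x + 1) - Real.log x ≤ (1 / x + 1 / (x + 1)) / 2 := by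
  let g : ℝ → ℝ := fun x => (Real.log (x + 1) - Real.log x) - (1 / x + 1 / (x + 1)) / 2
  have hd : ∀ y ∈ Set.Ioi (0 : ℝ),
      HasDerivAt g ((1 / (y + 1) - 1 / y) - (-1 / y ^ 2 + -1 / (y + 1) ^ 2) / 2) y := by
    intro y hy
    have hy : 0 < y := hy
    have h1 : HasDerivAt (fun y : ℝ => y + 1) 1 y := (hasDerivAt_id y).add_const 1
    have h2 := h1.log (by positivity)
    have h3 := Real.hasDerivAt_log hy.ne'
    have h4 := (hasDerivAt_id y).inv hy.ne'
    have h5 := h1.inv (by positivity)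
    have h := (h2.sub h3).sub ((h4.add h5).div_const 2)
    refine (h.congr_deriv ?_).congr_of_eventuallyEq ?_
    · simp
    · exact Eventually.of_forall fun z => by simp [g]
  have hmono : MonotoneOn g (Set.Ioi 0) := by
    refine monotoneOn_of_deriv_nonneg (convex_Ioi 0)
      (fun y hy => (hd y hy).continuousAt.continuousWithinAt) ?_ ?_
    · intro y hy
      rw [interior_Ioi] at hy
      exact (hd y hy).differentiableAt.differentiableWithinAt
    · intro y hy
      rw [interior_Ioi] at hy
      rw [(hd y hy).deriv]
      have hy : 0 < y := hy
      have : (1 / (y + 1) - 1 / y) - (-1 / y ^ 2 + -1 / (y + 1) ^ 2) / 2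
          = 1 / (2 * y ^ 2 * (y + 1) ^ 2) := by field_simp; ring
      rw [this]; positivity
  have hlim : Tendsto g atTop (𝓝 0) := by
    have h1 : Tendsto (fun x : ℝ => Real.log (x + 1) - Real.log x) atTop (𝓝 0) :=
      Real.tendsto_log_comp_add_sub_log 1
    have h2 : Tendsto (fun x : ℝ => 1 / x) atTop (𝓝 0) := by
      simpa using tendsto_inv_atTop_zero (𝕜 := ℝ)
    have h3 : Tendsto (fun x : ℝ => 1 / (x + 1)) atTop (𝓝 0) :=
      h2.comp (tendsto_atTop_add_const_right _ 1 tendsto_id)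
    simpa [g] using h1.sub ((h2.add h3).div_const 2)
  have := ge_of_tendsto hlim (b := g x) (by
    filter_upwards [eventually_ge_atTop x] with z hz
    exact hmono hx (hx.trans_le hz) hz)
  simp only [g] at this
  linarith

/-- The trapezoidal rule with the next term of the Euler-Maclaurin formula. -/
lemma le_log_one_add_inv {x : ℝ} (hx : 0 < x) :
    (1 / x + 1 / (x + 1)) / 2 - (1 / x ^ 2 - 1 / (x + 1) ^ 2) / 12
      ≤ Real.log (x + 1) - Real.log x := by
  let g : ℝ → ℝ := fun x => (Real.log (x + 1) - Real.log x) - (1 / x + 1 / (x + 1)) / 2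
    + (1 / x ^ 2 - 1 / (x + 1) ^ 2) / 12
  have hd : ∀ y ∈ Set.Ioi (0 : ℝ),
      HasDerivAt g ((1 / (y + 1) - 1 / y) - (-1 / y ^ 2 + -1 / (y + 1) ^ 2) / 2
        + (-2 / y ^ 3 - -2 / (y + 1) ^ 3) / 12) y := by
    intro y hy
    have hy : 0 < y := hy
    have h1 : HasDerivAt (fun y : ℝ => y + 1) 1 y := (hasDerivAt_id y).add_const 1
    have h2 := h1.log (by positivity)
    have h3 := Real.hasDerivAt_log hy.ne'
    have h4 := (hasDerivAt_id y).inv hy.ne'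
    have h5 := h1.inv (by positivity)
    have h6 := (((hasDerivAt_id y).pow 2).inv (by simp; positivity)).sub
      ((h1.pow 2).inv (by simp; positivity))
    have h := ((h2.sub h3).sub ((h4.add h5).div_const 2)).add (h6.div_const 12)
    refine (h.congr_deriv ?_).congr_of_eventuallyEq ?_
    · simp
      field_simp
    · exact Eventually.of_forall fun z => by simp [g]
  have hmono : AntitoneOn g (Set.Ioi 0) := by
    refine antitoneOn_of_deriv_nonpos (convex_Ioi 0)
      (fun y hy => (hd y hy).continuousAt.continuousWithinAt) ?_ ?_
    · intro y hy
      rw [interior_Ioi] at hy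
      exact (hd y hy).differentiableAt.differentiableWithinAt
    · intro y hy
      rw [interior_Ioi] at hy
      rw [(hd y hy).deriv]
      have hy : 0 < y := hy
      have : (1 / (y + 1) - 1 / y) - (-1 / y ^ 2 + -1 / (y + 1) ^ 2) / 2
          + (-2 / y ^ 3 - -2 / (y + 1) ^ 3) / 12
          = - (1 / (6 * y ^ 3 * (y + 1) ^ 3)) := by field_simp; ring
      rw [this]
      have : 0 ≤ 1 / (6 * y ^ 3 * (y + 1) ^ 3) := by positivity
      linarith
  have hlim : Tendsto g atTop (𝓝 0) := by
    have h1 : Tendsto (fun x : ℝ => Real.log (x + 1) - Real.log x) atTop (𝓝 0) :=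
      Real.tendsto_log_comp_add_sub_log 1
    have h2 : Tendsto (fun x : ℝ => 1 / x) atTop (𝓝 0) := by
      simpa using tendsto_inv_atTop_zero (𝕜 := ℝ)
    have h3 : Tendsto (fun x : ℝ => 1 / (x + 1)) atTop (𝓝 0) :=
      h2.comp (tendsto_atTop_add_const_right _ 1 tendsto_id)
    have := (h1.sub ((h2.add h3).div_const 2)).add (((h2.pow 2).sub (h3.pow 2)).div_const 12)
    simpa [g] using this
  have := le_of_tendsto hlim (b := g x) (by
    filter_upwards [eventually_ge_atTop x] with z hz
    exact hmono hx (hx.trans_le hz) hz)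
  simp only [g] at this
  linarith

/-- The deviation `∑_{i ≤ j} 1 / (v i + 1) - (log (v M) + γ) / v` at `M = v j + 1`. -/
def harmDev (v j : ℕ) : ℝ :=
  ∑ i ∈ range (j + 1), 1 / ((v : ℝ) * i + 1)
    - 1 / v * (Real.log (v * (v * j + 1)) + Real.eulerMascheroniConstant)

lemma tendsto_harmDev {v : ℕ} (hv : v = 1 ∨ v = 2) : Tendsto (harmDev v) atTop (𝓝 0) := by
  have hH := Real.tendsto_harmonic_sub_log
  rcases hv with rfl | rfl
  · have h := (hH.comp (tendsto_add_atTop_nat 1)).sub_const Real.eulerMascheroniConstant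
    rw [sub_self] at h
    refine h.congr fun j => ?_
    have : ((harmonic (j + 1) : ℚ) : ℝ) = ∑ i ∈ range (j + 1), 1 / ((i : ℝ) + 1) := by
      simp [harmonic]
    simp only [harmDev, Function.comp, this, Nat.cast_one, one_mul, div_one]
    push_cast
    ring
  · have h1 := hH.comp (tendsto_id.const_mul_atTop' (r := 2) (by norm_num) |>.comp
      (tendsto_add_atTop_nat 1))
    have h2 := hH.comp (tendsto_add_atTop_nat 1)
    have h3 : Tendsto (fun j : ℕ => Real.log (1 + 1 / (2 * (j : ℝ) + 1))) atTop (𝓝 0) := by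
      have : Tendsto (fun j : ℕ => 1 + 1 / (2 * (j : ℝ) + 1)) atTop (𝓝 (1 + 0)) := by
        refine tendsto_const_nhds.add ?_
        have := tendsto_one_div_add_atTop_nhds_zero_nat (𝕜 := ℝ)
        refine (this.comp (tendsto_id.const_mul_atTop' (r := 2) (by norm_num))).congr fun j => ?_
        simp
      have := this.log (by norm_num)
      simpa using this
    have h := ((h1.sub (h2.const_mul (1 / 2))).sub_const (1 / 2 * Real.eulerMascheroniConstant)).add
      (h3.const_mul (1 / 2))
    have e0 : Real.eulerMascheroniConstant - 1 / 2 * Real.eulerMascheroniConstant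
        - 1 / 2 * Real.eulerMascheroniConstant + 1 / 2 * 0 = 0 := by ring
    rw [e0] at h
    refine h.congr fun j => ?_
    have e1 : ∀ n : ℕ, ∑ i ∈ range n, 1 / ((2 : ℝ) * i + 1)
        = ((harmonic (2 * n) : ℚ) : ℝ) - 1 / 2 * ((harmonic n : ℚ) : ℝ) := by
      intro n
      induction n with
      | zero => simp
      | succ n ih =>
        rw [sum_range_succ, ih, show 2 * (n + 1) = 2 * n + 1 + 1 by ring, harmonic_succ,
          harmonic_succ, harmonic_succ]
        push_cast
        field_simp
        ring
    have e2 : Real.log (2 * (j + 1 : ℝ)) = Real.log 2 + Real.log (j + 1) :=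
      Real.log_mul (by norm_num) (by positivity)
    have e3 : Real.log (2 * (2 * j + 1 : ℝ)) = Real.log 2 + Real.log (2 * j + 1) :=
      Real.log_mul (by norm_num) (by positivity)
    have e4 : Real.log (1 + 1 / (2 * (j : ℝ) + 1)) = Real.log 2 + Real.log (j + 1)
        - Real.log (2 * j + 1) := by
      rw [← e2, ← Real.log_div (by positivity) (by positivity)]
      congr 1
      field_simp; ring
    simp only [harmDev, Function.comp, id, Nat.cast_ofNat, e1]
    rw [e3, e4]
    push_cast
    rw [e2]
    ring

lemma harmDev_sub (v j : ℕ) (hv : 0 < v) : harmDev v j - harmDev v (j + 1)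
    = 1 / v * (Real.log (((j : ℝ) + 1 / v) + 1) - Real.log ((j : ℝ) + 1 / v)
      - 1 / (((j : ℝ) + 1 / v) + 1)) := by
  have hv' : (0 : ℝ) < v := by exact_mod_cast hv
  unfold harmDev
  rw [sum_range_succ _ (j + 1)]
  have e1 : (v : ℝ) * (v * j + 1) = v ^ 2 * (j + 1 / v) := by field_simp
  have e2 : (v : ℝ) * (v * (j + 1 : ℕ) + 1) = v ^ 2 * (j + 1 / v + 1) := by
    push_cast; field_simp; ring
  rw [e1, e2, Real.log_mul (by positivity) (by positivity),
    Real.log_mul (by positivity) (by positivity)]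
  push_cast
  field_simp
  ring

/-- Telescoping `log_one_add_inv_le` down from infinity, where `harmDev` vanishes. -/
lemma harmDev_le {v : ℕ} (hv : v = 1 ∨ v = 2) (j : ℕ) :
    harmDev v j ≤ 1 / (2 * (v * j + 1)) := by
  have hv0 : 0 < v := by rcases hv with rfl | rfl <;> norm_num
  have hv' : (0 : ℝ) < v := by exact_mod_cast hv0
  have hlim0 : Tendsto (fun j : ℕ => 1 / (2 * ((v : ℝ) * j + 1))) atTop (𝓝 0) := by
    refine tendsto_const_nhds.div_atTop ?_
    exact ((tendsto_natCast_atTop_atTop.const_mul_atTop hv').atTop_add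
      tendsto_const_nhds).const_mul_atTop (by norm_num)
  have hlim := (tendsto_harmDev hv).sub hlim0
  have hm : Monotone fun j : ℕ => harmDev v j - 1 / (2 * ((v : ℝ) * j + 1)) := by
    refine monotone_nat_of_le_succ fun j => ?_
    have h := harmDev_sub v j hv0
    have h2 := log_one_add_inv_le (x := (j : ℝ) + 1 / v) (by positivity)
    have h3 : 1 / (2 * ((v : ℝ) * j + 1)) = 1 / v * (1 / (j + 1 / v) / 2) := by field_simp
    have h4 : 1 / (2 * ((v : ℝ) * (j + 1 : ℕ) + 1)) = 1 / v * (1 / (j + 1 / v + 1) / 2) := by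
      push_cast; field_simp; ring
    rw [h3, h4]
    have h5 : harmDev v j - harmDev v (j + 1) ≤ 1 / v * (1 / ((j : ℝ) + 1 / v) / 2
        - 1 / ((j : ℝ) + 1 / v + 1) / 2) := by
      rw [h]
      refine mul_le_mul_of_nonneg_left ?_ (by positivity)
      linarith
    linarith
  have := hm.ge_of_tendsto hlim j
  simp only [sub_zero] at this
  linarith

lemma le_harmDev {v : ℕ} (hv : v = 1 ∨ v = 2) (j : ℕ) :
    1 / (2 * (v * j + 1)) - v / (12 * (v * j + 1) ^ 2) ≤ harmDev v j := by
  have hv0 : 0 < v := by rcases hv with rfl | rfl <;> norm_num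
  have hv' : (0 : ℝ) < v := by exact_mod_cast hv0
  have hbase : Tendsto (fun j : ℕ => 1 / ((v : ℝ) * j + 1)) atTop (𝓝 0) :=
    tendsto_const_nhds.div_atTop ((tendsto_natCast_atTop_atTop.const_mul_atTop hv').atTop_add
      tendsto_const_nhds)
  have hlim := ((tendsto_harmDev hv).sub (hbase.const_mul (1 / 2))).add
    ((hbase.pow 2).const_mul (v / 12 : ℝ))
  have hm : Antitone fun j : ℕ => harmDev v j - 1 / 2 * (1 / ((v : ℝ) * j + 1))
      + v / 12 * (1 / ((v : ℝ) * j + 1)) ^ 2 := by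
    refine antitone_nat_of_succ_le fun j => ?_
    have h := harmDev_sub v j hv0
    have h2 := le_log_one_add_inv (x := (j : ℝ) + 1 / v) (by positivity)
    have h3 : 1 / ((v : ℝ) * j + 1) = 1 / v * (1 / (j + 1 / v)) := by field_simp
    have h4 : 1 / ((v : ℝ) * (j + 1 : ℕ) + 1) = 1 / v * (1 / (j + 1 / v + 1)) := by
      push_cast; field_simp; ring
    rw [h3, h4]
    have h5 : 1 / v * ((1 / ((j : ℝ) + 1 / v) / 2
        - 1 / ((j : ℝ) + 1 / v + 1) / 2) - (1 / ((j : ℝ) + 1 / v) ^ 2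
          - 1 / ((j : ℝ) + 1 / v + 1) ^ 2) / 12) ≤ harmDev v j - harmDev v (j + 1) := by
      rw [h]
      refine mul_le_mul_of_nonneg_left ?_ (by positivity)
      linarith
    have h6 : ∀ z : ℝ, (v : ℝ) / 12 * (1 / v * z) ^ 2 = 1 / v * (z ^ 2 / 12) := by
      intro z; field_simp
    rw [h6, h6]
    have h7 : ∀ z : ℝ, 1 / z ^ 2 = (1 / z) ^ 2 := by intro z; simp
    rw [h7, h7] at h5
    nlinarith [h5]
  have := hm.le_of_tendsto hlim j
  have e : (v : ℝ) / (12 * (v * j + 1) ^ 2) = v / 12 * (1 / ((v : ℝ) * j + 1)) ^ 2 := by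
    field_simp
  have e' : 1 / (2 * ((v : ℝ) * j + 1)) = 1 / 2 * (1 / ((v : ℝ) * j + 1)) := by
    field_simp
  rw [e, e']
  norm_num at this ⊢
  linarith

/-- The indicator function of the integers coprime to `v`. -/
def copr (v n : ℕ) : ℝ := if n.Coprime v then 1 else 0

lemma copr_one (n : ℕ) : copr 1 n = 1 := by simp [copr]

lemma copr_nonneg (v n : ℕ) : 0 ≤ copr v n := by unfold copr; split_ifs <;> norm_num

lemma copr_le_one (v n : ℕ) : copr v n ≤ 1 := by unfold copr; split_ifs <;> norm_num

lemma copr_mul (v m n : ℕ) : copr v (m * n) = copr v m * copr v n := by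
  unfold copr
  simp only [Nat.coprime_mul_iff_left]
  split_ifs <;> simp_all

lemma sum_copr_eq {v : ℕ} (hv : v = 1 ∨ v = 2) (n : ℕ) (g : ℕ → ℝ) :
    ∑ m ∈ Ioc 0 n, copr v m * g m = ∑ i ∈ range ((n + v - 1) / v), g (v * i + 1) := by
  rcases hv with rfl | rfl
  · simp only [copr_one, one_mul, Nat.add_sub_cancel, Nat.div_one]
    induction n with
    | zero => simp
    | succ n ih => rw [sum_Ioc_succ_top (Nat.zero_le _), ih, sum_range_succ]
  · induction n with
    | zero => simp
    | succ n ih =>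
      rw [sum_Ioc_succ_top (Nat.zero_le _), ih]
      rcases Nat.even_or_odd' n with ⟨k, rfl | rfl⟩
      · have h1 : (2 * k + 1 + 2 - 1) / 2 = k + 1 := by omega
        have h2 : (2 * k + 2 - 1) / 2 = k := by omega
        rw [h1, h2, sum_range_succ]
        have : copr 2 (2 * k + 1) = 1 := by simp [copr]
        rw [this]; ring
      · have h1 : (2 * k + 1 + 1 + 2 - 1) / 2 = k + 1 := by omega
        have h2 : (2 * k + 1 + 2 - 1) / 2 = k + 1 := by omega
        rw [h1, h2]
        have : copr 2 (2 * k + 1 + 1) = 0 := by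
          simp [copr, show 2 * k + 1 + 1 = 2 * (k + 1) by ring]
        rw [this]; ring

/-- The harmonic sum over the integers coprime to `v` up to `x`. -/
def harmSum (v : ℕ) (x : ℝ) : ℝ := ∑ m ∈ Ioc 0 ⌊x⌋₊, copr v m / m

/-- The error in `∑_{m ≤ x, (m, v) = 1} 1 / m = (log (v x) + γ) / v + harmErr v x`. -/
def harmErr (v : ℕ) (x : ℝ) : ℝ :=
  harmSum v x - 1 / v * (Real.log (v * x) + Real.eulerMascheroniConstant)

/-- The worst case is that of `x` slightly below `v + 1`. -/
lemma abs_harmErr_le {v : ℕ} (hv : v = 1 ∨ v = 2) {x : ℝ} (hx : 1 ≤ x) :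
    |harmErr v x| ≤ (1 / 2 + v / (12 * (v + 1))) / x := by
  have hv0 : 0 < v := by rcases hv with rfl | rfl <;> norm_num
  have hv' : (0 : ℝ) < v := by exact_mod_cast hv0
  have hv1 : (1 : ℝ) ≤ v := by exact_mod_cast hv0
  have hv2 : (v : ℝ) ≤ 2 := by rcases hv with rfl | rfl <;> norm_num
  have hx0 : 0 < x := by linarith
  obtain ⟨j, hj⟩ : ∃ j, j = (⌊x⌋₊ - 1) / v := ⟨_, rfl⟩
  have hfl : 1 ≤ ⌊x⌋₊ := Nat.one_le_floor_iff _ |>.mpr hx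
  have hj1 : (⌊x⌋₊ + v - 1) / v = j + 1 := by
    rw [hj, ← Nat.add_div_right _ hv0]; congr 1; omega
  have hM1 : v * j + 1 ≤ ⌊x⌋₊ := by
    have := Nat.mul_div_le (⌊x⌋₊ - 1) v
    rw [← hj] at this; omega
  have hM2 : ⌊x⌋₊ < v * (j + 1) + 1 := by
    have := Nat.lt_mul_div_succ (⌊x⌋₊ - 1) hv0
    rw [← hj] at this; omega
  have hM1' : (v : ℝ) * j + 1 ≤ x := by
    have := (Nat.le_floor_iff hx0.le).1 hM1
    exact_mod_cast this
  have hM2' : x ≤ (v : ℝ) * (j + 1) + 1 := by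
    have := (Nat.floor_lt hx0.le).1 hM2
    push_cast at this; exact this.le
  set M : ℝ := (v : ℝ) * j + 1 with hM
  have hMpos : 0 < M := by positivity
  have hM1pos : 1 ≤ M := by rw [hM]; have : (0 : ℝ) ≤ v * j := by positivity
                            linarith
  set N : ℝ := (v : ℝ) * (j + 1) + 1 with hN
  have hNM : N = M + v := by rw [hM, hN]; ring
  have hNpos : 0 < N := by positivity
  have hNv : (v : ℝ) + 1 ≤ N := by linarith
  have hS : harmSum v x = ∑ i ∈ range (j + 1), 1 / ((v : ℝ) * i + 1) := by
    unfold harmSum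
    have := sum_copr_eq hv ⌊x⌋₊ (fun m => 1 / (m : ℝ))
    simp only [mul_one_div] at this
    rw [this, hj1]
    push_cast
    rfl
  have e1 : harmErr v x = harmDev v j - 1 / v * (Real.log x - Real.log M) := by
    unfold harmErr harmDev
    rw [hS, Real.log_mul hv'.ne' hx0.ne', Real.log_mul hv'.ne' hMpos.ne']
    ring
  have e2 : harmErr v x = harmDev v (j + 1) - 1 / N + 1 / v * (Real.log N - Real.log x) := by
    unfold harmErr harmDev
    rw [hS, sum_range_succ _ (j + 1)]
    push_cast
    rw [← hN, Real.log_mul hv'.ne' hx0.ne', Real.log_mul hv'.ne' hNpos.ne']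
    ring
  have b1 := harmDev_le hv j
  have b2 := le_harmDev hv (j + 1)
  push_cast at b2
  rw [← hM] at b1
  rw [← hN] at b2
  have l1 : 1 - M / x ≤ Real.log x - Real.log M := by
    rw [← Real.log_div hx0.ne' hMpos.ne']
    have := Real.one_sub_inv_le_log_of_pos (x := x / M) (by positivity)
    rwa [inv_div] at this
  have l2 : 1 - x / N ≤ Real.log N - Real.log x := by
    rw [← Real.log_div hNpos.ne' hx0.ne']
    have := Real.one_sub_inv_le_log_of_pos (x := N / x) (by positivity)
    rwa [inv_div] at this
  rw [abs_le, le_div_iff₀ hx0, ← neg_div, div_le_iff₀ hx0]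
  constructor
  · have h1 : 1 / (2 * N) - v / (12 * N ^ 2) - 1 / N + 1 / v * (1 - x / N) ≤ harmErr v x := by
      rw [e2]
      have : 1 / (v : ℝ) * (1 - x / N) ≤ 1 / v * (Real.log N - Real.log x) :=
        mul_le_mul_of_nonneg_left l2 (by positivity)
      linarith
    have h2 := mul_le_mul_of_nonneg_right h1 hx0.le
    refine le_trans ?_ h2
    have h3 : 0 ≤ 1 / (v : ℝ) * (1 - x / N) * x := by
      have : x / N ≤ 1 := (div_le_one hNpos).2 hM2'
      have : 0 ≤ 1 - x / N := by linarith
      positivity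
    have h4 : x / (2 * N) ≤ 1 / 2 := by rw [div_le_div_iff₀ (by positivity) (by norm_num)]; linarith
    have h5 : v * x / (12 * N ^ 2) ≤ v / (12 * (v + 1)) := by
      rw [div_le_div_iff₀ (by positivity) (by positivity)]
      have : x * (v + 1) ≤ N ^ 2 := by
        rw [sq]; exact mul_le_mul hM2' hNv (by positivity) hNpos.le
      nlinarith
    have h6 : (1 / (2 * N) - v / (12 * N ^ 2) - 1 / N + 1 / v * (1 - x / N)) * x
        = - (x / (2 * N)) - v * x / (12 * N ^ 2) + 1 / (v : ℝ) * (1 - x / N) * x := by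
      field_simp; ring
    rw [h6]; linarith
  · have h1 : harmErr v x ≤ 1 / (2 * M) - 1 / v * (1 - M / x) := by
      rw [e1]
      have : 1 / (v : ℝ) * (1 - M / x) ≤ 1 / v * (Real.log x - Real.log M) :=
        mul_le_mul_of_nonneg_left l1 (by positivity)
      linarith
    have h2 := mul_le_mul_of_nonneg_right h1 hx0.le
    refine le_trans h2 ?_
    have h3 : (1 / (2 * M) - 1 / v * (1 - M / x)) * x = 1 / 2 + (x - M) * (1 / (2 * M) - 1 / v) := by
      field_simp; ring
    rw [h3]
    have h4 : 1 / (2 * M) ≤ 1 / v := one_div_le_one_div_of_le hv' (by linarith)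
    have h5 : 0 ≤ (v : ℝ) / (12 * (v + 1)) := by positivity
    nlinarith

/-! ### The logarithmic average of the squarefree integers coprime to `v` -/

/-- The Möbius function restricted to the integers coprime to `v`, as a real function. -/
def muc (v n : ℕ) : ℝ := copr v n * (ArithmeticFunction.moebius n : ℝ)

/-- The indicator function of the squarefree integers coprime to `v`. -/
def sqc (v n : ℕ) : ℝ := copr v n * (ArithmeticFunction.moebius n : ℝ) ^ 2

lemma abs_muc (v n : ℕ) : |muc v n| = sqc v n := by
  unfold muc sqc
  rw [abs_mul, abs_of_nonneg (copr_nonneg v n)]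
  congr 1
  rcases ArithmeticFunction.moebius_eq_or n with h | h | h <;> simp [h]

lemma sqc_nonneg (v n : ℕ) : 0 ≤ sqc v n := by rw [← abs_muc]; positivity

lemma sqc_le_copr (v n : ℕ) : sqc v n ≤ copr v n := by
  unfold sqc
  have : (ArithmeticFunction.moebius n : ℝ) ^ 2 ≤ 1 := by
    rcases ArithmeticFunction.moebius_eq_or n with h | h | h <;> simp [h]
  nlinarith [copr_nonneg v n]

lemma abs_muc_le_one (v n : ℕ) : |muc v n| ≤ 1 := by
  rw [abs_muc]; exact (sqc_le_copr v n).trans (copr_le_one v n)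

lemma sum_filter_dvd {R : Type*} [AddCommMonoid R] (N k : ℕ) (hk : 0 < k) (g : ℕ → R) :
    ∑ l ∈ Ioc 0 N with k ∣ l, g l = ∑ m ∈ Ioc 0 (N / k), g (k * m) := by
  symm
  refine sum_bij (fun m _ => k * m) ?_ ?_ ?_ ?_
  · intro m hm
    rw [mem_Ioc] at hm
    simp only [mem_filter, mem_Ioc, dvd_mul_right, and_true]
    exact ⟨Nat.mul_pos hk hm.1, by rw [mul_comm]; exact (Nat.le_div_iff_mul_le hk).1 hm.2⟩
  · intro a _ b _ h
    exact Nat.eq_of_mul_eq_mul_left hk h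
  · intro l hl
    simp only [mem_filter, mem_Ioc] at hl
    obtain ⟨⟨h0, h1⟩, m, rfl⟩ := hl
    refine ⟨m, ?_, rfl⟩
    rw [mem_Ioc]
    exact ⟨Nat.pos_of_mul_pos_left h0, (Nat.le_div_iff_mul_le hk).2 (by rwa [mul_comm])⟩
  · intro a _; rfl

/-- The indicator function of the squarefree integers is the sum of `μ(d)` over `d ^ 2 ∣ n`. -/
lemma moebius_sq_eq_sum {n D : ℕ} (hn : 0 < n) (hD : n ≤ D ^ 2) :
    (ArithmeticFunction.moebius n : ℝ) ^ 2
      = ∑ d ∈ Ioc 0 D with d ^ 2 ∣ n, (ArithmeticFunction.moebius d : ℝ) := by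
  obtain ⟨a, b, h0, h1, h2, hs⟩ := Nat.sq_mul_squarefree_of_pos hn
  have hset : (Ioc 0 D).filter (fun d => d ^ 2 ∣ n) = b.divisors := by
    ext d
    simp only [mem_filter, mem_Ioc, Nat.mem_divisors]
    constructor
    · rintro ⟨_, h⟩
      refine ⟨?_, h1.ne'⟩
      rw [← h2] at h
      by_contra hdb
      rcases Nat.eq_zero_or_pos d with rfl | hd
      · simp at h; omega
      obtain ⟨g, d', b', hg, hcop, hd', hb'⟩ :
          ∃ g d' b', 0 < g ∧ Nat.Coprime d' b' ∧ d = d' * g ∧ b = b' * g := by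
        obtain ⟨g, d', b', hg, hc, h3, h4⟩ := Nat.exists_coprime' (m := d) (n := b)
          (Nat.gcd_pos_of_pos_left _ hd)
        exact ⟨g, d', b', hg, hc, h3, h4⟩
      rw [hd', hb', mul_pow, mul_pow, mul_right_comm] at h
      have h' := Nat.dvd_of_mul_dvd_mul_right (by positivity) h
      have h'' : d' ^ 2 ∣ a := (Nat.Coprime.pow 2 2 hcop).dvd_of_dvd_mul_left h'
      have hu : IsUnit d' := hs d' (by rwa [← sq])
      rw [Nat.isUnit_iff] at hu
      apply hdb
      rw [hd', hb', hu, one_mul]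
      exact dvd_mul_left _ _
    · rintro ⟨h, _⟩
      have hd0 : 0 < d := Nat.pos_of_dvd_of_pos h h1
      have h3 : d ^ 2 ∣ n := by rw [← h2]; exact Dvd.dvd.mul_right (pow_dvd_pow_of_dvd h 2) _
      exact ⟨⟨hd0, (Nat.pow_le_pow_iff_left two_ne_zero).1 ((Nat.le_of_dvd hn h3).trans hD)⟩, h3⟩
  rw [hset]
  have hsum : ∑ d ∈ b.divisors, (ArithmeticFunction.moebius d : ℝ) = if b = 1 then 1 else 0 := by
    have := ArithmeticFunction.coe_zeta_mul_moebius
    have h4 := congrArg (fun f => f b) this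
    simp only [ArithmeticFunction.coe_zeta_mul_apply, ArithmeticFunction.one_apply] at h4
    exact_mod_cast h4
  rw [hsum]
  split_ifs with hb
  · have : n = a := by rw [← h2, hb]; simp
    rw [this, ArithmeticFunction.moebius_apply_of_squarefree hs]
    push_cast
    rw [← pow_mul, mul_comm, pow_mul]; simp
  · have : ¬ Squarefree n := by
      intro hsq
      have := hsq b ⟨a, by rw [← h2]; ring⟩
      exact hb (Nat.isUnit_iff.1 this)
    rw [ArithmeticFunction.moebius_eq_zero_of_not_squarefree this]; simp

/-- The sum of `1 / ℓ` over the squarefree `ℓ ≤ X` coprime to `v`. -/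
def sqSum (v : ℕ) (X : ℝ) : ℝ := ∑ l ∈ Ioc 0 ⌊X⌋₊, sqc v l / l

/-- The number of squarefree `d ≤ y` coprime to `v`. -/
def sqCount (v : ℕ) (y : ℝ) : ℝ := ∑ d ∈ Ioc 0 ⌊y⌋₊, sqc v d

lemma copr_sq (v d : ℕ) : copr v (d ^ 2) = copr v d := by
  rw [sq, copr_mul]; unfold copr; split_ifs <;> simp

lemma sqSum_sq (v : ℕ) {y : ℝ} (hy : 0 ≤ y) : sqSum v (y ^ 2)
    = ∑ d ∈ Ioc 0 ⌊y⌋₊, muc v d / d ^ 2 * harmSum v (y ^ 2 / d ^ 2) := by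
  have hfl : ⌊y ^ 2⌋₊ ≤ (⌊y⌋₊ + 1) ^ 2 := by
    have h1 : y ^ 2 ≤ (((⌊y⌋₊ + 1) ^ 2 : ℕ) : ℝ) := by
      push_cast
      have := (Nat.lt_floor_add_one y).le
      gcongr
    exact Nat.floor_le_of_le h1
  have h1 : sqSum v (y ^ 2) = ∑ l ∈ Ioc 0 ⌊y ^ 2⌋₊, ∑ d ∈ Ioc 0 (⌊y⌋₊ + 1),
      if d ^ 2 ∣ l then (ArithmeticFunction.moebius d : ℝ) * (copr v l / l) else 0 := by
    refine sum_congr rfl fun l hl => ?_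
    rw [mem_Ioc] at hl
    unfold sqc
    rw [moebius_sq_eq_sum hl.1 (hl.2.trans hfl), ← sum_filter, mul_sum, sum_div]
    refine sum_congr rfl fun d _ => by ring
  rw [h1, sum_comm]
  have h2 : ∀ d ∈ Ioc 0 (⌊y⌋₊ + 1), (∑ l ∈ Ioc 0 ⌊y ^ 2⌋₊,
      if d ^ 2 ∣ l then (ArithmeticFunction.moebius d : ℝ) * (copr v l / l) else 0)
      = muc v d / d ^ 2 * harmSum v (y ^ 2 / d ^ 2) := by
    intro d hd
    rw [mem_Ioc] at hd
    rw [← sum_filter, sum_filter_dvd _ _ (pow_pos hd.1 2)]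
    have h3 : ⌊y ^ 2 / (d : ℝ) ^ 2⌋₊ = ⌊y ^ 2⌋₊ / d ^ 2 := by
      have := Nat.floor_div_natCast (y ^ 2) (d ^ 2)
      push_cast at this; exact this
    unfold harmSum muc
    rw [h3, mul_sum]
    refine sum_congr rfl fun m _ => ?_
    rw [copr_mul, copr_sq]
    have : (d : ℝ) ≠ 0 := by exact_mod_cast hd.1.ne'
    push_cast
    field_simp
  rw [sum_congr rfl h2, sum_Ioc_succ_top (Nat.zero_le _)]
  have h4 : harmSum v (y ^ 2 / ((⌊y⌋₊ + 1 : ℕ) : ℝ) ^ 2) = 0 := by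
    unfold harmSum
    have : ⌊y ^ 2 / ((⌊y⌋₊ + 1 : ℕ) : ℝ) ^ 2⌋₊ = 0 := by
      rw [Nat.floor_eq_zero, div_lt_one (by positivity)]
      push_cast
      have := Nat.lt_floor_add_one y
      gcongr
    rw [this]; simp
  rw [h4]; ring

/-- The constant `∑ μ(d) / d ^ 2` over the `d` coprime to `v`. -/
def mucC (v : ℕ) : ℝ := ∑' d : ℕ, muc v d / d ^ 2

/-- The constant `∑ μ(d) log d / d ^ 2` over the `d` coprime to `v`. -/
def mucD (v : ℕ) : ℝ := ∑' d : ℕ, muc v d * Real.log d / d ^ 2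

/-- The coefficient of `log X` in the average of the squarefree integers coprime to `v`. -/
def sqLead (v : ℕ) : ℝ := mucC v / v

/-- The constant term in the average of the squarefree integers coprime to `v`. -/
def sqConst (v : ℕ) : ℝ :=
  1 / v * ((Real.eulerMascheroniConstant + Real.log v) * mucC v - 2 * mucD v)

/-- The error term in `∑ μ ^ 2(ℓ) / ℓ = sqLead v * log X + sqConst v + sqErr v X`. -/
def sqErr (v : ℕ) (X : ℝ) : ℝ := sqSum v X - (sqLead v * Real.log X + sqConst v)

/-- The tail `∑_{d > y} μ(d) (γ + log v + 2 log (y / d)) / d ^ 2` over the `d` coprime to `v`. -/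
def tailT (v : ℕ) (y : ℝ) : ℝ :=
  (Real.eulerMascheroniConstant + Real.log v + 2 * Real.log y) *
      (mucC v - ∑ d ∈ Ioc 0 ⌊y⌋₊, muc v d / d ^ 2)
    - 2 * (mucD v - ∑ d ∈ Ioc 0 ⌊y⌋₊, muc v d * Real.log d / d ^ 2)

/-- The error term at `X = y ^ 2`, from opening `μ ^ 2` as a sum over square divisors `d ^ 2`: the
harmonic sums over the `d ≤ y` contribute their errors, and the completion of the series over `d`
contributes the tail `tailT`. -/
lemma sqErr_sq {v : ℕ} (hv : 0 < v) {y : ℝ} (hy : 0 < y) : sqErr v (y ^ 2)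
    = ∑ d ∈ Ioc 0 ⌊y⌋₊, muc v d / d ^ 2 * harmErr v (y ^ 2 / d ^ 2) - 1 / v * tailT v y := by
  have hv' : (0 : ℝ) < v := by exact_mod_cast hv
  have h1 : ∑ d ∈ Ioc 0 ⌊y⌋₊, muc v d / d ^ 2 * harmSum v (y ^ 2 / d ^ 2)
      = ∑ d ∈ Ioc 0 ⌊y⌋₊, muc v d / d ^ 2 * harmErr v (y ^ 2 / d ^ 2)
       + 1 / v * ((Real.eulerMascheroniConstant + Real.log v + 2 * Real.log y) *
        ∑ d ∈ Ioc 0 ⌊y⌋₊, muc v d / d ^ 2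
        - 2 * ∑ d ∈ Ioc 0 ⌊y⌋₊, muc v d * Real.log d / d ^ 2) := by
    rw [mul_sum, mul_sum, ← sum_sub_distrib, mul_sum, ← sum_add_distrib]
    refine sum_congr rfl fun d hd => ?_
    rw [mem_Ioc] at hd
    have hd0 : (0 : ℝ) < d := by exact_mod_cast hd.1
    unfold harmErr
    rw [Real.log_mul hv'.ne' (by positivity), Real.log_div (by positivity) (by positivity),
      Real.log_pow, Real.log_pow]
    push_cast
    ring
  unfold sqErr sqLead sqConst tailT
  rw [sqSum_sq v hy.le, h1, Real.log_pow]
  push_cast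
  ring

/-- The bound from which all numerical estimates of the error term start. -/
lemma abs_sqErr_le {v : ℕ} (hv : v = 1 ∨ v = 2) {y : ℝ} (hy : 0 < y) :
    y * |sqErr v (y ^ 2)| ≤ (1 / 2 + v / (12 * (v + 1))) * sqCount v y / y
      + 1 / v * (y * |tailT v y|) := by
  have hv0 : 0 < v := by rcases hv with rfl | rfl <;> norm_num
  have hv' : (0 : ℝ) < v := by exact_mod_cast hv0
  rw [sqErr_sq hv0 hy]
  have h1 : |∑ d ∈ Ioc 0 ⌊y⌋₊, muc v d / d ^ 2 * harmErr v (y ^ 2 / d ^ 2)|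
      ≤ (1 / 2 + v / (12 * (v + 1))) * sqCount v y / y ^ 2 := by
    refine (abs_sum_le_sum_abs _ _).trans ?_
    unfold sqCount
    rw [mul_sum, sum_div]
    refine sum_le_sum fun d hd => ?_
    rw [mem_Ioc] at hd
    have hd0 : (0 : ℝ) < d := by exact_mod_cast hd.1
    have hdy : (d : ℝ) ≤ y := (Nat.le_floor_iff hy.le).1 hd.2
    have hge : 1 ≤ y ^ 2 / (d : ℝ) ^ 2 := by
      rw [one_le_div (by positivity)]; gcongr
    have h2 := abs_harmErr_le hv hge
    rw [abs_mul, abs_div, abs_muc, abs_of_pos (by positivity : (0 : ℝ) < (d : ℝ) ^ 2)]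
    calc sqc v d / (d : ℝ) ^ 2 * |harmErr v (y ^ 2 / d ^ 2)|
        ≤ sqc v d / (d : ℝ) ^ 2 * ((1 / 2 + v / (12 * (v + 1))) / (y ^ 2 / (d : ℝ) ^ 2)) :=
          mul_le_mul_of_nonneg_left h2 (by have := sqc_nonneg v d; positivity)
      _ = _ := by field_simp
  have h3 : |1 / (v : ℝ) * tailT v y| = 1 / v * |tailT v y| := by
    rw [abs_mul, abs_of_pos (by positivity)]
  calc y * |_ - 1 / (v : ℝ) * tailT v y|
      ≤ y * (|∑ d ∈ Ioc 0 ⌊y⌋₊, muc v d / d ^ 2 * harmErr v (y ^ 2 / d ^ 2)|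
          + |1 / (v : ℝ) * tailT v y|) := by gcongr; exact abs_sub _ _
    _ ≤ y * ((1 / 2 + v / (12 * (v + 1))) * sqCount v y / y ^ 2 + 1 / v * |tailT v y|) := by
        rw [h3]; gcongr
    _ = _ := by field_simp

/-! ### Bounding the tail of the Möbius sum -/

lemma sum_divisorsAntidiagonal_Ioc {R : Type*} [AddCommMonoid R] (N : ℕ) (f : ℕ → ℕ → R) :
    ∑ n ∈ Ioc 0 N, ∑ x ∈ n.divisorsAntidiagonal, f x.1 x.2
      = ∑ d ∈ Ioc 0 N, ∑ m ∈ Ioc 0 (N / d), f d m := by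
  have h1 : ∀ n ∈ Ioc 0 N, ∑ x ∈ n.divisorsAntidiagonal, f x.1 x.2
      = ∑ d ∈ Ioc 0 N, if d ∣ n then f d (n / d) else 0 := by
    intro n hn
    rw [mem_Ioc] at hn
    rw [Nat.sum_divisorsAntidiagonal (fun a b => f a b), ← sum_filter]
    refine sum_congr ?_ fun _ _ => rfl
    ext d
    simp only [Nat.mem_divisors, mem_filter, mem_Ioc]
    constructor
    · rintro ⟨h, _⟩
      exact ⟨⟨Nat.pos_of_dvd_of_pos h hn.1, (Nat.le_of_dvd hn.1 h).trans hn.2⟩, h⟩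
    · rintro ⟨_, h⟩
      exact ⟨h, hn.1.ne'⟩
  rw [sum_congr rfl h1, sum_comm]
  refine sum_congr rfl fun d hd => ?_
  rw [mem_Ioc] at hd
  rw [← sum_filter, sum_filter_dvd N d hd.1]
  refine sum_congr rfl fun m _ => ?_
  rw [Nat.mul_div_cancel_left m hd.1]

/-- The kernel `A_k (g + 2 log u) - 2 B_k`, where `A_k`, `B_k` are the tails beyond `k` of
`L = ∑ e(m) / m ^ 2` and `L' = ∑ e(m) log m / m ^ 2`. -/
def tailKer (e : ℕ → ℝ) (L L' g : ℝ) (k : ℕ) (u : ℝ) : ℝ :=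
  (L - ∑ m ∈ Ioc 0 k, e m / m ^ 2) * (g + 2 * Real.log u)
    - 2 * (L' - ∑ m ∈ Ioc 0 k, e m * Real.log m / m ^ 2)

/-- A mollified identity for the tail. If `e` is chosen so that `c = (μ χ) ∗ e` is supported on
`[1, J]`, then the sum of `c(n) (g + 2 log (y / n)) / n ^ 2` over `n ≤ y` is explicit for `y ≥ J`.
Splitting this sum along the convolution expresses `tailT v y` by values of `tailKer`, which decay
as soon as `e` has bounded partial sums. -/
lemma tailT_add_sum_eq {v : ℕ} {c e : ℕ → ℝ} {J : ℕ} {L L' g : ℝ} (hL : L ≠ 0)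
    (hg : g = Real.eulerMascheroniConstant + Real.log v + 2 * (L' / L))
    (hce : ∀ n, 0 < n → ∑ x ∈ n.divisorsAntidiagonal, muc v x.1 * e x.2 = c n)
    (hJ : ∀ n, J < n → c n = 0) {y : ℝ} (hy1 : 1 ≤ y) (hyJ : (J : ℝ) ≤ y) :
    L * tailT v y + ∑ d ∈ Ioc 0 ⌊y⌋₊, muc v d / d ^ 2 * tailKer e L L' g ⌊y / d⌋₊ (y / d)
      = 2 * (L * mucC v - ∑ n ∈ Ioc 0 J, c n / n ^ 2) * Real.log y
        + (L * (Real.eulerMascheroniConstant + Real.log v) * mucC v - 2 * L * mucD v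
          - (∑ n ∈ Ioc 0 J, c n / n ^ 2) * g + 2 * ∑ n ∈ Ioc 0 J, c n * Real.log n / n ^ 2) := by
  set C1 := ∑ n ∈ Ioc 0 J, c n / n ^ 2 with hC1
  set C2 := ∑ n ∈ Ioc 0 J, c n * Real.log n / n ^ 2 with hC2
  set G := Real.eulerMascheroniConstant + Real.log v with hG
  have hy : 0 < y := by linarith
  have hJN : J ≤ ⌊y⌋₊ := Nat.le_floor hyJ
  have h1 : ∑ d ∈ Ioc 0 ⌊y⌋₊, muc v d / d ^ 2 * tailKer e L L' g ⌊y / d⌋₊ (y / d)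
      = L * ((G + 2 * Real.log y) * ∑ d ∈ Ioc 0 ⌊y⌋₊, muc v d / d ^ 2
          - 2 * ∑ d ∈ Ioc 0 ⌊y⌋₊, muc v d * Real.log d / d ^ 2)
        - ∑ d ∈ Ioc 0 ⌊y⌋₊, ∑ m ∈ Ioc 0 (⌊y⌋₊ / d), muc v d * e m *
          ((g + 2 * Real.log y - 2 * Real.log (d * m : ℕ)) / (d * m : ℕ) ^ 2) := by
    rw [mul_sum, mul_sum, ← sum_sub_distrib, mul_sum, ← sum_sub_distrib]
    refine sum_congr rfl fun d hd => ?_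
    rw [mem_Ioc] at hd
    have hd0 : (0 : ℝ) < d := by exact_mod_cast hd.1
    have h2 : ∑ m ∈ Ioc 0 (⌊y⌋₊ / d), muc v d * e m *
          ((g + 2 * Real.log y - 2 * Real.log (d * m : ℕ)) / (d * m : ℕ) ^ 2)
        = muc v d / d ^ 2 * ((g + 2 * Real.log (y / d)) * ∑ m ∈ Ioc 0 (⌊y⌋₊ / d), e m / m ^ 2
          - 2 * ∑ m ∈ Ioc 0 (⌊y⌋₊ / d), e m * Real.log m / m ^ 2) := by
      rw [mul_sum, mul_sum, ← sum_sub_distrib, mul_sum]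
      refine sum_congr rfl fun m hm => ?_
      rw [mem_Ioc] at hm
      have hm0 : (0 : ℝ) < m := by exact_mod_cast hm.1
      push_cast
      rw [Real.log_mul hd0.ne' hm0.ne', Real.log_div hy.ne' hd0.ne']
      field_simp
      ring
    have h3 : L * g = L * G + 2 * L' := by rw [hg]; field_simp
    rw [h2, Nat.floor_div_natCast]
    unfold tailKer
    have h4 : Real.log (y / d) = Real.log y - Real.log d := Real.log_div hy.ne' hd0.ne'
    rw [h4]
    have h5 : L' = (L * g - L * G) / 2 := by rw [h3]; ring
    rw [h5]
    ring
  have h2 : ∑ d ∈ Ioc 0 ⌊y⌋₊, ∑ m ∈ Ioc 0 (⌊y⌋₊ / d), muc v d * e m *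
          ((g + 2 * Real.log y - 2 * Real.log (d * m : ℕ)) / (d * m : ℕ) ^ 2)
      = C1 * (g + 2 * Real.log y) - 2 * C2 := by
    rw [← sum_divisorsAntidiagonal_Ioc ⌊y⌋₊ (fun d m => muc v d * e m *
          ((g + 2 * Real.log y - 2 * Real.log (d * m : ℕ)) / (d * m : ℕ) ^ 2))]
    have h3 : ∀ n ∈ Ioc 0 ⌊y⌋₊, ∑ x ∈ n.divisorsAntidiagonal, muc v x.1 * e x.2 *
          ((g + 2 * Real.log y - 2 * Real.log (x.1 * x.2 : ℕ)) / (x.1 * x.2 : ℕ) ^ 2)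
        = c n * ((g + 2 * Real.log y - 2 * Real.log n) / n ^ 2) := by
      intro n hn
      rw [mem_Ioc] at hn
      rw [← hce n hn.1, sum_mul]
      refine sum_congr rfl fun x hx => ?_
      rw [(Nat.mem_divisorsAntidiagonal.1 hx).1]
    rw [sum_congr rfl h3]
    have h4 : ∑ n ∈ Ioc 0 ⌊y⌋₊, c n * ((g + 2 * Real.log y - 2 * Real.log n) / n ^ 2)
        = ∑ n ∈ Ioc 0 J, c n * ((g + 2 * Real.log y - 2 * Real.log n) / n ^ 2) := by
      symm
      refine sum_subset (Ioc_subset_Ioc_right hJN) ?_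
      intro n hn hn'
      rw [mem_Ioc] at hn hn'
      rw [hJ n (by by_contra h; exact hn' ⟨hn.1, by omega⟩), zero_mul]
    rw [h4, hC1, hC2, sum_mul, mul_sum, ← sum_sub_distrib]
    refine sum_congr rfl fun n _ => by ring
  rw [h1, h2]
  unfold tailT
  rw [← hG]
  ring

lemma summable_inv_sq_mul {a : ℕ → ℝ} (ha : ∀ n, |a n| ≤ 1) :
    Summable fun d : ℕ => a d / (d : ℝ) ^ 2 := by
  refine Summable.of_norm_bounded (g := fun d : ℕ => 1 / (d : ℝ) ^ 2)
    (Real.summable_one_div_nat_pow.2 (by norm_num)) fun d => ?_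
  rw [Real.norm_eq_abs, abs_div, abs_of_nonneg (by positivity : (0 : ℝ) ≤ (d : ℝ) ^ 2)]
  gcongr; exact ha d

lemma summable_log_div_sq_mul {a : ℕ → ℝ} (ha : ∀ n, |a n| ≤ 1) :
    Summable fun d : ℕ => a d * Real.log d / (d : ℝ) ^ 2 := by
  refine Summable.of_norm_bounded (g := fun d : ℕ => 2 * (1 / (d : ℝ) ^ (3 / 2 : ℝ)))
    ((Real.summable_one_div_nat_rpow.2 (by norm_num)).mul_left 2) fun d => ?_
  rcases Nat.eq_zero_or_pos d with rfl | hd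
  · simp
  have hd0 : (0 : ℝ) < d := by exact_mod_cast hd
  have hl : 0 ≤ Real.log d := Real.log_natCast_nonneg d
  rw [Real.norm_eq_abs, abs_div, abs_of_nonneg (by positivity : (0 : ℝ) ≤ (d : ℝ) ^ 2),
    abs_mul, abs_of_nonneg hl]
  have h1 := Real.log_le_rpow_div hd0.le (ε := 1 / 2) (by norm_num)
  have h2 : (d : ℝ) ^ 2 = (d : ℝ) ^ (1 / 2 : ℝ) * (d : ℝ) ^ (3 / 2 : ℝ) := by
    rw [← Real.rpow_add hd0]; norm_num
  rw [div_le_iff₀ (by positivity), h2]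
  have h3 : |a d| * Real.log d ≤ 1 * ((d : ℝ) ^ (1 / 2 : ℝ) / (1 / 2)) :=
    mul_le_mul (ha d) h1 hl zero_le_one
  have h4 : 2 * (1 / (d : ℝ) ^ (3 / 2 : ℝ)) * ((d : ℝ) ^ (1 / 2 : ℝ) * (d : ℝ) ^ (3 / 2 : ℝ))
      = 1 * ((d : ℝ) ^ (1 / 2 : ℝ) / (1 / 2)) := by
    field_simp
  rw [h4]; exact h3

lemma tendsto_sum_Ioc_floor {a : ℕ → ℝ} (ha : Summable a) (h0 : a 0 = 0) :
    Tendsto (fun y : ℝ => ∑ d ∈ Ioc 0 ⌊y⌋₊, a d) atTop (𝓝 (∑' d, a d)) := by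
  have h1 := ha.hasSum.tendsto_sum_nat.comp (tendsto_add_atTop_nat 1) |>.comp
    (tendsto_nat_floor_atTop (α := ℝ))
  refine h1.congr fun y => ?_
  simp only [Function.comp]
  rw [range_eq_Ico, ← sum_Ioo_add_eq_sum_Ico (by omega), h0, add_zero]
  congr 1

lemma abs_mucC_sub_le (v : ℕ) {N : ℕ} (hN : 0 < N) :
    |mucC v - ∑ d ∈ Ioc 0 N, muc v d / d ^ 2| ≤ 1 / N := by
  have hs := summable_inv_sq_mul (abs_muc_le_one v)
  have h1 := hs.hasSum.tendsto_sum_nat.comp (tendsto_add_atTop_nat 1)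
  have h2 := (h1.sub_const (∑ d ∈ Ioc 0 N, muc v d / d ^ 2)).abs
  refine le_of_tendsto h2 ?_
  filter_upwards [eventually_ge_atTop N] with M hM
  simp only [Function.comp]
  have h3 : ∑ d ∈ range (M + 1), muc v d / (d : ℝ) ^ 2
      = ∑ d ∈ Ioc 0 N, muc v d / (d : ℝ) ^ 2 + ∑ d ∈ Ioc N M, muc v d / (d : ℝ) ^ 2 := by
    rw [range_eq_Ico, ← sum_Ioo_add_eq_sum_Ico (by omega), sum_Ioc_consecutive _ (by omega) hM]
    simp
    congr 1
  rw [h3, add_sub_cancel_left]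
  calc |∑ d ∈ Ioc N M, muc v d / (d : ℝ) ^ 2| ≤ ∑ d ∈ Ioc N M, ((d : ℝ) ^ 2)⁻¹ := by
        refine (abs_sum_le_sum_abs _ _).trans (sum_le_sum fun d _ => ?_)
        rw [abs_div, abs_of_nonneg (by positivity : (0 : ℝ) ≤ (d : ℝ) ^ 2), ← one_div]
        gcongr; exact abs_muc_le_one v d
    _ ≤ (N : ℝ)⁻¹ - (M : ℝ)⁻¹ := sum_Ioc_inv_sq_le_sub hN.ne' hM
    _ ≤ 1 / N := by rw [one_div]; have : (0 : ℝ) ≤ (M : ℝ)⁻¹ := by positivity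
                    linarith

lemma tendsto_tailT (v : ℕ) : Tendsto (tailT v) atTop (𝓝 0) := by
  have h1 : Tendsto (fun y : ℝ => (Real.eulerMascheroniConstant + Real.log v + 2 * Real.log y) *
      (mucC v - ∑ d ∈ Ioc 0 ⌊y⌋₊, muc v d / d ^ 2)) atTop (𝓝 0) := by
    have hl : Tendsto (fun y : ℝ => |Real.eulerMascheroniConstant + Real.log v
        + 2 * Real.log y| * (2 / y)) atTop (𝓝 0) := by
      have ha : Tendsto (fun y : ℝ => Real.log y / y) atTop (𝓝 0) := by
        simpa using (Real.isLittleO_log_id_atTop).tendsto_div_nhds_zero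
      have hb : Tendsto (fun y : ℝ => 1 / y) atTop (𝓝 0) := by
        simpa using tendsto_inv_atTop_zero (𝕜 := ℝ)
      have hc := ((hb.const_mul (2 * (Real.eulerMascheroniConstant + Real.log v))).add
        (ha.const_mul 4)).abs
      rw [mul_zero, mul_zero, add_zero, abs_zero] at hc
      refine hc.congr' ?_
      filter_upwards [eventually_gt_atTop 0] with y hy
      have h2y : 0 < 2 / y := by positivity
      rw [← abs_of_pos h2y, ← abs_mul]
      congr 1; field_simp; ring
    refine squeeze_zero_norm' ?_ hl
    filter_upwards [eventually_ge_atTop 1] with y hy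
    rw [Real.norm_eq_abs, abs_mul]
    refine mul_le_mul_of_nonneg_left ?_ (abs_nonneg _)
    have hf : 1 ≤ ⌊y⌋₊ := (Nat.one_le_floor_iff _).2 hy
    refine (abs_mucC_sub_le v hf).trans ?_
    have h3 := Nat.lt_floor_add_one y
    have h4 : (1 : ℝ) ≤ ⌊y⌋₊ := by exact_mod_cast hf
    rw [div_le_div_iff₀ (by linarith) (by linarith)]
    linarith
  have h2 := (tendsto_sum_Ioc_floor (summable_log_div_sq_mul (abs_muc_le_one v))
    (by simp)).const_sub (mucD v)
  have h3 := h1.sub (h2.const_mul 2)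
  have : mucD v - ∑' d : ℕ, muc v d * Real.log d / (d : ℝ) ^ 2 = 0 := sub_self _
  rw [this, mul_zero, sub_zero] at h3
  exact h3

/-- Both sides of `tailT_add_sum_eq` tend to `0`, so the coefficients on the right vanish. -/
lemma tailT_coeff_eq_zero {v : ℕ} {c e : ℕ → ℝ} {J : ℕ} {L L' g B : ℝ} (hL : L ≠ 0)
    (hg : g = Real.eulerMascheroniConstant + Real.log v + 2 * (L' / L))
    (hce : ∀ n, 0 < n → ∑ x ∈ n.divisorsAntidiagonal, muc v x.1 * e x.2 = c n)
    (hJ : ∀ n, J < n → c n = 0)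
    (hB : ∀ u : ℝ, 1 ≤ u → |tailKer e L L' g ⌊u⌋₊ u| ≤ B / u ^ 2) :
    2 * (L * mucC v - ∑ n ∈ Ioc 0 J, c n / n ^ 2) = 0 ∧
      L * (Real.eulerMascheroniConstant + Real.log v) * mucC v - 2 * L * mucD v
        - (∑ n ∈ Ioc 0 J, c n / n ^ 2) * g + 2 * ∑ n ∈ Ioc 0 J, c n * Real.log n / n ^ 2 = 0 := by
  set a := 2 * (L * mucC v - ∑ n ∈ Ioc 0 J, c n / n ^ 2) with ha'
  set b := L * (Real.eulerMascheroniConstant + Real.log v) * mucC v - 2 * L * mucD v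
    - (∑ n ∈ Ioc 0 J, c n / n ^ 2) * g + 2 * ∑ n ∈ Ioc 0 J, c n * Real.log n / n ^ 2 with hb'
  have hab : ∀ y : ℝ, 1 ≤ y → (J : ℝ) ≤ y → L * tailT v y + ∑ d ∈ Ioc 0 ⌊y⌋₊,
      muc v d / d ^ 2 * tailKer e L L' g ⌊y / d⌋₊ (y / d) = a * Real.log y + b :=
    fun y h1 h2 => tailT_add_sum_eq hL hg hce hJ h1 h2
  have hBn : 0 ≤ B := by
    have := (abs_nonneg _).trans (hB 1 le_rfl); simpa using this
  have hsum : ∀ y : ℝ, 1 ≤ y →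
      |∑ d ∈ Ioc 0 ⌊y⌋₊, muc v d / d ^ 2 * tailKer e L L' g ⌊y / d⌋₊ (y / d)| ≤ B / y := by
    intro y hy
    have hy0 : 0 < y := by linarith
    calc _ ≤ ∑ d ∈ Ioc 0 ⌊y⌋₊, B / y ^ 2 := by
          refine (abs_sum_le_sum_abs _ _).trans (sum_le_sum fun d hd => ?_)
          rw [mem_Ioc] at hd
          have hd0 : (0 : ℝ) < d := by exact_mod_cast hd.1
          have hdy : (d : ℝ) ≤ y := (Nat.le_floor_iff hy0.le).1 hd.2
          have h1 := hB (y / d) ((one_le_div hd0).2 hdy)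
          rw [abs_mul, abs_div, abs_of_pos (by positivity : (0 : ℝ) < (d : ℝ) ^ 2)]
          calc |muc v d| / (d : ℝ) ^ 2 * |tailKer e L L' g ⌊y / d⌋₊ (y / d)|
              ≤ 1 / (d : ℝ) ^ 2 * (B / (y / d) ^ 2) := by
                gcongr; exact abs_muc_le_one v d
            _ = B / y ^ 2 := by field_simp
      _ = ⌊y⌋₊ * (B / y ^ 2) := by simp
      _ ≤ y * (B / y ^ 2) := by gcongr; exact Nat.floor_le hy0.le
      _ = B / y := by field_simp
  have hlim : Tendsto (fun y : ℝ => a * Real.log y + b) atTop (𝓝 0) := by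
    have h1 : Tendsto (fun y : ℝ => L * tailT v y + ∑ d ∈ Ioc 0 ⌊y⌋₊, muc v d / d ^ 2 *
        tailKer e L L' g ⌊y / d⌋₊ (y / d)) atTop (𝓝 (L * 0 + 0)) := by
      refine ((tendsto_tailT v).const_mul L).add (squeeze_zero_norm' ?_
        (tendsto_const_nhds.div_atTop tendsto_id : Tendsto (fun y : ℝ => B / y) atTop (𝓝 0)))
      filter_upwards [eventually_ge_atTop 1] with y hy using hsum y hy
    rw [mul_zero, add_zero] at h1
    refine h1.congr' ?_
    filter_upwards [eventually_ge_atTop 1, eventually_ge_atTop (J : ℝ)] with y h h' using hab y h h'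
  have ha : a = 0 := by
    have h2 : Tendsto (fun y : ℝ => a * Real.log (Real.exp 1 * y) + b) atTop (𝓝 0) :=
      hlim.comp (tendsto_id.const_mul_atTop (Real.exp_pos 1))
    have h3 := h2.sub hlim
    rw [sub_zero] at h3
    have h4 : Tendsto (fun _ : ℝ => a) atTop (𝓝 0) := by
      refine h3.congr' ?_
      filter_upwards [eventually_gt_atTop 0] with y hy
      rw [Real.log_mul (Real.exp_pos 1).ne' hy.ne', Real.log_exp]; ring
    exact tendsto_nhds_unique tendsto_const_nhds h4
  have hb : b = 0 := by
    rw [ha] at hlim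
    simp only [zero_mul, zero_add] at hlim
    exact tendsto_nhds_unique tendsto_const_nhds hlim
  exact ⟨ha, hb⟩

/-- The tail as a sum of kernel values, without a main term. -/
lemma tailT_eq_neg_sum {v : ℕ} {c e : ℕ → ℝ} {J : ℕ} {L L' g B : ℝ} (hL : L ≠ 0)
    (hg : g = Real.eulerMascheroniConstant + Real.log v + 2 * (L' / L))
    (hce : ∀ n, 0 < n → ∑ x ∈ n.divisorsAntidiagonal, muc v x.1 * e x.2 = c n)
    (hJ : ∀ n, J < n → c n = 0)
    (hB : ∀ u : ℝ, 1 ≤ u → |tailKer e L L' g ⌊u⌋₊ u| ≤ B / u ^ 2)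
    {y : ℝ} (hy1 : 1 ≤ y) (hyJ : (J : ℝ) ≤ y) :
    L * tailT v y
      = -∑ d ∈ Ioc 0 ⌊y⌋₊, muc v d / d ^ 2 * tailKer e L L' g ⌊y / d⌋₊ (y / d) := by
  have h1 := tailT_add_sum_eq hL hg hce hJ hy1 hyJ
  obtain ⟨h2, h3⟩ := tailT_coeff_eq_zero hL hg hce hJ hB
  rw [h2, h3] at h1
  linarith

/-! ### Total variation of the kernel -/

lemma antitoneOn_log_div_sq :
    AntitoneOn (fun t : ℝ => Real.log t / t ^ 2) (Set.Ici (Real.exp (1 / 2))) := by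
  have := Real.log_div_self_rpow_antitoneOn (a := 2) (by norm_num)
  simpa using this

lemma monotoneOn_log_div_sq :
    MonotoneOn (fun t : ℝ => Real.log t / t ^ 2) (Set.Ioc 0 (Real.exp (1 / 2))) := by
  have hd : ∀ t : ℝ, 0 < t → HasDerivAt (fun t : ℝ => Real.log t / t ^ 2)
      ((t⁻¹ * t ^ 2 - Real.log t * (2 * t)) / (t ^ 2) ^ 2) t := by
    intro t ht
    have := (Real.hasDerivAt_log ht.ne').div (hasDerivAt_pow 2 t) (by positivity)
    simp only [Nat.cast_ofNat, Nat.add_one_sub_one, pow_one] at this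
    exact this
  refine monotoneOn_of_deriv_nonneg (convex_Ioc _ _) ?_ ?_ ?_
  · exact fun t ht => (hd t ht.1).continuousAt.continuousWithinAt
  · rw [interior_Ioc]
    exact fun t ht => (hd t ht.1).differentiableAt.differentiableWithinAt
  · rw [interior_Ioc]
    intro t ht
    have ht0 : 0 < t := ht.1
    rw [(hd t ht0).deriv]
    have h1 : Real.log t ≤ 1 / 2 := (Real.log_le_iff_le_exp ht0).2 ht.2.le
    have h2 : t⁻¹ * t ^ 2 = t := by field_simp
    rw [h2]
    apply div_nonneg _ (by positivity)
    nlinarith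

/-- The total variation of `log t / t ^ 2` from `0` to `t`, up to a constant. -/
def logVar (t : ℝ) : ℝ :=
  if t ≤ Real.exp (1 / 2) then Real.log t / t ^ 2 else Real.exp (-1) - Real.log t / t ^ 2

lemma abs_sub_le_logVar {a b : ℝ} (ha : 0 < a) (hab : a ≤ b) :
    |Real.log a / a ^ 2 - Real.log b / b ^ 2| ≤ logVar b - logVar a := by
  have hpk : Real.log (Real.exp (1 / 2)) / Real.exp (1 / 2) ^ 2 = Real.exp (-1) / 2 := by
    rw [Real.log_exp, ← Real.exp_nat_mul, Real.exp_neg]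
    norm_num
    ring
  have hE := Real.exp_pos (1 / 2)
  unfold logVar
  rcases le_or_gt b (Real.exp (1 / 2)) with hb | hb
  · rw [if_pos hb, if_pos (hab.trans hb)]
    have := monotoneOn_log_div_sq (Set.mem_Ioc.2 ⟨ha, hab.trans hb⟩)
      (Set.mem_Ioc.2 ⟨ha.trans_le hab, hb⟩) hab
    simp only at this
    rw [abs_of_nonpos (by linarith)]
    linarith
  · rw [if_neg hb.not_ge]
    have h1 := antitoneOn_log_div_sq (Set.mem_Ici.2 le_rfl) (Set.mem_Ici.2 hb.le) hb.le
    simp only at h1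
    rw [hpk] at h1
    rcases le_or_gt a (Real.exp (1 / 2)) with ha' | ha'
    · rw [if_pos ha']
      have h2 := monotoneOn_log_div_sq (Set.mem_Ioc.2 ⟨ha, ha'⟩)
        (Set.mem_Ioc.2 ⟨hE, le_rfl⟩) ha'
      simp only at h2
      rw [hpk] at h2
      rw [abs_le]; constructor <;> linarith
    · rw [if_neg ha'.not_ge]
      have h2 := antitoneOn_log_div_sq (Set.mem_Ici.2 ha'.le) (Set.mem_Ici.2 hb.le) hab
      simp only at h2
      rw [abs_of_nonneg (by linarith)]
      linarith

/-- Abel summation with bounded partial sums of `e` against a sequence of bounded variation. -/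
lemma abs_sum_mul_le {e φ Γ : ℕ → ℝ} {C : ℝ} {k : ℕ}
    (hE : ∀ M, |∑ m ∈ Ioc k M, e m| ≤ C)
    (hΓ : ∀ m, k < m → |φ m - φ (m + 1)| ≤ Γ (m + 1) - Γ m) (n : ℕ) :
    |∑ m ∈ Ioc k (k + n + 1), e m * φ m|
      ≤ C * (|φ (k + n + 1)| + Γ (k + n + 1) - Γ (k + 1)) := by
  have hC : 0 ≤ C := (abs_nonneg _).trans (hE 0)
  have key : |∑ m ∈ Ioc k (k + n + 1), e m * φ m
      - (∑ m ∈ Ioc k (k + n + 1), e m) * φ (k + n + 1)| ≤ C * (Γ (k + n + 1) - Γ (k + 1)) := by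
    induction n with
    | zero => simp
    | succ n ih =>
      have e1 : k + (n + 1) + 1 = (k + n + 1) + 1 := by ring
      have s1 := sum_Ioc_succ_top (by omega : k ≤ k + n + 1) fun m => e m * φ m
      have s2 := sum_Ioc_succ_top (by omega : k ≤ k + n + 1) e
      rw [e1, s1, s2]
      have h1 := hΓ (k + n + 1) (by omega)
      have h2 : |(∑ m ∈ Ioc k (k + n + 1), e m) * (φ (k + n + 1) - φ (k + n + 1 + 1))|
          ≤ C * (Γ (k + n + 1 + 1) - Γ (k + n + 1)) := by
        rw [abs_mul]; exact mul_le_mul (hE _) h1 (abs_nonneg _) hC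
      calc _ = |(∑ m ∈ Ioc k (k + n + 1), e m * φ m
                  - (∑ m ∈ Ioc k (k + n + 1), e m) * φ (k + n + 1))
                + (∑ m ∈ Ioc k (k + n + 1), e m) * (φ (k + n + 1) - φ (k + n + 1 + 1))| := by
              congr 1; ring
        _ ≤ _ := (abs_add_le _ _).trans (add_le_add ih h2)
        _ = _ := by ring
  have h3 : |(∑ m ∈ Ioc k (k + n + 1), e m) * φ (k + n + 1)| ≤ C * |φ (k + n + 1)| := by
    rw [abs_mul]; gcongr; exact hE _
  calc _ = |(∑ m ∈ Ioc k (k + n + 1), e m * φ m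
      - (∑ m ∈ Ioc k (k + n + 1), e m) * φ (k + n + 1))
        + (∑ m ∈ Ioc k (k + n + 1), e m) * φ (k + n + 1)| := by congr 1; ring
    _ ≤ _ := (abs_add_le _ _).trans (add_le_add key h3)
    _ = _ := by ring

lemma tendsto_log_div_sq : Tendsto (fun t : ℝ => Real.log t / t ^ 2) atTop (𝓝 0) := by
  have := (isLittleO_log_rpow_atTop (r := 2) (by norm_num)).tendsto_div_nhds_zero
  simpa using this

/-- With `w = u * exp (g / 2)`, the kernel is `-(2 / w ^ 2) * ∑ e(m) φ(m / w)` over `m > u`, where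
`φ(t) = log t / t ^ 2`. Partial summation bounds it by `C` times the total variation of `φ` beyond
`exp (-g / 2)`. -/
lemma abs_tailKer_le {e : ℕ → ℝ} {L L' g C : ℝ} (hg : 0 ≤ g)
    (hL : Tendsto (fun M : ℕ => ∑ m ∈ Ioc 0 M, e m / m ^ 2) atTop (𝓝 L))
    (hL' : Tendsto (fun M : ℕ => ∑ m ∈ Ioc 0 M, e m * Real.log m / m ^ 2) atTop (𝓝 L'))
    (hE : ∀ k M, |∑ m ∈ Ioc k M, e m| ≤ C) {u : ℝ} (hu : 1 ≤ u) :
    |tailKer e L L' g ⌊u⌋₊ u| ≤ C * (g + 2 * Real.exp (-1 - g)) / u ^ 2 := by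
  set k := ⌊u⌋₊ with hk
  have hu0 : 0 < u := by linarith
  set w := u * Real.exp (g / 2) with hw
  have hw0 : 0 < w := by positivity
  have hw2 : w ^ 2 = u ^ 2 * Real.exp g := by
    rw [hw, mul_pow, ← Real.exp_nat_mul]; congr 2; push_cast; ring
  have hlw : 2 * Real.log w = g + 2 * Real.log u := by
    rw [hw, Real.log_mul hu0.ne' (Real.exp_pos _).ne', Real.log_exp]; ring
  have hC : 0 ≤ C := (abs_nonneg _).trans (hE 0 0)
  let φ : ℕ → ℝ := fun m => -(2 / w ^ 2) * (Real.log (m / w) / (m / w) ^ 2)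
  let Γ : ℕ → ℝ := fun m => 2 / w ^ 2 * logVar (m / w)
  have hφ : ∀ m : ℕ, 0 < m → e m * φ m
      = e m / m ^ 2 * (g + 2 * Real.log u) - 2 * (e m * Real.log m / m ^ 2) := by
    intro m hm
    have hm0 : (0 : ℝ) < m := by exact_mod_cast hm
    simp only [φ]
    rw [Real.log_div hm0.ne' hw0.ne', ← hlw]
    field_simp
    ring
  have hΓ : ∀ m, k < m → |φ m - φ (m + 1)| ≤ Γ (m + 1) - Γ m := by
    intro m hm
    have hm0 : (0 : ℝ) < m := by exact_mod_cast (by omega : 0 < m)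
    simp only [φ, Γ]
    rw [← mul_sub, ← mul_sub, abs_mul, abs_neg, abs_of_pos (by positivity : 0 < 2 / w ^ 2)]
    refine mul_le_mul_of_nonneg_left ?_ (by positivity)
    apply abs_sub_le_logVar (by positivity)
    push_cast; gcongr; linarith
  have hwt : Tendsto (fun n : ℕ => ((k + n + 1 : ℕ) : ℝ) / w) atTop atTop := by
    refine Tendsto.atTop_div_const hw0 (tendsto_natCast_atTop_atTop.comp ?_)
    exact tendsto_atTop_mono (fun n => by simp only [id]; omega) tendsto_id
  have hsh : Tendsto (fun n : ℕ => k + n + 1) atTop atTop :=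
    tendsto_atTop_mono (fun n => by simp only [id]; omega) tendsto_id
  have hφ0 : Tendsto (fun n : ℕ => |φ (k + n + 1)|) atTop (𝓝 0) := by
    have := (((tendsto_log_div_sq.comp hwt).const_mul (-(2 / w ^ 2))).abs)
    simpa [φ, Function.comp] using this
  have hΓ0 : Tendsto (fun n : ℕ => Γ (k + n + 1)) atTop (𝓝 (2 / w ^ 2 * Real.exp (-1))) := by
    have h1 := ((tendsto_log_div_sq.comp hwt).const_sub (Real.exp (-1))).const_mul (2 / w ^ 2)
    rw [sub_zero] at h1
    refine h1.congr' ?_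
    filter_upwards [hwt.eventually_gt_atTop (Real.exp (1 / 2))] with n hn
    simp only [Γ, Function.comp, logVar]
    rw [if_neg hn.not_ge]
  have hlhs : Tendsto (fun n : ℕ => |∑ m ∈ Ioc k (k + n + 1), e m * φ m|) atTop
      (𝓝 |tailKer e L L' g k u|) := by
    have h1 := (((hL.comp hsh).sub_const (∑ m ∈ Ioc 0 k, e m / m ^ 2)).mul_const
      (g + 2 * Real.log u)).sub (((hL'.comp hsh).sub_const
        (∑ m ∈ Ioc 0 k, e m * Real.log m / m ^ 2)).const_mul 2)
    refine (h1.congr fun n => ?_).abs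
    simp only [Function.comp]
    rw [← sum_Ioc_consecutive _ (Nat.zero_le k) (by omega : k ≤ k + n + 1),
      ← sum_Ioc_consecutive (fun m : ℕ => e m * Real.log m / (m : ℝ) ^ 2) (Nat.zero_le k)
        (by omega : k ≤ k + n + 1), add_sub_cancel_left, add_sub_cancel_left, sum_mul, mul_sum,
      ← sum_sub_distrib]
    refine sum_congr rfl fun m hm => ?_
    rw [mem_Ioc] at hm
    rw [hφ m (by omega)]
  have hrhs := ((hφ0.add hΓ0).sub_const (Γ (k + 1))).const_mul C
  have hfin := le_of_tendsto_of_tendsto' hlhs hrhs (fun n => abs_sum_mul_le (hE k) hΓ n)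
  refine hfin.trans ?_
  have hk1 : Real.exp (-(g / 2)) ≤ ((k + 1 : ℕ) : ℝ) / w := by
    rw [le_div_iff₀ hw0, hw, mul_comm u, ← mul_assoc, ← Real.exp_add]
    simp only [neg_add_cancel, Real.exp_zero, one_mul]
    push_cast
    exact (Nat.lt_floor_add_one u).le
  have hmono : logVar (Real.exp (-(g / 2))) ≤ logVar (((k + 1 : ℕ) : ℝ) / w) := by
    have := (abs_nonneg _).trans (abs_sub_le_logVar (Real.exp_pos _) hk1)
    linarith
  have hval : logVar (Real.exp (-(g / 2))) = -(g / 2) * Real.exp g := by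
    unfold logVar
    rw [if_pos (Real.exp_le_exp.2 (by linarith)), Real.log_exp, ← Real.exp_nat_mul,
      div_eq_mul_inv, ← Real.exp_neg]
    congr 2; push_cast; ring
  rw [hval] at hmono
  have hexp : Real.exp (-1 - g) * Real.exp g = Real.exp (-1) := by
    rw [← Real.exp_add]; congr 1; ring
  calc C * (0 + 2 / w ^ 2 * Real.exp (-1) - Γ (k + 1))
      ≤ C * (0 + 2 / w ^ 2 * Real.exp (-1) - 2 / w ^ 2 * (-(g / 2) * Real.exp g)) := by
        have : (0 : ℝ) ≤ 2 / w ^ 2 := by positivity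
        refine mul_le_mul_of_nonneg_left (sub_le_sub_left ?_ _) hC
        exact mul_le_mul_of_nonneg_left hmono this
    _ = C * (g + 2 * Real.exp (-1 - g)) / u ^ 2 := by
        rw [hw2, ← hexp]
        have := (Real.exp_pos g).ne'
        field_simp
        ring

/-- On `[k, k + 1]` the kernel is an affine function of `log u`. -/
lemma abs_tailKer_le_of_mem {e : ℕ → ℝ} {L L' g b : ℝ} {k : ℕ} (hk : 0 < k)
    (h1 : |tailKer e L L' g k k| ≤ b) (h2 : |tailKer e L L' g k (k + 1)| ≤ b)
    {u : ℝ} (hu1 : (k : ℝ) ≤ u) (hu2 : u ≤ k + 1) : |tailKer e L L' g k u| ≤ b := by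
  have hk0 : (0 : ℝ) < k := by exact_mod_cast hk
  have l1 := Real.log_le_log hk0 hu1
  have l2 := Real.log_le_log (hk0.trans_le hu1) hu2
  unfold tailKer at *
  rw [abs_le] at *
  rcases le_total 0 (L - ∑ m ∈ Ioc 0 k, e m / (m : ℝ) ^ 2) with h | h
  · constructor <;> nlinarith
  · constructor <;> nlinarith

/-! ### Sums over blocks and counting squarefree integers -/

/-- Each term `1 / d ^ 2` is at most the mean value of `1 / t ^ 2` on the interval of length `v` that
is centred at `d`. -/
lemma sum_copr_div_sq_le {v : ℕ} (hv : v = 1 ∨ v = 2) {m n : ℕ} (hm : 0 < m) (hmn : m ≤ n) :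
    ∑ d ∈ Ioc m n, copr v d / (d : ℝ) ^ 2
      ≤ 1 / v * (1 / ((m : ℝ) + 1 - v / 2) - 1 / ((n : ℝ) + v / 2)) := by
  have tele : ∀ G : ℕ → ℝ, (∀ d, 0 < d → copr v (d + 1) / ((d + 1 : ℕ) : ℝ) ^ 2 ≤ G d - G (d + 1)) →
      ∑ d ∈ Ioc m n, copr v d / (d : ℝ) ^ 2 ≤ G m - G n := by
    intro G hG
    induction n, hmn using Nat.le_induction with
    | base => simp
    | succ n hn ih =>
      rw [sum_Ioc_succ_top (by omega)]
      have := hG n (by omega)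
      linarith
  have hm1 : (1 : ℝ) ≤ m := by exact_mod_cast hm
  have hn1 : (1 : ℝ) ≤ n := by exact_mod_cast hm.trans_le hmn
  rcases hv with rfl | rfl
  · refine (tele (fun d => 1 / ((d : ℝ) + 1 / 2)) ?_).trans ?_
    · intro d hd
      rw [copr_one, div_sub_div _ _ (by positivity) (by positivity), div_le_div_iff₀ (by positivity)
        (by positivity)]
      push_cast
      nlinarith [(by positivity : (0 : ℝ) ≤ d)]
    · push_cast
      apply le_of_eq
      rw [show (m : ℝ) + 1 - 1 / 2 = m + 1 / 2 by ring]; ring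
  · refine (tele (fun d => 1 / (2 * ((2 * ((d + 1) / 2) : ℕ) : ℝ))) ?_).trans ?_
    · intro d hd
      rcases Nat.even_or_odd' d with ⟨c, rfl | rfl⟩
      · have h1 : (2 * c + 1) / 2 = c := by omega
        have h2 : (2 * c + 1 + 1) / 2 = c + 1 := by omega
        have hc : (0 : ℝ) < c := by exact_mod_cast (by omega : 0 < c)
        rw [h1, h2]
        refine (div_le_div_of_nonneg_right (copr_le_one _ _) (by positivity)).trans ?_
        rw [div_sub_div _ _ (by positivity) (by positivity), div_le_div_iff₀ (by positivity)
          (by positivity)]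
        push_cast
        nlinarith
      · have h1 : (2 * c + 1 + 1) / 2 = c + 1 := by omega
        have h2 : (2 * c + 1 + 1 + 1) / 2 = c + 1 := by omega
        rw [h1, h2]
        have : copr 2 (2 * c + 1 + 1) = 0 := by
          unfold copr; rw [if_neg]; rw [Nat.coprime_two_right]; rw [Nat.not_odd_iff_even]
          exact ⟨c + 1, by ring⟩
        rw [this]; simp
    · have hl : (m : ℝ) ≤ ((2 * ((m + 1) / 2) : ℕ) : ℝ) := by exact_mod_cast (by omega)
      have hr : ((2 * ((n + 1) / 2) : ℕ) : ℝ) ≤ n + 1 := by exact_mod_cast (by omega)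
      have hr0 : (0 : ℝ) < ((2 * ((n + 1) / 2) : ℕ) : ℝ) := by exact_mod_cast (by omega)
      have h1 : 1 / (2 * ((2 * ((m + 1) / 2) : ℕ) : ℝ)) ≤ 1 / (2 * m) := by gcongr
      have h2 : 1 / (2 * ((n : ℝ) + 1)) ≤ 1 / (2 * ((2 * ((n + 1) / 2) : ℕ) : ℝ)) := by gcongr
      have h3 : 1 / ((2 : ℕ) : ℝ) * (1 / ((m : ℝ) + 1 - (2 : ℕ) / 2) - 1 / ((n : ℝ) + (2 : ℕ) / 2))
          = 1 / (2 * m) - 1 / (2 * ((n : ℝ) + 1)) := by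
        push_cast
        rw [show (m : ℝ) + 1 - 2 / 2 = m by ring, show (n : ℝ) + 2 / 2 = n + 1 by ring]
        field_simp
      rw [h3]; linarith

/-- The block consists of the `d` with `⌊y / d⌋ = k`. -/
lemma sum_block_le {v : ℕ} (hv : v = 1 ∨ v = 2) {k : ℕ} (hk : 0 < k) {y : ℝ}
    (hy : (v : ℝ) * (k + 1) ≤ y) :
    y * ∑ d ∈ Ioc ⌊y / (k + 1)⌋₊ ⌊y / k⌋₊, copr v d / (d : ℝ) ^ 2
      ≤ 1 / v + 3 / 2 * (k + 1) ^ 2 / y := by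
  have hv1 : (1 : ℝ) ≤ v := by rcases hv with rfl | rfl <;> norm_num
  have hk0 : (0 : ℝ) < k := by exact_mod_cast hk
  have hy0 : 0 < y := by nlinarith
  have hY1 : (v : ℝ) ≤ y / (k + 1) := by rw [le_div_iff₀ (by positivity)]; exact hy
  have hm : 0 < ⌊y / (k + 1)⌋₊ := Nat.floor_pos.2 (hv1.trans hY1)
  have hle : y / (k + 1) ≤ y / k := by gcongr; linarith
  have h1 := sum_copr_div_sq_le hv hm (Nat.floor_le_floor hle)
  set A := y / (k + 1) with hA
  set B := y / k with hB
  have hB0 : 0 < B := by positivity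
  have hA0 : 0 < A := by positivity
  have h2 : A < ⌊A⌋₊ + 1 := Nat.lt_floor_add_one A
  have h3 : (⌊B⌋₊ : ℝ) ≤ B := Nat.floor_le hB0.le
  have h4 : 1 / ((⌊A⌋₊ : ℝ) + 1 - v / 2) ≤ 1 / (A - v / 2) := by
    apply one_div_le_one_div_of_le <;> linarith
  have h5 : 1 / (B + v / 2) ≤ 1 / ((⌊B⌋₊ : ℝ) + v / 2) := by gcongr
  have h6 : 1 / (A - v / 2) ≤ 1 / A + v / A ^ 2 := by
    have : 0 < A - v / 2 := by linarith
    rw [div_add_div _ _ hA0.ne' (by positivity), div_le_div_iff₀ this (by positivity)]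
    nlinarith [mul_nonneg (mul_nonneg hA0.le (by linarith : (0 : ℝ) ≤ v)) (sub_nonneg.2 hY1)]
  have h7 : 1 / B - v / 2 / B ^ 2 ≤ 1 / (B + v / 2) := by
    rw [div_sub_div _ _ hB0.ne' (by positivity), div_le_div_iff₀ (by positivity) (by positivity)]
    nlinarith [sq_nonneg (v : ℝ), hB0, mul_nonneg hB0.le (sq_nonneg (v : ℝ))]
  have h8 : ∑ d ∈ Ioc ⌊A⌋₊ ⌊B⌋₊, copr v d / (d : ℝ) ^ 2
      ≤ 1 / v * (1 / A + v / A ^ 2 - (1 / B - v / 2 / B ^ 2)) := by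
    refine h1.trans ?_
    apply mul_le_mul_of_nonneg_left _ (by positivity); linarith
  calc y * ∑ d ∈ Ioc ⌊A⌋₊ ⌊B⌋₊, copr v d / (d : ℝ) ^ 2
      ≤ y * (1 / v * (1 / A + v / A ^ 2 - (1 / B - v / 2 / B ^ 2))) := by gcongr
    _ = 1 / v + ((k + 1) ^ 2 + k ^ 2 / 2) / y := by
        rw [hA, hB]; field_simp; ring
    _ ≤ _ := by
        gcongr; nlinarith

lemma sum_indicator_dvd (N k : ℕ) :
    ∑ n ∈ Ioc 0 N, (if k ∣ n then (1 : ℝ) else 0) = ((N / k : ℕ) : ℝ) := by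
  rw [sum_boole, Nat.Ioc_filter_dvd_card_eq_div]

lemma sqc_eq_zero {v n k : ℕ} (hk : 1 < k) (h : k ^ 2 ∣ n) : sqc v n = 0 := by
  unfold sqc
  rw [ArithmeticFunction.moebius_eq_zero_of_not_squarefree]
  · simp
  · intro hs
    have := hs k (by rw [← sq]; exact h)
    rw [Nat.isUnit_iff] at this; omega

lemma natCast_div_le_and (N k : ℕ) (hk : 0 < k) :
    (N : ℝ) / k - 1 ≤ ((N / k : ℕ) : ℝ) ∧ ((N / k : ℕ) : ℝ) ≤ (N : ℝ) / k := by
  refine ⟨?_, Nat.cast_div_le⟩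
  have hk0 : (0 : ℝ) < k := by exact_mod_cast hk
  rw [← Nat.floor_div_eq_div (K := ℝ)]
  linarith [Nat.lt_floor_add_one ((N : ℝ) / k)]

/-- Inclusion and exclusion for the integers that are divisible by none of `4`, `9`, `25`. -/
lemma sqCount_one_le {y : ℝ} (hy : 0 ≤ y) : sqCount 1 y ≤ 16 / 25 * y + 4 := by
  have h1 : sqCount 1 y ≤ ∑ n ∈ Ioc 0 ⌊y⌋₊, (1 - (if 4 ∣ n then (1 : ℝ) else 0)
      - (if 9 ∣ n then (1 : ℝ) else 0) - (if 25 ∣ n then (1 : ℝ) else 0)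
      + (if 36 ∣ n then (1 : ℝ) else 0) + (if 100 ∣ n then (1 : ℝ) else 0)
      + (if 225 ∣ n then (1 : ℝ) else 0) - (if 900 ∣ n then (1 : ℝ) else 0)) := by
    refine sum_le_sum fun n _ => ?_
    have h36 : 36 ∣ n ↔ 4 ∣ n ∧ 9 ∣ n := by omega
    have h100 : 100 ∣ n ↔ 4 ∣ n ∧ 25 ∣ n := by omega
    have h225 : 225 ∣ n ↔ 9 ∣ n ∧ 25 ∣ n := by omega
    have h900 : 900 ∣ n ↔ 4 ∣ n ∧ 9 ∣ n ∧ 25 ∣ n := by omega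
    simp only [h36, h100, h225, h900]
    have hle : sqc 1 n ≤ 1 := (sqc_le_copr _ _).trans (copr_le_one _ _)
    by_cases h4 : 4 ∣ n
    · rw [sqc_eq_zero (k := 2) (by norm_num) (by norm_num; exact h4)]
      simp only [h4, true_and, if_true]
      split_ifs <;> simp_all
    by_cases h9 : 9 ∣ n
    · rw [sqc_eq_zero (k := 3) (by norm_num) (by norm_num; exact h9)]
      simp only [h9, true_and, if_true]
      split_ifs <;> simp_all
    by_cases h25 : 25 ∣ n
    · rw [sqc_eq_zero (k := 5) (by norm_num) (by norm_num; exact h25)]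
      simp only [h25, if_true]
      split_ifs <;> simp_all
    simpa [h4, h9, h25] using hle
  refine h1.trans ?_
  simp only [sum_add_distrib, sum_sub_distrib, sum_indicator_dvd]
  have hN : (⌊y⌋₊ : ℝ) ≤ y := Nat.floor_le hy
  have a4 := natCast_div_le_and ⌊y⌋₊ 4 (by norm_num)
  have a9 := natCast_div_le_and ⌊y⌋₊ 9 (by norm_num)
  have a25 := natCast_div_le_and ⌊y⌋₊ 25 (by norm_num)
  have a36 := natCast_div_le_and ⌊y⌋₊ 36 (by norm_num)
  have a100 := natCast_div_le_and ⌊y⌋₊ 100 (by norm_num)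
  have a225 := natCast_div_le_and ⌊y⌋₊ 225 (by norm_num)
  have a900 := natCast_div_le_and ⌊y⌋₊ 900 (by norm_num)
  push_cast at *
  simp only [sum_const, Nat.card_Ioc, nsmul_eq_mul, mul_one, Nat.sub_zero]
  linarith [a4.1, a9.1, a25.1, a36.2, a100.2, a225.2, a900.1]

/-- The odd integers that are not divisible by `9`. -/
lemma sqCount_two_le {y : ℝ} (hy : 0 ≤ y) : sqCount 2 y ≤ 4 / 9 * y + 2 := by
  have h1 : sqCount 2 y ≤ ∑ n ∈ Ioc 0 ⌊y⌋₊, (1 - (if 2 ∣ n then (1 : ℝ) else 0)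
      - (if 9 ∣ n then (1 : ℝ) else 0) + (if 18 ∣ n then (1 : ℝ) else 0)) := by
    refine sum_le_sum fun n _ => ?_
    have h18 : 18 ∣ n ↔ 2 ∣ n ∧ 9 ∣ n := by omega
    simp only [h18]
    have hle : sqc 2 n ≤ 1 := (sqc_le_copr _ _).trans (copr_le_one _ _)
    by_cases h2 : 2 ∣ n
    · have : sqc 2 n = 0 := by
        unfold sqc copr
        rw [if_neg (by rw [Nat.coprime_two_right, Nat.not_odd_iff_even]; exact even_iff_two_dvd.2 h2)]
        simp
      rw [this]
      simp only [h2, true_and, if_true]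
      split_ifs <;> simp_all
    by_cases h9 : 9 ∣ n
    · rw [sqc_eq_zero (k := 3) (by norm_num) (by norm_num; exact h9)]
      simp [h2, h9]
    simpa [h2, h9] using hle
  refine h1.trans ?_
  simp only [sum_add_distrib, sum_sub_distrib, sum_indicator_dvd]
  have hN : (⌊y⌋₊ : ℝ) ≤ y := Nat.floor_le hy
  have a2 := natCast_div_le_and ⌊y⌋₊ 2 (by norm_num)
  have a9 := natCast_div_le_and ⌊y⌋₊ 9 (by norm_num)
  have a18 := natCast_div_le_and ⌊y⌋₊ 18 (by norm_num)
  push_cast at *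
  simp only [sum_const, Nat.card_Ioc, nsmul_eq_mul, mul_one, Nat.sub_zero]
  linarith [a2.1, a9.1, a18.2]

/-- The bound for the tail of the Möbius sum that results from grouping the `d ≤ y` according
to `⌊y / d⌋`: the `d ≤ y / k₀` are counted, the others are treated as an integral. -/
lemma abs_tailT_le {v : ℕ} (hv : v = 1 ∨ v = 2) {c e : ℕ → ℝ} {J k₀ : ℕ} {L L' g B : ℝ}
    {b : ℕ → ℝ} (hL : 0 < L)
    (hg : g = Real.eulerMascheroniConstant + Real.log v + 2 * (L' / L))
    (hce : ∀ n, 0 < n → ∑ x ∈ n.divisorsAntidiagonal, muc v x.1 * e x.2 = c n)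
    (hJ : ∀ n, J < n → c n = 0)
    (hB : ∀ u : ℝ, 1 ≤ u → |tailKer e L L' g ⌊u⌋₊ u| ≤ B / u ^ 2) (hk₀ : 0 < k₀)
    (hb1 : ∀ k, 0 < k → k < k₀ → |tailKer e L L' g k k| ≤ b k)
    (hb2 : ∀ k, 0 < k → k < k₀ → |tailKer e L L' g k (k + 1)| ≤ b k)
    {y : ℝ} (hy1 : 1 ≤ y) (hyJ : (J : ℝ) ≤ y) (hyk : (v : ℝ) * k₀ ≤ y) :
    L * (y * |tailT v y|)
      ≤ ∑ k ∈ Ico 1 k₀, b k * (1 / v + 3 / 2 * (k + 1) ^ 2 / y)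
        + B * (sqCount v (y / k₀) / y) := by
  have hy0 : 0 < y := by linarith
  have hk0 : (0 : ℝ) < k₀ := by exact_mod_cast hk₀
  have h1 := tailT_eq_neg_sum hL.ne' hg hce hJ hB hy1 hyJ
  let F : ℕ → ℝ := fun d => muc v d / d ^ 2 * tailKer e L L' g ⌊y / d⌋₊ (y / d)
  have h2 : L * (y * |tailT v y|) = y * |∑ d ∈ Ioc 0 ⌊y⌋₊, F d| := by
    have : L * |tailT v y| = |∑ d ∈ Ioc 0 ⌊y⌋₊, F d| := by
      rw [← abs_neg (∑ d ∈ Ioc 0 ⌊y⌋₊, F d), ← h1, abs_mul, abs_of_pos hL]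
    rw [← this]; ring
  rw [h2]
  have hsplit : |∑ d ∈ Ioc 0 ⌊y⌋₊, F d| ≤ ∑ d ∈ Ioc 0 ⌊y / k₀⌋₊, |F d|
      + ∑ k ∈ Ico 1 k₀, ∑ d ∈ Ioc ⌊y / (k + 1)⌋₊ ⌊y / k⌋₊, |F d| := by
    refine (abs_sum_le_sum_abs _ _).trans (le_of_eq ?_)
    have hch : ∀ K : ℕ, 1 ≤ K → ∑ d ∈ Ioc 0 ⌊y⌋₊, |F d| = ∑ d ∈ Ioc 0 ⌊y / K⌋₊, |F d|
        + ∑ k ∈ Ico 1 K, ∑ d ∈ Ioc ⌊y / (k + 1)⌋₊ ⌊y / k⌋₊, |F d| := by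
      intro K hK
      induction K, hK using Nat.le_induction with
      | base => simp
      | succ K hK ih =>
        have hK0 : (0 : ℝ) < K := by exact_mod_cast hK
        rw [ih, sum_Ico_succ_top hK, ← sum_Ioc_consecutive (fun d => |F d|) (Nat.zero_le ⌊y / (K + 1)⌋₊)
          (Nat.floor_le_floor (by gcongr; linarith) : ⌊y / (K + 1)⌋₊ ≤ ⌊y / K⌋₊)]
        push_cast
        ring
    exact hch k₀ hk₀
  have hA : ∑ d ∈ Ioc 0 ⌊y / k₀⌋₊, |F d| ≤ B / y ^ 2 * sqCount v (y / k₀) := by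
    unfold sqCount
    rw [mul_sum]
    refine sum_le_sum fun d hd => ?_
    rw [mem_Ioc] at hd
    have hd0 : (0 : ℝ) < d := by exact_mod_cast hd.1
    have hdy : (d : ℝ) ≤ y / k₀ := (Nat.le_floor_iff (by positivity)).1 hd.2
    have hk1 : (1 : ℝ) ≤ k₀ := by exact_mod_cast hk₀
    have hdy' : (d : ℝ) ≤ y := hdy.trans (div_le_self hy0.le hk1)
    have h1 := hB (y / d) ((one_le_div hd0).2 hdy')
    simp only [F]
    rw [abs_mul, abs_div, abs_of_pos (by positivity : (0 : ℝ) < (d : ℝ) ^ 2), abs_muc]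
    calc sqc v d / (d : ℝ) ^ 2 * |tailKer e L L' g ⌊y / d⌋₊ (y / d)|
        ≤ sqc v d / (d : ℝ) ^ 2 * (B / (y / d) ^ 2) := by
          gcongr; exact div_nonneg (sqc_nonneg _ _) (by positivity)
      _ = B / y ^ 2 * sqc v d := by field_simp
  have hBk : ∀ k ∈ Ico 1 k₀, y * ∑ d ∈ Ioc ⌊y / (k + 1)⌋₊ ⌊y / k⌋₊, |F d|
      ≤ b k * (1 / v + 3 / 2 * (k + 1) ^ 2 / y) := by
    intro k hk
    rw [mem_Ico] at hk
    have hk' : (0 : ℝ) < k := by exact_mod_cast hk.1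
    have hbk : 0 ≤ b k := (abs_nonneg _).trans (hb1 k hk.1 hk.2)
    have hvk : (v : ℝ) * (k + 1) ≤ y := by
      refine le_trans ?_ hyk
      gcongr
      exact_mod_cast hk.2
    refine le_trans ?_ (mul_le_mul_of_nonneg_left (sum_block_le hv hk.1 hvk) hbk)
    have : ∑ d ∈ Ioc ⌊y / (k + 1)⌋₊ ⌊y / k⌋₊, |F d|
        ≤ b k * ∑ d ∈ Ioc ⌊y / (k + 1)⌋₊ ⌊y / k⌋₊, copr v d / (d : ℝ) ^ 2 := by
      rw [mul_sum]
      refine sum_le_sum fun d hd => ?_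
      rw [mem_Ioc] at hd
      have hdpos : 0 < d := by omega
      have hd0 : (0 : ℝ) < d := by exact_mod_cast hdpos
      have hdy : (d : ℝ) ≤ y / k := (Nat.le_floor_iff (by positivity)).1 hd.2
      have hdy' : y / (k + 1) < d := (Nat.floor_lt (by positivity)).1 hd.1
      have u1 : (k : ℝ) ≤ y / d := by
        rw [le_div_iff₀ hd0]; rw [le_div_iff₀ hk'] at hdy; linarith
      have u2 : y / d < k + 1 := by
        rw [div_lt_iff₀ hd0]; rw [div_lt_iff₀ (by positivity)] at hdy'; linarith
      have hfl : ⌊y / d⌋₊ = k := (Nat.floor_eq_iff (by positivity)).2 ⟨u1, u2⟩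
      simp only [F]
      rw [hfl, abs_mul, abs_div, abs_of_pos (by positivity : (0 : ℝ) < (d : ℝ) ^ 2), abs_muc,
        mul_comm (b k)]
      have := abs_tailKer_le_of_mem hk.1 (hb1 k hk.1 hk.2) (hb2 k hk.1 hk.2) u1 u2.le
      have h3 := sqc_le_copr v d
      have h4 := sqc_nonneg v d
      have h5 := copr_nonneg v d
      gcongr
    calc y * ∑ d ∈ Ioc ⌊y / (k + 1)⌋₊ ⌊y / k⌋₊, |F d|
        ≤ y * (b k * ∑ d ∈ Ioc ⌊y / (k + 1)⌋₊ ⌊y / k⌋₊, copr v d / (d : ℝ) ^ 2) := by gcongr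
      _ = _ := by ring
  calc y * |∑ d ∈ Ioc 0 ⌊y⌋₊, F d|
      ≤ y * (B / y ^ 2 * sqCount v (y / k₀)
        + ∑ k ∈ Ico 1 k₀, ∑ d ∈ Ioc ⌊y / (k + 1)⌋₊ ⌊y / k⌋₊, |F d|) := by
        gcongr; linarith
    _ = ∑ k ∈ Ico 1 k₀, y * ∑ d ∈ Ioc ⌊y / (k + 1)⌋₊ ⌊y / k⌋₊, |F d|
        + B * (sqCount v (y / k₀) / y) := by
        rw [← mul_sum]; field_simp; ring
    _ ≤ _ := add_le_add_left (sum_le_sum hBk) _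

/-! ### Fixed-point evaluation of arithmetic sums by the kernel -/

/-- `f n`, with `n` reduced to a literal by the kernel before `f` is entered. -/
def forceNat {β : Type} (n : ℕ) (f : ℕ → β) : β := Nat.rec (f 0) (fun k _ => f (k + 1)) n

lemma forceNat_eq {β : Type} (n : ℕ) (f : ℕ → β) : forceNat n f = f n := by
  cases n <;> rfl

/-- `f z`, with `z` reduced to a literal by the kernel before `f` is entered. -/
def forceInt {β : Type} (z : ℤ) (f : ℤ → β) : β :=
  Int.rec (fun n => forceNat n fun m => f (Int.ofNat m))
    (fun n => forceNat n fun m => f (Int.negSucc m)) z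

lemma forceInt_eq {β : Type} (z : ℤ) (f : ℤ → β) : forceInt z f = f z := by
  cases z <;> simp only [forceInt, forceNat_eq]

/-- The truncated series `∑ t x ^ (-i) / (d + 2 i)`, with every division rounded down. -/
def logSer : ℕ → ℕ → ℕ → ℕ → ℕ
  | 0, _, _, _ => 0
  | f + 1, t, d, x => t / d + forceNat (t / x) fun t => logSer f t (d + 2) x

/-- An approximation to `10 ^ 15 (log (n + 1) - log n)`. -/
def logStep (n : ℕ) : ℕ :=
  logSer (bif Nat.ble n 9 then 16 else 6) (2 * 10 ^ 15 / (2 * n + 1)) 1 ((2 * n + 1) ^ 2)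

lemma abs_logSer_sub_le (f : ℕ) : ∀ (t d x : ℕ) (T : ℝ), 0 < d → 2 ≤ x → |(t : ℝ) - T| ≤ 2 →
    |(logSer f t d x : ℝ) - ∑ i ∈ range f, T / x ^ i / (d + 2 * i)| ≤ 3 * f := by
  induction f with
  | zero => intro t d x T _ _ _; simp [logSer]
  | succ f ih =>
    intro t d x T hd hx hT
    have hd0 : (1 : ℝ) ≤ d := by exact_mod_cast hd
    have hx0 : (2 : ℝ) ≤ x := by exact_mod_cast hx
    have h1 := natCast_div_le_and t d hd
    have h2 := natCast_div_le_and t x (by omega)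
    have h3 : |((t / x : ℕ) : ℝ) - T / x| ≤ 2 := by
      have : |(t : ℝ) / x - T / x| ≤ 1 := by
        rw [← sub_div, abs_div, abs_of_pos (by linarith : (0 : ℝ) < x), div_le_one (by linarith)]
        linarith
      rw [abs_le] at *; constructor <;> linarith
    have h4 := ih (t / x) (d + 2) x (T / x) (by omega) hx h3
    have h5 : |(t : ℝ) / d - T / d| ≤ 2 := by
      rw [← sub_div, abs_div, abs_of_pos (by linarith : (0 : ℝ) < d)]
      exact (div_le_self (abs_nonneg _) hd0).trans hT
    have h6 : ∑ i ∈ range (f + 1), T / (x : ℝ) ^ i / (d + 2 * i)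
        = T / d + ∑ i ∈ range f, T / x / (x : ℝ) ^ i / (((d + 2 : ℕ) : ℝ) + 2 * i) := by
      rw [sum_range_succ', add_comm]
      congr 1
      · simp
      · refine sum_congr rfl fun i _ => ?_
        push_cast
        rw [pow_succ']
        simp only [div_div]
        congr 1; ring
    rw [h6, logSer, forceNat_eq]
    push_cast
    push_cast at h4
    rw [abs_le] at *
    constructor <;> linarith

/-- `log (n + 1) - log n` is `2 artanh (1 / (2 n + 1))`. The errors of the steps add up to at most
`60 n` in the logarithm of `n`. -/
lemma abs_logStep_sub_le {n : ℕ} (hn : 0 < n) :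
    |(logStep n : ℝ) - 10 ^ 15 * (Real.log (n + 1) - Real.log n)| ≤ 60 := by
  have hn0 : (1 : ℝ) ≤ n := by exact_mod_cast hn
  set x : ℝ := 1 / (2 * n + 1) with hx
  have hx0 : 0 < x := by positivity
  have hx1 : x ≤ 1 / 3 := by rw [hx]; apply one_div_le_one_div_of_le <;> linarith
  have hlog : Real.log ((1 + x) / (1 - x)) = Real.log (n + 1) - Real.log n := by
    rw [← Real.log_div (by positivity) (by positivity)]
    congr 1
    rw [hx]; field_simp; ring
  set f := bif Nat.ble n 9 then 16 else 6 with hf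
  have h1 := Real.sum_range_le_log_div hx0.le (by linarith) f
  have h2 := Real.log_div_le_sum_range_add hx0.le (by linarith) f
  rw [hlog] at h1 h2
  have h3 := abs_logSer_sub_le f (2 * 10 ^ 15 / (2 * n + 1)) 1 ((2 * n + 1) ^ 2)
    (2 * 10 ^ 15 / (2 * n + 1)) one_pos (by nlinarith) (by
      have := natCast_div_le_and (2 * 10 ^ 15) (2 * n + 1) (by omega)
      push_cast at this ⊢
      rw [abs_le]; constructor <;> linarith)
  have h4 : ∑ i ∈ range f, (2 * 10 ^ 15 / (2 * (n : ℝ) + 1)) / (((2 * n + 1) ^ 2 : ℕ) : ℝ) ^ i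
      / (((1 : ℕ) : ℝ) + 2 * i) = 2 * 10 ^ 15 * ∑ i ∈ range f, x ^ (2 * i + 1) / (2 * i + 1) := by
    rw [mul_sum]
    refine sum_congr rfl fun i _ => ?_
    rw [hx]
    push_cast
    rw [div_pow, one_pow, ← pow_mul, pow_succ]
    field_simp
    ring
  rw [h4] at h3
  have hfl : (f : ℝ) ≤ 16 := by
    rw [hf]; cases Nat.ble n 9 <;> norm_num
  have htail : 2 * 10 ^ 15 * (x ^ (2 * f + 1) / (1 - x ^ 2)) ≤ 5 := by
    have h9 : 1 - x ^ 2 ≥ 8 / 9 := by nlinarith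
    have h10 : x ^ (2 * f + 1) ≤ 1 / 10 ^ 15 := by
      rw [hf]
      rcases Nat.lt_or_ge 9 n with h | h
      · have : Nat.ble n 9 = false := by
          rw [Bool.eq_false_iff]; intro h'; have := Nat.le_of_ble_eq_true h'; omega
        rw [this]
        have hx2 : x ≤ 1 / 21 := by
          rw [hx]; apply one_div_le_one_div_of_le (by norm_num)
          have : (10 : ℝ) ≤ n := by exact_mod_cast h
          linarith
        calc x ^ (2 * 6 + 1) ≤ (1 / 21) ^ (2 * 6 + 1) := by gcongr
          _ ≤ _ := by norm_num
      · have : Nat.ble n 9 = true := Nat.ble_eq_true_of_le h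
        rw [this]
        calc x ^ (2 * 16 + 1) ≤ (1 / 3) ^ (2 * 16 + 1) := by gcongr
          _ ≤ _ := by norm_num
    rw [← mul_div_assoc, div_le_iff₀ (by linarith)]
    nlinarith
  have hlg : (logStep n : ℝ) = logSer f (2 * 10 ^ 15 / (2 * n + 1)) 1 ((2 * n + 1) ^ 2) := rfl
  rw [hlg]
  rw [abs_le] at *
  constructor <;> nlinarith

lemma eq_one_or_prime_of_lt_sq {n K : ℕ} (h : ∀ p, p.Prime → p ∣ n → K ≤ p) (hn : 0 < n)
    (hK : n < K ^ 2) : n = 1 ∨ n.Prime := by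
  by_contra! hc
  have h1 := h _ (Nat.minFac_prime hc.1) (Nat.minFac_dvd n)
  have h2 := Nat.minFac_sq_le_self hn hc.2
  have := Nat.pow_le_pow_left h1 2
  omega

/-- `s μ(n)`, by trial division by the primes in the list. The division stops at `p ^ 2 > n`, when what
is left of `n` is `1` or a prime. -/
def mobSign : List ℕ → ℕ → ℤ → ℤ
  | [], n, s => bif Nat.beq n 1 then s else -s
  | p :: ps, n, s =>
    bif Nat.ble (n + 1) (p ^ 2) then bif Nat.beq n 1 then s else -s
    else bif Nat.beq (n % p) 0 then
      forceNat (n / p) fun m => bif Nat.beq (m % p) 0 then 0 else mobSign ps m (-s)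
    else mobSign ps n s

lemma mobSign_eq (ps : List ℕ) : ∀ (n : ℕ) (s : ℤ), (∀ p ∈ ps, p.Prime ∧ p < 71) →
    ps.Pairwise (· < ·) → 0 < n → n < 71 ^ 2 → (∀ p, p.Prime → p ∣ n → p ∈ ps ∨ 71 ≤ p) →
    mobSign ps n s = s * ArithmeticFunction.moebius n := by
  have base : ∀ (n : ℕ) (s : ℤ), n = 1 ∨ n.Prime →
      (bif Nat.beq n 1 then s else -s) = s * ArithmeticFunction.moebius n := by
    rintro n s (rfl | h)
    · simp
    · have h1 : Nat.beq n 1 = false := by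
        rw [Bool.eq_false_iff]; intro h'; exact h.ne_one (Nat.eq_of_beq_eq_true h')
      rw [h1, ArithmeticFunction.moebius_apply_prime h]; simp
  induction ps with
  | nil =>
    intro n s _ _ hn hn' h
    rw [mobSign]
    exact base n s (eq_one_or_prime_of_lt_sq (fun p hp hd => by simpa using h p hp hd) hn hn')
  | cons p ps ih =>
    intro n s hps hsort hn hn' h
    have hp := (hps p (by simp)).1
    have hp71 := (hps p (by simp)).2
    rw [List.pairwise_cons] at hsort
    rw [mobSign]
    cases hc : Nat.ble (n + 1) (p ^ 2) with
    | true =>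
      have hlt := Nat.le_of_ble_eq_true hc
      refine base n s (eq_one_or_prime_of_lt_sq (K := p) (fun r hr hd => ?_) hn (by omega))
      rcases h r hr hd with h1 | h1
      · rcases List.mem_cons.1 h1 with rfl | h2
        · exact le_rfl
        · exact (hsort.1 r h2).le
      · omega
    | false =>
      simp only [cond_false]
      cases hc2 : Nat.beq (n % p) 0 with
      | true =>
        have hd : p ∣ n := Nat.dvd_of_mod_eq_zero (Nat.eq_of_beq_eq_true hc2)
        obtain ⟨m, rfl⟩ := hd
        have hm : 0 < m := Nat.pos_of_ne_zero (by rintro rfl; simp at hn)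
        rw [cond_true, forceNat_eq, Nat.mul_div_cancel_left m hp.pos]
        cases hc3 : Nat.beq (m % p) 0 with
        | true =>
          have hd : p ∣ m := Nat.dvd_of_mod_eq_zero (Nat.eq_of_beq_eq_true hc3)
          rw [ArithmeticFunction.moebius_eq_zero_of_not_squarefree]
          · simp
          · intro hs
            have := hs p (mul_dvd_mul_left p hd)
            rw [Nat.isUnit_iff] at this; exact hp.ne_one this
        | false =>
          have hnd : ¬ p ∣ m := by
            intro hd
            rw [Nat.dvd_iff_mod_eq_zero] at hd
            rw [hd] at hc3; simp at hc3
          rw [cond_false, ih m (-s) (fun r hr => hps r (by simp [hr])) hsort.2 hm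
            (lt_of_le_of_lt (Nat.le_mul_of_pos_left m hp.pos) hn')]
          · rw [ArithmeticFunction.isMultiplicative_moebius.map_mul_of_coprime
              ((Nat.Prime.coprime_iff_not_dvd hp).2 hnd),
              ArithmeticFunction.moebius_apply_prime hp]
            ring
          · intro r hr hrm
            rcases h r hr (hrm.mul_left p) with h1 | h1
            · rcases List.mem_cons.1 h1 with rfl | h2
              · exact absurd hrm hnd
              · exact Or.inl h2
            · exact Or.inr h1
      | false =>
        have hnd : ¬ p ∣ n := by
          intro hd
          rw [Nat.dvd_iff_mod_eq_zero] at hd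
          rw [hd] at hc2; simp at hc2
        rw [cond_false, ih n s (fun r hr => hps r (by simp [hr])) hsort.2 hn hn']
        intro r hr hrm
        rcases h r hr hrm with h1 | h1
        · rcases List.mem_cons.1 h1 with rfl | h2
          · exact absurd hrm hnd
          · exact Or.inl h2
        · exact Or.inr h1

/-- `μ(n)` if `n < 71 ^ 2` is coprime to `v`, and `0` if `n` is not coprime to `v`. -/
def mobCopr (v n : ℕ) : ℤ :=
  bif Nat.beq (Nat.gcd n v) 1 then
    mobSign [2, 3, 5, 7, 11, 13, 17, 19, 23, 29, 31, 37, 41, 43, 47, 53, 59, 61, 67] n 1 else 0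

lemma mobCopr_eq {v n : ℕ} (hn : 0 < n) (hn' : n < 5041) : (mobCopr v n : ℝ) = muc v n := by
  unfold mobCopr muc copr
  by_cases h : n.Coprime v
  · have : Nat.beq (Nat.gcd n v) 1 = true := by rw [h]; rfl
    rw [if_pos h, this, cond_true, mobSign_eq _ n 1 (by norm_num) (by simp) hn (by simpa using hn')]
    · simp
    · intro p hp _
      by_cases h71 : 71 ≤ p
      · exact Or.inr h71
      · left
        have hlt : p < 71 := by omega
        clear h71
        interval_cases p <;> first | (simp; done) | (exfalso; revert hp; norm_num)
  · have : Nat.beq (Nat.gcd n v) 1 = false := by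
      rw [Bool.eq_false_iff]; intro h'; exact h (Nat.eq_of_beq_eq_true h')
    rw [if_neg h, this]; simp

/-- The state of a scan: the approximation `l` to `10 ^ 15 log n`, and three sums over the
positive integers up to `n`. -/
structure Acc where
  /-- the last integer that was added -/
  n : ℕ
  /-- the approximate logarithm of `n` -/
  l : ℤ
  /-- the first sum -/
  a : ℤ
  /-- the second sum -/
  b : ℤ
  /-- the third sum -/
  c : ℤ

/-- The terms to be added, as functions of `n` and its approximate logarithm, and the condition to
be checked for every `n`, which depends on the state and on the approximate logarithm of
`n + 1`. -/
structure Recipe where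
  /-- the term of the first sum -/
  wA : ℕ → ℤ → ℤ
  /-- the term of the second sum -/
  wB : ℕ → ℤ → ℤ
  /-- the term of the third sum -/
  wC : ℕ → ℤ → ℤ
  /-- the condition -/
  ok : Acc → ℤ → Bool

/-- Advance the state by a number of steps; the result is `none` if the condition fails. -/
def scan (R : Recipe) : ℕ → Acc → Option Acc
  | 0, s => some s
  | f + 1, s =>
    forceInt (s.l + bif Nat.beq s.n 0 then 0 else (logStep s.n : ℤ)) fun l =>
    bif R.ok s l then
      forceNat (s.n + 1) fun n =>
      forceInt (s.a + R.wA n l) fun a =>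
      forceInt (s.b + R.wB n l) fun b =>
      forceInt (s.c + R.wC n l) fun c =>
      scan R f ⟨n, l, a, b, c⟩
    else none

/-- Several runs of `scan` in a row; this keeps the recursion shallow. -/
def scanBlocks (R : Recipe) (f : ℕ) : ℕ → Acc → Option Acc
  | 0, s => some s
  | g + 1, s => match scan R f s with
    | some s' => scanBlocks R f g s'
    | none => none

/-- The integers in the state approximate the sums of `a`, `b`, `c`, scaled by `10 ^ 15`. -/
structure Acc.Approx (a b c : ℕ → ℝ) (s : Acc) : Prop where
  log : |(s.l : ℝ) - 10 ^ 15 * Real.log s.n| ≤ 60 * (s.n : ℝ)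
  a : |(s.a : ℝ) - 10 ^ 15 * ∑ m ∈ Ioc 0 s.n, a m| ≤ 70 * (s.n : ℝ)
  b : |(s.b : ℝ) - 10 ^ 15 * ∑ m ∈ Ioc 0 s.n, b m| ≤ 70 * (s.n : ℝ)
  c : |(s.c : ℝ) - 10 ^ 15 * ∑ m ∈ Ioc 0 s.n, c m| ≤ 70 * (s.n : ℝ)

/-- The terms of the recipe approximate `a`, `b`, `c` up to `N`, scaled by `10 ^ 15`. -/
def Recipe.Approx (R : Recipe) (N : ℕ) (a b c : ℕ → ℝ) : Prop :=
  ∀ n : ℕ, 0 < n → n ≤ N → ∀ l : ℤ, |(l : ℝ) - 10 ^ 15 * Real.log n| ≤ 60 * (n : ℝ) →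
    |(R.wA n l : ℝ) - 10 ^ 15 * a n| ≤ 70 ∧ |(R.wB n l : ℝ) - 10 ^ 15 * b n| ≤ 70 ∧
      |(R.wC n l : ℝ) - 10 ^ 15 * c n| ≤ 70

lemma scan_sound {R : Recipe} {N : ℕ} {a b c : ℕ → ℝ} (hR : R.Approx N a b c) (f : ℕ) :
    ∀ s s' : Acc, s.Approx a b c → s.n + f ≤ N → scan R f s = some s' →
      s'.Approx a b c ∧ s'.n = s.n + f ∧ ∀ n, s.n ≤ n → n < s.n + f →
        ∃ (t : Acc) (l : ℤ), t.n = n ∧ t.Approx a b c ∧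
          |(l : ℝ) - 10 ^ 15 * Real.log (n + 1)| ≤ 60 * ((n : ℝ) + 1) ∧ R.ok t l = true := by
  induction f with
  | zero =>
    intro s s' hs _ h
    rw [scan, Option.some_inj] at h
    subst h
    exact ⟨hs, rfl, fun n h1 h2 => by omega⟩
  | succ f ih =>
    intro s s' hs hN h
    rw [scan, forceInt_eq] at h
    set l := s.l + bif Nat.beq s.n 0 then 0 else (logStep s.n : ℤ) with hl
    have hlog : |(l : ℝ) - 10 ^ 15 * Real.log (s.n + 1)| ≤ 60 * ((s.n : ℝ) + 1) := by
      rcases Nat.eq_zero_or_pos s.n with h0 | h0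
      · have h1 : l = s.l := by rw [hl, h0]; simp
        have h2 := hs.log
        rw [h0] at h2 ⊢
        rw [h1]
        simp only [Nat.cast_zero, Real.log_zero, mul_zero, sub_zero] at h2
        simp only [Nat.cast_zero, zero_add, Real.log_one, mul_zero, sub_zero]
        linarith
      · have h1 : (l : ℝ) = s.l + logStep s.n := by
          have : Nat.beq s.n 0 = false := by
            rw [Bool.eq_false_iff]; intro h'; have := Nat.eq_of_beq_eq_true h'; omega
          rw [hl, this]; push_cast; simp
        have h2 := hs.log
        have h3 := abs_logStep_sub_le h0
        rw [h1]
        rw [abs_le] at *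
        constructor <;> linarith
    cases hok : R.ok s l with
    | false => rw [hok] at h; simp at h
    | true =>
      rw [hok] at h
      simp only [cond_true, forceNat_eq, forceInt_eq] at h
      have hw := hR (s.n + 1) (by omega) (by omega) l (by push_cast; exact hlog)
      have happ : Acc.Approx a b c ⟨s.n + 1, l, s.a + R.wA (s.n + 1) l, s.b + R.wB (s.n + 1) l,
          s.c + R.wC (s.n + 1) l⟩ := by
        refine ⟨by push_cast; exact hlog, ?_, ?_, ?_⟩
        · have h1 := hs.a
          have h2 := hw.1
          simp only [sum_Ioc_succ_top (Nat.zero_le s.n)]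
          push_cast at *
          rw [abs_le] at *
          constructor <;> linarith
        · have h1 := hs.b
          have h2 := hw.2.1
          simp only [sum_Ioc_succ_top (Nat.zero_le s.n)]
          push_cast at *
          rw [abs_le] at *
          constructor <;> linarith
        · have h1 := hs.c
          have h2 := hw.2.2
          simp only [sum_Ioc_succ_top (Nat.zero_le s.n)]
          push_cast at *
          rw [abs_le] at *
          constructor <;> linarith
      obtain ⟨h1, h2, h3⟩ := ih _ s' happ (by simp only; omega) h
      simp only at h2 h3
      refine ⟨h1, by omega, fun n hn1 hn2 => ?_⟩
      rcases Nat.eq_or_lt_of_le hn1 with h4 | h4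
      · subst h4
        exact ⟨s, l, rfl, hs, hlog, hok⟩
      · exact h3 n (by omega) (by omega)

lemma scanBlocks_sound {R : Recipe} {N : ℕ} {a b c : ℕ → ℝ} (hR : R.Approx N a b c) (f g : ℕ) :
    ∀ s : Acc, s.Approx a b c → s.n + f * g ≤ N → (scanBlocks R f g s).isSome = true →
      ∀ n, s.n ≤ n → n < s.n + f * g →
        ∃ (t : Acc) (l : ℤ), t.n = n ∧ t.Approx a b c ∧
          |(l : ℝ) - 10 ^ 15 * Real.log (n + 1)| ≤ 60 * ((n : ℝ) + 1) ∧ R.ok t l = true := by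
  induction g with
  | zero => intro s _ _ _ n h1 h2; omega
  | succ g ih =>
    intro s hs hN h n hn1 hn2
    rw [scanBlocks] at h
    have hfg : f * (g + 1) = f + f * g := by ring
    rw [hfg] at hN hn2
    cases hsc : scan R f s with
    | none => rw [hsc] at h; simp at h
    | some s' =>
      rw [hsc] at h
      obtain ⟨h1, h2, h3⟩ := scan_sound hR f s s' hs (by omega) hsc
      rcases Nat.lt_or_ge n (s.n + f) with h4 | h4
      · exact h3 n hn1 h4
      · exact ih s' h1 (by omega) h n (by omega) (by omega)

/-- The state before the first step. -/
def Acc.init : Acc := ⟨0, 0, 0, 0, 0⟩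

lemma Acc.approx_init (a b c : ℕ → ℝ) : Acc.init.Approx a b c := by
  constructor <;> simp [Acc.init]

/-- A successful scan gives the checked condition for every `n` that it passes. -/
lemma exists_of_scan {R : Recipe} {N : ℕ} {a b c : ℕ → ℝ} (hR : R.Approx N a b c) {f g : ℕ}
    (hN : f * g ≤ N) (h : (scanBlocks R f g Acc.init).isSome = true) {n : ℕ} (hn : n < f * g) :
    ∃ (t : Acc) (l : ℤ), t.n = n ∧ t.Approx a b c ∧
      |(l : ℝ) - 10 ^ 15 * Real.log (n + 1)| ≤ 60 * ((n : ℝ) + 1) ∧ R.ok t l = true :=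
  scanBlocks_sound hR f g Acc.init (Acc.approx_init a b c) (by simpa [Acc.init] using hN) h n
    (by simp [Acc.init]) (by simpa [Acc.init] using hn)

lemma abs_ediv_sub_le (z : ℤ) {d : ℤ} (hd : 0 < d) : |((z / d : ℤ) : ℝ) - z / d| ≤ 1 := by
  have hd0 : (0 : ℝ) < d := by exact_mod_cast hd
  have h1 : (z : ℝ) = d * ((z / d : ℤ) : ℝ) + ((z % d : ℤ) : ℝ) := by
    exact_mod_cast (Int.mul_ediv_add_emod z d).symm
  have h2 : (0 : ℝ) ≤ ((z % d : ℤ) : ℝ) := by exact_mod_cast Int.emod_nonneg z hd.ne'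
  have h3 : ((z % d : ℤ) : ℝ) < d := by exact_mod_cast Int.emod_lt_of_pos z hd
  have h4 : ((z / d : ℤ) : ℝ) - z / d = -(((z % d : ℤ) : ℝ) / d) := by
    rw [h1]; field_simp; ring
  rw [h4, abs_neg, abs_of_nonneg (by positivity), div_le_one hd0]
  exact h3.le

/-- Rounding error for a coefficient over `n ^ 2`. -/
lemma abs_coeff_div_sq_sub_le {n : ℕ} (hn : 0 < n) {z : ℤ} {x : ℝ} (hz : (z : ℝ) = x) :
    |((z * 10 ^ 15 / (n : ℤ) ^ 2 : ℤ) : ℝ) - 10 ^ 15 * (x / (n : ℝ) ^ 2)| ≤ 70 := by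
  have h := abs_ediv_sub_le (z * 10 ^ 15) (d := (n : ℤ) ^ 2) (by positivity)
  push_cast at h ⊢
  rw [hz] at h
  rw [show (10 : ℝ) ^ 15 * (x / (n : ℝ) ^ 2) = x * 10 ^ 15 / (n : ℝ) ^ 2 by ring]
  linarith

/-- Rounding error for a coefficient times a logarithm over `n ^ 2`. -/
lemma abs_coeff_log_div_sq_sub_le {n : ℕ} (hn : 0 < n) {z l : ℤ} {x : ℝ} (hz : (z : ℝ) = x)
    (hx : |x| ≤ n) (hl : |(l : ℝ) - 10 ^ 15 * Real.log n| ≤ 60 * (n : ℝ)) :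
    |((z * l / (n : ℤ) ^ 2 : ℤ) : ℝ) - 10 ^ 15 * (x * Real.log n / (n : ℝ) ^ 2)| ≤ 70 := by
  have hn0 : (1 : ℝ) ≤ n := by exact_mod_cast hn
  have h := abs_ediv_sub_le (z * l) (d := (n : ℤ) ^ 2) (by positivity)
  push_cast at h ⊢
  rw [hz] at h
  have h2 : |x * l / (n : ℝ) ^ 2 - 10 ^ 15 * (x * Real.log n / (n : ℝ) ^ 2)| ≤ 60 := by
    rw [show x * l / (n : ℝ) ^ 2 - 10 ^ 15 * (x * Real.log n / (n : ℝ) ^ 2)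
      = x * (l - 10 ^ 15 * Real.log n) / (n : ℝ) ^ 2 by ring, abs_div, abs_mul,
      abs_of_pos (by positivity : (0 : ℝ) < (n : ℝ) ^ 2), div_le_iff₀ (by positivity)]
    calc |x| * |(l : ℝ) - 10 ^ 15 * Real.log n| ≤ n * (60 * n) := by gcongr
      _ ≤ 60 * (n : ℝ) ^ 2 := by nlinarith
  rw [abs_le] at *
  constructor <;> linarith

/-! ### Mollified coefficients with bounded partial sums -/

/-- The indicator function of the integers coprime to `v`, as an arithmetic function. -/
def coprAF (v : ℕ) : ArithmeticFunction ℝ := ⟨fun n => if n = 0 then 0 else copr v n, by simp⟩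

/-- The Möbius function restricted to the integers coprime to `v`, as an arithmetic function. -/
def mucAF (v : ℕ) : ArithmeticFunction ℝ := ⟨muc v, by simp [muc]⟩

lemma mucAF_mul_coprAF (v : ℕ) : mucAF v * coprAF v = 1 := by
  ext n
  rcases Nat.eq_zero_or_pos n with rfl | hn
  · simp
  have h1 := congrArg (fun f : ArithmeticFunction ℝ => f n)
    (ArithmeticFunction.coe_moebius_mul_coe_zeta (R := ℝ))
  simp only [ArithmeticFunction.mul_apply] at h1
  have h2 : (mucAF v * coprAF v) n
      = copr v n * (1 : ArithmeticFunction ℝ) n := by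
    rw [ArithmeticFunction.mul_apply, ← h1, mul_sum]
    refine sum_congr rfl fun x hx => ?_
    obtain ⟨h3, h4⟩ := Nat.mem_divisorsAntidiagonal.1 hx
    have h5 : x.2 ≠ 0 := by rintro h; rw [h] at h3; simp at h3; omega
    simp only [mucAF, coprAF, ArithmeticFunction.coe_mk, muc, if_neg h5,
      ArithmeticFunction.intCoe_apply, ArithmeticFunction.natCoe_apply,
      ArithmeticFunction.zeta_apply]
    rw [← h3, copr_mul]
    push_cast
    ring
  rw [h2]
  rcases eq_or_ne n 1 with rfl | h
  · simp [copr]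
  · rw [ArithmeticFunction.one_apply_ne h, mul_zero]

/-- The indicator function of the integers coprime to `v`, dilated by `j`. -/
def dilate (v j m : ℕ) : ℝ := if j ∣ m then copr v (m / j) else 0

lemma sum_muc_mul_dilate (v : ℕ) {j n : ℕ} (hn : 0 < n) :
    ∑ x ∈ n.divisorsAntidiagonal, muc v x.1 * dilate v j x.2 = if n = j then 1 else 0 := by
  let δ : ArithmeticFunction ℝ := ⟨fun m => if m = 0 then 0 else if m = j then 1 else 0, by simp⟩
  have h1 : ∀ m, 0 < m → dilate v j m = (δ * coprAF v) m := by
    intro m hm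
    rw [ArithmeticFunction.mul_apply, Nat.sum_divisorsAntidiagonal (fun a b => δ a * coprAF v b)]
    have : ∀ i ∈ m.divisors, δ i * coprAF v (m / i) = if i = j then copr v (m / j) else 0 := by
      intro i hi
      have hi' := Nat.mem_divisors.1 hi
      have hi0 : i ≠ 0 := by rintro rfl; simp at hi'
      have hmi : m / i ≠ 0 := (Nat.div_pos (Nat.le_of_dvd hm hi'.1) (by omega)).ne'
      simp only [δ, coprAF, ArithmeticFunction.coe_mk, if_neg hi0, if_neg hmi]
      split_ifs with h
      · rw [h, one_mul]
      · simp
    rw [sum_congr rfl this, sum_ite_eq']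
    simp [dilate, Nat.mem_divisors, hm.ne']
  have h2 : ∑ x ∈ n.divisorsAntidiagonal, muc v x.1 * dilate v j x.2
      = (mucAF v * (δ * coprAF v)) n := by
    rw [ArithmeticFunction.mul_apply]
    refine sum_congr rfl fun x hx => ?_
    obtain ⟨h3, h4⟩ := Nat.mem_divisorsAntidiagonal.1 hx
    rw [h1 x.2 (Nat.pos_of_ne_zero (by rintro h; rw [h] at h3; simp at h3; omega))]
    rfl
  rw [h2, mul_left_comm, mucAF_mul_coprAF, mul_one]
  simp [δ, hn.ne']

lemma sum_dilate_mul (v : ℕ) {j : ℕ} (hj : 0 < j) (N : ℕ) (φ : ℕ → ℝ) :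
    ∑ m ∈ Ioc 0 N, dilate v j m * φ m = ∑ m ∈ Ioc 0 (N / j), copr v m * φ (j * m) := by
  simp only [dilate, ite_mul, zero_mul]
  rw [← sum_filter, sum_filter_dvd N j hj]
  refine sum_congr rfl fun m _ => ?_
  rw [Nat.mul_div_cancel_left m hj]

/-- The integer combination `∑ a χ(m / j)`, over the pairs `(j, a)` in the list with `j ∣ m`, of
dilations of the indicator function `χ` of the integers coprime to `v`. -/
def mollify (v : ℕ) (l : List (ℕ × ℤ)) (m : ℕ) : ℤ :=
  (l.map fun p => bif Nat.beq (m % p.1) 0 && Nat.beq (Nat.gcd (m / p.1) v) 1 then p.2 else 0).sum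

lemma mollify_eq (v : ℕ) (l : List (ℕ × ℤ)) (m : ℕ) :
    (mollify v l m : ℝ) = (l.map fun p => (p.2 : ℝ) * dilate v p.1 m).sum := by
  have hb : ∀ a b : ℕ, Nat.beq a b = decide (a = b) := fun a b => by
    by_cases h : a = b
    · subst h; simp
    · have : Nat.beq a b = false := by
        rw [Bool.eq_false_iff]; intro h'; exact h (Nat.eq_of_beq_eq_true h')
      simp [this, h]
  unfold mollify
  induction l with
  | nil => simp
  | cons p l ih =>
    rw [List.map_cons, List.map_cons, List.sum_cons, List.sum_cons, Int.cast_add, ih]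
    congr 1
    rw [hb, hb, dilate, copr]
    simp only [Nat.dvd_iff_mod_eq_zero, Nat.Coprime]
    by_cases h1 : m % p.1 = 0 <;> by_cases h2 : (m / p.1).gcd v = 1 <;> simp [h1, h2]

lemma sum_list_comm {ι : Type*} (s : Finset ι) (l : List (ℕ × ℤ)) (f : ι → ℕ × ℤ → ℝ) :
    ∑ i ∈ s, (l.map (f i)).sum = (l.map fun p => ∑ i ∈ s, f i p).sum := by
  induction l with
  | nil => simp
  | cons p l ih => simp only [List.map_cons, List.sum_cons, sum_add_distrib, ih]

lemma list_sum_congr {l : List (ℕ × ℤ)} {f g : ℕ × ℤ → ℝ} (h : ∀ p ∈ l, f p = g p) :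
    (l.map f).sum = (l.map g).sum := by
  rw [List.map_congr_left h]

lemma tendsto_list_sum {l : List (ℕ × ℤ)} {f : ℕ → ℕ × ℤ → ℝ} {a : ℕ × ℤ → ℝ}
    (h : ∀ p ∈ l, Tendsto (fun n => f n p) atTop (𝓝 (a p))) :
    Tendsto (fun n => (l.map (f n)).sum) atTop (𝓝 (l.map a).sum) := by
  induction l with
  | nil => simp
  | cons p l ih =>
    simp only [List.map_cons, List.sum_cons]
    exact (h p (by simp)).add (ih fun q hq => h q (by simp [hq]))

/-- The convolution of `μ χ` with `mollify v l` is supported on the first entries of the list. -/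
lemma sum_muc_mul_mollify (v : ℕ) (l : List (ℕ × ℤ)) {n : ℕ} (hn : 0 < n) :
    ∑ x ∈ n.divisorsAntidiagonal, muc v x.1 * (mollify v l x.2 : ℝ)
      = (l.map fun p => (p.2 : ℝ) * if n = p.1 then 1 else 0).sum := by
  simp only [mollify_eq, ← List.sum_map_mul_left]
  rw [sum_list_comm]
  refine list_sum_congr fun p _ => ?_
  rw [← sum_muc_mul_dilate v hn, mul_sum]
  exact sum_congr rfl fun x _ => by ring

lemma sum_mollify_mul (v : ℕ) {l : List (ℕ × ℤ)} (hl : ∀ p ∈ l, 0 < p.1) (N : ℕ) (φ : ℕ → ℝ) :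
    ∑ m ∈ Ioc 0 N, (mollify v l m : ℝ) * φ m
      = (l.map fun p => (p.2 : ℝ) * ∑ m ∈ Ioc 0 (N / p.1), copr v m * φ (p.1 * m)).sum := by
  simp only [mollify_eq, ← List.sum_map_mul_right]
  rw [sum_list_comm]
  refine list_sum_congr fun p hp => ?_
  rw [← sum_dilate_mul v (hl p hp), mul_sum]
  exact sum_congr rfl fun x _ => by ring

/-- The sum `∑ 1 / n ^ 2` over the `n` coprime to `v`. -/
def zetaC (v : ℕ) : ℝ := ∑' n : ℕ, copr v n / (n : ℝ) ^ 2

/-- The sum `∑ log n / n ^ 2` over the `n` coprime to `v`. -/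
def zetaLog (v : ℕ) : ℝ := ∑' n : ℕ, copr v n * Real.log n / (n : ℝ) ^ 2

lemma abs_copr_le_one (v n : ℕ) : |copr v n| ≤ 1 := by
  rw [abs_of_nonneg (copr_nonneg v n)]; exact copr_le_one v n

lemma tendsto_sum_copr_div_sq (v : ℕ) :
    Tendsto (fun N : ℕ => ∑ m ∈ Ioc 0 N, copr v m / (m : ℝ) ^ 2) atTop (𝓝 (zetaC v)) := by
  have h := (tendsto_sum_Ioc_floor (summable_inv_sq_mul (abs_copr_le_one v)) (by simp)).comp
    (tendsto_natCast_atTop_atTop (R := ℝ))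
  refine h.congr fun N => ?_
  simp

lemma tendsto_sum_copr_log_div_sq (v : ℕ) :
    Tendsto (fun N : ℕ => ∑ m ∈ Ioc 0 N, copr v m * Real.log m / (m : ℝ) ^ 2) atTop
      (𝓝 (zetaLog v)) := by
  have h := (tendsto_sum_Ioc_floor (summable_log_div_sq_mul (abs_copr_le_one v)) (by simp)).comp
    (tendsto_natCast_atTop_atTop (R := ℝ))
  refine h.congr fun N => ?_
  simp

/-- The value at `2` of the Dirichlet polynomial with the coefficients in the list. -/
def molSum (l : List (ℕ × ℤ)) : ℝ := (l.map fun p => (p.2 : ℝ) / (p.1 : ℝ) ^ 2).sum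

/-- Minus the derivative at `2` of the Dirichlet polynomial with the coefficients in the list. -/
def molLog (l : List (ℕ × ℤ)) : ℝ :=
  (l.map fun p => (p.2 : ℝ) * Real.log p.1 / (p.1 : ℝ) ^ 2).sum

lemma tendsto_div_atTop {j : ℕ} (hj : 0 < j) : Tendsto (fun N : ℕ => N / j) atTop atTop :=
  Nat.tendsto_div_const_atTop hj.ne'

lemma tendsto_sum_mollify (v : ℕ) {l : List (ℕ × ℤ)} (hl : ∀ p ∈ l, 0 < p.1) :
    Tendsto (fun N : ℕ => ∑ m ∈ Ioc 0 N, (mollify v l m : ℝ) / (m : ℝ) ^ 2) atTop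
      (𝓝 (molSum l * zetaC v)) := by
  have h1 : Tendsto (fun N : ℕ => (l.map fun p => (p.2 : ℝ) / (p.1 : ℝ) ^ 2 *
      ∑ m ∈ Ioc 0 (N / p.1), copr v m / (m : ℝ) ^ 2).sum) atTop (𝓝 (molSum l * zetaC v)) := by
    rw [molSum, ← List.sum_map_mul_right]
    exact tendsto_list_sum fun p hp =>
      ((tendsto_sum_copr_div_sq v).comp (tendsto_div_atTop (hl p hp))).const_mul _
  refine h1.congr fun N => ?_
  simp only [div_eq_mul_inv]
  rw [sum_mollify_mul v hl]
  refine list_sum_congr fun p hp => ?_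
  simp only [mul_sum]
  refine sum_congr rfl fun m _ => ?_
  push_cast
  rw [mul_pow, mul_inv]; ring

lemma tendsto_sum_mollify_log (v : ℕ) {l : List (ℕ × ℤ)} (hl : ∀ p ∈ l, 0 < p.1) :
    Tendsto (fun N : ℕ => ∑ m ∈ Ioc 0 N, (mollify v l m : ℝ) * Real.log m / (m : ℝ) ^ 2) atTop
      (𝓝 (molLog l * zetaC v + molSum l * zetaLog v)) := by
  have h1 : Tendsto (fun N : ℕ => (l.map fun p => (p.2 : ℝ) * Real.log p.1 / (p.1 : ℝ) ^ 2 *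
      ∑ m ∈ Ioc 0 (N / p.1), copr v m / (m : ℝ) ^ 2).sum + (l.map fun p =>
      (p.2 : ℝ) / (p.1 : ℝ) ^ 2 * ∑ m ∈ Ioc 0 (N / p.1), copr v m * Real.log m / (m : ℝ) ^ 2).sum)
      atTop (𝓝 (molLog l * zetaC v + molSum l * zetaLog v)) := by
    rw [molSum, molLog, ← List.sum_map_mul_right, ← List.sum_map_mul_right]
    exact (tendsto_list_sum fun p hp =>
      ((tendsto_sum_copr_div_sq v).comp (tendsto_div_atTop (hl p hp))).const_mul _).add
      (tendsto_list_sum fun p hp =>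
      ((tendsto_sum_copr_log_div_sq v).comp (tendsto_div_atTop (hl p hp))).const_mul _)
  refine h1.congr fun N => ?_
  have h2 := sum_mollify_mul v hl N fun m => Real.log m / (m : ℝ) ^ 2
  simp only [← mul_div_assoc] at h2
  rw [h2, ← List.sum_map_add]
  refine list_sum_congr fun p hp => ?_
  have hp0 : (0 : ℝ) < p.1 := by exact_mod_cast hl p hp
  simp only [mul_sum]
  rw [← sum_add_distrib]
  refine sum_congr rfl fun m hm => ?_
  have hm0 : (0 : ℝ) < m := by exact_mod_cast (mem_Ioc.1 hm).1
  push_cast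
  rw [Real.log_mul hp0.ne' hm0.ne']
  field_simp

/-- The partial sums of `mollify v l`. -/
def molPartial (v : ℕ) (l : List (ℕ × ℤ)) (N : ℕ) : ℤ :=
  (l.map fun p => p.2 * (((N / p.1 + v - 1) / v : ℕ) : ℤ)).sum

lemma sum_mollify {v : ℕ} (hv : v = 1 ∨ v = 2) {l : List (ℕ × ℤ)} (hl : ∀ p ∈ l, 0 < p.1) (N : ℕ) :
    ∑ m ∈ Ioc 0 N, (mollify v l m : ℝ) = molPartial v l N := by
  have h1 := sum_mollify_mul v hl N fun _ => 1
  simp only [mul_one] at h1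
  rw [h1, molPartial]
  have : ∀ l : List (ℕ × ℤ), (l.map fun p => (p.2 : ℝ) * ∑ m ∈ Ioc 0 (N / p.1), copr v m).sum
      = (((l.map fun p => p.2 * (((N / p.1 + v - 1) / v : ℕ) : ℤ)).sum : ℤ) : ℝ) := by
    intro l
    induction l with
    | nil => simp
    | cons p l ih =>
      simp only [List.map_cons, List.sum_cons]
      rw [Int.cast_add, ← ih]
      congr 1
      have h2 := sum_copr_eq hv (N / p.1) fun _ => 1
      simp only [mul_one, sum_const, card_range, nsmul_eq_mul] at h2
      rw [h2, Int.cast_mul, Int.cast_natCast]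
  exact this l

lemma abs_sum_mollify_le {v : ℕ} (hv : v = 1 ∨ v = 2) {l : List (ℕ × ℤ)}
    (hl : ∀ p ∈ l, 0 < p.1) {a : ℤ} (h : ∀ N, a ≤ molPartial v l N ∧ molPartial v l N ≤ a + 2)
    (k M : ℕ) : |∑ m ∈ Ioc k M, (mollify v l m : ℝ)| ≤ 2 := by
  rcases le_total k M with hk | hk
  · have h1 := sum_Ioc_consecutive (fun m => (mollify v l m : ℝ)) (Nat.zero_le k) hk
    rw [sum_mollify hv hl, sum_mollify hv hl] at h1
    have h2 : ∑ m ∈ Ioc k M, (mollify v l m : ℝ)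
        = ((molPartial v l M - molPartial v l k : ℤ) : ℝ) := by push_cast; linarith
    rw [h2, ← Int.cast_abs]
    have : |molPartial v l M - molPartial v l k| ≤ 2 := by
      have := h M; have := h k
      rw [abs_le]; omega
    exact_mod_cast this
  · rw [Ioc_eq_empty (by omega)]; simp

/-- The parameter `γ + log v + 2 L' / L` of the kernel that belongs to `mollify v l`. -/
def molShift (v : ℕ) (l : List (ℕ × ℤ)) : ℝ :=
  Real.eulerMascheroniConstant + Real.log v
    + 2 * ((molLog l * zetaC v + molSum l * zetaLog v) / (molSum l * zetaC v))

lemma sum_Ioc_single_div {l : List (ℕ × ℤ)} {J : ℕ} (hl : ∀ p ∈ l, 0 < p.1 ∧ p.1 ≤ J)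
    (φ : ℕ → ℝ) :
    ∑ n ∈ Ioc 0 J, (l.map fun p => (p.2 : ℝ) * if n = p.1 then 1 else 0).sum * φ n
      = (l.map fun p => (p.2 : ℝ) * φ p.1).sum := by
  simp only [← List.sum_map_mul_right]
  rw [sum_list_comm]
  refine list_sum_congr fun p hp => ?_
  rw [sum_eq_single p.1]
  · simp
  · intro b _ hb; simp [hb]
  · intro h; exact absurd (mem_Ioc.2 (hl p hp)) h

/-- The values `1 / ζ(2)` and `(1 / ζ)'(2)`, up to the Euler factor at `v`; they are read off from the
vanishing coefficients in `tailT_coeff_eq_zero`. -/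
lemma mucC_mucD_eq {v : ℕ} {l : List (ℕ × ℤ)} (hl : ∀ p ∈ l, 0 < p.1)
    (hE : ∀ k M, |∑ m ∈ Ioc k M, (mollify v l m : ℝ)| ≤ 2) (hL : 0 < molSum l)
    (hz : 0 < zetaC v) (hg : 0 ≤ molShift v l) :
    mucC v = 1 / zetaC v ∧ mucD v = -zetaLog v / zetaC v ^ 2 := by
  obtain ⟨J, hJ⟩ : ∃ J, ∀ p ∈ l, p.1 ≤ J := by
    clear hE hL hg hl
    induction l with
    | nil => exact ⟨0, by simp⟩
    | cons p l ih =>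
      obtain ⟨J, hJ⟩ := ih
      refine ⟨p.1 + J, fun q hq => ?_⟩
      rcases List.mem_cons.1 hq with rfl | h
      · omega
      · have := hJ q h; omega
  have hLne : molSum l * zetaC v ≠ 0 := (mul_pos hL hz).ne'
  have h := tailT_coeff_eq_zero (e := fun m => (mollify v l m : ℝ)) hLne rfl
    (fun n hn => sum_muc_mul_mollify v l hn) (J := J)
    (fun n hn => by
      refine (list_sum_congr fun p hp => ?_).trans (by simp : (l.map fun _ => (0 : ℝ)).sum = 0)
      have := hJ p hp
      simp [show n ≠ p.1 by omega])
    (fun u hu => abs_tailKer_le hg (tendsto_sum_mollify v hl) (tendsto_sum_mollify_log v hl)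
      hE hu)
  have s1 := sum_Ioc_single_div (fun p hp => ⟨hl p hp, hJ p hp⟩) fun n => 1 / (n : ℝ) ^ 2
  have s2 := sum_Ioc_single_div (fun p hp => ⟨hl p hp, hJ p hp⟩) fun n => Real.log n / (n : ℝ) ^ 2
  simp only [← mul_div_assoc, mul_one] at s1 s2
  rw [s1, s2] at h
  change 2 * (molSum l * zetaC v * mucC v - molSum l) = 0 ∧ molSum l * zetaC v * _ * mucC v
    - 2 * (molSum l * zetaC v) * mucD v - molSum l * molShift v l + 2 * molLog l = 0 at h
  obtain ⟨h1, h2⟩ := h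
  have h3 : mucC v = 1 / zetaC v := by
    rw [eq_div_iff hz.ne']
    have : molSum l * (mucC v * zetaC v - 1) = 0 := by linarith
    have := (mul_eq_zero.1 this).resolve_left hL.ne'
    linarith
  refine ⟨h3, ?_⟩
  rw [h3, molShift] at h2
  rw [eq_div_iff (by positivity)]
  field_simp at h2
  have h4 : molSum l * (mucD v * zetaC v ^ 2 + zetaLog v) = 0 := by
    nlinarith
  have := (mul_eq_zero.1 h4).resolve_left hL.ne'
  linarith

lemma zetaC_one : zetaC 1 = Real.pi ^ 2 / 6 := by
  simp only [zetaC, copr_one]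
  exact hasSum_zeta_two.tsum_eq

lemma tsum_copr_two {φ : ℕ → ℝ} (h : Summable φ) :
    ∑' n, copr 2 n * φ n = ∑' n, φ n - ∑' n, φ (2 * n) := by
  have hs : Summable fun n => copr 2 n * φ n := by
    refine Summable.of_norm_bounded (g := fun n => |φ n|) h.abs fun n => ?_
    rw [norm_mul, Real.norm_eq_abs, Real.norm_eq_abs]
    exact mul_le_of_le_one_left (abs_nonneg _) (abs_copr_le_one 2 n)
  have he : Function.Injective fun n : ℕ => 2 * n := fun a b h => by simp only at h; omega
  have ho : Function.Injective fun n : ℕ => 2 * n + 1 := fun a b h => by simp only at h; omega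
  have h1 : ∑' n, φ (2 * n) + ∑' n, φ (2 * n + 1) = ∑' n, φ n :=
    tsum_even_add_odd (h.comp_injective he) (h.comp_injective ho)
  have h2 : ∑' n, copr 2 (2 * n) * φ (2 * n) + ∑' n, copr 2 (2 * n + 1) * φ (2 * n + 1)
      = ∑' n, copr 2 n * φ n :=
    tsum_even_add_odd (f := fun n => copr 2 n * φ n) (hs.comp_injective he) (hs.comp_injective ho)
  have h3 : ∀ n, copr 2 (2 * n) = 0 := by
    intro n
    unfold copr
    rw [if_neg]
    rw [Nat.coprime_two_right, Nat.not_odd_iff_even]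
    exact even_two_mul n
  have h4 : ∀ n, copr 2 (2 * n + 1) = 1 := by
    intro n
    unfold copr
    rw [if_pos]
    rw [Nat.coprime_two_right]
    exact odd_two_mul_add_one n
  have h5 : ∑' n, copr 2 (2 * n) * φ (2 * n) = 0 := by simp only [h3, zero_mul, tsum_zero]
  have h6 : ∑' n, copr 2 (2 * n + 1) * φ (2 * n + 1) = ∑' n, φ (2 * n + 1) := by
    simp only [h4, one_mul]
  rw [h5, h6, zero_add] at h2
  linarith

lemma zetaC_two : zetaC 2 = Real.pi ^ 2 / 8 := by
  have h := tsum_copr_two (φ := fun n : ℕ => 1 / (n : ℝ) ^ 2)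
    (Real.summable_one_div_nat_pow.2 (by norm_num))
  simp only [mul_one_div] at h
  rw [zetaC, h, hasSum_zeta_two.tsum_eq]
  have : ∀ n : ℕ, 1 / ((2 * n : ℕ) : ℝ) ^ 2 = 1 / 4 * (1 / (n : ℝ) ^ 2) := fun n => by
    push_cast; rw [mul_pow, one_div_mul_one_div]; norm_num
  simp only [this, tsum_mul_left, hasSum_zeta_two.tsum_eq]
  ring

lemma zetaLog_two : zetaLog 2 = 3 / 4 * zetaLog 1 - Real.log 2 * (Real.pi ^ 2 / 24) := by
  have hs := summable_log_div_sq_mul (a := fun _ => 1) (by simp)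
  have h := tsum_copr_two hs
  simp only [← mul_div_assoc, one_mul] at h
  rw [zetaLog, h]
  have h1 : zetaLog 1 = ∑' n : ℕ, Real.log n / (n : ℝ) ^ 2 := by simp [zetaLog, copr_one]
  rw [← h1]
  have h2 : ∀ n : ℕ, Real.log ((2 * n : ℕ) : ℝ) / ((2 * n : ℕ) : ℝ) ^ 2
      = Real.log 2 / 4 * (1 / (n : ℝ) ^ 2) + 1 / 4 * (Real.log n / (n : ℝ) ^ 2) := by
    intro n
    rcases Nat.eq_zero_or_pos n with rfl | hn
    · simp
    have hn0 : (n : ℝ) ≠ 0 := by exact_mod_cast hn.ne'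
    push_cast
    rw [Real.log_mul two_ne_zero hn0]
    field_simp
    ring
  simp only [h2]
  simp only [one_mul] at hs
  rw [Summable.tsum_add (hasSum_zeta_two.summable.mul_left _) (hs.mul_left _), tsum_mul_left,
    tsum_mul_left, hasSum_zeta_two.tsum_eq, ← h1]
  ring

/-! ### Numerical values of the constants -/

lemma sum_log_div_sq_bounds {N M : ℕ} (hN : 2 ≤ N) (hM : N ≤ M) :
    (Real.log (N + 1) + 1) / (N + 1) - (Real.log (M + 1) + 1) / (M + 1)
        ≤ ∑ n ∈ Ioc N M, Real.log n / (n : ℝ) ^ 2 ∧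
      ∑ n ∈ Ioc N M, Real.log n / (n : ℝ) ^ 2
        ≤ (Real.log N + 1) / N - (Real.log M + 1) / M := by
  have hd : ∀ t : ℝ, 0 < t → HasDerivAt (fun t : ℝ => (Real.log t + 1) / t)
      (-(Real.log t / t ^ 2)) t := by
    intro t ht
    have h := ((Real.hasDerivAt_log ht.ne').add_const 1).div (hasDerivAt_id t) ht.ne'
    have e : -(Real.log t / t ^ 2) = (t⁻¹ * t - (Real.log t + 1) * 1) / t ^ 2 := by
      field_simp
      ring
    rw [e]
    exact h
  have he : Real.exp (1 / 2) ≤ 2 := by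
    have h1 := Real.exp_one_lt_d9
    have h2 : Real.exp (1 / 2) ^ 2 = Real.exp 1 := by rw [← Real.exp_nat_mul]; norm_num
    nlinarith [Real.exp_pos (1 / 2)]
  -- the mean value theorem on `[n, n + 1]`
  have key : ∀ n : ℕ, 2 ≤ n →
      Real.log (n + 1 : ℕ) / ((n + 1 : ℕ) : ℝ) ^ 2
          ≤ (Real.log n + 1) / n - (Real.log (n + 1) + 1) / (n + 1) ∧
        (Real.log n + 1) / n - (Real.log (n + 1) + 1) / (n + 1) ≤ Real.log n / (n : ℝ) ^ 2 := by
    intro n hn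
    have hn0 : (2 : ℝ) ≤ n := by exact_mod_cast hn
    obtain ⟨ξ, hξ, h⟩ := exists_hasDerivAt_eq_slope (fun t : ℝ => (Real.log t + 1) / t)
      (fun t => -(Real.log t / t ^ 2)) (by linarith : (n : ℝ) < n + 1)
      (fun t ht => (hd t (by linarith [ht.1])).continuousAt.continuousWithinAt)
      (fun t ht => hd t (by linarith [ht.1]))
    have h1 := antitoneOn_log_div_sq (Set.mem_Ici.2 (he.trans hn0))
      (Set.mem_Ici.2 (he.trans (hn0.trans hξ.1.le))) hξ.1.le
    have h2 := antitoneOn_log_div_sq (Set.mem_Ici.2 (he.trans (hn0.trans hξ.1.le)))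
      (Set.mem_Ici.2 (he.trans (hn0.trans (by linarith : (n : ℝ) ≤ n + 1)))) hξ.2.le
    rw [add_sub_cancel_left, div_one] at h
    simp only at h1 h2
    push_cast
    constructor <;> linarith
  induction M, hM using Nat.le_induction with
  | base => simp
  | succ M hM ih =>
    rw [sum_Ioc_succ_top (by omega)]
    have h1 := (key M (by omega)).1
    have h2 := (key (M + 1) (by omega)).2
    push_cast at h1 h2 ⊢
    constructor <;> linarith [ih.1, ih.2]

lemma zetaLog_one_bounds {N : ℕ} (hN : 2 ≤ N) :
    ∑ n ∈ Ioc 0 N, Real.log n / (n : ℝ) ^ 2 + (Real.log (N + 1) + 1) / (N + 1) ≤ zetaLog 1 ∧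
      zetaLog 1 ≤ ∑ n ∈ Ioc 0 N, Real.log n / (n : ℝ) ^ 2 + (Real.log N + 1) / N := by
  have h := tendsto_sum_copr_log_div_sq 1
  simp only [copr_one, one_mul] at h
  have hG : Tendsto (fun M : ℕ => (Real.log M + 1) / (M : ℝ)) atTop (𝓝 0) := by
    have ha : Tendsto (fun y : ℝ => Real.log y / y) atTop (𝓝 0) := by
      simpa using (Real.isLittleO_log_id_atTop).tendsto_div_nhds_zero
    have hb : Tendsto (fun y : ℝ => 1 / y) atTop (𝓝 0) := by
      simpa using tendsto_inv_atTop_zero (𝕜 := ℝ)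
    have := (ha.add hb).comp (tendsto_natCast_atTop_atTop (R := ℝ))
    rw [add_zero] at this
    refine this.congr fun M => ?_
    simp only [Function.comp]; rw [add_div]
  have hG' := hG.comp (tendsto_add_atTop_nat 1)
  have hsplit : ∀ M : ℕ, N ≤ M → ∑ n ∈ Ioc 0 M, Real.log n / (n : ℝ) ^ 2
      = ∑ n ∈ Ioc 0 N, Real.log n / (n : ℝ) ^ 2 + ∑ n ∈ Ioc N M, Real.log n / (n : ℝ) ^ 2 :=
    fun M hM => (sum_Ioc_consecutive _ (Nat.zero_le N) hM).symm
  constructor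
  · have h1 := h.add hG'
    rw [add_zero] at h1
    refine ge_of_tendsto h1 ?_
    filter_upwards [eventually_ge_atTop N] with M hM
    have := (sum_log_div_sq_bounds hN hM).1
    simp only [Function.comp]
    rw [hsplit M hM]
    push_cast
    linarith
  · have h1 := h.add hG
    rw [add_zero] at h1
    refine le_of_tendsto h1 ?_
    filter_upwards [eventually_ge_atTop N] with M hM
    have := (sum_log_div_sq_bounds hN hM).2
    rw [hsplit M hM]
    linarith

/-- The harmonic sum and the sum of `log n / n ^ 2`; the condition encloses some logarithms and the
sums up to `4000`. -/
def constRecipe : Recipe where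
  wA n _ := 10 ^ 15 / (n : ℤ)
  wB n l := 1 * l / (n : ℤ) ^ 2
  wC _ _ := 0
  ok s _ :=
    if s.n = 3 then decide (|s.l - 1098612288668110| ≤ 1000)
    else if s.n = 5 then decide (|s.l - 1609437912434100| ≤ 1000)
    else if s.n = 7 then decide (|s.l - 1945910149055313| ≤ 1000)
    else if s.n = 4000 then decide (|s.l - 8294049640102027| ≤ 1000000) &&
      decide (|s.a - 8871390299795227| ≤ 1000000) && decide (|s.b - 935225001074572| ≤ 1000000)
    else true

lemma constRecipe_approx : constRecipe.Approx 4050 (fun n => 1 / n)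
    (fun n => 1 * Real.log n / (n : ℝ) ^ 2) 0 := by
  intro n hn _ l hl
  refine ⟨?_, abs_coeff_log_div_sq_sub_le hn (by norm_num) ?_ hl, ?_⟩
  · have h := abs_ediv_sub_le (10 ^ 15) (d := (n : ℤ)) (by exact_mod_cast hn)
    simp only [constRecipe]
    push_cast at h ⊢
    rw [mul_one_div]
    linarith
  · rw [abs_one]; exact_mod_cast hn
  · simp [constRecipe]

set_option maxRecDepth 100000 in
lemma constRecipe_scan : (scanBlocks constRecipe 50 81 Acc.init).isSome = true := by
  decide +kernel

lemma log_of_const {n : ℕ} (hn : n < 4050) {z r : ℤ}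
    (h : ∀ s l, s.n = n → constRecipe.ok s l = true → |s.l - z| ≤ r) :
    |Real.log n - (z : ℝ) / 10 ^ 15| ≤ (60 * (n : ℝ) + r) / 10 ^ 15 := by
  obtain ⟨t, l, h1, h2, -, h3⟩ := exists_of_scan constRecipe_approx (f := 50) (g := 81)
    (by norm_num) constRecipe_scan hn
  have h4 : |((t.l - z : ℤ) : ℝ)| ≤ r := by exact_mod_cast h t l h1 h3
  have h5 := h2.log
  rw [h1] at h5
  push_cast at h4
  rw [abs_le] at *
  constructor <;> linarith

lemma abs_log_three_sub_le : |Real.log 3 - 1.09861228866811| ≤ 1 / 10 ^ 11 := by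
  have := log_of_const (n := 3) (z := 1098612288668110) (r := 1000) (by norm_num) (by
    intro s l hs h
    simpa [constRecipe, hs] using h)
  push_cast at this
  rw [abs_le] at *; constructor <;> linarith

lemma abs_log_five_sub_le : |Real.log 5 - 1.6094379124341| ≤ 1 / 10 ^ 11 := by
  have := log_of_const (n := 5) (z := 1609437912434100) (r := 1000) (by norm_num) (by
    intro s l hs h
    simpa [constRecipe, hs] using h)
  push_cast at this
  rw [abs_le] at *; constructor <;> linarith

lemma abs_log_seven_sub_le : |Real.log 7 - 1.945910149055313| ≤ 1 / 10 ^ 11 := by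
  have := log_of_const (n := 7) (z := 1945910149055313) (r := 1000) (by norm_num) (by
    intro s l hs h
    simpa [constRecipe, hs] using h)
  push_cast at this
  rw [abs_le] at *; constructor <;> linarith

lemma harmDev_one (N : ℕ) : harmDev 1 N = ∑ m ∈ Ioc 0 (N + 1), 1 / (m : ℝ)
    - (Real.log ((N + 1 : ℕ) : ℝ) + Real.eulerMascheroniConstant) := by
  have h := sum_copr_eq (v := 1) (Or.inl rfl) (N + 1) fun m => 1 / (m : ℝ)
  simp only [copr_one, one_mul, Nat.add_sub_cancel, Nat.div_one] at h
  rw [h, harmDev]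
  push_cast
  simp only [one_mul, div_one]

/-- Euler's constant from a harmonic sum, and `-ζ'(2)` from the sum up to `4000` and an integral for
the tail. -/
lemma const_bounds : |Real.eulerMascheroniConstant - 0.5772156649| ≤ 1 / 10 ^ 8 ∧
    |zetaLog 1 - 0.9375482543| ≤ 3 / 10 ^ 7 := by
  obtain ⟨t, l, h1, h2, -, h3⟩ := exists_of_scan constRecipe_approx (f := 50) (g := 81)
    (by norm_num) constRecipe_scan (by norm_num : 4000 < 50 * 81)
  simp only [constRecipe, h1] at h3
  norm_num at h3
  obtain ⟨⟨k1, k2⟩, k3⟩ := h3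
  have k1' : |((t.l - 8294049640102027 : ℤ) : ℝ)| ≤ 1000000 := by exact_mod_cast k1
  have k2' : |((t.a - 8871390299795227 : ℤ) : ℝ)| ≤ 1000000 := by exact_mod_cast k2
  have k3' : |((t.b - 935225001074572 : ℤ) : ℝ)| ≤ 1000000 := by exact_mod_cast k3
  push_cast at k1' k2' k3'
  have a1 := h2.log
  have a2 := h2.a
  have a3 := h2.b
  simp only [h1] at a1 a2 a3
  have b1 := harmDev_le (v := 1) (Or.inl rfl) 3999
  have b2 := le_harmDev (v := 1) (Or.inl rfl) 3999
  rw [harmDev_one] at b1 b2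
  obtain ⟨z1, z2⟩ := zetaLog_one_bounds (N := 4000) (by norm_num)
  simp only [one_mul] at a3
  have e4 : 3999 + 1 = 4000 := rfl
  rw [e4] at b1 b2
  generalize ∑ m ∈ Ioc (0 : ℕ) 4000, 1 / (m : ℝ) = H at *
  generalize ∑ m ∈ Ioc (0 : ℕ) 4000, Real.log m / (m : ℝ) ^ 2 = Z at *
  push_cast at *
  have hl : 1 / 4001 ≤ Real.log (4000 + 1) - Real.log 4000 := by
    rw [← Real.log_div (by norm_num) (by norm_num)]
    refine le_trans ?_ (Real.one_sub_inv_le_log_of_pos (by norm_num))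
    norm_num
  rw [abs_le] at *
  norm_num at *
  exact ⟨by constructor <;> linarith, by rw [abs_le]; constructor <;> linarith⟩

lemma abs_log_two_sub_le : |Real.log 2 - 0.69314718055| ≤ 3 / 10 ^ 10 := by
  have h1 := Real.log_two_gt_d9
  have h2 := Real.log_two_lt_d9
  rw [abs_le]; constructor <;> linarith

lemma pi_sq_bounds : 9.8696044010 < Real.pi ^ 2 ∧ Real.pi ^ 2 < 9.8696044012 := by
  have h1 := Real.pi_gt_d20
  have h2 := Real.pi_lt_d20
  constructor <;> nlinarith

/-! ### Mollifiers -/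

/-- The mollifier for `v = 1`. The coefficients `a` at `j` satisfy `∑ a / j = 0`, so the partial sums
of `mollify 1 mol₁` are periodic, modulo `210`; they take values in `{0, 1, 2}`. -/
def mol₁ : List (ℕ × ℤ) :=
  [(1, 1), (2, -1), (3, -1), (5, -1), (6, 1), (7, -1), (70, 1), (210, -1)]

/-- The mollifier for `v = 2`, again with `∑ a / j = 0`; the partial sums of `mollify 2 mol₂` take
values in `{-1, 0, 1}`. -/
def mol₂ : List (ℕ × ℤ) := [(1, 1), (3, -2), (5, -1), (7, -1), (105, 1)]

lemma mol₁_pos : ∀ p ∈ mol₁, 0 < p.1 := by decide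
lemma mol₂_pos : ∀ p ∈ mol₂, 0 < p.1 := by decide

lemma abs_sum_mol₁_le (k M : ℕ) : |∑ m ∈ Ioc k M, (mollify 1 mol₁ m : ℝ)| ≤ 2 := by
  refine abs_sum_mollify_le (Or.inl rfl) mol₁_pos (a := 0) (fun N => ?_) k M
  have h1 : ∀ r < 210, 0 ≤ molPartial 1 mol₁ r ∧ molPartial 1 mol₁ r ≤ 0 + 2 := by decide +kernel
  have h2 : molPartial 1 mol₁ N = molPartial 1 mol₁ (N % 210) := by
    simp only [molPartial, mol₁, List.map_cons, List.map_nil, List.sum_cons, List.sum_nil,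
      Nat.add_sub_cancel, Nat.div_one]
    omega
  rw [h2]
  exact h1 _ (Nat.mod_lt _ (by norm_num))

lemma abs_sum_mol₂_le (k M : ℕ) : |∑ m ∈ Ioc k M, (mollify 2 mol₂ m : ℝ)| ≤ 2 := by
  refine abs_sum_mollify_le (Or.inr rfl) mol₂_pos (a := (-1)) (fun N => ?_) k M
  have h1 : ∀ r < 210, ((-1) : ℤ) ≤ molPartial 2 mol₂ r ∧ molPartial 2 mol₂ r ≤ (-1) + 2 := by
    decide +kernel
  have h2 : molPartial 2 mol₂ N = molPartial 2 mol₂ (N % 210) := by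
    have e1 : (N / 1 + 2 - 1) / 2 = 105 * (N / 210) + (N % 210 / 1 + 2 - 1) / 2 := by omega
    have e3 : (N / 3 + 2 - 1) / 2 = 35 * (N / 210) + (N % 210 / 3 + 2 - 1) / 2 := by omega
    have e5 : (N / 5 + 2 - 1) / 2 = 21 * (N / 210) + (N % 210 / 5 + 2 - 1) / 2 := by omega
    have e7 : (N / 7 + 2 - 1) / 2 = 15 * (N / 210) + (N % 210 / 7 + 2 - 1) / 2 := by omega
    have e105 : (N / 105 + 2 - 1) / 2 = N / 210 + (N % 210 / 105 + 2 - 1) / 2 := by omega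
    simp only [molPartial, mol₂, List.map_cons, List.map_nil, List.sum_cons, List.sum_nil]
    rw [e1, e3, e5, e7, e105]
    push_cast
    ring
  rw [h2]
  exact h1 _ (Nat.mod_lt _ (by norm_num))

lemma molSum_mol₁ : molSum mol₁ = 6686/11025 := by
  simp only [molSum, mol₁, List.map_cons, List.map_nil, List.sum_cons, List.sum_nil]; norm_num

lemma molSum_mol₂ : molSum mol₂ = 226/315 := by
  simp only [molSum, mol₂, List.map_cons, List.map_nil, List.sum_cons, List.sum_nil]; norm_num

lemma abs_molLog_mol₁_sub_le : |molLog mol₁ - ((-0.3489279091242))| ≤ 1 / 10 ^ 9 := by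
  have h6 : Real.log 6 = Real.log 2 + Real.log 3 := by
    rw [← Real.log_mul (by norm_num) (by norm_num)]; norm_num
  have h70 : Real.log 70 = Real.log 2 + Real.log 5 + Real.log 7 := by
    rw [← Real.log_mul (by norm_num) (by norm_num), ← Real.log_mul (by norm_num) (by norm_num)]
    norm_num
  have h210 : Real.log 210 = Real.log 3 + Real.log 70 := by
    rw [← Real.log_mul (by norm_num) (by norm_num)]; norm_num
  have a2 := abs_log_two_sub_le
  have a3 := abs_log_three_sub_le
  have a5 := abs_log_five_sub_le
  have a7 := abs_log_seven_sub_le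
  simp only [molLog, mol₁, List.map_cons, List.map_nil, List.sum_cons, List.sum_nil]
  push_cast
  rw [h210, h70, h6, Real.log_one]
  rw [abs_le] at *
  constructor <;> linarith

lemma abs_molLog_mol₂_sub_le : |molLog mol₂ - ((-0.3478039047445))| ≤ 1 / 10 ^ 9 := by
  have h105 : Real.log 105 = Real.log 3 + Real.log 5 + Real.log 7 := by
    rw [← Real.log_mul (by norm_num) (by norm_num), ← Real.log_mul (by norm_num) (by norm_num)]
    norm_num
  have a3 := abs_log_three_sub_le
  have a5 := abs_log_five_sub_le
  have a7 := abs_log_seven_sub_le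
  simp only [molLog, mol₂, List.map_cons, List.map_nil, List.sum_cons, List.sum_nil]
  push_cast
  rw [h105, Real.log_one]
  rw [abs_le] at *
  constructor <;> linarith

/-! ### The error term in the logarithmic average of the squarefree integers -/

/-- Numerical values of `molShift`, `mucC`, `mucD` and of the limits of the mollified sums. -/
lemma mol₁_bounds : |molSum mol₁ * zetaC 1 - 0.9975536662991| ≤ 1 / 10 ^ 10 ∧
    |(molLog mol₁ * zetaC 1 + molSum mol₁ * zetaLog 1) - (-0.0053967263)| ≤ 2 / 10 ^ 7 ∧
    |molShift 1 mol₁ - 0.5663957432| ≤ 6 / 10 ^ 7 := by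
  obtain ⟨p1, p2⟩ := pi_sq_bounds
  obtain ⟨hγ, hz⟩ := const_bounds
  have hm := abs_molLog_mol₁_sub_le
  have h1 : |molSum mol₁ * zetaC 1 - 0.9975536662991| ≤ 1 / 10 ^ 10 := by
    rw [molSum_mol₁, zetaC_one, abs_le]; constructor <;> linarith
  have hmz : |molLog mol₁ * zetaC 1 - (-0.3489279091242) * zetaC 1| ≤ 2 / 10 ^ 9 := by
    rw [← sub_mul, abs_mul, abs_of_pos (by rw [zetaC_one]; positivity : 0 < zetaC 1), zetaC_one]
    have := abs_nonneg (molLog mol₁ - (-0.3489279091242))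
    nlinarith
  have h2 : |(molLog mol₁ * zetaC 1 + molSum mol₁ * zetaLog 1) - (-0.0053967263)| ≤ 2 / 10 ^ 7 := by
    rw [molSum_mol₁]
    rw [zetaC_one] at *
    rw [abs_le] at *; constructor <;> linarith
  refine ⟨h1, h2, ?_⟩
  rw [molShift]
  set Λ := molSum mol₁ * zetaC 1
  set Λ' := molLog mol₁ * zetaC 1 + molSum mol₁ * zetaLog 1
  have h3 : |Λ' / Λ - (-0.0054099610)| ≤ 25 / 10 ^ 8 := by
    have hΛ : 0 < Λ := by rw [abs_le] at h1; linarith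
    rw [abs_le, le_sub_iff_add_le, sub_le_iff_le_add, le_div_iff₀ hΛ, div_le_iff₀ hΛ]
    rw [abs_le] at h1 h2
    constructor <;> nlinarith
  rw [abs_le] at *
  norm_num at *
  constructor <;> linarith

lemma mol₂_bounds : |molSum mol₂ * zetaC 2 - 0.8851311883517| ≤ 1 / 10 ^ 10 ∧
    |(molLog mol₂ * zetaC 2 + molSum mol₂ * zetaLog 2) - (-0.1291043467)| ≤ 2 / 10 ^ 7 ∧
    |molShift 2 mol₂ - 0.9786448529| ≤ 6 / 10 ^ 7 := by
  obtain ⟨p1, p2⟩ := pi_sq_bounds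
  obtain ⟨hγ, hz⟩ := const_bounds
  have hm := abs_molLog_mol₂_sub_le
  have hl2 := abs_log_two_sub_le
  have hz2 : |zetaLog 2 - 0.4181158381| ≤ 24 / 10 ^ 8 := by
    rw [zetaLog_two]
    rw [abs_le] at *; constructor <;> nlinarith
  have h1 : |molSum mol₂ * zetaC 2 - 0.8851311883517| ≤ 1 / 10 ^ 10 := by
    rw [molSum_mol₂, zetaC_two, abs_le]; constructor <;> linarith
  have hmz : |molLog mol₂ * zetaC 2 - (-0.3478039047445) * zetaC 2| ≤ 2 / 10 ^ 9 := by
    rw [← sub_mul, abs_mul, abs_of_pos (by rw [zetaC_two]; positivity : 0 < zetaC 2), zetaC_two]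
    have := abs_nonneg (molLog mol₂ - (-0.3478039047445))
    nlinarith
  have h2 : |(molLog mol₂ * zetaC 2 + molSum mol₂ * zetaLog 2) - (-0.1291043467)| ≤ 2 / 10 ^ 7 := by
    rw [molSum_mol₂]
    rw [zetaC_two] at *
    rw [abs_le] at *; constructor <;> linarith
  refine ⟨h1, h2, ?_⟩
  rw [molShift]
  set Λ := molSum mol₂ * zetaC 2
  set Λ' := molLog mol₂ * zetaC 2 + molSum mol₂ * zetaLog 2
  have h3 : |Λ' / Λ - (-0.1458589963)| ≤ 25 / 10 ^ 8 := by
    have hΛ : 0 < Λ := by rw [abs_le] at h1; linarith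
    rw [abs_le, le_sub_iff_add_le, sub_le_iff_le_add, le_div_iff₀ hΛ, div_le_iff₀ hΛ]
    rw [abs_le] at h1 h2
    constructor <;> nlinarith
  rw [abs_le] at *
  norm_num at *
  constructor <;> linarith

lemma mucC_mucD_one : mucC 1 = 6 / Real.pi ^ 2 ∧ mucD 1 = -zetaLog 1 * (6 / Real.pi ^ 2) ^ 2 := by
  obtain ⟨h1, h2, h3⟩ := mol₁_bounds
  rw [abs_le] at h1 h3
  have h := mucC_mucD_eq mol₁_pos abs_sum_mol₁_le (by rw [molSum_mol₁]; norm_num)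
    (by rw [zetaC_one]; positivity) (by linarith)
  rw [zetaC_one] at h
  refine ⟨by rw [h.1]; field_simp, by rw [h.2]; field_simp⟩

lemma mucC_mucD_two : mucC 2 = 8 / Real.pi ^ 2 ∧ mucD 2 = -zetaLog 2 * (8 / Real.pi ^ 2) ^ 2 := by
  obtain ⟨h1, h2, h3⟩ := mol₂_bounds
  rw [abs_le] at h1 h3
  have h := mucC_mucD_eq mol₂_pos abs_sum_mol₂_le (by rw [molSum_mol₂]; norm_num)
    (by rw [zetaC_two]; positivity) (by linarith)
  rw [zetaC_two] at h
  refine ⟨by rw [h.1]; field_simp, by rw [h.2]; field_simp⟩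

lemma mucC_mucD_one_bounds : |mucC 1 - 0.6079271018540| ≤ 1 / 10 ^ 10 ∧
    |mucD 1 - (-0.3464947347)| ≤ 2 / 10 ^ 7 := by
  obtain ⟨p1, p2⟩ := pi_sq_bounds
  obtain ⟨-, hz⟩ := const_bounds
  obtain ⟨h1, h2⟩ := mucC_mucD_one
  have h3 : |mucC 1 - 0.6079271018540| ≤ 1 / 10 ^ 10 := by
    have hp : 0 < Real.pi ^ 2 := by positivity
    rw [h1, abs_le, le_sub_iff_add_le, sub_le_iff_le_add, le_div_iff₀ hp, div_le_iff₀ hp]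
    constructor <;> nlinarith
  refine ⟨h3, ?_⟩
  rw [h2, ← h1]
  have h4 : |mucC 1 ^ 2 - 0.36957536117| ≤ 3 / 10 ^ 10 := by
    rw [abs_le] at *; constructor <;> nlinarith
  rw [abs_le] at *
  constructor <;> nlinarith

lemma mucC_mucD_two_bounds : |mucC 2 - 0.8105694691387| ≤ 2 / 10 ^ 10 ∧
    |mucD 2 - (-0.2747116655)| ≤ 2 / 10 ^ 7 := by
  obtain ⟨p1, p2⟩ := pi_sq_bounds
  obtain ⟨-, hz⟩ := const_bounds
  obtain ⟨h1, h2⟩ := mucC_mucD_two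
  have hl2 := abs_log_two_sub_le
  have hz2 : |zetaLog 2 - 0.4181158381| ≤ 24 / 10 ^ 8 := by
    rw [zetaLog_two]
    rw [abs_le] at *; constructor <;> nlinarith
  have h3 : |mucC 2 - 0.8105694691387| ≤ 2 / 10 ^ 10 := by
    have hp : 0 < Real.pi ^ 2 := by positivity
    rw [h1, abs_le, le_sub_iff_add_le, sub_le_iff_le_add, le_div_iff₀ hp, div_le_iff₀ hp]
    constructor <;> nlinarith
  refine ⟨h3, ?_⟩
  rw [h2, ← h1]
  have h4 : |mucC 2 ^ 2 - 0.6570228643| ≤ 5 / 10 ^ 10 := by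
    rw [abs_le] at *; constructor <;> nlinarith
  rw [abs_le] at *
  constructor <;> nlinarith

lemma sqConst_one_bounds : |sqConst 1 - 1.0438945157| ≤ 1 / 10 ^ 6 := by
  obtain ⟨h1, h2⟩ := mucC_mucD_one_bounds
  obtain ⟨hγ, -⟩ := const_bounds
  rw [sqConst]
  norm_num at *
  rw [abs_le] at *
  constructor <;> nlinarith

lemma sqConst_two_bounds : |sqConst 2 - 0.7895703342| ≤ 1 / 10 ^ 6 := by
  obtain ⟨h1, h2⟩ := mucC_mucD_two_bounds
  obtain ⟨hγ, -⟩ := const_bounds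
  have hl2 := abs_log_two_sub_le
  rw [sqConst]
  norm_num at *
  rw [abs_le] at *
  constructor <;> nlinarith

/-- The rounding error in an expression `μ w - 2 d`. -/
lemma abs_mul_sub_le {P W D : ℝ} {μ w d ε₁ ε₃ ε₄ : ℝ} (h1 : |P - μ| ≤ ε₁) (h3 : |W - w| ≤ ε₃)
    (h4 : |D - d| ≤ ε₄) :
    |μ * w - 2 * d| ≤ |P * W - 2 * D| + (ε₁ * |W| + |μ| * ε₃ + 2 * ε₄) := by
  have e : μ * w - 2 * d = (P * W - 2 * D) - ((P - μ) * W + μ * (W - w) - 2 * (D - d)) := by ring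
  rw [e]
  refine (abs_sub _ _).trans (add_le_add_right ?_ _)
  refine (abs_sub _ _).trans (add_le_add ((abs_add_le _ _).trans (add_le_add ?_ ?_)) ?_)
  · rw [abs_mul]; gcongr
  · rw [abs_mul]; gcongr
  · rw [abs_mul, abs_two]; gcongr

lemma abs_affine_le_max {a b x y z : ℝ} (h1 : x ≤ y) (h2 : y ≤ z) :
    |a * y + b| ≤ max |a * x + b| |a * z + b| := by
  rcases le_total 0 a with h | h
  · refine abs_le_max_abs_abs ?_ ?_ <;> gcongr
  · rw [max_comm]
    have h3 := mul_le_mul_of_nonpos_left h1 h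
    have h4 := mul_le_mul_of_nonpos_left h2 h
    refine abs_le_max_abs_abs ?_ ?_ <;> linarith

lemma log_le_nine {x : ℝ} (h0 : 0 < x) (hx : x ≤ 5042) : Real.log x ≤ 9 := by
  rw [Real.log_le_iff_le_exp h0]
  have h1 := Real.exp_one_gt_d9
  have h2 : Real.exp 9 = Real.exp 1 ^ 9 := by rw [← Real.exp_nat_mul]; norm_num
  have h3 : (2.7 : ℝ) ^ 9 ≤ Real.exp 1 ^ 9 := by gcongr; linarith
  rw [h2]
  refine hx.trans (le_trans (by norm_num) h3)

/-- Evaluation of the bound `abs_sqErr_le` for the integers `n₀ < n`; in the condition, `κ` is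
scaled by `72 * 10 ^ 30`. -/
def tailRecipe (v : ℕ) (G C D : ℤ) (n₀ κ : ℕ) : Recipe where
  wA n _ := mobCopr v n * 10 ^ 15 / (n : ℤ) ^ 2
  wB n l := mobCopr v n * l / (n : ℤ) ^ 2
  wC n _ := mobCopr v n ^ 2 * 10 ^ 15
  ok s l := Nat.ble s.n n₀ ||
    (decide (((72 / v * (s.n * (s.n + 1)) : ℕ) : ℤ)
        * |(G + 2 * s.l) * (C - s.a) - 2 * (D - s.b) * 10 ^ 15| + (38 + v) * s.c * 10 ^ 15 ≤ κ * s.n)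
      && decide (((72 / v * (s.n * (s.n + 1)) : ℕ) : ℤ)
        * |(G + 2 * l) * (C - s.a) - 2 * (D - s.b) * 10 ^ 15| + (38 + v) * s.c * 10 ^ 15 ≤ κ * s.n))

lemma tailRecipe_approx (v : ℕ) (G C D : ℤ) (n₀ κ : ℕ) : (tailRecipe v G C D n₀ κ).Approx 5040
    (fun n => muc v n / (n : ℝ) ^ 2) (fun n => muc v n * Real.log n / (n : ℝ) ^ 2) (sqc v) := by
  intro n hn hN l hl
  have hm := mobCopr_eq (v := v) hn (by omega)
  have hn0 : (1 : ℝ) ≤ n := by exact_mod_cast hn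
  refine ⟨abs_coeff_div_sq_sub_le hn hm, abs_coeff_log_div_sq_sub_le hn hm
    ((abs_muc_le_one v n).trans hn0) hl, ?_⟩
  simp only [tailRecipe]
  push_cast
  rw [hm, ← sq_abs, abs_muc]
  have : sqc v n ^ 2 = sqc v n := by
    unfold sqc copr
    rcases ArithmeticFunction.moebius_eq_or n with h | h | h <;> simp [h]
  rw [this, mul_comm]; norm_num

set_option maxHeartbeats 1000000 in
/-- For `n ≤ y < n + 1` the tail is an affine function of `log y`, so it is enough to check both ends.
The summand `0.013` absorbs the rounding errors, which are magnified by a factor of the size of `y`. -/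
lemma tail_bound_of_scan {v : ℕ} (hv : v = 1 ∨ v = 2) {G C D : ℤ} {n₀ κ : ℕ}
    (hG : |(G : ℝ) / 10 ^ 15 - (Real.eulerMascheroniConstant + Real.log v)| ≤ 1 / 10 ^ 7)
    (hC : |(C : ℝ) / 10 ^ 15 - mucC v| ≤ 1 / 10 ^ 9) (hD : |(D : ℝ) / 10 ^ 15 - mucD v| ≤ 1 / 10 ^ 6)
    (h : (scanBlocks (tailRecipe v G C D n₀ κ) 50 100 Acc.init).isSome = true)
    {y : ℝ} (hy0 : (n₀ : ℝ) + 1 ≤ y) (hy : y < 5000) :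
    (1 / 2 + v / (12 * (v + 1))) * sqCount v y / y + 1 / v * (y * |tailT v y|)
      ≤ κ / (72 * 10 ^ 30) + 0.013 := by
  have hv1 : (1 : ℝ) ≤ v := by rcases hv with rfl | rfl <;> norm_num
  have hv2 : (v : ℝ) ≤ 2 := by rcases hv with rfl | rfl <;> norm_num
  have hy0' : (0 : ℝ) ≤ n₀ := Nat.cast_nonneg _
  have hy1 : 1 ≤ y := by linarith
  set n := ⌊y⌋₊ with hn
  have hn1 : n₀ + 1 ≤ n := Nat.le_floor (by push_cast; exact hy0)
  have hn2 : n < 50 * 100 := by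
    rw [hn, Nat.floor_lt (by linarith)]; push_cast; linarith
  have hnle : (n : ℝ) ≤ y := Nat.floor_le (by linarith)
  have hnlt : y < n + 1 := Nat.lt_floor_add_one y
  have hnr1 : (1 : ℝ) ≤ n := by exact_mod_cast (by omega : 1 ≤ n)
  have hnr2 : (n : ℝ) + 1 ≤ 5000 := by exact_mod_cast hn2
  obtain ⟨t, l, h1, h2, h3, h4⟩ := exists_of_scan (tailRecipe_approx v G C D n₀ κ)
    (by norm_num) h hn2
  have hlog := h2.log
  have ha := h2.a
  have hb := h2.b
  have hc := h2.c
  rw [h1] at hlog ha hb hc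
  have hnb : Nat.ble n n₀ = false := by
    rw [Bool.eq_false_iff]; intro h'; have := Nat.le_of_ble_eq_true h'; omega
  simp only [tailRecipe, h1, hnb, Bool.false_or, Bool.and_eq_true, decide_eq_true_eq] at h4
  set g := Real.eulerMascheroniConstant + Real.log v with hg
  set w := mucC v - ∑ d ∈ Ioc 0 n, muc v d / (d : ℝ) ^ 2 with hw
  set dd := mucD v - ∑ d ∈ Ioc 0 n, muc v d * Real.log d / (d : ℝ) ^ 2 with hdd
  set W : ℝ := (C - t.a) / 10 ^ 15 with hW
  set E : ℝ := (D - t.b) / 10 ^ 15 with hE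
  have hw1 : |w| ≤ 1 := by
    refine (abs_mucC_sub_le v (by omega)).trans ?_
    rw [div_le_one (by linarith)]; exact hnr1
  have hWw : |W - w| ≤ 2 / 10 ^ 9 := by
    rw [abs_le] at *; rw [hW, hw]; constructor <;> linarith
  have hEd : |E - dd| ≤ 1001 / 10 ^ 9 := by
    rw [abs_le] at *; rw [hE, hdd]; constructor <;> linarith
  have hW1 : |W| ≤ 2 := by
    rw [abs_le] at *; constructor <;> linarith
  have hκ : (0 : ℝ) ≤ (κ : ℝ) * n := by positivity
  -- the condition, for one of the two endpoints
  have key : ∀ (z : ℤ) (x : ℝ), 1 ≤ x → x ≤ n + 1 →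
      |(z : ℝ) / 10 ^ 15 - Real.log x| ≤ 1 / 10 ^ 9 →
      ((72 / v * (n * (n + 1)) : ℕ) : ℤ) * |(G + 2 * z) * (C - t.a) - 2 * (D - t.b) * 10 ^ 15|
        + (38 + v) * t.c * 10 ^ 15 ≤ κ * n →
      72 / v * (n * (n + 1)) * |(g + 2 * Real.log x) * w - 2 * dd|
        + (38 + v) * (t.c / 10 ^ 15) ≤ κ / 10 ^ 30 * n
          + 72 / v * (n * (n + 1)) * (249 / 10 ^ 8) := by
    intro z x hx1 hx2 hz hcond
    have hP : |((G : ℝ) + 2 * z) / 10 ^ 15 - (g + 2 * Real.log x)| ≤ 102 / 10 ^ 9 := by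
      rw [abs_le] at *; constructor <;> linarith
    have hμ : |g + 2 * Real.log x| ≤ 20 := by
      have a1 := Real.log_nonneg hx1
      have a2 := log_le_nine (by linarith) (by linarith : x ≤ 5042)
      have a3 := const_bounds.1
      have a4 : Real.log v ≤ 0.7 := by
        have := Real.log_two_lt_d9
        rcases hv with rfl | rfl <;> norm_num; linarith
      have a5 : 0 ≤ Real.log v := Real.log_nonneg hv1
      rw [abs_le] at *
      rw [hg]
      constructor <;> linarith
    have h5 := abs_mul_sub_le hP hWw hEd
    have h6 : (102 / 10 ^ 9 * |W| + |g + 2 * Real.log x| * (2 / 10 ^ 9) + 2 * (1001 / 10 ^ 9) : ℝ)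
        ≤ 249 / 10 ^ 8 := by linarith
    have h7 : (((72 / v * (n * (n + 1)) : ℕ) : ℤ) : ℝ) = 72 / v * (n * (n + 1)) := by
      rcases hv with rfl | rfl <;> norm_num
    have h8 : (((72 / v * (n * (n + 1)) : ℕ) : ℤ) : ℝ)
        * |((G : ℝ) + 2 * z) * (C - t.a) - 2 * (D - t.b) * 10 ^ 15|
        + (38 + v) * t.c * 10 ^ 15 ≤ κ * n := by exact_mod_cast hcond
    have h9 : |((G : ℝ) + 2 * z) / 10 ^ 15 * W - 2 * E|
        = |((G : ℝ) + 2 * z) * (C - t.a) - 2 * (D - t.b) * 10 ^ 15| / 10 ^ 30 := by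
      rw [← abs_of_pos (by norm_num : (0 : ℝ) < 10 ^ 30), ← abs_div, hW, hE]
      congr 1
      ring
    rw [h9] at h5
    rw [h7] at h8
    have hpos : (0 : ℝ) ≤ 72 / v * (n * (n + 1)) := by positivity
    have h10 := mul_le_mul_of_nonneg_left (h5.trans (add_le_add_right h6 _)) hpos
    generalize |((G : ℝ) + 2 * z) * (C - t.a) - 2 * (D - t.b) * 10 ^ 15| = A at *
    have h11 : (72 / v * (n * (n + 1)) * A + (38 + v) * t.c * 10 ^ 15) / 10 ^ 30
        ≤ κ * n / 10 ^ 30 := by gcongr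
    have h12 : (72 / v * (n * (n + 1)) * A + (38 + v) * (t.c : ℝ) * 10 ^ 15) / 10 ^ 30
        = 72 / v * (n * (n + 1)) * (A / 10 ^ 30) + (38 + v) * (t.c / 10 ^ 15) := by ring
    rw [h12] at h11
    linarith [h10, h11, show (κ : ℝ) * n / 10 ^ 30 = κ / 10 ^ 30 * n by ring]
  have k1 := key t.l n hnr1 (by linarith) (by
    rw [abs_le] at *; constructor <;> linarith) h4.1
  have k2 := key l (n + 1) (by linarith) le_rfl (by
    rw [abs_le] at *; constructor <;> linarith) h4.2
  have hT : |tailT v y| ≤ max |(g + 2 * Real.log n) * w - 2 * dd|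
      |(g + 2 * Real.log (n + 1)) * w - 2 * dd| := by
    have l1 := Real.log_le_log (by linarith) hnle
    have l2 := Real.log_le_log (by linarith) hnlt.le
    have e : ∀ x, (g + 2 * x) * w - 2 * dd = 2 * w * x + (g * w - 2 * dd) := fun x => by ring
    have e' : tailT v y = (g + 2 * Real.log y) * w - 2 * dd := rfl
    rw [e', e, e, e]
    exact abs_affine_le_max l1 l2
  set M := max |(g + 2 * Real.log n) * w - 2 * dd| |(g + 2 * Real.log (n + 1)) * w - 2 * dd| with hM
  have k3 : 72 / v * (n * (n + 1)) * M + (38 + v) * ((t.c : ℝ) / 10 ^ 15)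
      ≤ κ / 10 ^ 30 * n + 72 / v * (n * (n + 1)) * (249 / 10 ^ 8) := by
    rcases max_choice |(g + 2 * Real.log n) * w - 2 * dd|
      |(g + 2 * Real.log (n + 1)) * w - 2 * dd| with h' | h' <;> rw [hM, h'] <;> assumption
  have hq : sqCount v y ≤ t.c / 10 ^ 15 + 1 / 10 ^ 9 := by
    have : sqCount v y = ∑ m ∈ Ioc 0 n, sqc v m := rfl
    rw [this]; rw [abs_le] at hc; linarith
  have hn0 : (0 : ℝ) < n := by linarith
  have hcv : (1 : ℝ) / 2 + v / (12 * (v + 1)) = (38 + v) / 72 := by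
    rcases hv with rfl | rfl <;> norm_num
  have hM0 : 0 ≤ M := (abs_nonneg _).trans hT
  have hsq0 : 0 ≤ sqCount v y := sum_nonneg fun _ _ => sqc_nonneg _ _
  calc (1 / 2 + v / (12 * (v + 1))) * sqCount v y / y + 1 / v * (y * |tailT v y|)
      ≤ (38 + v) / 72 * (t.c / 10 ^ 15 + 1 / 10 ^ 9) / n + 1 / v * ((n + 1) * M) := by
        have hq0 := hsq0.trans hq
        rw [hcv]
        gcongr
    _ = (72 / v * (n * (n + 1)) * M + (38 + v) * ((t.c : ℝ) / 10 ^ 15)) / (72 * n)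
        + (38 + v) / 72 / 10 ^ 9 / n := by field_simp; ring
    _ ≤ (κ / 10 ^ 30 * n + 72 / v * (n * (n + 1)) * (249 / 10 ^ 8)) / (72 * n)
        + (38 + v) / 72 / 10 ^ 9 / n := by gcongr
    _ = κ / (72 * 10 ^ 30) + 1 / v * (n + 1) * (249 / 10 ^ 8) + (38 + v) / 72 / 10 ^ 9 / n := by
        field_simp
    _ ≤ κ / (72 * 10 ^ 30) + 1 * 5000 * (249 / 10 ^ 8) + (38 + 2) / 72 / 10 ^ 9 / 1 := by
        gcongr
        rw [div_le_one (by linarith)]; exact hv1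
    _ ≤ κ / (72 * 10 ^ 30) + 0.013 := by linarith

/-- Evaluation of the error term itself for the integers `n` with `n₀ ≤ n < n₁`; in the condition,
`κ` is scaled by `10 ^ 60`. -/
def sqRecipe (v : ℕ) (c b : ℤ) (n₀ n₁ κ : ℕ) : Recipe where
  wA n _ := mobCopr v n ^ 2 * 10 ^ 15 / (n : ℤ)
  wB _ _ := 0
  wC _ _ := 0
  ok s l := Nat.ble (s.n + 1) n₀ || Nat.ble n₁ s.n ||
    (decide ((s.a * 10 ^ 15 - (c * s.l + b * 10 ^ 15)) ^ 2 * (s.n + 1) ≤ κ)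
      && decide ((s.a * 10 ^ 15 - (c * l + b * 10 ^ 15)) ^ 2 * (s.n + 1) ≤ κ))

lemma sqRecipe_approx (v : ℕ) (c b : ℤ) (n₀ n₁ κ : ℕ) : (sqRecipe v c b n₀ n₁ κ).Approx 5040
    (fun n => sqc v n / (n : ℝ)) 0 0 := by
  intro n hn hN l hl
  have hm := mobCopr_eq (v := v) hn (by omega)
  refine ⟨?_, by simp [sqRecipe], by simp [sqRecipe]⟩
  have h := abs_ediv_sub_le (mobCopr v n ^ 2 * 10 ^ 15) (d := (n : ℤ)) (by exact_mod_cast hn)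
  simp only [sqRecipe]
  push_cast at h ⊢
  rw [hm, ← sq_abs (muc v n), abs_muc] at h
  have : sqc v n ^ 2 = sqc v n := by
    unfold sqc copr
    rcases ArithmeticFunction.moebius_eq_or n with h | h | h <;> simp [h]
  rw [this] at h
  rw [show (10 : ℝ) ^ 15 * (sqc v n / n) = sqc v n * 10 ^ 15 / n by ring]
  linarith

/-- On `[n, n + 1)` the error term is an affine function of `log X`, so it is enough to check both
ends; the factor `√X` is at most `√(n + 1)`. -/
lemma sqErr_bound_of_scan {v : ℕ} {c b : ℤ} {n₀ n₁ κ : ℕ} {τ : ℝ} (hτ : 0 ≤ τ)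
    (hκ : (κ : ℝ) ≤ τ ^ 2 * 10 ^ 60)
    (hc : |(c : ℝ) / 10 ^ 15 - sqLead v| ≤ 1 / 10 ^ 9)
    (hb : |(b : ℝ) / 10 ^ 15 - sqConst v| ≤ 1 / 10 ^ 6)
    (hc1 : |(c : ℝ)| ≤ 10 ^ 15)
    (h : (scanBlocks (sqRecipe v c b n₀ n₁ κ) 30 30 Acc.init).isSome = true) (hn₀ : 1 ≤ n₀)
    (hn₁ : n₁ ≤ 900) {X : ℝ} (hX0 : n₀ ≤ X) (hX1 : X < n₁) :
    √X * |sqErr v X| ≤ τ + 4 / 10 ^ 5 := by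
  have hn₀' : (1 : ℝ) ≤ n₀ := by exact_mod_cast hn₀
  have hn₁' : (n₁ : ℝ) ≤ 900 := by exact_mod_cast hn₁
  have hX : 1 ≤ X := by linarith
  set n := ⌊X⌋₊ with hn
  have hn1 : n₀ ≤ n := Nat.le_floor hX0
  have hn2 : n < n₁ := by rw [hn, Nat.floor_lt (by linarith)]; exact hX1
  have hnle : (n : ℝ) ≤ X := Nat.floor_le (by linarith)
  have hnlt : X < n + 1 := Nat.lt_floor_add_one X
  have hnr1 : (1 : ℝ) ≤ n := by exact_mod_cast (by omega : 1 ≤ n)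
  have hnr2 : (n : ℝ) + 1 ≤ 900 := by exact_mod_cast (by omega : n + 1 ≤ 900)
  obtain ⟨t, l, h1, h2, h3, h4⟩ := exists_of_scan (sqRecipe_approx v c b n₀ n₁ κ)
    (by norm_num) h (by omega : n < 30 * 30)
  have hlog := h2.log
  have ha := h2.a
  rw [h1] at hlog ha
  have hb1 : Nat.ble (n + 1) n₀ = false := by
    rw [Bool.eq_false_iff]; intro h'; have := Nat.le_of_ble_eq_true h'; omega
  have hb2 : Nat.ble n₁ n = false := by
    rw [Bool.eq_false_iff]; intro h'; have := Nat.le_of_ble_eq_true h'; omega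
  simp only [sqRecipe, h1, hb1, hb2, Bool.false_or, Bool.and_eq_true, decide_eq_true_eq] at h4
  have hsq : (0 : ℝ) < √((n : ℝ) + 1) := by positivity
  have hsq2 : √((n : ℝ) + 1) ^ 2 = n + 1 := Real.sq_sqrt (by positivity)
  have hsq30 : √((n : ℝ) + 1) ≤ 30 := by
    rw [Real.sqrt_le_left (by norm_num)]; linarith
  have key : ∀ (z : ℤ) (x : ℝ), 1 ≤ x → x ≤ n + 1 →
      |(z : ℝ) / 10 ^ 15 - Real.log x| ≤ 1 / 10 ^ 9 →
      (t.a * 10 ^ 15 - (c * z + b * 10 ^ 15)) ^ 2 * (n + 1) ≤ (κ : ℤ) →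
      √((n : ℝ) + 1) * |sqSum v X - (sqLead v * Real.log x + sqConst v)| ≤ τ + 4 / 10 ^ 5 := by
    intro z x hx1 hx2 hz hcond
    set e : ℝ := (t.a * 10 ^ 15 - (c * z + b * 10 ^ 15)) / 10 ^ 30 with he
    have h5 : (t.a * 10 ^ 15 - (c * z + b * 10 ^ 15) : ℝ) ^ 2 * (n + 1) ≤ κ := by
      exact_mod_cast hcond
    have h6 : √((n : ℝ) + 1) * |e| ≤ τ := by
      apply abs_le_of_sq_le_sq' _ hτ |>.2
      rw [mul_pow, hsq2, sq_abs, he, div_pow]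
      have : (10 ^ 30 : ℝ) ^ 2 = 10 ^ 60 := by norm_num
      rw [this, mul_div_assoc', div_le_iff₀ (by norm_num)]
      linarith
    have hlx := log_le_nine (by linarith) (by linarith : x ≤ 5042)
    have hlx0 := Real.log_nonneg hx1
    have h7 : |(c : ℝ) / 10 ^ 15 * (z / 10 ^ 15) - sqLead v * Real.log x| ≤ 1 / 10 ^ 8 := by
      have e1 : (c : ℝ) / 10 ^ 15 * (z / 10 ^ 15) - sqLead v * Real.log x
          = c / 10 ^ 15 * (z / 10 ^ 15 - Real.log x) + (c / 10 ^ 15 - sqLead v) * Real.log x := by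
        ring
      rw [e1]
      refine (abs_add_le _ _).trans ?_
      rw [abs_mul, abs_mul, abs_div, abs_of_pos (by norm_num : (0 : ℝ) < 10 ^ 15),
        abs_of_nonneg hlx0]
      have h9 : |(c : ℝ)| / 10 ^ 15 ≤ 1 := by rw [div_le_one (by norm_num)]; exact hc1
      calc |(c : ℝ)| / 10 ^ 15 * |(z : ℝ) / 10 ^ 15 - Real.log x|
            + |(c : ℝ) / 10 ^ 15 - sqLead v| * Real.log x
          ≤ 1 * (1 / 10 ^ 9) + 1 / 10 ^ 9 * 9 := by gcongr
        _ ≤ 1 / 10 ^ 8 := by norm_num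
    have h8 : |sqSum v X - (sqLead v * Real.log x + sqConst v) - e| ≤ 12 / 10 ^ 7 := by
      have e1 : sqSum v X = ∑ m ∈ Ioc 0 n, sqc v m / (m : ℝ) := rfl
      rw [e1]
      have e2 : e = t.a / 10 ^ 15 - (c / 10 ^ 15 * (z / 10 ^ 15) + b / 10 ^ 15) := by
        rw [he]; ring
      rw [e2]
      rw [abs_le] at *
      constructor <;> linarith
    have h9 : |sqSum v X - (sqLead v * Real.log x + sqConst v)| ≤ |e| + 12 / 10 ^ 7 := by
      have := abs_sub_abs_le_abs_sub (sqSum v X - (sqLead v * Real.log x + sqConst v)) e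
      linarith
    calc √((n : ℝ) + 1) * |sqSum v X - (sqLead v * Real.log x + sqConst v)|
        ≤ √((n : ℝ) + 1) * (|e| + 12 / 10 ^ 7) := by gcongr
      _ ≤ τ + 30 * (12 / 10 ^ 7) := by rw [mul_add]; gcongr
      _ ≤ _ := by norm_num
  have k1 := key t.l n hnr1 (by linarith) (by
    rw [abs_le] at *; constructor <;> linarith) h4.1
  have k2 := key l (n + 1) (by linarith) le_rfl (by
    rw [abs_le] at *; constructor <;> linarith) h4.2
  have hT : |sqErr v X| ≤ max |sqSum v X - (sqLead v * Real.log n + sqConst v)|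
      |sqSum v X - (sqLead v * Real.log (n + 1) + sqConst v)| := by
    have l1 := Real.log_le_log (by linarith) hnle
    have l2 := Real.log_le_log (by linarith) hnlt.le
    have e : ∀ x, sqSum v X - (sqLead v * x + sqConst v)
        = -sqLead v * x + (sqSum v X - sqConst v) := fun x => by ring
    rw [sqErr, e, e, e]
    exact abs_affine_le_max l1 l2
  calc √X * |sqErr v X| ≤ √((n : ℝ) + 1) * max |sqSum v X - (sqLead v * Real.log n + sqConst v)|
        |sqSum v X - (sqLead v * Real.log (n + 1) + sqConst v)| := by gcongr
    _ ≤ τ + 4 / 10 ^ 5 := by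
        rw [mul_max_of_nonneg _ _ hsq.le]
        exact max_le k1 k2

/-! ### Scans over the range of moderate `X` -/

set_option maxRecDepth 100000 in
/-- The range `30 ≤ y < 5000`. The integers are `γ`, `mucC 1` and `mucD 1`, scaled by `10 ^ 15`, and
the checked bound is `0.415`. -/
lemma tailRecipe_one_scan : (scanBlocks (tailRecipe 1 577215664900000 607927101854000
    (-346494734700000) 29 (72 * 415 * 10 ^ 27)) 50 100 Acc.init).isSome = true := by
  decide +kernel

set_option maxRecDepth 100000 in
/-- The range `5 ≤ y < 5000`, with the bound `0.39`. -/
lemma tailRecipe_two_scan : (scanBlocks (tailRecipe 2 1270362845450000 810569469138700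
    (-274711665500000) 4 (72 * 390 * 10 ^ 27)) 50 100 Acc.init).isSome = true := by
  decide +kernel

set_option maxRecDepth 100000 in
/-- The range `2 ≤ X < 900`, with the bound `0.429`. -/
lemma sqRecipe_one_scan : (scanBlocks (sqRecipe 1 607927101854000 1043894515700000 2 900
    (429 ^ 2 * 10 ^ 54)) 30 30 Acc.init).isSome = true := by
  decide +kernel

set_option maxRecDepth 100000 in
/-- The range `1 ≤ X < 25`, with the bound `0.409`. -/
lemma sqRecipe_two_scan : (scanBlocks (sqRecipe 2 405284734569350 789570334200000 1 25
    (409 ^ 2 * 10 ^ 54)) 30 30 Acc.init).isSome = true := by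
  decide +kernel

/-! ### The tail for large `y`, and the bounds for the error term -/

/-- Evaluation of the kernel `tailKer` at the two ends of the intervals `[k, k + 1]` with
`k < k₀`; the bounds in the table are scaled by `10 ^ 6`. -/
def kerRecipe (v : ℕ) (c : List (ℕ × ℤ)) (G A B : ℤ) (k₀ : ℕ) (tbl : List ℕ) : Recipe where
  wA n _ := mollify v c n * 10 ^ 15 / (n : ℤ) ^ 2
  wB n l := mollify v c n * l / (n : ℤ) ^ 2
  wC _ _ := 0
  ok s l := Nat.beq s.n 0 || Nat.ble k₀ s.n || (decide (|A - s.a| ≤ 10 ^ 15) &&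
    (decide (|(G + 2 * s.l) * (A - s.a) - 2 * (B - s.b) * 10 ^ 15|
      ≤ ((tbl.getD (s.n - 1) 0 : ℕ) : ℤ) * 10 ^ 24)
    && decide (|(G + 2 * l) * (A - s.a) - 2 * (B - s.b) * 10 ^ 15|
      ≤ ((tbl.getD (s.n - 1) 0 : ℕ) : ℤ) * 10 ^ 24)))

lemma kerRecipe_approx {v : ℕ} {c : List (ℕ × ℤ)}
    (hE : ∀ k M, |∑ m ∈ Ioc k M, (mollify v c m : ℝ)| ≤ 2) (h1 : mollify v c 1 = 1)
    (G A B : ℤ) (k₀ : ℕ) (tbl : List ℕ) : (kerRecipe v c G A B k₀ tbl).Approx 5040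
    (fun n => (mollify v c n : ℝ) / (n : ℝ) ^ 2)
    (fun n => (mollify v c n : ℝ) * Real.log n / (n : ℝ) ^ 2) 0 := by
  intro n hn _ l hl
  refine ⟨abs_coeff_div_sq_sub_le hn rfl, abs_coeff_log_div_sq_sub_le hn rfl ?_ hl,
    by simp [kerRecipe]⟩
  rcases Nat.lt_or_ge 1 n with h | h
  · have h2 := hE (n - 1) n
    have h3 : Ioc (n - 1) n = {n} := by ext x; simp; omega
    rw [h3, sum_singleton] at h2
    have : (2 : ℝ) ≤ n := by exact_mod_cast h
    linarith
  · have : n = 1 := by omega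
    subst this
    rw [h1]; simp

/-- The summand `2` next to an entry of the table absorbs the rounding errors. -/
lemma tailKer_bound_of_scan {v : ℕ} {c : List (ℕ × ℤ)}
    (hE : ∀ k M, |∑ m ∈ Ioc k M, (mollify v c m : ℝ)| ≤ 2) (h1 : mollify v c 1 = 1)
    {G A B : ℤ} {k₀ : ℕ} {tbl : List ℕ} {g L L' : ℝ} (hg0 : 0 ≤ g) (hg2 : g ≤ 2)
    (hG : |(G : ℝ) / 10 ^ 15 - g| ≤ 6 / 10 ^ 7) (hA : |(A : ℝ) / 10 ^ 15 - L| ≤ 1 / 10 ^ 9)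
    (hB : |(B : ℝ) / 10 ^ 15 - L'| ≤ 2 / 10 ^ 7) (hk₀ : k₀ ≤ 100)
    (h : (scanBlocks (kerRecipe v c G A B k₀ tbl) 10 10 Acc.init).isSome = true)
    {k : ℕ} (hk : 0 < k) (hkk : k < k₀) :
    |tailKer (fun m => (mollify v c m : ℝ)) L L' g k k|
        ≤ ((tbl.getD (k - 1) 0 + 2 : ℕ) : ℝ) / 10 ^ 6 ∧
      |tailKer (fun m => (mollify v c m : ℝ)) L L' g k (k + 1)|
        ≤ ((tbl.getD (k - 1) 0 + 2 : ℕ) : ℝ) / 10 ^ 6 := by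
  obtain ⟨t, l, t1, t2, t3, t4⟩ := exists_of_scan (kerRecipe_approx hE h1 G A B k₀ tbl)
    (by norm_num) h (by omega : k < 10 * 10)
  have hlog := t2.log
  have ha := t2.a
  have hb := t2.b
  rw [t1] at hlog ha hb
  have hb1 : Nat.beq k 0 = false := by
    rw [Bool.eq_false_iff]; intro h'; have := Nat.eq_of_beq_eq_true h'; omega
  have hb2 : Nat.ble k₀ k = false := by
    rw [Bool.eq_false_iff]; intro h'; have := Nat.le_of_ble_eq_true h'; omega
  simp only [kerRecipe, t1, hb1, hb2, Bool.false_or, Bool.and_eq_true, decide_eq_true_eq] at t4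
  obtain ⟨t5, t6, t7⟩ := t4
  have hk1 : (1 : ℝ) ≤ k := by exact_mod_cast hk
  have hk2 : (k : ℝ) + 1 ≤ 100 := by exact_mod_cast (by omega : k + 1 ≤ 100)
  set w := L - ∑ m ∈ Ioc 0 k, (mollify v c m : ℝ) / (m : ℝ) ^ 2 with hw
  set d := L' - ∑ m ∈ Ioc 0 k, (mollify v c m : ℝ) * Real.log m / (m : ℝ) ^ 2 with hd
  set W : ℝ := (A - t.a) / 10 ^ 15 with hW
  set D : ℝ := (B - t.b) / 10 ^ 15 with hD
  have hW1 : |W| ≤ 1 := by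
    rw [hW, abs_div, abs_of_pos (by norm_num : (0 : ℝ) < 10 ^ 15), div_le_one (by norm_num)]
    exact_mod_cast t5
  have hWw : |W - w| ≤ 2 / 10 ^ 9 := by
    rw [abs_le] at *; rw [hW, hw]; constructor <;> linarith
  have hDd : |D - d| ≤ 2001 / 10 ^ 10 := by
    rw [abs_le] at *; rw [hD, hd]; constructor <;> linarith
  have key : ∀ (z : ℤ) (x : ℝ), 1 ≤ x → x ≤ 100 →
      |(z : ℝ) / 10 ^ 15 - Real.log x| ≤ 1 / 10 ^ 9 →
      |(G + 2 * z) * (A - t.a) - 2 * (B - t.b) * 10 ^ 15|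
        ≤ ((tbl.getD (k - 1) 0 : ℕ) : ℤ) * 10 ^ 24 →
      |tailKer (fun m => (mollify v c m : ℝ)) L L' g k x|
        ≤ ((tbl.getD (k - 1) 0 + 2 : ℕ) : ℝ) / 10 ^ 6 := by
    intro z x hx1 hx2 hz hcond
    have hP : |((G : ℝ) + 2 * z) / 10 ^ 15 - (g + 2 * Real.log x)| ≤ 61 / 10 ^ 8 := by
      rw [abs_le] at *; constructor <;> linarith
    have hμ : |g + 2 * Real.log x| ≤ 20 := by
      have a1 := Real.log_nonneg hx1
      have a2 := log_le_nine (by linarith) (by linarith : x ≤ 5042)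
      rw [abs_le]; constructor <;> linarith
    have h5 := abs_mul_sub_le hP hWw hDd
    have h6 : (61 / 10 ^ 8 * |W| + |g + 2 * Real.log x| * (2 / 10 ^ 9) + 2 * (2001 / 10 ^ 10) : ℝ)
        ≤ 2 / 10 ^ 6 := by linarith
    have h8 : |((G : ℝ) + 2 * z) * (A - t.a) - 2 * (B - t.b) * 10 ^ 15|
        ≤ ((tbl.getD (k - 1) 0 : ℕ) : ℝ) * 10 ^ 24 := by exact_mod_cast hcond
    have h9 : |((G : ℝ) + 2 * z) / 10 ^ 15 * W - 2 * D|
        = |((G : ℝ) + 2 * z) * (A - t.a) - 2 * (B - t.b) * 10 ^ 15| / 10 ^ 30 := by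
      rw [← abs_of_pos (by norm_num : (0 : ℝ) < 10 ^ 30), ← abs_div, hW, hD]
      congr 1
      ring
    rw [h9] at h5
    have h10 : tailKer (fun m => (mollify v c m : ℝ)) L L' g k x
        = (g + 2 * Real.log x) * w - 2 * d := by
      rw [tailKer, hw, hd]; ring
    rw [h10]
    generalize |((G : ℝ) + 2 * z) * (A - t.a) - 2 * (B - t.b) * 10 ^ 15| = Q at h5 h8
    generalize |(g + 2 * Real.log x) * w - 2 * d| = R at h5 ⊢
    push_cast
    generalize ((tbl.getD (k - 1) 0 : ℕ) : ℝ) = N at h8 ⊢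
    have h11 : Q / 10 ^ 30 ≤ N / 10 ^ 6 := by
      rw [div_le_div_iff₀ (by norm_num) (by norm_num)]; linarith
    have h12 : (N + 2) / 10 ^ 6 = N / 10 ^ 6 + 2 / 10 ^ 6 := by ring
    rw [h12]
    exact h5.trans (add_le_add h11 h6)
  exact ⟨key t.l k hk1 (by linarith) (by rw [abs_le] at *; constructor <;> linarith) t6,
    key l (k + 1) (by linarith) hk2 (by rw [abs_le] at *; constructor <;> linarith) t7⟩

lemma sum_table_le {tbl : List ℕ} {k₀ a b : ℕ} (ha : ∑ k ∈ Ico 1 k₀, (tbl.getD (k - 1) 0 + 2) = a)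
    (hb : ∑ k ∈ Ico 1 k₀, (tbl.getD (k - 1) 0 + 2) * (k + 1) ^ 2 = b) (v : ℕ) {y : ℝ}
    (hy : 5000 ≤ y) :
    ∑ k ∈ Ico 1 k₀, ((tbl.getD (k - 1) 0 + 2 : ℕ) : ℝ) / 10 ^ 6 *
        (1 / (v : ℝ) + 3 / 2 * ((k : ℝ) + 1) ^ 2 / y)
      ≤ ((a : ℝ) / v + 3 / 10000 * (b : ℝ)) / 10 ^ 6 := by
  have ha' : ∑ k ∈ Ico 1 k₀, ((tbl.getD (k - 1) 0 + 2 : ℕ) : ℝ) = (a : ℝ) := by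
    rw [← ha, Nat.cast_sum]
  have hb' : ∑ k ∈ Ico 1 k₀, ((tbl.getD (k - 1) 0 + 2 : ℕ) : ℝ) * ((k : ℝ) + 1) ^ 2
      = (b : ℝ) := by
    rw [← hb, Nat.cast_sum]
    exact sum_congr rfl fun k _ => by push_cast; ring
  rw [← ha', ← hb', sum_div, mul_sum, ← sum_add_distrib, sum_div]
  refine sum_le_sum fun k _ => ?_
  have h1 : (3 : ℝ) / 2 * ((k : ℝ) + 1) ^ 2 / y ≤ 3 / 2 * ((k : ℝ) + 1) ^ 2 / 5000 := by gcongr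
  have h0 : (0 : ℝ) ≤ ((tbl.getD (k - 1) 0 + 2 : ℕ) : ℝ) := Nat.cast_nonneg _
  calc _ ≤ ((tbl.getD (k - 1) 0 + 2 : ℕ) : ℝ) / 10 ^ 6 *
          (1 / (v : ℝ) + 3 / 2 * ((k : ℝ) + 1) ^ 2 / 5000) := by gcongr
    _ = _ := by ring

lemma exp_neg_le {x : ℝ} (hx : 0 ≤ x) :
    Real.exp (-x) ≤ 1 / (1 + x + x ^ 2 / 2 + x ^ 3 / 6 + x ^ 4 / 24) := by
  rw [Real.exp_neg, ← one_div]
  have h := Real.sum_le_exp_of_nonneg hx 5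
  simp only [sum_range_succ, range_zero, sum_empty, zero_add, Nat.factorial] at h
  norm_num at h
  gcongr

/-- Bounds for the kernel of `mol₁` on `[k, k + 1]`, `1 ≤ k ≤ 99`, scaled by `10 ^ 6`. -/
def table₁ : List ℕ :=
  [9408, 6017, 4033, 2626, 1534, 642, 767, 1343, 1858, 5246, 565, 442, 4007, 1328, 1567, 1921,
   101, 160, 2069, 732, 689, 818, 290, 326, 360, 393, 424, 358, 340, 340, 268, 285, 301, 317,
   176, 206, 219, 229, 239, 138, 208, 133, 181, 187, 110, 125, 136, 140, 144, 96, 108, 119, 85,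
   87, 89, 102, 112, 121, 44, 123, 30, 31, 121, 128, 136, 143, 17, 18, 19, 140, 29, 29, 82, 87,
   16, 16, 16, 17, 79, 11, 11, 12, 75, 7, 7, 7, 7, 7, 68, 3, 3, 3, 4, 4, 4, 4, 59, 1, 1]

/-- Bounds for the kernel of `mol₂` on `[k, k + 1]`, `1 ≤ k ≤ 30`, scaled by `10 ^ 6`. -/
def table₂ : List ℕ :=
  [145793, 106600, 2139, 1701, 3071, 4230, 5233, 6118, 7774, 9411, 1380, 1432, 5189, 5961, 3164,
   3564, 177, 159, 2872, 3159, 1429, 1572, 304, 328, 350, 372, 1050, 1126, 46, 53]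

set_option maxRecDepth 100000 in
lemma kerRecipe_one_scan : (scanBlocks (kerRecipe 1 mol₁ 566395743200000 997553666299100
    (-5396726300000) 100 table₁) 10 10 Acc.init).isSome = true := by
  decide +kernel

set_option maxRecDepth 100000 in
lemma kerRecipe_two_scan : (scanBlocks (kerRecipe 2 mol₂ 978644852900000 885131188351700
    (-129104346700000) 31 table₂) 10 10 Acc.init).isSome = true := by
  decide +kernel

lemma sum_table₁ : ∑ k ∈ Ico 1 100, (table₁.getD (k - 1) 0 + 2) = 57182 ∧
    ∑ k ∈ Ico 1 100, (table₁.getD (k - 1) 0 + 2) * (k + 1) ^ 2 = 25710514 := by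
  decide +kernel

lemma sum_table₂ : ∑ k ∈ Ico 1 31, (table₂.getD (k - 1) 0 + 2) = 325817 ∧
    ∑ k ∈ Ico 1 31, (table₂.getD (k - 1) 0 + 2) * (k + 1) ^ 2 = 16273836 := by
  decide +kernel

lemma tailT_one_le {y : ℝ} (hy : 5000 ≤ y) : y * |tailT 1 y| ≤ 0.08271 := by
  obtain ⟨b1, b2, b3⟩ := mol₁_bounds
  have hL : 0.9975536 ≤ molSum mol₁ * zetaC 1 := by rw [abs_le] at b1; linarith
  have hg0 : 0.566 ≤ molShift 1 mol₁ := by rw [abs_le] at b3; linarith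
  have hg1 : molShift 1 mol₁ ≤ 0.5664 := by rw [abs_le] at b3; linarith
  have hker := fun k (h1 : 0 < k) (h2 : k < 100) => tailKer_bound_of_scan abs_sum_mol₁_le
    (L := molSum mol₁ * zetaC 1) (L' := molLog mol₁ * zetaC 1 + molSum mol₁ * zetaLog 1)
    (g := molShift 1 mol₁)
    (by decide +kernel) (by linarith) (by linarith)
    (by rw [abs_sub_comm] at b3; refine le_trans (le_of_eq ?_) b3; norm_num [abs_sub_comm])
    (by rw [abs_sub_comm] at b1; refine (le_trans (le_of_eq ?_) b1).trans (by norm_num); norm_num)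
    (by rw [abs_sub_comm] at b2; refine le_trans (le_of_eq ?_) b2; norm_num) le_rfl
    kerRecipe_one_scan h1 h2
  have h := abs_tailT_le (Or.inl rfl) (J := 210) (k₀ := 100) (L := molSum mol₁ * zetaC 1)
    (B := 2 * (molShift 1 mol₁ + 2 * Real.exp (-1 - molShift 1 mol₁)))
    (b := fun k => ((table₁.getD (k - 1) 0 + 2 : ℕ) : ℝ) / 10 ^ 6) (y := y)
    (by linarith) rfl (fun n hn => sum_muc_mul_mollify 1 mol₁ hn)
    (fun n hn => by
      simp only [mol₁, List.map_cons, List.map_nil, List.sum_cons, List.sum_nil]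
      repeat rw [if_neg (by omega)]
      norm_num)
    (fun u hu => abs_tailKer_le (by linarith : (0 : ℝ) ≤ molShift 1 mol₁)
      (tendsto_sum_mollify 1 mol₁_pos) (tendsto_sum_mollify_log 1 mol₁_pos) abs_sum_mol₁_le hu)
    (by norm_num) (fun k h1 h2 => (hker k h1 h2).1) (fun k h1 h2 => (hker k h1 h2).2)
    (by linarith) (by push_cast; linarith) (by push_cast; linarith)
  have hs := sum_table_le sum_table₁.1 sum_table₁.2 1 hy
  have he : Real.exp (-1 - molShift 1 mol₁) ≤ 0.2137 := by
    rw [show -1 - molShift 1 mol₁ = -(1 + molShift 1 mol₁) by ring]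
    refine (Real.exp_le_exp.2 (by linarith : -(1 + molShift 1 mol₁) ≤ -1.566)).trans ?_
    exact (exp_neg_le (by norm_num)).trans (by norm_num)
  have hq : sqCount 1 (y / (100 : ℕ)) / y ≤ 0.0072 := by
    have hy0 : 0 < y := by linarith
    rw [div_le_iff₀ hy0]
    refine (sqCount_one_le (by positivity)).trans ?_
    push_cast; linarith
  have hq0 : 0 ≤ sqCount 1 (y / (100 : ℕ)) / y :=
    div_nonneg (sum_nonneg fun _ _ => sqc_nonneg _ _) (by linarith)
  have hB : 2 * (molShift 1 mol₁ + 2 * Real.exp (-1 - molShift 1 mol₁)) ≤ 1.988 := by linarith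
  have hT : 0 ≤ y * |tailT 1 y| := by positivity
  have h1 : 2 * (molShift 1 mol₁ + 2 * Real.exp (-1 - molShift 1 mol₁)) *
      (sqCount 1 (y / (100 : ℕ)) / y) ≤ 1.988 * 0.0072 :=
    mul_le_mul hB hq hq0 (by norm_num)
  have h2 : 0.9975536 * (y * |tailT 1 y|) ≤ molSum mol₁ * zetaC 1 * (y * |tailT 1 y|) := by gcongr
  have h3 := h2.trans (h.trans (add_le_add hs h1))
  norm_num at h3 ⊢
  linarith

lemma tailT_two_le {y : ℝ} (hy : 5000 ≤ y) : y * |tailT 2 y| ≤ 0.26 := by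
  obtain ⟨b1, b2, b3⟩ := mol₂_bounds
  have hL : 0.8851311 ≤ molSum mol₂ * zetaC 2 := by rw [abs_le] at b1; linarith
  have hg0 : 0.978 ≤ molShift 2 mol₂ := by rw [abs_le] at b3; linarith
  have hg1 : molShift 2 mol₂ ≤ 0.9787 := by rw [abs_le] at b3; linarith
  have hker := fun k (h1 : 0 < k) (h2 : k < 31) => tailKer_bound_of_scan abs_sum_mol₂_le
    (L := molSum mol₂ * zetaC 2) (L' := molLog mol₂ * zetaC 2 + molSum mol₂ * zetaLog 2)
    (g := molShift 2 mol₂)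
    (by decide +kernel) (by linarith) (by linarith)
    (by rw [abs_sub_comm] at b3; refine le_trans (le_of_eq ?_) b3; norm_num [abs_sub_comm])
    (by rw [abs_sub_comm] at b1; refine (le_trans (le_of_eq ?_) b1).trans (by norm_num); norm_num)
    (by rw [abs_sub_comm] at b2; refine le_trans (le_of_eq ?_) b2; norm_num) (by norm_num)
    kerRecipe_two_scan h1 h2
  have h := abs_tailT_le (Or.inr rfl) (J := 105) (k₀ := 31) (L := molSum mol₂ * zetaC 2)
    (B := 2 * (molShift 2 mol₂ + 2 * Real.exp (-1 - molShift 2 mol₂)))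
    (b := fun k => ((table₂.getD (k - 1) 0 + 2 : ℕ) : ℝ) / 10 ^ 6) (y := y)
    (by linarith) rfl (fun n hn => sum_muc_mul_mollify 2 mol₂ hn)
    (fun n hn => by
      simp only [mol₂, List.map_cons, List.map_nil, List.sum_cons, List.sum_nil]
      repeat rw [if_neg (by omega)]
      norm_num)
    (fun u hu => abs_tailKer_le (by linarith : (0 : ℝ) ≤ molShift 2 mol₂)
      (tendsto_sum_mollify 2 mol₂_pos) (tendsto_sum_mollify_log 2 mol₂_pos) abs_sum_mol₂_le hu)
    (by norm_num) (fun k h1 h2 => (hker k h1 h2).1) (fun k h1 h2 => (hker k h1 h2).2)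
    (by linarith) (by push_cast; linarith) (by push_cast; linarith)
  have hs := sum_table_le sum_table₂.1 sum_table₂.2 2 hy
  have he : Real.exp (-1 - molShift 2 mol₂) ≤ 0.1459 := by
    rw [show -1 - molShift 2 mol₂ = -(1 + molShift 2 mol₂) by ring]
    refine (Real.exp_le_exp.2 (by linarith : -(1 + molShift 2 mol₂) ≤ -1.978)).trans ?_
    exact (exp_neg_le (by norm_num)).trans (by norm_num)
  have hq : sqCount 2 (y / (31 : ℕ)) / y ≤ 0.0148 := by
    have hy0 : 0 < y := by linarith
    rw [div_le_iff₀ hy0]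
    refine (sqCount_two_le (by positivity)).trans ?_
    push_cast; linarith
  have hq0 : 0 ≤ sqCount 2 (y / (31 : ℕ)) / y :=
    div_nonneg (sum_nonneg fun _ _ => sqc_nonneg _ _) (by linarith)
  have hB : 2 * (molShift 2 mol₂ + 2 * Real.exp (-1 - molShift 2 mol₂)) ≤ 2.542 := by linarith
  have hT : 0 ≤ y * |tailT 2 y| := by positivity
  have h1 : 2 * (molShift 2 mol₂ + 2 * Real.exp (-1 - molShift 2 mol₂)) *
      (sqCount 2 (y / (31 : ℕ)) / y) ≤ 2.542 * 0.0148 :=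
    mul_le_mul hB hq hq0 (by norm_num)
  have h2 : 0.8851311 * (y * |tailT 2 y|) ≤ molSum mol₂ * zetaC 2 * (y * |tailT 2 y|) := by gcongr
  have h3 := h2.trans (h.trans (add_le_add hs h1))
  norm_num at h3 ⊢
  linarith

/-- The error term for all squarefree integers: a scan of the values for `X < 900`, a scan of the tail
for `√X < 5000`, and the mollified tail beyond. The inequality fails for `X` slightly below `2`. -/
lemma sqErr_one_le {X : ℝ} (hX : 2 ≤ X) : √X * |sqErr 1 X| ≤ 0.43 := by
  have hc := mucC_mucD_one_bounds
  rcases lt_or_ge X 900 with h | h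
  · have hb := sqConst_one_bounds
    have := sqErr_bound_of_scan (v := 1) (τ := 0.429) (by norm_num) (by norm_num)
      (by have := hc.1; rw [sqLead]; rw [abs_le] at *; norm_num at *; constructor <;> linarith)
      (by rw [abs_le] at *; norm_num at *; constructor <;> linarith)
      (by norm_num) sqRecipe_one_scan (by norm_num) (by norm_num)
      (by exact_mod_cast hX) (by exact_mod_cast h)
    linarith
  · set y := √X with hy
    have hX0 : 0 ≤ X := by linarith
    have hyX : y ^ 2 = X := Real.sq_sqrt hX0
    have hy30 : 30 ≤ y := by rw [hy]; apply Real.le_sqrt_of_sq_le; linarith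
    have h1 := abs_sqErr_le (v := 1) (Or.inl rfl) (by linarith : 0 < y)
    rw [hyX] at h1
    refine h1.trans ?_
    rcases lt_or_ge y 5000 with h5 | h5
    · have hγ := const_bounds.1
      have := tail_bound_of_scan (v := 1) (Or.inl rfl)
        (by rw [abs_le] at *; norm_num at *; constructor <;> linarith)
        (by have := hc.1; rw [abs_le] at *; norm_num at *; constructor <;> linarith)
        (by have := hc.2; rw [abs_le] at *; norm_num at *; constructor <;> linarith)
        tailRecipe_one_scan (by norm_num; linarith) h5
      refine this.trans ?_
      norm_num
    · have hT := tailT_one_le h5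
      have hq : sqCount 1 y / y ≤ 0.6408 := by
        rw [div_le_iff₀ (by linarith)]
        refine (sqCount_one_le (by linarith)).trans ?_
        linarith
      rw [mul_div_assoc]
      norm_num at *
      linarith

/-- The error term for the odd squarefree integers, by the same three methods. The constant is just
below `0.12 * (2 + √2)`. -/
lemma sqErr_two_le {X : ℝ} (hX : 1 ≤ X) : √X * |sqErr 2 X| ≤ 0.4097 := by
  have hc := mucC_mucD_two_bounds
  rcases lt_or_ge X 25 with h | h
  · have hb := sqConst_two_bounds
    have := sqErr_bound_of_scan (v := 2) (τ := 0.409) (by norm_num) (by norm_num)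
      (by have := hc.1; rw [sqLead]; rw [abs_le] at *; norm_num at *; constructor <;> linarith)
      (by rw [abs_le] at *; norm_num at *; constructor <;> linarith)
      (by norm_num) sqRecipe_two_scan (by norm_num) (by norm_num)
      (by exact_mod_cast hX) (by exact_mod_cast h)
    linarith
  · set y := √X with hy
    have hX0 : 0 ≤ X := by linarith
    have hyX : y ^ 2 = X := Real.sq_sqrt hX0
    have hy30 : 5 ≤ y := by rw [hy]; apply Real.le_sqrt_of_sq_le; linarith
    have h1 := abs_sqErr_le (v := 2) (Or.inr rfl) (by linarith : 0 < y)
    rw [hyX] at h1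
    refine h1.trans ?_
    rcases lt_or_ge y 5000 with h5 | h5
    · have hγ := const_bounds.1
      have hl2 := abs_log_two_sub_le
      have := tail_bound_of_scan (v := 2) (Or.inr rfl)
        (by rw [abs_le] at *; norm_num at *; constructor <;> linarith)
        (by have := hc.1; rw [abs_le] at *; norm_num at *; constructor <;> linarith)
        (by have := hc.2; rw [abs_le] at *; norm_num at *; constructor <;> linarith)
        tailRecipe_two_scan (by norm_num; linarith) h5
      refine this.trans ?_
      norm_num
    · have hT := tailT_two_le h5
      have hq : sqCount 2 y / y ≤ 0.4449 := by
        rw [div_le_iff₀ (by linarith)]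
        refine (sqCount_two_le (by linarith)).trans ?_
        linarith
      rw [mul_div_assoc]
      norm_num at *
      linarith

/-! ### Dirichlet series of multiplicative functions -/

/-- The multiplicative function with the value `a p k` at the prime power `p ^ k`, `k ≥ 1`; its
value at `0` is `0`. -/
def mulExt (a : ℕ → ℕ → ℂ) (n : ℕ) : ℂ := if n = 0 then 0 else n.factorization.prod a

lemma mulExt_zero (a : ℕ → ℕ → ℂ) : mulExt a 0 = 0 := by simp [mulExt]

lemma mulExt_one (a : ℕ → ℕ → ℂ) : mulExt a 1 = 1 := by simp [mulExt]

lemma mulExt_mul (a : ℕ → ℕ → ℂ) {m n : ℕ} (h : m.Coprime n) :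
    mulExt a (m * n) = mulExt a m * mulExt a n := by
  rcases Nat.eq_zero_or_pos m with rfl | hm
  · simp [mulExt]
  rcases Nat.eq_zero_or_pos n with rfl | hn
  · simp [mulExt]
  simp only [mulExt, mul_eq_zero, hm.ne', hn.ne', or_self, if_false]
  rw [Nat.factorization_mul_of_coprime h, Finsupp.prod_add_index_of_disjoint]
  simpa using h.disjoint_primeFactors

lemma mulExt_prime_pow (a : ℕ → ℕ → ℂ) {p k : ℕ} (hp : p.Prime) (hk : k ≠ 0) :
    mulExt a (p ^ k) = a p k := by
  rw [mulExt, if_neg (pow_ne_zero _ hp.ne_zero), hp.factorization_pow, Finsupp.prod,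
    Finsupp.support_single p hk]
  simp

/-- The sums over the smooth numbers are finite products of local sums, so they stay bounded. -/
lemma summable_of_prime_powers {f : ℕ → ℝ} (hf0 : f 0 = 0) (hf1 : f 1 = 1)
    (hmul : ∀ {m n : ℕ}, m.Coprime n → f (m * n) = f m * f n) (hnn : ∀ n, 0 ≤ f n)
    (hk : ∀ {p : ℕ}, p.Prime → Summable fun k : ℕ => f (p ^ (k + 1)))
    (hp : Summable fun p : Nat.Primes => ∑' k : ℕ, f ((p : ℕ) ^ (k + 1))) : Summable f := by
  classical
  refine summable_of_sum_le hnn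
    (c := Real.exp (∑' p : Nat.Primes, ∑' k : ℕ, f ((p : ℕ) ^ (k + 1)))) fun u => ?_
  have hk' : ∀ {p : ℕ}, p.Prime → Summable fun k : ℕ => ‖f (p ^ k)‖ := fun {p} h => by
    have h1 := (summable_nat_add_iff (f := fun k => f (p ^ k)) 1).1 (hk h)
    simpa [abs_of_nonneg (hnn _)] using h1
  let s := range (u.sup id + 1)
  have h1 := (EulerProduct.summable_and_hasSum_factoredNumbers_prod_filter_prime_tsum hf1 hmul
    hk' s).2
  have h2 : ∑ n ∈ u, f n ≤ ∏ p ∈ s with p.Prime, ∑' n : ℕ, f (p ^ n) := by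
    have h3 := sum_le_hasSum (u.subtype (· ∈ Nat.factoredNumbers s)) (fun _ _ => hnn _) h1
    rw [sum_subtype_eq_sum_filter (f := f)] at h3
    refine le_trans (le_of_eq ?_) h3
    rw [sum_filter]
    refine sum_congr rfl fun n hn => ?_
    split_ifs with h
    · rfl
    · rcases Nat.eq_zero_or_pos n with rfl | hn0
      · exact hf0
      · refine absurd (Nat.mem_factoredNumbers.2 ⟨hn0.ne', fun p hp => ?_⟩) h
        have h4 : n ≤ u.sup id := le_sup (f := id) hn
        have h5 := Nat.le_of_dvd hn0 (Nat.dvd_of_mem_primeFactorsList hp)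
        exact mem_range.2 (by omega)
  have h0 : ∀ p : ℕ, 0 ≤ ∑' k : ℕ, f (p ^ (k + 1)) := fun p => tsum_nonneg fun _ => hnn _
  have h3 : ∏ p ∈ s with p.Prime, ∑' n : ℕ, f (p ^ n)
      ≤ Real.exp (∑ p ∈ s with p.Prime, ∑' k : ℕ, f (p ^ (k + 1))) := by
    rw [Real.exp_sum]
    refine prod_le_prod (fun p _ => tsum_nonneg fun _ => hnn _) fun p hp => ?_
    rw [((hk' (mem_filter.1 hp).2).of_norm).tsum_eq_zero_add, pow_zero, hf1, add_comm]
    exact Real.add_one_le_exp _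
  refine (h2.trans h3).trans (Real.exp_le_exp.2 ?_)
  let T : Finset Nat.Primes := s.subtype Nat.Prime
  have h4 : ∑ p ∈ T, ∑' k : ℕ, f ((p : ℕ) ^ (k + 1))
      ≤ ∑' p : Nat.Primes, ∑' k : ℕ, f ((p : ℕ) ^ (k + 1)) := hp.sum_le_tsum T fun p _ => h0 p
  refine le_trans (le_of_eq ?_) h4
  exact (sum_subtype_eq_sum_filter (s := s) (p := Nat.Prime)
    (f := fun p => ∑' k : ℕ, f (p ^ (k + 1)))).symm

lemma natCast_pow_cpow (p k : ℕ) (s : ℂ) : ((p ^ k : ℕ) : ℂ) ^ s = ((p : ℂ) ^ s) ^ k := by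
  induction k with
  | zero => simp
  | succ k ih => rw [pow_succ, Nat.cast_mul, Complex.natCast_mul_natCast_cpow, ih, pow_succ]

lemma term_mulExt_mul (a : ℕ → ℕ → ℂ) (s : ℂ) {m n : ℕ} (h : m.Coprime n) :
    LSeries.term (mulExt a) s (m * n)
      = LSeries.term (mulExt a) s m * LSeries.term (mulExt a) s n := by
  rcases Nat.eq_zero_or_pos m with rfl | hm
  · simp
  rcases Nat.eq_zero_or_pos n with rfl | hn
  · simp
  rw [LSeries.term_of_ne_zero (by positivity), LSeries.term_of_ne_zero hm.ne',
    LSeries.term_of_ne_zero hn.ne', mulExt_mul a h, Nat.cast_mul,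
    Complex.natCast_mul_natCast_cpow, mul_div_mul_comm]

lemma term_mulExt_prime_pow (a : ℕ → ℕ → ℂ) (s : ℂ) {p k : ℕ} (hp : p.Prime) :
    LSeries.term (mulExt a) s (p ^ (k + 1)) = a p (k + 1) / ((p : ℂ) ^ s) ^ (k + 1) := by
  rw [LSeries.term_of_ne_zero (pow_ne_zero _ hp.ne_zero), mulExt_prime_pow a hp (by omega),
    natCast_pow_cpow]

lemma norm_term_mulExt_prime_pow (a : ℕ → ℕ → ℂ) (s : ℂ) {p k : ℕ} (hp : p.Prime) :
    ‖LSeries.term (mulExt a) s (p ^ (k + 1))‖ = ‖a p (k + 1)‖ / ((p : ℝ) ^ s.re) ^ (k + 1) := by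
  rw [term_mulExt_prime_pow a s hp, norm_div, norm_pow,
    Complex.norm_natCast_cpow_of_pos hp.pos]

lemma term_mulExt_one (a : ℕ → ℕ → ℂ) (s : ℂ) : LSeries.term (mulExt a) s 1 = 1 := by
  rw [LSeries.term_of_ne_zero one_ne_zero, mulExt_one]; simp

lemma lseriesSummable_mulExt {a : ℕ → ℕ → ℂ} {s : ℂ}
    (hk : ∀ {p : ℕ}, p.Prime → Summable fun k : ℕ => ‖a p (k + 1)‖ / ((p : ℝ) ^ s.re) ^ (k + 1))
    (hp : Summable fun p : Nat.Primes =>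
      ∑' k : ℕ, ‖a p (k + 1)‖ / (((p : ℕ) : ℝ) ^ s.re) ^ (k + 1)) :
    LSeriesSummable (mulExt a) s := by
  refine Summable.of_norm (summable_of_prime_powers (by simp) ?_ ?_ (fun _ => norm_nonneg _) ?_ ?_)
  · rw [term_mulExt_one, norm_one]
  · intro m n h; rw [term_mulExt_mul a s h, norm_mul]
  · intro p h; simpa only [norm_term_mulExt_prime_pow a s h] using hk h
  · simpa only [fun p : Nat.Primes => fun k : ℕ =>
      norm_term_mulExt_prime_pow a s (k := k) p.2] using hp

/-- The Euler product of an absolutely convergent Dirichlet series. -/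
lemma hasProd_mulExt {a : ℕ → ℕ → ℂ} {s : ℂ} (h : LSeriesSummable (mulExt a) s) :
    HasProd (fun p : Nat.Primes => 1 + ∑' k : ℕ, a p (k + 1) / (((p : ℕ) : ℂ) ^ s) ^ (k + 1))
      (LSeries (mulExt a) s) := by
  have h1 := EulerProduct.eulerProduct_hasProd (term_mulExt_one a s)
    (fun {m n} h => term_mulExt_mul a s h) h.norm (by simp)
  have h2 : ∀ p : Nat.Primes, ∑' e : ℕ, LSeries.term (mulExt a) s ((p : ℕ) ^ e)
      = 1 + ∑' k : ℕ, a p (k + 1) / (((p : ℕ) : ℂ) ^ s) ^ (k + 1) := by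
    intro p
    have h3 : Summable fun e : ℕ => LSeries.term (mulExt a) s ((p : ℕ) ^ e) :=
      Summable.comp_injective h (Nat.pow_right_injective p.2.one_lt)
    rw [h3.tsum_eq_zero_add, pow_zero, term_mulExt_one]
    simp only [term_mulExt_prime_pow a s p.2]
  simp_rw [h2] at h1
  exact h1

lemma hasProd_norm_mulExt {a : ℕ → ℕ → ℂ} {s : ℂ} (h : LSeriesSummable (mulExt a) s) :
    HasProd (fun p : Nat.Primes =>
        1 + ∑' k : ℕ, ‖a p (k + 1)‖ / (((p : ℕ) : ℝ) ^ s.re) ^ (k + 1))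
      (∑' n, ‖LSeries.term (mulExt a) s n‖) := by
  have h1 := EulerProduct.eulerProduct_hasProd (f := fun n => ‖LSeries.term (mulExt a) s n‖)
    (by rw [term_mulExt_one, norm_one])
    (fun {m n} h => by rw [term_mulExt_mul a s h, norm_mul]) h.norm.norm (by simp)
  have h2 : ∀ p : Nat.Primes, ∑' e : ℕ, ‖LSeries.term (mulExt a) s ((p : ℕ) ^ e)‖
      = 1 + ∑' k : ℕ, ‖a p (k + 1)‖ / (((p : ℕ) : ℝ) ^ s.re) ^ (k + 1) := by
    intro p
    have h3 : Summable fun e : ℕ => ‖LSeries.term (mulExt a) s ((p : ℕ) ^ e)‖ :=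
      h.norm.comp_injective (Nat.pow_right_injective p.2.one_lt)
    rw [h3.tsum_eq_zero_add, pow_zero, term_mulExt_one, norm_one]
    simp only [norm_term_mulExt_prime_pow a s p.2]
  simpa only [h2] using h1

/-! ### The Euler products attached to the values at the primes -/

lemma summable_primes_rpow_inv {σ : ℝ} (hσ : 1 < σ) :
    Summable fun p : Nat.Primes => 1 / ((p : ℕ) : ℝ) ^ σ := by
  have h := Nat.Primes.summable_rpow.2 (by linarith : -σ < -1)
  refine h.congr fun p => ?_
  rw [Real.rpow_neg (Nat.cast_nonneg _), one_div]

lemma sqrt_le_rpow {p : ℕ} (hp : p.Prime) {σ : ℝ} (hσ : 1 / 2 ≤ σ) : √(p : ℝ) ≤ (p : ℝ) ^ σ := by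
  rw [Real.sqrt_eq_rpow]
  exact Real.rpow_le_rpow_of_exponent_le (by exact_mod_cast hp.one_lt.le) hσ

lemma one_lt_sqrt_prime {p : ℕ} (hp : p.Prime) : 1 < √(p : ℝ) := by
  rw [Real.lt_sqrt (by norm_num)]
  have := hp.one_lt
  have : (1 : ℝ) < p := by exact_mod_cast this
  simpa using this

lemma sqrt_prime_sub_one_ge {p : ℕ} (hp : p.Prime) : √(p : ℝ) / 4 ≤ √(p : ℝ) - 1 := by
  have h2 : (4 / 3 : ℝ) ≤ √(p : ℝ) := by
    apply Real.le_sqrt_of_sq_le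
    have : (2 : ℝ) ≤ p := by exact_mod_cast hp.two_le
    linarith
  linarith

/-- The values at prime powers of the multiplicative function `g` with
`μ ^ 2 F = g * u`, where `u` is the indicator function of the squarefree integers, modified at the
prime `2`. -/
def gPow (F : ℕ → ℂ) (p k : ℕ) : ℂ := if p = 2 then 0 else (-1) ^ (k - 1) * (F p - 1)

/-- The values at prime powers of the multiplicative function `h`. -/
def hPow (F : ℕ → ℂ) (q p k : ℕ) : ℂ :=
  if p ∣ q then 0 else if k = 1 then F p - 1 else if k = 2 then -F p else 0

lemma norm_gPow (F : ℕ → ℂ) (p k : ℕ) : ‖gPow F p k‖ = if p = 2 then 0 else ‖F p - 1‖ := by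
  unfold gPow
  split_ifs <;> simp

lemma hasSum_inv_pow_succ {t : ℝ} (ht : 1 < t) (c : ℝ) :
    HasSum (fun k : ℕ => c / t ^ (k + 1)) (c / (t - 1)) := by
  have h := (hasSum_geometric_of_lt_one (r := t⁻¹) (by positivity)
    (inv_lt_one_of_one_lt₀ ht)).mul_left (c / t)
  have h0 : t ≠ 0 := by positivity
  have h1 : t - 1 ≠ 0 := by linarith
  convert! h using 1
  · ext k; rw [inv_pow]; field_simp; ring
  · field_simp

lemma hasSum_norm_gPow (F : ℕ → ℂ) {p : ℕ} {t : ℝ} (ht : 1 < t) :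
    HasSum (fun k : ℕ => ‖gPow F p (k + 1)‖ / t ^ (k + 1))
      (if p = 2 then 0 else ‖F p - 1‖ / (t - 1)) := by
  simp only [norm_gPow]
  split_ifs
  · simp
  · exact hasSum_inv_pow_succ ht _

lemma tsum_gPow (F : ℕ → ℂ) {p : ℕ} {y : ℂ} (hy : 1 < ‖y‖) :
    ∑' k : ℕ, gPow F p (k + 1) / y ^ (k + 1) = if p = 2 then 0 else (F p - 1) / (y + 1) := by
  unfold gPow
  split_ifs
  · simp
  · have hy0 : y ≠ 0 := by rintro rfl; simp at hy; linarith
    have hy1 : y + 1 ≠ 0 := by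
      intro h
      rw [eq_neg_of_add_eq_zero_left h] at hy
      simp at hy
    have h := (hasSum_geometric_of_norm_lt_one (ξ := -y⁻¹)
      (by rw [norm_neg, norm_inv]; exact inv_lt_one_of_one_lt₀ hy)).mul_left ((F p - 1) / y)
    have h1 : 1 - -y⁻¹ = (y + 1) / y := by field_simp; ring
    rw [← h.tsum_eq.trans (show (F p - 1) / y * (1 - -y⁻¹)⁻¹ = (F p - 1) / (y + 1) by
      rw [h1]; field_simp)]
    refine tsum_congr fun k => ?_
    rw [Nat.add_sub_cancel, neg_pow y⁻¹, inv_pow, pow_succ]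
    field_simp

lemma lseriesSummable_gPow {F : ℕ → ℂ}
    (hF : Summable fun p : Nat.Primes => ‖F p - 1‖ / √((p : ℕ) : ℝ)) {s : ℂ}
    (hs : 1 / 2 ≤ s.re) : LSeriesSummable (mulExt (gPow F)) s := by
  have ht : ∀ {p : ℕ}, p.Prime → 1 < (p : ℝ) ^ s.re := fun hp =>
    (one_lt_sqrt_prime hp).trans_le (sqrt_le_rpow hp hs)
  refine lseriesSummable_mulExt (fun {p} hp => (hasSum_norm_gPow F (ht hp)).summable) ?_
  simp_rw [fun p : Nat.Primes => (hasSum_norm_gPow F (p := p) (ht p.2)).tsum_eq]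
  refine (hF.mul_left 4).of_nonneg_of_le (fun p => ?_) fun p => ?_
  · split_ifs
    · rfl
    · have := ht p.2
      exact div_nonneg (norm_nonneg _) (by linarith)
  · have h1 := sqrt_prime_sub_one_ge p.2
    have h2 := sqrt_le_rpow p.2 hs
    have h3 := one_lt_sqrt_prime p.2
    split_ifs
    · positivity
    · calc ‖F p - 1‖ / (((p : ℕ) : ℝ) ^ s.re - 1) ≤ ‖F p - 1‖ / (√((p : ℕ) : ℝ) / 4) := by
            gcongr; linarith
        _ = _ := by field_simp

/-- The Euler product of the series `∑ g(d) / d ^ s`. -/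
lemma hasProd_gPow {F : ℕ → ℂ}
    (hF : Summable fun p : Nat.Primes => ‖F p - 1‖ / √((p : ℕ) : ℝ)) {s : ℂ}
    (hs : 1 / 2 ≤ s.re) :
    HasProd (fun p : Nat.Primes =>
        if (p : ℕ) = 2 then 1 else 1 + (F p - 1) / (((p : ℕ) : ℂ) ^ s + 1))
      (LSeries (mulExt (gPow F)) s) := by
  have h := hasProd_mulExt (lseriesSummable_gPow hF hs)
  have h2 : ∀ p : Nat.Primes, 1 + ∑' k : ℕ, gPow F p (k + 1) / (((p : ℕ) : ℂ) ^ s) ^ (k + 1)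
      = if (p : ℕ) = 2 then 1 else 1 + (F p - 1) / (((p : ℕ) : ℂ) ^ s + 1) := by
    intro p
    rw [tsum_gPow F]
    · split_ifs <;> simp
    · rw [Complex.norm_natCast_cpow_of_pos p.2.pos]
      exact (one_lt_sqrt_prime p.2).trans_le (sqrt_le_rpow p.2 hs)
  simp_rw [h2] at h
  exact h

/-- The Euler product of the series `∑ |g(d)| / √d`. -/
lemma hasProd_norm_gPow {F : ℕ → ℂ}
    (hF : Summable fun p : Nat.Primes => ‖F p - 1‖ / √((p : ℕ) : ℝ)) :
    HasProd (fun p : Nat.Primes =>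
        if (p : ℕ) = 2 then 1 else 1 + ‖F p - 1‖ / (√((p : ℕ) : ℝ) - 1))
      (∑' n, ‖LSeries.term (mulExt (gPow F)) (1 / 2) n‖) := by
  have hre : (1 / 2 : ℂ).re = 1 / 2 := by norm_num
  have h := hasProd_norm_mulExt (lseriesSummable_gPow hF (s := 1 / 2) hre.ge)
  rw [hre] at h
  have h2 : ∀ p : Nat.Primes,
      1 + ∑' k : ℕ, ‖gPow F p (k + 1)‖ / (((p : ℕ) : ℝ) ^ (1 / 2 : ℝ)) ^ (k + 1)
      = if (p : ℕ) = 2 then 1 else 1 + ‖F p - 1‖ / (√((p : ℕ) : ℝ) - 1) := by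
    intro p
    rw [← Real.sqrt_eq_rpow, (hasSum_norm_gPow F (one_lt_sqrt_prime p.2)).tsum_eq]
    split_ifs <;> simp
  simp_rw [h2] at h
  exact h

/-- The factor at `p` of the Euler product of `∑ h(d) / d ^ s`. -/
def hFac (F : ℕ → ℂ) (q : ℕ) (s : ℂ) (p : ℕ) : ℂ :=
  if p ∣ q then 1 else (1 - 1 / (p : ℂ) ^ s) * (1 + F p / (p : ℂ) ^ s)

lemma hasSum_hPow (F : ℕ → ℂ) (q : ℕ) {p : ℕ} {y : ℂ} (hy : y ≠ 0) :
    HasSum (fun k : ℕ => hPow F q p (k + 1) / y ^ (k + 1))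
      ((if p ∣ q then 1 else (1 - 1 / y) * (1 + F p / y)) - 1) := by
  have h : ∀ k ∉ range 2, hPow F q p (k + 1) / y ^ (k + 1) = 0 := by
    intro k hk
    rw [mem_range] at hk
    rw [hPow, if_neg (by omega : ¬ k + 1 = 1), if_neg (by omega : ¬ k + 1 = 2)]
    simp
  have h' := hasSum_sum_of_ne_finset_zero (L := SummationFilter.unconditional ℕ) h
  convert! h' using 1
  simp only [sum_range_succ, range_zero, sum_empty, hPow]
  split_ifs
  · simp
  · simp_all
  · field_simp
    simp
    ring

lemma hasSum_norm_hPow (F : ℕ → ℂ) (q : ℕ) {p : ℕ} {t : ℝ} :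
    HasSum (fun k : ℕ => ‖hPow F q p (k + 1)‖ / t ^ (k + 1))
      (if p ∣ q then 0 else ‖F p - 1‖ / t + ‖F p‖ / t ^ 2) := by
  have h : ∀ k ∉ range 2, ‖hPow F q p (k + 1)‖ / t ^ (k + 1) = 0 := by
    intro k hk
    rw [mem_range] at hk
    rw [hPow, if_neg (by omega : ¬ k + 1 = 1), if_neg (by omega : ¬ k + 1 = 2)]
    simp
  have h' := hasSum_sum_of_ne_finset_zero (L := SummationFilter.unconditional ℕ) h
  convert! h' using 1
  simp only [sum_range_succ, range_zero, sum_empty, hPow]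
  split_ifs
  · simp
  · simp_all
  · simp

lemma norm_div_add_norm_div_sq_le (z : ℂ) {p : ℕ} (hp : p.Prime) {σ₀ σ : ℝ}
    (h0 : 1 / 2 ≤ σ₀) (hσ : σ₀ ≤ σ) :
    ‖z - 1‖ / (p : ℝ) ^ σ + ‖z‖ / ((p : ℝ) ^ σ) ^ 2
      ≤ 2 * (‖z - 1‖ / √(p : ℝ)) + 1 / (p : ℝ) ^ (2 * σ₀) := by
  have hp1 : (1 : ℝ) ≤ p := by exact_mod_cast hp.one_lt.le
  have h1 := one_lt_sqrt_prime hp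
  have h2 := sqrt_le_rpow hp (h0.trans hσ)
  have h3 : (p : ℝ) ^ σ₀ ≤ (p : ℝ) ^ σ := Real.rpow_le_rpow_of_exponent_le hp1 hσ
  have h4 : (p : ℝ) ^ (2 * σ₀) = ((p : ℝ) ^ σ₀) ^ 2 := by
    rw [mul_comm, Real.rpow_mul (by linarith)]; norm_cast
  have h5 : 0 < (p : ℝ) ^ σ₀ := by positivity
  have hz : ‖z‖ ≤ ‖z - 1‖ + 1 := by simpa using norm_add_le (z - 1) 1
  have e1 : ‖z - 1‖ / (p : ℝ) ^ σ ≤ ‖z - 1‖ / √(p : ℝ) := by gcongr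
  have e2 : ‖z‖ / ((p : ℝ) ^ σ) ^ 2 ≤ (‖z - 1‖ + 1) / ((p : ℝ) ^ σ) ^ 2 := by gcongr
  have e3 : ‖z - 1‖ / ((p : ℝ) ^ σ) ^ 2 ≤ ‖z - 1‖ / √(p : ℝ) := by
    gcongr; nlinarith
  have e4 : 1 / ((p : ℝ) ^ σ) ^ 2 ≤ 1 / (p : ℝ) ^ (2 * σ₀) := by rw [h4]; gcongr
  rw [add_div] at e2
  linarith

lemma lseriesSummable_hPow {F : ℕ → ℂ}
    (hF : Summable fun p : Nat.Primes => ‖F p - 1‖ / √((p : ℕ) : ℝ)) (q : ℕ) {s : ℂ}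
    (hs : 1 / 2 < s.re) : LSeriesSummable (mulExt (hPow F q)) s := by
  refine lseriesSummable_mulExt (fun {p} hp => (hasSum_norm_hPow F q).summable) ?_
  simp_rw [fun p : Nat.Primes =>
    (hasSum_norm_hPow F q (p := p) (t := ((p : ℕ) : ℝ) ^ s.re)).tsum_eq]
  refine ((hF.mul_left 2).add (summable_primes_rpow_inv
    (by linarith : 1 < 2 * s.re))).of_nonneg_of_le (fun p => ?_) fun p => ?_
  · split_ifs <;> positivity
  · have := norm_div_add_norm_div_sq_le (F p) p.2 hs.le le_rfl
    split_ifs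
    · positivity
    · exact this

lemma hasProd_hPow {F : ℕ → ℂ}
    (hF : Summable fun p : Nat.Primes => ‖F p - 1‖ / √((p : ℕ) : ℝ)) (q : ℕ) {s : ℂ}
    (hs : 1 / 2 < s.re) :
    HasProd (fun p : Nat.Primes => hFac F q s p) (LSeries (mulExt (hPow F q)) s) := by
  have h := hasProd_mulExt (lseriesSummable_hPow hF q hs)
  have h2 : ∀ p : Nat.Primes, 1 + ∑' k : ℕ, hPow F q p (k + 1) / (((p : ℕ) : ℂ) ^ s) ^ (k + 1)
      = hFac F q s p := by
    intro p
    rw [(hasSum_hPow F q (Complex.cpow_ne_zero_iff_of_exponent_ne_zero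
      (by rintro rfl; norm_num at hs) |>.2 (Nat.cast_ne_zero.2 p.2.ne_zero))).tsum_eq, hFac]
    ring
  simp_rw [h2] at h
  exact h

/-- The product `∏_{p ∣ q} (1 - p ^ (-s))`. -/
def phiFac (q : ℕ) (s : ℂ) : ℂ := ∏ p ∈ q.primeFactors, (1 - 1 / (p : ℂ) ^ s)

lemma hasProd_ite_dvd {R : Type*} [CommMonoid R] [TopologicalSpace R] {q : ℕ} (hq : 0 < q)
    (c : ℕ → R) :
    HasProd (fun p : Nat.Primes => if (p : ℕ) ∣ q then c p else 1) (∏ p ∈ q.primeFactors, c p) := by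
  classical
  let T : Finset Nat.Primes := q.primeFactors.subtype Nat.Prime
  have h : ∀ p ∉ T, (if (p : ℕ) ∣ q then c p else 1) = 1 := by
    intro p hp
    rw [if_neg fun hd => hp (mem_subtype.2 (Nat.mem_primeFactors.2 ⟨p.2, hd, hq.ne'⟩))]
  have h' := hasProd_prod_of_ne_finset_one (L := SummationFilter.unconditional Nat.Primes) h
  convert! h' using 1
  have h2 : ∏ p ∈ T, (if (p : ℕ) ∣ q then c p else 1)
      = ∏ p ∈ q.primeFactors with p.Prime, (if p ∣ q then c p else 1) :=
    prod_subtype_eq_prod_filter (s := q.primeFactors) (p := Nat.Prime)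
      (f := fun p : ℕ => if p ∣ q then c p else 1)
  rw [h2, filter_true_of_mem fun p hp => (Nat.mem_primeFactors.1 hp).1]
  exact prod_congr rfl fun p hp => by rw [if_pos (Nat.mem_primeFactors.1 hp).2.1]

lemma hasProd_phiFac {q : ℕ} (hq : 0 < q) (s : ℂ) :
    HasProd (fun p : Nat.Primes => if (p : ℕ) ∣ q then 1 - 1 / ((p : ℕ) : ℂ) ^ s else 1)
      (phiFac q s) :=
  hasProd_ite_dvd hq fun p : ℕ => 1 - 1 / (p : ℂ) ^ s

/-- Comparison of the Dirichlet series of `g` and `h`, factor by factor. -/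
lemma lseries_gPow_mul {F : ℕ → ℂ}
    (hF : Summable fun p : Nat.Primes => ‖F p - 1‖ / √((p : ℕ) : ℝ)) {q : ℕ} (hq : 0 < q)
    (hFq : ∀ p, p.Prime → p ∣ q → F p = 0) {s : ℂ} (hs : 1 / 2 < s.re) :
    LSeries (mulExt (gPow F)) s * (1 + F 2 / 2 ^ s)
      = phiFac q s * LSeries (mulExt (hPow F q)) s * riemannZeta (2 * s) * (1 + 1 / 2 ^ s) := by
  have hy : ∀ p : Nat.Primes, 1 < ‖((p : ℕ) : ℂ) ^ s‖ := fun p => by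
    rw [Complex.norm_natCast_cpow_of_pos p.2.pos]
    exact (one_lt_sqrt_prime p.2).trans_le (sqrt_le_rpow p.2 hs.le)
  let two : Nat.Primes := ⟨2, Nat.prime_two⟩
  have htwo : ∀ c : ℂ, HasProd (fun p : Nat.Primes => if p = two then c else 1) c :=
    fun c => hasProd_ite_eq two c
  have h1 := (hasProd_gPow hF hs.le).mul (htwo (1 + F 2 / 2 ^ s))
  have h2 := (((hasProd_phiFac hq s).mul (hasProd_hPow hF q hs)).mul
    (riemannZeta_eulerProduct_hasProd (s := 2 * s) (by simp; linarith))).mul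
    (htwo (1 + 1 / 2 ^ s))
  refine h1.unique ?_
  convert! h2 using 1
  ext p
  have hp2 : p = two ↔ (p : ℕ) = 2 := Subtype.ext_iff
  have hyp := hy p
  have hz : ((p : ℕ) : ℂ) ^ (-(2 * s)) = 1 / (((p : ℕ) : ℂ) ^ s) ^ 2 := by
    rw [Complex.cpow_neg, two_mul, Complex.cpow_add _ _ (Nat.cast_ne_zero.2 p.2.ne_zero)]
    field_simp
  rw [hz]
  have e2 : (p : ℕ) = 2 → (2 : ℂ) ^ s = ((p : ℕ) : ℂ) ^ s := fun h => by rw [h]; norm_num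
  have e3 : (p : ℕ) = 2 → F 2 = F p := fun h => by rw [h]
  have hq0 : (p : ℕ) ∣ q → F p = 0 := hFq p p.2
  unfold hFac
  generalize ((p : ℕ) : ℂ) ^ s = y at *
  have hy0 : y ≠ 0 := by rintro rfl; simp at hyp; linarith
  have hy1 : y + 1 ≠ 0 := by
    intro h
    rw [eq_neg_of_add_eq_zero_left h] at hyp
    simp at hyp
  have hy2 : y - 1 ≠ 0 := by
    intro h
    rw [sub_eq_zero.1 h] at hyp
    simp at hyp
  have hy3 : 1 - 1 / y ^ 2 ≠ 0 := by
    have : 1 - 1 / y ^ 2 = (y - 1) * (y + 1) / y ^ 2 := by field_simp; ring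
    rw [this]; positivity
  have hy4 : (1 - 1 / y ^ 2)⁻¹ = y ^ 2 / ((y - 1) * (y + 1)) := by
    rw [inv_eq_one_div, div_eq_div_iff hy3 (mul_ne_zero hy2 hy1)]; field_simp; ring
  rw [hy4]
  by_cases h2 : (p : ℕ) = 2
  · rw [if_pos h2, if_pos (hp2.2 h2), if_pos (hp2.2 h2), e2 h2, e3 h2]
    split_ifs with hd
    · rw [hq0 hd]; field_simp; ring
    · field_simp
  · rw [if_neg h2, if_neg (mt hp2.1 h2), if_neg (mt hp2.1 h2)]
    split_ifs with hd
    · rw [hq0 hd]; field_simp; ring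
    · field_simp
      ring

/-! ### Partial summation against a power -/

/-- The error term in `∑_{n ≤ X} c(n) = K log X + k + errC c K k X`. -/
def errC (c : ℕ → ℂ) (K k : ℂ) (X : ℝ) : ℂ :=
  ∑ n ∈ Ioc 0 ⌊X⌋₊, c n - (K * (Real.log X : ℂ) + k)

lemma hasDerivAt_rpow_mul_log (K k : ℂ) {b : ℝ} (hb : b ≠ 0) {t : ℝ} (ht : 0 < t) :
    HasDerivAt (fun t : ℝ => ((t ^ b : ℝ) : ℂ) * (K * (Real.log t : ℂ) + k)
        - K / b * ((t ^ b : ℝ) : ℂ))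
      ((b : ℂ) * ((t ^ (b - 1) : ℝ) : ℂ) * (K * (Real.log t : ℂ) + k)) t := by
  have h1 := (Real.hasDerivAt_rpow_const (x := t) (p := b) (Or.inl ht.ne')).ofReal_comp
  have h2 := (Real.hasDerivAt_log ht.ne').ofReal_comp
  have h3 := (h1.mul ((h2.const_mul K).add_const k)).sub (h1.const_mul (K / b))
  have hb' : (b : ℂ) ≠ 0 := by exact_mod_cast hb
  convert! h3 using 1
  have h4 : (t ^ b : ℝ) = t ^ (b - 1) * t := by
    rw [← Real.rpow_add_one ht.ne']; ring_nf
  rw [h4]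
  have ht' : (t : ℂ) ≠ 0 := by exact_mod_cast ht.ne'
  push_cast
  field_simp
  ring

lemma continuousOn_rpow_mul_log (K k : ℂ) (b : ℝ) {Y X : ℝ} (hY : 0 < Y) :
    ContinuousOn (fun t : ℝ => (b : ℂ) * ((t ^ (b - 1) : ℝ) : ℂ) * (K * (Real.log t : ℂ) + k))
      (Set.Icc Y X) := by
  have h0 : ∀ t ∈ Set.Icc Y X, t ≠ 0 := fun t ht => (hY.trans_le ht.1).ne'
  have h1 : ContinuousOn (fun t : ℝ => t ^ (b - 1)) (Set.Icc Y X) := fun t ht =>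
    (Real.continuousAt_rpow_const t (b - 1) (Or.inl (h0 t ht))).continuousWithinAt
  have h2 : ContinuousOn (fun t : ℝ => Real.log t) (Set.Icc Y X) :=
    Real.continuousOn_log.mono fun t ht => h0 t ht
  exact (continuousOn_const.mul (Complex.continuous_ofReal.comp_continuousOn h1)).mul
    ((continuousOn_const.mul (Complex.continuous_ofReal.comp_continuousOn h2)).add
      continuousOn_const)

lemma integral_rpow_mul_log (K k : ℂ) {b : ℝ} (hb : b ≠ 0) {Y X : ℝ} (hY : 0 < Y) (hX : Y ≤ X) :
    ∫ t in Y..X, (b : ℂ) * ((t ^ (b - 1) : ℝ) : ℂ) * (K * (Real.log t : ℂ) + k)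
      = (((X ^ b : ℝ) : ℂ) * (K * (Real.log X : ℂ) + k) - K / b * ((X ^ b : ℝ) : ℂ))
        - (((Y ^ b : ℝ) : ℂ) * (K * (Real.log Y : ℂ) + k) - K / b * ((Y ^ b : ℝ) : ℂ)) := by
  refine intervalIntegral.integral_eq_sub_of_hasDerivAt (f := fun t : ℝ => ((t ^ b : ℝ) : ℂ) *
    (K * (Real.log t : ℂ) + k) - K / b * ((t ^ b : ℝ) : ℂ)) (fun t ht => ?_) ?_
  · rw [Set.uIcc_of_le hX] at ht
    exact hasDerivAt_rpow_mul_log K k hb (hY.trans_le ht.1)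
  · exact ContinuousOn.intervalIntegrable_of_Icc hX (continuousOn_rpow_mul_log K k b hY)

lemma sum_Icc_zero_eq {c : ℕ → ℂ} (hc : c 0 = 0) (N : ℕ) :
    ∑ n ∈ Icc 0 N, c n = ∑ n ∈ Ioc 0 N, c n := by
  rw [Icc_eq_cons_Ioc (Nat.zero_le _), sum_cons, hc, zero_add]

lemma intervalIntegrable_rpow_mul_errC (c : ℕ → ℂ) (K k : ℂ) (b : ℝ) {X : ℝ} (hX : 1 ≤ X) :
    IntervalIntegrable (fun t : ℝ => (b : ℂ) * ((t ^ (b - 1) : ℝ) : ℂ) * errC c K k t)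
      MeasureTheory.volume 1 X := by
  have h0 : ContinuousOn (fun t : ℝ => (b : ℂ) * ((t ^ (b - 1) : ℝ) : ℂ)) (Set.Icc 1 X) := by
    simpa using continuousOn_rpow_mul_log 0 1 b (X := X) one_pos
  have h1 : MeasureTheory.IntegrableOn (fun t : ℝ => (b : ℂ) * ((t ^ (b - 1) : ℝ) : ℂ) *
      ∑ n ∈ Icc 1 ⌊t⌋₊, c n) (Set.Icc 1 X) :=
    integrableOn_mul_sum_Icc c zero_le_one (h0.integrableOn_Icc)
  have h2 := (continuousOn_rpow_mul_log K k b (X := X) one_pos).integrableOn_Icc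
    (μ := MeasureTheory.volume)
  rw [intervalIntegrable_iff_integrableOn_Icc_of_le hX]
  refine (h1.sub h2).congr_fun (fun t _ => ?_) measurableSet_Icc
  have : Icc 1 ⌊t⌋₊ = Ioc 0 ⌊t⌋₊ := rfl
  simp only [errC, Pi.sub_apply, this]
  ring

/-- Partial summation: the sum of `c(n) n ^ b` in terms of the error term in the sum of
`c(n)`. -/
lemma sum_mul_rpow_eq (c : ℕ → ℂ) (K k : ℂ) {b : ℝ} (hb : b ≠ 0) {X : ℝ} (hX : 1 ≤ X) :
    ∑ n ∈ Ioc 0 ⌊X⌋₊, c n * (((n : ℝ) ^ b : ℝ) : ℂ)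
      = ((X ^ b : ℝ) : ℂ) * errC c K k X + K / b * ((X ^ b : ℝ) : ℂ) + (k - K / b)
        - ∫ t in (1 : ℝ)..X, (b : ℂ) * ((t ^ (b - 1) : ℝ) : ℂ) * errC c K k t := by
  let c' : ℕ → ℂ := fun n => if n = 0 then 0 else c n
  have hc' : ∀ N : ℕ, ∑ n ∈ Icc 0 N, c' n = ∑ n ∈ Ioc 0 N, c n := fun N => by
    rw [sum_Icc_zero_eq (by simp [c'])]
    exact sum_congr rfl fun n hn => if_neg (mem_Ioc.1 hn).1.ne'
  have hd : ∀ t ∈ Set.Icc 1 X, HasDerivAt (fun t : ℝ => ((t ^ b : ℝ) : ℂ))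
      ((b : ℂ) * ((t ^ (b - 1) : ℝ) : ℂ)) t := fun t ht => by
    have h1 := (Real.hasDerivAt_rpow_const (x := t) (p := b)
      (Or.inl (by linarith [ht.1]))).ofReal_comp
    simpa using h1
  have h0 : ContinuousOn (fun t : ℝ => (b : ℂ) * ((t ^ (b - 1) : ℝ) : ℂ)) (Set.Icc 1 X) := by
    simpa using continuousOn_rpow_mul_log 0 1 b (X := X) one_pos
  have h := sum_mul_eq_sub_integral_mul₀ c' (f := fun t : ℝ => ((t ^ b : ℝ) : ℂ)) (by simp [c']) X
    (fun t ht => (hd t ht).differentiableAt)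
    ((h0.integrableOn_Icc).congr_fun (fun t ht => (hd t ht).deriv.symm) measurableSet_Icc)
  have e1 : ∑ n ∈ Icc 0 ⌊X⌋₊, (((n : ℝ) ^ b : ℝ) : ℂ) * c' n
      = ∑ n ∈ Ioc 0 ⌊X⌋₊, c n * (((n : ℝ) ^ b : ℝ) : ℂ) := by
    rw [sum_Icc_zero_eq (c := fun n => (((n : ℝ) ^ b : ℝ) : ℂ) * c' n) (by simp [c'])]
    exact sum_congr rfl fun n hn => by
      simp only [c', if_neg (mem_Ioc.1 hn).1.ne']; ring
  have e2 : ∫ t in Set.Ioc 1 X, deriv (fun t : ℝ => ((t ^ b : ℝ) : ℂ)) t * ∑ n ∈ Icc 0 ⌊t⌋₊, c' n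
      = (∫ t in (1 : ℝ)..X, (b : ℂ) * ((t ^ (b - 1) : ℝ) : ℂ) * errC c K k t)
        + ∫ t in (1 : ℝ)..X, (b : ℂ) * ((t ^ (b - 1) : ℝ) : ℂ) * (K * (Real.log t : ℂ) + k) := by
    rw [← intervalIntegral.integral_add (intervalIntegrable_rpow_mul_errC c K k b hX)
      (ContinuousOn.intervalIntegrable_of_Icc hX (continuousOn_rpow_mul_log K k b one_pos)),
      intervalIntegral.integral_of_le hX]
    refine MeasureTheory.setIntegral_congr_fun measurableSet_Ioc fun t ht => ?_
    simp only [(hd t ⟨ht.1.le, ht.2⟩).deriv, hc', errC]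
    ring
  rw [e1, e2, hc', integral_rpow_mul_log K k hb one_pos hX] at h
  rw [h, errC]
  simp
  ring

/-! ### The Dirichlet series of the squarefree numbers -/

lemma sqErr_eq_of_floor {v : ℕ} {X : ℝ} {c : ℝ} {n : ℕ} (hn : ⌊X⌋₊ = n)
    (hc : ∑ l ∈ Ioc 0 n, sqc v l / l = c) :
    sqErr v X = c - (sqLead v * Real.log X + sqConst v) := by
  rw [sqErr, sqSum, hn, hc]

lemma sqc_one_one : sqc 1 1 = 1 := by simp [sqc, copr]
lemma sqc_one_two : sqc 1 2 = 1 := by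
  simp [sqc, copr, ArithmeticFunction.moebius_apply_prime Nat.prime_two]
lemma sqc_one_three : sqc 1 3 = 1 := by
  simp [sqc, copr, ArithmeticFunction.moebius_apply_prime Nat.prime_three]
lemma sqc_two_one : sqc 2 1 = 1 := by simp [sqc, copr]

lemma sqLead_one_bounds : 0.6079271017 ≤ sqLead 1 ∧ sqLead 1 ≤ 0.607927102 := by
  have h := mucC_mucD_one_bounds.1
  rw [abs_le] at h
  rw [sqLead]
  norm_num at h ⊢
  constructor <;> linarith

lemma sqLead_two_bounds : 0.4052847343 ≤ sqLead 2 ∧ sqLead 2 ≤ 0.4052847348 := by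
  have h := mucC_mucD_two_bounds.1
  rw [abs_le] at h
  rw [sqLead]
  norm_num at h ⊢
  constructor <;> linarith

lemma sqErr_one_of_lt_two {X : ℝ} (h1 : 1 ≤ X) (h2 : X < 2) :
    sqErr 1 X = 1 - (sqLead 1 * Real.log X + sqConst 1) :=
  sqErr_eq_of_floor (n := 1) ((Nat.floor_eq_iff (by linarith)).2 ⟨by simpa, by norm_num; linarith⟩)
    (by simp [sqc_one_one])

/-- The error term is bounded by a constant multiple of `1 / √X` from `1` on. -/
lemma abs_sqErr_le_of_one_le {v : ℕ} (hv : v = 1 ∨ v = 2) {X : ℝ} (hX : 1 ≤ X) :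
    √X * |sqErr v X| ≤ 0.66 := by
  rcases hv with rfl | rfl
  · rcases lt_or_ge X 2 with h | h
    · rw [sqErr_one_of_lt_two hX h]
      obtain ⟨l1, l2⟩ := sqLead_one_bounds
      have hc := sqConst_one_bounds
      have hl2 := Real.log_two_lt_d9
      have h3 : Real.log X ≤ Real.log 2 := Real.log_le_log (by linarith) h.le
      have h4 := Real.log_nonneg hX
      have h5 : √X ≤ 1.41422 := by
        rw [Real.sqrt_le_left (by norm_num)]; linarith
      rw [abs_le] at hc
      have h6 : |1 - (sqLead 1 * Real.log X + sqConst 1)| ≤ 0.4654 := by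
        rw [abs_le]
        constructor <;> nlinarith
      nlinarith [abs_nonneg (1 - (sqLead 1 * Real.log X + sqConst 1)), Real.sqrt_nonneg X]
    · linarith [sqErr_one_le h]
  · linarith [sqErr_two_le hX]

lemma measurable_sqErr (v : ℕ) : Measurable (sqErr v) := by
  unfold sqErr sqSum
  have h : Measurable fun N : ℕ => ∑ l ∈ Ioc 0 N, sqc v l / (l : ℝ) := measurable_from_nat
  exact (h.comp Nat.measurable_floor).sub ((Real.measurable_log.const_mul _).add_const _)

lemma errC_sqc (v : ℕ) (X : ℝ) :
    errC (fun n => ((sqc v n / n : ℝ) : ℂ)) (sqLead v) (sqConst v) X = (sqErr v X : ℂ) := by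
  rw [errC, sqErr, sqSum]; push_cast; rfl

/-- The error term on `(1, ∞)`, extended by zero. -/
def sqTail (v : ℕ) (t : ℝ) : ℂ := if 1 < t then (sqErr v t : ℂ) else 0

/-- The integral `∫_1^∞ E(t) t ^ (-s) dt` of the error term `E`. -/
def sqMellin (v : ℕ) (s : ℂ) : ℂ := mellin (sqTail v) (1 - s)

lemma norm_sqTail_le {v : ℕ} (hv : v = 1 ∨ v = 2) (t : ℝ) :
    ‖sqTail v t‖ ≤ 0.66 * t ^ (-(1 / 2) : ℝ) ∨ ‖sqTail v t‖ = 0 := by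
  unfold sqTail
  split_ifs with h
  · left
    have h1 := abs_sqErr_le_of_one_le hv h.le
    have h0 : 0 < t := by linarith
    rw [Complex.norm_real, Real.norm_eq_abs, Real.rpow_neg h0.le, ← Real.sqrt_eq_rpow,
      ← div_eq_mul_inv, le_div_iff₀ (Real.sqrt_pos.2 h0)]
    linarith
  · right; simp

lemma measurable_sqTail (v : ℕ) : Measurable (sqTail v) :=
  Measurable.ite measurableSet_Ioi (Complex.measurable_ofReal.comp (measurable_sqErr v))
    measurable_const

lemma differentiableAt_sqMellin {v : ℕ} (hv : v = 1 ∨ v = 2) {s : ℂ} (hs : 1 / 2 < s.re) :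
    DifferentiableAt ℂ (sqMellin v) s := by
  have hb : ∀ t, ‖sqTail v t‖ ≤ 1 := fun t => by
    unfold sqTail
    split_ifs with h
    · have h1 := abs_sqErr_le_of_one_le hv h.le
      rw [Complex.norm_real, Real.norm_eq_abs]
      have : 1 ≤ √t := by rw [Real.one_le_sqrt]; exact h.le
      nlinarith [abs_nonneg (sqErr v t)]
    · simp
  have h1 : DifferentiableAt ℂ (mellin (sqTail v)) (1 - s) := by
    refine mellin_differentiableAt_of_isBigO_rpow (a := 1 / 2) (b := (1 - s).re - 1) ?_ ?_ ?_ ?_ ?_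
    · refine (MeasureTheory.locallyIntegrable_const (1 : ℝ)).mono
        (measurable_sqTail v).aestronglyMeasurable ?_ |>.locallyIntegrableOn _
      exact Eventually.of_forall fun t => by simpa using hb t
    · refine Asymptotics.IsBigO.of_bound 0.66 ?_
      filter_upwards [eventually_gt_atTop 0] with t ht
      rw [Real.norm_of_nonneg (Real.rpow_nonneg ht.le _)]
      rcases norm_sqTail_le hv t with h | h
      · exact h
      · rw [h]; positivity
    · simp; linarith
    · refine Asymptotics.IsBigO.of_bound 1 ?_
      filter_upwards [Ioo_mem_nhdsGT (zero_lt_one' ℝ)] with t ht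
      rw [sqTail, if_neg (by linarith [ht.2])]
      simp
    · linarith
  exact DifferentiableAt.comp s h1 (by fun_prop)

lemma sqMellin_eq (v : ℕ) (a : ℝ) :
    sqMellin v a = ∫ t in Set.Ioi (1 : ℝ), ((t ^ (-a) * sqErr v t : ℝ) : ℂ) := by
  have h : (fun t : ℝ => (t : ℂ) ^ (1 - (a : ℂ) - 1) • sqTail v t)
      =ᵐ[MeasureTheory.volume.restrict (Set.Ioi 0)]
        (Set.Ioi (1 : ℝ)).indicator fun t => ((t ^ (-a) * sqErr v t : ℝ) : ℂ) := by
    refine (MeasureTheory.ae_restrict_iff' measurableSet_Ioi).2 (Eventually.of_forall fun t ht => ?_)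
    simp only [sqTail, Set.indicator, Set.mem_Ioi]
    split_ifs with h1
    · push_cast
      rw [Complex.ofReal_cpow (le_of_lt ht), smul_eq_mul]
      push_cast; ring_nf
    · simp
  rw [sqMellin, mellin, MeasureTheory.integral_congr_ae h,
    MeasureTheory.setIntegral_indicator measurableSet_Ioi]
  congr 2
  ext t
  simp

lemma integrableOn_rpow_mul_sqErr {v : ℕ} (hv : v = 1 ∨ v = 2) {a : ℝ} (ha : 1 / 2 < a)
    {X : ℝ} (hX : 1 ≤ X) :
    MeasureTheory.IntegrableOn (fun t : ℝ => t ^ (-a) * sqErr v t) (Set.Ioi X) := by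
  have h1 := (integrableOn_Ioi_rpow_of_lt (by linarith : -a - 1 / 2 < -1)
    (by linarith : 0 < X)).const_mul 0.66
  refine MeasureTheory.Integrable.mono' h1 ?_ ?_
  · exact ((measurable_id.pow_const _).mul (measurable_sqErr v)).aestronglyMeasurable
  · refine (MeasureTheory.ae_restrict_iff' measurableSet_Ioi).2 (Eventually.of_forall fun t ht => ?_)
    have ht0 : 0 < t := by have : X < t := ht; linarith
    have h2 := abs_sqErr_le_of_one_le hv (le_trans hX (le_of_lt ht))
    rw [norm_mul, Real.norm_of_nonneg (Real.rpow_nonneg ht0.le _), Real.norm_eq_abs,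
      Real.rpow_sub ht0, ← Real.sqrt_eq_rpow]
    have h3 : |sqErr v t| ≤ 0.66 / √t := by
      rw [le_div_iff₀ (Real.sqrt_pos.2 ht0)]; linarith
    calc t ^ (-a) * |sqErr v t| ≤ t ^ (-a) * (0.66 / √t) := by gcongr
      _ = _ := by ring

/-! ### The continuation of the Dirichlet series to `Re s > 1 / 2` -/

/-- The sum of `ℓ ^ (-a)` over the squarefree `ℓ ≤ X` coprime to `v`. -/
def sqSumPow (v : ℕ) (a X : ℝ) : ℝ := ∑ n ∈ Ioc 0 ⌊X⌋₊, sqc v n / (n : ℝ) ^ a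

/-- The value at a real point of the function `(s - 1) ∑ μ ^ 2(ℓ) ℓ ^ (-s)`, the sum being over the
`ℓ` coprime to `v`, continued to `s > 1 / 2` by means of the error term `sqErr`. -/
def sqPolyR (v : ℕ) (a : ℝ) : ℝ :=
  sqLead v + sqConst v * (a - 1) + (a - 1) ^ 2 * ∫ t in Set.Ioi (1 : ℝ), t ^ (-a) * sqErr v t

/-- The function `(s - 1) ∑ μ ^ 2(ℓ) ℓ ^ (-s)`, the sum being over the `ℓ` coprime to `v`, continued
to `Re s > 1 / 2` by means of the error term `sqErr`. -/
def sqPoly (v : ℕ) (s : ℂ) : ℂ := sqLead v + sqConst v * (s - 1) + (s - 1) ^ 2 * sqMellin v s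

lemma sqPoly_ofReal (v : ℕ) (a : ℝ) : sqPoly v a = (sqPolyR v a : ℂ) := by
  rw [sqPoly, sqPolyR, sqMellin_eq, integral_complex_ofReal]
  push_cast; rfl

/-- The error term in the sum of `ℓ ^ (-a)` over the squarefree `ℓ ≤ X` coprime to `v`. -/
def powErr (v : ℕ) (a X : ℝ) : ℝ :=
  sqSumPow v a X - (sqPolyR v a - sqLead v * X ^ (1 - a)) / (a - 1)

/-- Partial summation from infinity, which is possible for every `a > 1 / 2` because the main term is
defined by means of the integral of the error term over `(1, ∞)`. -/
lemma powErr_eq {v : ℕ} (hv : v = 1 ∨ v = 2) {a : ℝ} (ha : 1 / 2 < a) (ha1 : a ≠ 1) {X : ℝ}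
    (hX : 1 ≤ X) : powErr v a X
      = X ^ (1 - a) * sqErr v X - (a - 1) * ∫ t in Set.Ioi X, t ^ (-a) * sqErr v t := by
  have hb : 1 - a ≠ 0 := sub_ne_zero.2 ha1.symm
  have hX0 : 0 < X := by linarith
  have h := sum_mul_rpow_eq (fun n => ((sqc v n / n : ℝ) : ℂ)) (sqLead v) (sqConst v) hb hX
  simp only [errC_sqc] at h
  have e1 : ∑ n ∈ Ioc 0 ⌊X⌋₊, ((sqc v n / n : ℝ) : ℂ) * (((n : ℝ) ^ (1 - a) : ℝ) : ℂ)
      = (sqSumPow v a X : ℂ) := by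
    rw [sqSumPow]
    push_cast
    refine sum_congr rfl fun n hn => ?_
    have hn0 : (0 : ℝ) < n := by exact_mod_cast (mem_Ioc.1 hn).1
    rw [Real.rpow_sub hn0, Real.rpow_one]
    have : (n : ℂ) ≠ 0 := by exact_mod_cast hn0.ne'
    push_cast; field_simp
  have e2 : ∫ t in (1 : ℝ)..X, ((1 - a : ℝ) : ℂ) * ((t ^ (1 - a - 1) : ℝ) : ℂ) * (sqErr v t : ℂ)
      = (((1 - a) * ∫ t in (1 : ℝ)..X, t ^ (-a) * sqErr v t : ℝ) : ℂ) := by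
    rw [← intervalIntegral.integral_const_mul, ← intervalIntegral.integral_ofReal]
    congr 1
    ext t
    rw [show 1 - a - 1 = -a by ring]
    push_cast; ring
  rw [e1, e2] at h
  have h' : sqSumPow v a X = X ^ (1 - a) * sqErr v X + sqLead v / (1 - a) * X ^ (1 - a)
      + (sqConst v - sqLead v / (1 - a)) - (1 - a) * ∫ t in (1 : ℝ)..X, t ^ (-a) * sqErr v t := by
    exact_mod_cast h
  have h3 : ∫ t in (1 : ℝ)..X, t ^ (-a) * sqErr v t
      = (∫ t in Set.Ioi (1 : ℝ), t ^ (-a) * sqErr v t)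
        - ∫ t in Set.Ioi X, t ^ (-a) * sqErr v t := by
    rw [eq_sub_iff_add_eq]
    exact intervalIntegral.integral_interval_add_Ioi
      (integrableOn_rpow_mul_sqErr hv ha le_rfl) (integrableOn_rpow_mul_sqErr hv ha hX)
  rw [powErr, h', h3, sqPolyR]
  have hb' : a - 1 ≠ 0 := sub_ne_zero.2 ha1
  have hb2 : 1 - a = -(a - 1) := by ring
  generalize X ^ (1 - a) = Y
  rw [hb2]
  field_simp
  ring

/-- The error term with exponent `a` is, up to the contribution of the integral, `X ^ (1 - a)` times
the one with exponent `1`. -/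
lemma abs_powErr_sub_le {v : ℕ} (hv : v = 1 ∨ v = 2) {a : ℝ} (ha : 1 / 2 < a) (ha1 : a ≠ 1)
    {X D : ℝ} (hX : 1 ≤ X) (hD : ∀ t, X ≤ t → √t * |sqErr v t| ≤ D) :
    |powErr v a X - X ^ (1 - a) * sqErr v X|
      ≤ D * (|a - 1| / (a - 1 / 2)) * X ^ (1 / 2 - a) := by
  have hX0 : 0 < X := by linarith
  rw [powErr_eq hv ha ha1 hX, sub_sub_cancel_left, abs_neg, abs_mul]
  have h1 : |∫ t in Set.Ioi X, t ^ (-a) * sqErr v t| ≤ ∫ t in Set.Ioi X, D * t ^ (-a - 1 / 2) := by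
    rw [← Real.norm_eq_abs]
    refine MeasureTheory.norm_integral_le_of_norm_le
      ((integrableOn_Ioi_rpow_of_lt (by linarith) hX0).const_mul D) ?_
    refine (MeasureTheory.ae_restrict_iff' measurableSet_Ioi).2 (Eventually.of_forall fun t ht => ?_)
    have ht0 : 0 < t := hX0.trans ht
    have h2 := hD t (le_of_lt ht)
    rw [norm_mul, Real.norm_of_nonneg (Real.rpow_nonneg ht0.le _), Real.norm_eq_abs,
      Real.rpow_sub ht0, ← Real.sqrt_eq_rpow]
    have h3 : |sqErr v t| ≤ D / √t := by
      rw [le_div_iff₀ (Real.sqrt_pos.2 ht0)]; linarith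
    calc t ^ (-a) * |sqErr v t| ≤ t ^ (-a) * (D / √t) := by gcongr
      _ = _ := by ring
  rw [MeasureTheory.integral_const_mul, integral_Ioi_rpow_of_lt (by linarith) hX0,
    show -a - 1 / 2 + 1 = 1 / 2 - a by ring] at h1
  calc |a - 1| * |∫ t in Set.Ioi X, t ^ (-a) * sqErr v t|
      ≤ |a - 1| * (D * (-X ^ (1 / 2 - a) / (1 / 2 - a))) := by gcongr
    _ = _ := by
      have : a - 1 / 2 ≠ 0 := by linarith
      have h2 : 1 / 2 - a = -(a - 1 / 2) := by ring
      generalize X ^ (1 / 2 - a) = Y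
      rw [h2]
      field_simp

lemma tendsto_rpow_atTop_zero {b : ℝ} (hb : b < 0) :
    Tendsto (fun X : ℝ => X ^ b) atTop (𝓝 0) := by
  simpa using tendsto_rpow_neg_atTop (y := -b) (by linarith)

lemma tendsto_powErr {v : ℕ} (hv : v = 1 ∨ v = 2) {a : ℝ} (ha : 1 < a) :
    Tendsto (fun X : ℝ => powErr v a X) atTop (𝓝 0) := by
  have h1 := tendsto_rpow_atTop_zero (by linarith : 1 / 2 - a < 0)
  refine squeeze_zero_norm' ?_ (by simpa using
    (h1.const_mul (0.66 * (|a - 1| / (a - 1 / 2)) + 0.66)))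
  filter_upwards [eventually_ge_atTop 1] with X hX
  have h2 := abs_powErr_sub_le hv (by linarith) ha.ne' hX (D := 0.66)
    fun t ht => abs_sqErr_le_of_one_le hv (hX.trans ht)
  have h3 := abs_sqErr_le_of_one_le hv hX
  have hX0 : 0 < X := by linarith
  have h4 : |X ^ (1 - a) * sqErr v X| ≤ 0.66 * X ^ (1 / 2 - a) := by
    rw [abs_mul, abs_of_nonneg (Real.rpow_nonneg hX0.le _),
      show 1 - a = 1 / 2 - a + 1 / 2 by ring, Real.rpow_add hX0, ← Real.sqrt_eq_rpow, mul_assoc,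
      mul_comm]
    gcongr
  have h5 := abs_add_le (powErr v a X - X ^ (1 - a) * sqErr v X) (X ^ (1 - a) * sqErr v X)
  rw [sub_add_cancel] at h5
  rw [Real.norm_eq_abs]
  linarith

lemma sqc_mul {v m n : ℕ} (h : m.Coprime n) : sqc v (m * n) = sqc v m * sqc v n := by
  unfold sqc
  rw [copr_mul, ArithmeticFunction.isMultiplicative_moebius.map_mul_of_coprime h]
  push_cast; ring

lemma sqc_prime_pow (v : ℕ) {p k : ℕ} (hp : p.Prime) (hk : k ≠ 0) :
    sqc v (p ^ k) = if k = 1 ∧ p.Coprime v then 1 else 0 := by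
  rcases eq_or_ne k 1 with rfl | h1
  · simp [sqc, copr, ArithmeticFunction.moebius_apply_prime hp]
  · rw [if_neg (fun h => h1 h.1), sqc, ArithmeticFunction.moebius_apply_prime_pow hp hk, if_neg h1]
    simp

/-- A multiplicative function is determined by its values at the prime powers. -/
lemma eq_mulExt {f : ℕ → ℂ} (hf1 : f 1 = 1)
    (hmul : ∀ m n : ℕ, m.Coprime n → f (m * n) = f m * f n) {a : ℕ → ℕ → ℂ}
    (ha : ∀ p k : ℕ, p.Prime → k ≠ 0 → f (p ^ k) = a p k) {n : ℕ} (hn : n ≠ 0) :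
    f n = mulExt a n := by
  rw [Nat.multiplicative_factorization f hmul hf1 hn, mulExt, if_neg hn]
  refine Finsupp.prod_congr fun p hp => ha p _ ?_ ?_
  · exact Nat.prime_of_mem_primeFactors hp
  · exact Finsupp.mem_support_iff.1 hp

/-- The factor by which the Dirichlet series of the squarefree integers coprime to `v` differs from
`ζ(s) / ζ(2 s)`. -/
def kap (v : ℕ) (s : ℂ) : ℂ := if v = 2 then 1 + 1 / 2 ^ s else 1

lemma lseriesSummable_sqc (v : ℕ) {s : ℂ} (hs : 1 < s.re) :
    LSeriesSummable (fun n => (sqc v n : ℂ)) s := by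
  refine LSeriesSummable_of_bounded_of_one_lt_re (m := 1) (fun n _ => ?_) hs
  rw [Complex.norm_real, Real.norm_of_nonneg (sqc_nonneg v n)]
  exact (sqc_le_copr v n).trans (copr_le_one v n)

/-- The Euler product of the squarefree integers in the half-plane of absolute convergence. -/
lemma lseries_sqc_mul {v : ℕ} (hv : v = 1 ∨ v = 2) {s : ℂ} (hs : 1 < s.re) :
    LSeries (fun n => (sqc v n : ℂ)) s * (riemannZeta (2 * s) * kap v s) = riemannZeta s := by
  have e : ∀ {n : ℕ}, n ≠ 0 → (sqc v n : ℂ)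
      = mulExt (fun p k => if k = 1 ∧ p.Coprime v then 1 else 0) n := fun {n} hn =>
    eq_mulExt (f := fun n => (sqc v n : ℂ)) (by rcases hv with rfl | rfl <;> simp [sqc, copr])
      (fun m n h => by rw [sqc_mul h]; push_cast; rfl)
      (fun p k hp hk => by rw [sqc_prime_pow v hp hk]; split_ifs <;> simp) hn
  have hsum := lseriesSummable_sqc v hs
  rw [LSeriesSummable_congr s e] at hsum
  rw [LSeries_congr e s]
  have h1 := hasProd_mulExt hsum
  let two : Nat.Primes := ⟨2, Nat.prime_two⟩
  have htwo : HasProd (fun p : Nat.Primes => if p = two then kap v s else 1) (kap v s) :=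
    hasProd_ite_eq two _
  have h2 := h1.mul ((riemannZeta_eulerProduct_hasProd (s := 2 * s) (by simp; linarith)).mul htwo)
  refine h2.unique ?_
  convert! riemannZeta_eulerProduct_hasProd hs using 1
  ext p
  have hyp : 1 < ‖((p : ℕ) : ℂ) ^ s‖ := by
    rw [Complex.norm_natCast_cpow_of_pos p.2.pos]
    exact (one_lt_sqrt_prime p.2).trans_le (sqrt_le_rpow p.2 (by linarith))
  have hz : ((p : ℕ) : ℂ) ^ (-(2 * s)) = 1 / (((p : ℕ) : ℂ) ^ s) ^ 2 := by
    rw [Complex.cpow_neg, two_mul, Complex.cpow_add _ _ (Nat.cast_ne_zero.2 p.2.ne_zero)]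
    field_simp
  have hp2 : p = two ↔ (p : ℕ) = 2 := Subtype.ext_iff
  rw [hz, Complex.cpow_neg, kap]
  have e2 : (p : ℕ) = 2 → (2 : ℂ) ^ s = ((p : ℕ) : ℂ) ^ s := fun h => by rw [h]; norm_num
  generalize ((p : ℕ) : ℂ) ^ s = y at *
  have h3 : ∑' k : ℕ, (if k + 1 = 1 ∧ (p : ℕ).Coprime v then (1 : ℂ) else 0) / y ^ (k + 1)
      = if (p : ℕ).Coprime v then 1 / y else 0 := by
    rw [tsum_eq_single 0 fun k hk => by rw [if_neg (fun h => hk (by omega))]; simp]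
    simp [ite_div]
  rw [h3]
  have hy0 : y ≠ 0 := by rintro rfl; simp at hyp; linarith
  have hy1 : y + 1 ≠ 0 := by
    intro h
    rw [eq_neg_of_add_eq_zero_left h] at hyp
    simp at hyp
  have hy2 : y - 1 ≠ 0 := by
    intro h
    rw [sub_eq_zero.1 h] at hyp
    simp at hyp
  have hy3 : 1 - 1 / y ^ 2 = (y - 1) * (y + 1) / y ^ 2 := by field_simp; ring
  have hy4 : 1 - y⁻¹ = (y - 1) / y := by field_simp
  rw [hy3, hy4, inv_div, inv_div]
  rcases hv with rfl | rfl
  · simp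
    field_simp
  · have hc : (p : ℕ).Coprime 2 ↔ ¬ (p : ℕ) = 2 := by
      rw [Nat.coprime_primes p.2 Nat.prime_two]
    by_cases h : (p : ℕ) = 2
    · rw [if_neg (by simp [h]), if_pos (hp2.2 h), if_pos rfl, e2 h]
      field_simp
      ring
    · rw [if_pos (hc.2 h), if_neg (mt hp2.1 h)]
      field_simp

lemma sqSumPow_natCast (v : ℕ) (a : ℝ) (N : ℕ) : ((sqSumPow v a N : ℝ) : ℂ)
    = ∑ n ∈ range (N + 1), LSeries.term (fun n => (sqc v n : ℂ)) a n := by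
  have h : range (N + 1) = insert 0 (Ioc 0 N) := by ext; simp only [mem_range, mem_insert, mem_Ioc]; omega
  rw [h, sum_insert (by simp), LSeries.term_zero, zero_add, sqSumPow, Nat.floor_natCast]
  push_cast
  refine sum_congr rfl fun n hn => ?_
  rw [LSeries.term_of_ne_zero (mem_Ioc.1 hn).1.ne', Complex.ofReal_cpow (Nat.cast_nonneg _)]
  push_cast; rfl

/-- The analytic continuation of the Dirichlet series at the real points `a > 1`. -/
lemma lseries_sqc_eq {v : ℕ} (hv : v = 1 ∨ v = 2) {a : ℝ} (ha : 1 < a) :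
    LSeries (fun n => (sqc v n : ℂ)) a * (a - 1) = sqPoly v a := by
  have h1 : Tendsto (fun N : ℕ => ((sqSumPow v a N : ℝ) : ℂ)) atTop
      (𝓝 (LSeries (fun n => (sqc v n : ℂ)) a)) := by
    simp_rw [sqSumPow_natCast]
    exact ((lseriesSummable_sqc v (s := a) (by simpa)).hasSum.tendsto_sum_nat).comp
      (tendsto_add_atTop_nat 1)
  have h2 : Tendsto (fun X : ℝ => sqSumPow v a X) atTop (𝓝 (sqPolyR v a / (a - 1))) := by
    have h3 := (tendsto_powErr hv ha).add (((tendsto_const_nhds (x := sqPolyR v a)).sub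
      ((tendsto_rpow_atTop_zero (by linarith : 1 - a < 0)).const_mul (sqLead v))).div_const (a - 1))
    simp only [powErr, sub_add_cancel] at h3
    simpa using h3
  have h3 := tendsto_nhds_unique h1
    ((Complex.continuous_ofReal.tendsto _).comp (h2.comp tendsto_natCast_atTop_atTop))
  rw [h3, sqPoly_ofReal]
  have : (a : ℂ) - 1 ≠ 0 := by
    rw [sub_ne_zero]; exact_mod_cast ha.ne'
  push_cast
  field_simp

lemma differentiableAt_sqPoly {v : ℕ} (hv : v = 1 ∨ v = 2) {s : ℂ} (hs : 1 / 2 < s.re) :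
    DifferentiableAt ℂ (sqPoly v) s := by
  have := differentiableAt_sqMellin hv hs
  unfold sqPoly
  fun_prop

lemma isOpen_re_gt_half : IsOpen {s : ℂ | 1 / 2 < s.re} :=
  isOpen_lt continuous_const Complex.continuous_re

lemma differentiableAt_zeta_two_mul {s : ℂ} (hs : 1 / 2 < s.re) :
    DifferentiableAt ℂ (fun s => riemannZeta (2 * s)) s := by
  have h1 : 2 * s ≠ 1 := fun h => by
    have := congrArg Complex.re h; simp at this; linarith
  exact DifferentiableAt.comp (g := riemannZeta) s (differentiableAt_riemannZeta h1) (by fun_prop)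

lemma differentiableAt_kap (v : ℕ) (s : ℂ) : DifferentiableAt ℂ (kap v) s := by
  have h0 : ∀ s : ℂ, (2 : ℂ) ^ s ≠ 0 := fun s => by simp [Complex.cpow_def]
  unfold kap
  split_ifs
  · have : DifferentiableAt ℂ (fun s : ℂ => (2 : ℂ) ^ s) s := by
      exact (differentiableAt_id).const_cpow (Or.inl (by norm_num))
    exact (differentiableAt_const _).add ((differentiableAt_const _).div this (h0 s))
  · exact differentiableAt_const _

/-- The continuation of the Dirichlet series of the squarefree integers, in terms of the zeta
function. Both sides are analytic for `Re s > 1 / 2` and agree at the real points `s > 1`; here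
`riemannZeta₁ s` is `(s - 1) ζ(s)`. -/
theorem sqPoly_mul {v : ℕ} (hv : v = 1 ∨ v = 2) {s : ℂ} (hs : 1 / 2 < s.re) :
    sqPoly v s * (riemannZeta (2 * s) * kap v s) = riemannZeta₁ s := by
  have hU : IsPreconnected {s : ℂ | 1 / 2 < s.re} :=
    (convex_halfSpace_re_gt (1 / 2)).isPreconnected
  have hA : AnalyticOnNhd ℂ (fun s => sqPoly v s * (riemannZeta (2 * s) * kap v s))
      {s : ℂ | 1 / 2 < s.re} := by
    refine DifferentiableOn.analyticOnNhd (fun s hs => ?_) isOpen_re_gt_half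
    exact ((differentiableAt_sqPoly hv hs).mul ((differentiableAt_zeta_two_mul hs).mul
      (differentiableAt_kap v s))).differentiableWithinAt
  have hB : AnalyticOnNhd ℂ riemannZeta₁ {s : ℂ | 1 / 2 < s.re} :=
    DifferentiableOn.analyticOnNhd differentiable_riemannZeta₁.differentiableOn isOpen_re_gt_half
  refine hA.eqOn_of_preconnected_of_frequently_eq hB hU (z₀ := 2) (by norm_num) ?_ hs
  have h1 : Tendsto (fun x : ℝ => (x : ℂ)) (𝓝[>] 2) (𝓝[≠] 2) := by
    refine tendsto_nhdsWithin_iff.2 ⟨?_, ?_⟩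
    · exact (Complex.continuous_ofReal.tendsto' 2 2 (by simp)).mono_left nhdsWithin_le_nhds
    · filter_upwards [self_mem_nhdsWithin] with x hx
      have : (2 : ℝ) < x := hx
      simp only [Set.mem_compl_iff, Set.mem_singleton_iff]
      exact_mod_cast this.ne'
  refine h1.frequently (Eventually.frequently ?_)
  filter_upwards [self_mem_nhdsWithin] with x hx
  have hx2 : (2 : ℝ) < x := hx
  have hx1 : (x : ℂ) ≠ 1 := by exact_mod_cast (by linarith : x ≠ 1)
  have h2 := lseries_sqc_mul hv (s := x) (by simp; linarith)
  have h3 := riemannZeta_eq_inv_sub_mul hx1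
  rw [← lseries_sqc_eq hv (by linarith : 1 < x), mul_right_comm, h2, h3]
  field_simp [sub_ne_zero.2 hx1]

/-! ### The sum of `ℓ ^ (-a)` over squarefree integers: all ranges of `X` -/

/-- The convexity of `exp`, for the powers of `X` and `Y`. -/
lemma rpow_sub_rpow_le {X Y : ℝ} (hX : 0 < X) (hY : 0 < Y) (b : ℝ) :
    X ^ (-b) - Y ^ (-b) ≤ b * (Real.log Y - Real.log X) * X ^ (-b) ∧
      b * (Real.log Y - Real.log X) * Y ^ (-b) ≤ X ^ (-b) - Y ^ (-b) := by
  have h1 : Y ^ (-b) = X ^ (-b) * Real.exp (-(b * (Real.log Y - Real.log X))) := by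
    rw [Real.rpow_def_of_pos hX, Real.rpow_def_of_pos hY, ← Real.exp_add]; ring_nf
  have h2 : X ^ (-b) = Y ^ (-b) * Real.exp (b * (Real.log Y - Real.log X)) := by
    rw [Real.rpow_def_of_pos hX, Real.rpow_def_of_pos hY, ← Real.exp_add]; ring_nf
  have e1 := Real.add_one_le_exp (-(b * (Real.log Y - Real.log X)))
  have e2 := Real.add_one_le_exp (b * (Real.log Y - Real.log X))
  have p1 : 0 < X ^ (-b) := Real.rpow_pos_of_pos hX _
  have p2 : 0 < Y ^ (-b) := Real.rpow_pos_of_pos hY _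
  constructor
  · rw [h1]; nlinarith
  · nlinarith

lemma mul_neg_log_le {x : ℝ} (hx : 0 < x) : x * -Real.log x ≤ Real.exp (-1) := by
  have h := Real.log_le_sub_one_of_pos (by positivity : 0 < Real.exp (-1) / x)
  rw [Real.log_div (Real.exp_ne_zero _) hx.ne', Real.log_exp] at h
  have h2 : -Real.log x ≤ Real.exp (-1) / x := by linarith
  calc x * -Real.log x ≤ x * (Real.exp (-1) / x) := by gcongr
    _ = Real.exp (-1) := by field_simp

/-- A bound for the maximum of `x ^ (1 - z) - x`, by the weighted inequality between the arithmetic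
and the geometric mean. -/
lemma rpow_one_sub_sub_le {x z l : ℝ} (hx : 0 < x) (hz : 0 < z) (hz1 : z < 1)
    (hl : 1 - z ≤ Real.exp (-(l * z))) :
    x ^ (1 - z) - x ≤ z * (Real.exp (-l) / (1 - z)) := by
  have h1 := Real.geom_mean_le_arith_mean2_weighted (by linarith : 0 ≤ 1 - z) hz.le hx.le
    (Real.exp_pos (-l)).le (by ring)
  have h2 : Real.exp (-l) ^ z = Real.exp (-(l * z)) := by rw [← Real.exp_mul]; ring_nf
  rw [h2] at h1
  set c := Real.exp (-l)
  set d := Real.exp (-(l * z))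
  have hc : 0 < c := Real.exp_pos _
  have hd : 0 < d := Real.exp_pos _
  have h3 : x ^ (1 - z) * (1 - z) ≤ (1 - z) * x + z * c :=
    (mul_le_mul_of_nonneg_left hl (Real.rpow_nonneg hx.le _)).trans h1
  have h4 : 0 < 1 - z := by linarith
  have h5 : z * (c / (1 - z)) = (z * c) / (1 - z) := by ring
  rw [h5, le_div_iff₀ h4]
  linarith

/-- The range below `1` for `a > 1`. The sum is empty and the error term is minus the main term
`δ + c (1 - X ^ (1 - a)) / (a - 1)`, where `δ = A - B` is the value at `X = 1`. -/
lemma small_range_of_one_lt {a c δ X : ℝ} (ha : 1 < a) (hX : 0 < X) (hX1 : X ≤ 1) (hc : 0 ≤ c)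
    (hδ : 2 * c * Real.exp (-1) ≤ δ) :
    |δ + c * ((1 - X ^ (1 - a)) / (a - 1))| * X ^ (a - 1 / 2) ≤ δ := by
  have hb : 0 < a - 1 := by linarith
  have hs : 0 < √X := Real.sqrt_pos.2 hX
  have h1 : X ^ (1 - a) * X ^ (a - 1 / 2) = √X := by
    rw [← Real.rpow_add hX, Real.sqrt_eq_rpow]; ring_nf
  have h0 : 0 < X ^ (a - 1 / 2) := Real.rpow_pos_of_pos hX _
  have h2 : X ^ (a - 1 / 2) ≤ 1 := Real.rpow_le_one hX.le hX1 (by linarith)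
  obtain ⟨-, h3⟩ := rpow_sub_rpow_le one_pos hX (a - 1)
  obtain ⟨h4, -⟩ := rpow_sub_rpow_le hX one_pos (a - 1)
  rw [neg_sub, Real.one_rpow, Real.log_one, zero_sub] at h4
  set q := (X ^ (1 - a) - 1) / (a - 1) with hq
  have hq0 : 0 ≤ q := div_nonneg (by
    have := Real.one_le_rpow_of_pos_of_le_one_of_nonpos hX hX1 (by linarith : 1 - a ≤ 0)
    linarith) hb.le
  have hq1 : q ≤ -Real.log X * X ^ (1 - a) := by
    rw [hq, div_le_iff₀ hb]; linarith
  have h5 : q * X ^ (a - 1 / 2) ≤ 2 * Real.exp (-1) := by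
    have h6 : √X * -Real.log X ≤ 2 * Real.exp (-1) := by
      have := mul_neg_log_le hs
      rw [Real.log_sqrt hX.le] at this
      linarith
    calc q * X ^ (a - 1 / 2) ≤ (-Real.log X * X ^ (1 - a)) * X ^ (a - 1 / 2) := by gcongr
      _ = √X * -Real.log X := by rw [mul_assoc, h1]; ring
      _ ≤ _ := h6
  have h7 : δ + c * ((1 - X ^ (1 - a)) / (a - 1)) = δ - c * q := by rw [hq]; ring
  have hδ0 : 0 ≤ δ := le_trans (by positivity) hδ
  rw [h7, ← abs_of_pos h0, ← abs_mul, abs_le]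
  have h8 : 0 ≤ c * (q * X ^ (a - 1 / 2)) := by positivity
  have h9 : c * (q * X ^ (a - 1 / 2)) ≤ c * (2 * Real.exp (-1)) := by gcongr
  constructor <;> nlinarith

lemma one_sub_le_exp {z : ℝ} (hz : 1 / 5 ≤ z) (hz1 : z ≤ 1) :
    1 - z ≤ Real.exp (-(1.04 * z)) := by
  have h := Real.one_sub_le_exp_neg (1.04 * z / 2)
  have h2 : Real.exp (-(1.04 * z)) = Real.exp (-(1.04 * z / 2)) ^ 2 := by
    rw [← Real.exp_nat_mul]; ring_nf
  rw [h2]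
  nlinarith

/-- The range below `1` for `1 / 2 < a < 1`, where a lower bound for the value `δ` at `X = 1` is
known. For `0 ≤ δ`, the term with `c` is at most the first entry of the maximum if `a ≤ 9 / 10`, and
at most `δ` otherwise. -/
lemma small_range_of_lt_one {a c D m δ X : ℝ} (ha : 1 / 2 < a) (ha1 : a < 1) (hX : 0 < X)
    (hX1 : X ≤ 1) (hc : 0 ≤ c) (hδ : m - D * (|a - 1| / (a - 1 / 2)) ≤ δ)
    (hm : 2 * c ≤ m + D) (hcD : 2 * c * Real.exp (-1.04) ≤ D)
    (hcm : 2 * c * Real.exp (-1) ≤ 0.8 * m - 0.2 * D) :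
    |δ + c * ((1 - X ^ (1 - a)) / (a - 1))| * X ^ (a - 1 / 2)
      ≤ max (D * (1 + |a - 1| / (a - 1 / 2))) |δ| := by
  set z := 2 * (1 - a) with hz
  have hz0 : 0 < z := by rw [hz]; linarith
  have hz1 : z < 1 := by rw [hz]; linarith
  have h1z : 0 < 1 - z := by linarith
  have hρ : |a - 1| / (a - 1 / 2) = z / (1 - z) := by
    rw [abs_of_neg (by linarith), hz, div_eq_div_iff (by linarith) (by linarith)]; ring
  have hρ1 : 1 + |a - 1| / (a - 1 / 2) = 1 / (1 - z) := by rw [hρ]; field_simp; ring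
  rw [hρ1]
  rw [hρ] at hδ
  set x := √X with hx
  have hx0 : 0 < x := Real.sqrt_pos.2 hX
  have hx1 : x ≤ 1 := Real.sqrt_le_one.2 hX1
  have hp : X ^ (a - 1 / 2) = x ^ (1 - z) := by
    rw [hx, Real.sqrt_eq_rpow, ← Real.rpow_mul hX.le, hz]; ring_nf
  have hp1 : X ^ (1 - a) * X ^ (a - 1 / 2) = x := by
    rw [← Real.rpow_add hX, hx, Real.sqrt_eq_rpow]; ring_nf
  have h0 : 0 < X ^ (a - 1 / 2) := Real.rpow_pos_of_pos hX _
  have h2 : X ^ (a - 1 / 2) ≤ 1 := Real.rpow_le_one hX.le hX1 (by linarith)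
  have hxx : x ≤ x ^ (1 - z) := by
    have := Real.rpow_le_rpow_of_exponent_ge hx0 hx1 (by linarith : 1 - z ≤ 1)
    rwa [Real.rpow_one] at this
  set ψ := 2 * c * ((x ^ (1 - z) - x) / z) with hψ
  have hψ0 : 0 ≤ ψ := by
    have : 0 ≤ x ^ (1 - z) - x := by linarith
    positivity
  have hψ2 : ψ ≤ 2 * c := by
    have h3 := Real.geom_mean_le_arith_mean2_weighted h1z.le hz0.le hx0.le zero_le_one (by ring)
    rw [Real.one_rpow] at h3
    have : (x ^ (1 - z) - x) / z ≤ 1 := by rw [div_le_one hz0]; nlinarith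
    rw [hψ]; nlinarith
  have hψl : ∀ l, 1 - z ≤ Real.exp (-(l * z)) → ψ ≤ 2 * c * Real.exp (-l) * (1 / (1 - z)) := by
    intro l hl
    have h3 := rpow_one_sub_sub_le hx0 hz0 hz1 hl
    have : (x ^ (1 - z) - x) / z ≤ Real.exp (-l) / (1 - z) := by
      rw [div_le_iff₀ hz0]; linarith
    calc ψ ≤ 2 * c * (Real.exp (-l) / (1 - z)) := by rw [hψ]; gcongr
      _ = _ := by ring
  have h7 : (δ + c * ((1 - X ^ (1 - a)) / (a - 1))) * X ^ (a - 1 / 2)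
      = δ * X ^ (a - 1 / 2) - ψ := by
    have e : a - 1 = -(z / 2) := by rw [hz]; ring
    rw [add_mul, hψ, mul_assoc c, div_mul_eq_mul_div, sub_mul, one_mul, hp1, hp, e]
    field_simp
    ring
  rw [← abs_of_pos h0, ← abs_mul, h7]
  have hρ0 : 0 ≤ z / (1 - z) := by positivity
  have hρ2 : 1 / (1 - z) = 1 + z / (1 - z) := by field_simp; ring
  have hz1' : 0 < 1 / (1 - z) := by positivity
  rcases le_or_gt 0 δ with hd | hd
  · rw [abs_of_nonneg hd]
    have hmain : ψ ≤ max (D * (1 / (1 - z))) δ := by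
      rcases le_or_gt (1 / 5) z with h | h
      · refine le_max_of_le_left ((hψl 1.04 (one_sub_le_exp h hz1.le)).trans ?_)
        gcongr
      · refine le_max_of_le_right ((hψl 1 ?_).trans (le_trans ?_ hδ))
        · have := Real.one_sub_le_exp_neg z
          simpa using this
        · rw [mul_one_div, div_le_iff₀ h1z, sub_mul, mul_assoc D, div_mul_cancel₀ _ h1z.ne']
          have hm0 : 0 ≤ m := by
            have : 0 ≤ 2 * c * Real.exp (-1) := by positivity
            nlinarith
          nlinarith
    rw [abs_le]
    constructor
    · have : 0 ≤ δ * X ^ (a - 1 / 2) := by positivity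
      linarith
    · refine le_max_of_le_right ?_
      nlinarith
  · refine le_max_of_le_left ?_
    rw [abs_le, hρ2]
    constructor <;> nlinarith

/-! ### The range `1 ≤ X < 2` -/

lemma two_rpow_tangent (t t₀ : ℝ) :
    (2 : ℝ) ^ (-t₀) * (1 - Real.log 2 * (t - t₀)) ≤ 2 ^ (-t) := by
  have h : (2 : ℝ) ^ (-t) = 2 ^ (-t₀) * Real.exp (-(Real.log 2 * (t - t₀))) := by
    rw [Real.rpow_def_of_pos two_pos, Real.rpow_def_of_pos two_pos, ← Real.exp_add]; ring_nf
  rw [h]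
  gcongr
  exact Real.one_sub_le_exp_neg _

/-- A bound for `(1 - u) / t` with `u = 2 ^ (-t)`, from the tangents of `u` at integers. -/
lemma one_sub_two_rpow_le {t : ℝ} (ht : 0 < t) :
    0.608 * (1 - (2 : ℝ) ^ (-t)) ≤ t * (0.132 + 0.465 * 2 ^ (-t)) := by
  have hu0 : 0 < (2 : ℝ) ^ (-t) := by positivity
  have l1 := Real.log_two_gt_d9
  have l2 := Real.log_two_lt_d9
  have key : ∀ u₀ t₀ : ℝ, (2 : ℝ) ^ (-t₀) = u₀ → 0 ≤ u₀ →
      u₀ * (1 - Real.log 2 * (t - t₀)) * (0.465 * t + 0.608) ≤ 2 ^ (-t) * (0.465 * t + 0.608) := by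
    intro u₀ t₀ h _
    have := two_rpow_tangent t t₀
    rw [h] at this
    gcongr
  suffices h : 0.608 - 0.132 * t ≤ 2 ^ (-t) * (0.465 * t + 0.608) by linarith
  rcases le_or_gt t 0.54 with h0 | h0
  · have := key 1 0 (by simp) zero_le_one
    have h5 : Real.log 2 * t * (0.465 * t + 0.608) ≤ 0.6932 * t * (0.465 * t + 0.608) := by
      gcongr; linarith
    nlinarith [mul_nonneg ht.le (sub_nonneg.2 h0)]
  rcases le_or_gt t 1.5 with h1 | h1
  · have := key (1 / 2) 1 (by rw [Real.rpow_neg two_pos.le]; norm_num) (by norm_num)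
    nlinarith [mul_nonneg (sub_nonneg.2 h0.le) (sub_nonneg.2 h1)]
  rcases le_or_gt t 2.5 with h2 | h2
  · have := key (1 / 4) 2 (by rw [Real.rpow_neg two_pos.le]; norm_num) (by norm_num)
    nlinarith [mul_nonneg (sub_nonneg.2 h1.le) (sub_nonneg.2 h2)]
  rcases le_or_gt t 3.5 with h3 | h3
  · have := key (1 / 8) 3 (by rw [Real.rpow_neg two_pos.le]; norm_num) (by norm_num)
    nlinarith [mul_nonneg (sub_nonneg.2 h2.le) (sub_nonneg.2 h3)]
  rcases le_or_gt t 4.61 with h4 | h4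
  · have := key (1 / 16) 4 (by rw [Real.rpow_neg two_pos.le]; norm_num) (by norm_num)
    nlinarith [mul_nonneg (sub_nonneg.2 h3.le) (sub_nonneg.2 h4)]
  · have : 0 ≤ (2 : ℝ) ^ (-t) * (0.465 * t + 0.608) := by positivity
    linarith

/-- The maximum is about `0.364`, near `a = 1.9`. -/
lemma ratio_mul_two_thirds_rpow_le {a : ℝ} (ha : 1 < a) :
    (a - 1) / (a - 1 / 2) * (2 / 3 : ℝ) ^ (a - 1 / 2) ≤ 0.373 := by
  set s := a - 1 / 2 with hs
  have hs0 : 1 / 2 < s := by rw [hs]; linarith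
  have hl : 0.405 ≤ Real.log (3 / 2) := by
    have h2 := abs_log_two_sub_le
    have h3 := abs_log_three_sub_le
    rw [Real.log_div (by norm_num) (by norm_num)]
    rw [abs_le] at h2 h3
    linarith
  have h1 : (2 / 3 : ℝ) ^ s ≤ 1 / (1 + 0.405 * s + (0.405 * s) ^ 2 / 2) := by
    have e : (2 / 3 : ℝ) ^ s = 1 / Real.exp (Real.log (3 / 2) * s) := by
      rw [show (2 / 3 : ℝ) = (3 / 2)⁻¹ by norm_num, Real.inv_rpow (by norm_num),
        Real.rpow_def_of_pos (by norm_num), one_div]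
    rw [e]
    have := Real.quadratic_le_exp_of_nonneg (by positivity : 0 ≤ 0.405 * s)
    have h2 : Real.exp (0.405 * s) ≤ Real.exp (Real.log (3 / 2) * s) := by gcongr
    gcongr
    linarith
  have h2 : (a - 1) / s = (s - 1 / 2) / s := by rw [hs]; ring
  rw [h2]
  have h3 : 0 ≤ (s - 1 / 2) / s := div_nonneg (by linarith) (by linarith)
  refine (mul_le_mul_of_nonneg_left h1 h3).trans ?_
  rw [div_mul_div_comm, div_le_iff₀ (by positivity)]
  nlinarith [mul_nonneg (by linarith : (0:ℝ) ≤ s - 1/2) (sq_nonneg (s - 1.4)),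
    sq_nonneg (s - 1.4), mul_nonneg (by linarith : (0:ℝ) ≤ s - 1/2) (by linarith : (0:ℝ) ≤ s)]

lemma powErr_eq_sub (v : ℕ) {a : ℝ} (ha1 : a ≠ 1) (X : ℝ) :
    powErr v a X = sqSumPow v a X - ((sqPolyR v a - sqLead v) / (a - 1)
      + sqLead v * ((1 - X ^ (1 - a)) / (a - 1))) := by
  rw [powErr]; field_simp [sub_ne_zero.2 ha1]; ring

lemma sqSumPow_of_lt_one (v : ℕ) (a : ℝ) {X : ℝ} (hX : X < 1) : sqSumPow v a X = 0 := by
  rw [sqSumPow, Nat.floor_eq_zero.2 hX]; simp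

lemma sqSumPow_one_of_lt_two (a : ℝ) {X : ℝ} (h1 : 1 ≤ X) (h2 : X < 2) : sqSumPow 1 a X = 1 := by
  have : ⌊X⌋₊ = 1 := (Nat.floor_eq_iff (by linarith)).2 ⟨by simpa, by norm_num; linarith⟩
  rw [sqSumPow, this]; simp [sqc_one_one]

lemma sqSumPow_one_two (a : ℝ) : sqSumPow 1 a 2 = 1 + 1 / 2 ^ a := by
  have : ⌊(2 : ℝ)⌋₊ = 2 := by simp
  rw [sqSumPow, this, sum_Ioc_succ_top (by norm_num)]
  simp [sqc_one_one, sqc_one_two]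

lemma sqSumPow_one_three (a : ℝ) : sqSumPow 1 a 3 = 1 + 1 / 2 ^ a + 1 / 3 ^ a := by
  have : ⌊(3 : ℝ)⌋₊ = 3 := by simp
  rw [sqSumPow, this, sum_Ioc_succ_top (by norm_num), sum_Ioc_succ_top (by norm_num)]
  simp [sqc_one_one, sqc_one_two, sqc_one_three]

lemma sqErr_one_two_bounds : 0.0347 ≤ sqErr 1 2 ∧ sqErr 1 2 ≤ 0.0348 := by
  have : ⌊(2 : ℝ)⌋₊ = 2 := by simp
  have h : sqErr 1 2 = 3 / 2 - (sqLead 1 * Real.log 2 + sqConst 1) := by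
    refine sqErr_eq_of_floor (n := 2) this ?_
    rw [sum_Ioc_succ_top (by norm_num)]
    simp [sqc_one_one, sqc_one_two]; norm_num
  obtain ⟨l1, l2⟩ := sqLead_one_bounds
  have hc := sqConst_one_bounds
  have h1 := Real.log_two_gt_d9
  have h2 := Real.log_two_lt_d9
  rw [abs_le] at hc
  rw [h]
  constructor <;> nlinarith

lemma sqErr_one_three_bounds : 0.1215 ≤ sqErr 1 3 ∧ sqErr 1 3 ≤ 0.1216 := by
  have : ⌊(3 : ℝ)⌋₊ = 3 := by simp
  have h : sqErr 1 3 = 11 / 6 - (sqLead 1 * Real.log 3 + sqConst 1) := by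
    refine sqErr_eq_of_floor (n := 3) this ?_
    rw [sum_Ioc_succ_top (by norm_num), sum_Ioc_succ_top (by norm_num)]
    simp [sqc_one_one, sqc_one_two, sqc_one_three]; norm_num
  obtain ⟨l1, l2⟩ := sqLead_one_bounds
  have hc := sqConst_one_bounds
  have h3 := abs_log_three_sub_le
  rw [abs_le] at hc h3
  rw [h]
  constructor <;> nlinarith

/-- The constant `A - B` in the sum of `ℓ ^ (-a)` over `ℓ ≤ X`, with main term
`A - B * X ^ (1 - a)`. -/
def powGap (v : ℕ) (a : ℝ) : ℝ := (sqPolyR v a - sqLead v) / (a - 1)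

lemma powErr_eq_powGap (v : ℕ) {a : ℝ} (ha1 : a ≠ 1) (X : ℝ) : powErr v a X
    = sqSumPow v a X - (powGap v a + sqLead v * ((1 - X ^ (1 - a)) / (a - 1))) :=
  powErr_eq_sub v ha1 X

lemma one_div_rpow_eq {x : ℝ} (hx : 0 < x) (a : ℝ) : 1 / x ^ a = x ^ (1 - a) / x := by
  rw [Real.rpow_sub hx, Real.rpow_one]; field_simp

lemma abs_powErr_one_two_sub_le {a : ℝ} (ha : 1 / 2 < a) (ha1 : a ≠ 1) :
    |powErr 1 a 2 - 2 ^ (1 - a) * sqErr 1 2|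
      ≤ 0.43 * (|a - 1| / (a - 1 / 2)) * 2 ^ (1 / 2 - a) :=
  abs_powErr_sub_le (Or.inl rfl) ha ha1 (by norm_num) fun _ ht => sqErr_one_le ht

/-- `A - B` expressed by the error term at `2`. -/
lemma powGap_one_eq {a : ℝ} (ha1 : a ≠ 1) : powGap 1 a
    = 1 + 2 ^ (1 - a) / 2 - sqLead 1 * ((1 - 2 ^ (1 - a)) / (a - 1)) - powErr 1 a 2 := by
  rw [powErr_eq_powGap 1 ha1, sqSumPow_one_two, one_div_rpow_eq two_pos]; ring

lemma ratio_nonneg {a : ℝ} (ha : 1 / 2 < a) : 0 ≤ |a - 1| / (a - 1 / 2) :=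
  div_nonneg (abs_nonneg _) (by linarith)

lemma ratio_lt_one {a : ℝ} (ha : 1 < a) : |a - 1| / (a - 1 / 2) < 1 := by
  rw [abs_of_pos (by linarith), div_lt_one (by linarith)]; linarith

/-- Bounds for `(1 - 2 ^ (1 - a)) / (a - 1)`. -/
lemma quot_two_le {a : ℝ} :
    (1 < a → (1 - (2 : ℝ) ^ (1 - a)) / (a - 1) ≤ Real.log 2) ∧
      (a < 1 → (1 - (2 : ℝ) ^ (1 - a)) / (a - 1) ≤ Real.log 2 * 2 ^ (1 - a)) := by
  obtain ⟨h1, h2⟩ := rpow_sub_rpow_le one_pos two_pos (a - 1)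
  rw [neg_sub, Real.one_rpow, Real.log_one, sub_zero] at h1 h2
  constructor
  · intro h
    rw [div_le_iff₀ (by linarith)]; linarith
  · intro h
    rw [div_le_iff_of_neg (by linarith)]; linarith

lemma half_sub_rpow (a : ℝ) : √2 * (2 : ℝ) ^ (1 / 2 - a) = 2 ^ (1 - a) := by
  rw [Real.sqrt_eq_rpow, ← Real.rpow_add two_pos]; ring_nf

lemma sqrt_two_bounds : 1.41421 ≤ √(2 : ℝ) ∧ √(2 : ℝ) ≤ 1.41422 := by
  constructor
  · apply Real.le_sqrt_of_sq_le; norm_num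
  · rw [Real.sqrt_le_left (by norm_num)]; norm_num

/-- Lower bounds for `A - B`, from the error term at `2`. -/
lemma powGap_one_ge_of_lt {a : ℝ} (ha : 1 / 2 < a) (ha1 : a < 1) :
    1.04 - 0.43 * (|a - 1| / (a - 1 / 2)) ≤ powGap 1 a := by
  have h1 := abs_powErr_one_two_sub_le ha ha1.ne
  have h2 := (@quot_two_le a).2 ha1
  obtain ⟨l1, l2⟩ := sqLead_one_bounds
  obtain ⟨e1, e2⟩ := sqErr_one_two_bounds
  have hl := Real.log_two_lt_d9
  rw [powGap_one_eq ha1.ne]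
  have hρ := ratio_nonneg ha
  have hr : (2 : ℝ) ^ (1 / 2 - a) ≤ 1 := Real.rpow_le_one_of_one_le_of_nonpos (by norm_num)
    (by linarith)
  have hu : 1 ≤ (2 : ℝ) ^ (1 - a) := Real.one_le_rpow (by norm_num) (by linarith)
  generalize |a - 1| / (a - 1 / 2) = ρ at *
  generalize (2 : ℝ) ^ (1 - a) = u at *
  generalize (2 : ℝ) ^ (1 / 2 - a) = r at *
  have h3 : sqLead 1 * ((1 - u) / (a - 1)) ≤ 0.4214 * u := by
    calc sqLead 1 * ((1 - u) / (a - 1)) ≤ sqLead 1 * (Real.log 2 * u) := by gcongr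
      _ ≤ 0.607927102 * (0.6931471808 * u) := by gcongr
      _ ≤ _ := by nlinarith
  have h4 : 0.43 * ρ * r ≤ 0.43 * ρ := by nlinarith
  rw [abs_le] at h1
  nlinarith

lemma powGap_one_ge_of_gt {a : ℝ} (ha : 1 < a) : 0.57 ≤ powGap 1 a := by
  have h1 := abs_powErr_one_two_sub_le (by linarith : 1 / 2 < a) ha.ne'
  have h2 := (@quot_two_le a).1 ha
  obtain ⟨l1, l2⟩ := sqLead_one_bounds
  obtain ⟨e1, e2⟩ := sqErr_one_two_bounds
  have hl := Real.log_two_lt_d9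
  rw [powGap_one_eq ha.ne']
  have hρ := ratio_nonneg (by linarith : 1 / 2 < a)
  have hρ1 := ratio_lt_one ha
  have hs := half_sub_rpow a
  obtain ⟨s1, s2⟩ := sqrt_two_bounds
  have hr0 : 0 < (2 : ℝ) ^ (1 / 2 - a) := by positivity
  generalize |a - 1| / (a - 1 / 2) = ρ at *
  generalize (2 : ℝ) ^ (1 - a) = u at *
  generalize (2 : ℝ) ^ (1 / 2 - a) = r at *
  have h3 : sqLead 1 * ((1 - u) / (a - 1)) ≤ 0.4214 := by
    calc sqLead 1 * ((1 - u) / (a - 1)) ≤ sqLead 1 * Real.log 2 := by gcongr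
      _ ≤ 0.607927102 * 0.6931471808 := by gcongr
      _ ≤ _ := by norm_num
  have h4 : 0.43 * ρ * r ≤ 0.43 * r := by nlinarith
  have h5 : 1.41421 * r ≤ u := by rw [← hs]; gcongr
  rw [abs_le] at h1
  nlinarith

/-- A lower bound for the error term at `2`, from its value at `3`. -/
lemma powErr_one_two_ge {a : ℝ} (ha : 1 < a) : -(0.43 * 0.373 + 0.0493)
    ≤ (2 : ℝ) ^ (a - 1 / 2) * (powErr 1 a 2 - 2 ^ (1 - a) * sqErr 1 2) := by
  have h3 : |powErr 1 a 3 - 3 ^ (1 - a) * sqErr 1 3|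
      ≤ 0.43 * (|a - 1| / (a - 1 / 2)) * 3 ^ (1 / 2 - a) :=
    abs_powErr_sub_le (Or.inl rfl) (by linarith) ha.ne' (by norm_num)
      fun _ ht => sqErr_one_le (by linarith)
  have hq : powErr 1 a 2 = powErr 1 a 3 - 3 ^ (1 - a) / 3
      + sqLead 1 * ((2 ^ (1 - a) - 3 ^ (1 - a)) / (a - 1)) := by
    rw [powErr_eq_powGap 1 ha.ne', powErr_eq_powGap 1 ha.ne', sqSumPow_one_two, sqSumPow_one_three,
      one_div_rpow_eq two_pos, one_div_rpow_eq three_pos]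
    ring
  have hlog : 0.4 * (3 : ℝ) ^ (1 - a) ≤ (2 ^ (1 - a) - 3 ^ (1 - a)) / (a - 1) := by
    obtain ⟨-, h2⟩ := rpow_sub_rpow_le two_pos three_pos (a - 1)
    rw [neg_sub] at h2
    rw [le_div_iff₀ (by linarith)]
    refine le_trans ?_ h2
    have l2 := abs_log_two_sub_le
    have l3 := abs_log_three_sub_le
    rw [abs_le] at l2 l3
    have : 0 < (3 : ℝ) ^ (1 - a) := by positivity
    rw [mul_comm, ← mul_assoc]
    gcongr
    linarith
  have hR := half_sub_rpow a
  have hRr : (2 : ℝ) ^ (a - 1 / 2) * 2 ^ (1 / 2 - a) = 1 := by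
    rw [← Real.rpow_add two_pos]; ring_nf; simp
  have hR3 : (2 : ℝ) ^ (a - 1 / 2) * 3 ^ (1 / 2 - a) = (2 / 3) ^ (a - 1 / 2) := by
    rw [Real.div_rpow two_pos.le three_pos.le, show 1 / 2 - a = -(a - 1 / 2) by ring,
      Real.rpow_neg three_pos.le]
    rfl
  have hb := ratio_mul_two_thirds_rpow_le ha
  rw [← abs_of_pos (by linarith : 0 < a - 1)] at hb
  obtain ⟨l1, l2⟩ := sqLead_one_bounds
  obtain ⟨e1, e2⟩ := sqErr_one_two_bounds
  obtain ⟨f1, f2⟩ := sqErr_one_three_bounds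
  obtain ⟨s1, s2⟩ := sqrt_two_bounds
  have hR0 : 0 < (2 : ℝ) ^ (a - 1 / 2) := by positivity
  have hw0 : 0 < (3 : ℝ) ^ (1 - a) := by positivity
  rw [hq]
  rw [abs_of_pos (by linarith : 0 < a - 1)] at *
  generalize (a - 1) / (a - 1 / 2) = ρ at *
  rw [← hR3] at hb
  rw [← hR]
  rw [← hR] at hlog
  generalize (2 : ℝ) ^ (a - 1 / 2) = R at *
  generalize (2 : ℝ) ^ (1 / 2 - a) = r at *
  generalize (3 : ℝ) ^ (1 / 2 - a) = r3 at *
  generalize (3 : ℝ) ^ (1 - a) = w at *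
  generalize (√2 * r - w) / (a - 1) = Q at *
  have h4 : 0.24 * w ≤ sqLead 1 * Q := by
    calc 0.24 * w ≤ 0.6079271017 * (0.4 * w) := by nlinarith
      _ ≤ sqLead 1 * Q := by gcongr
  rw [abs_le] at h3
  have h5 : -(0.43 * ρ * r3) - √2 * r * sqErr 1 2
      ≤ powErr 1 a 3 - w / 3 + sqLead 1 * Q - √2 * r * sqErr 1 2 := by nlinarith [h3.1]
  have h6 : R * (√2 * r * sqErr 1 2) ≤ 0.0493 := by
    calc R * (√2 * r * sqErr 1 2) = (R * r) * (√2 * sqErr 1 2) := by ring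
      _ = √2 * sqErr 1 2 := by rw [hRr, one_mul]
      _ ≤ 1.41422 * 0.0348 := by gcongr
      _ ≤ _ := by norm_num
  calc -(0.43 * 0.373 + 0.0493) ≤ -(0.43 * (ρ * (R * r3))) - R * (√2 * r * sqErr 1 2) := by
        linarith
    _ = R * (-(0.43 * ρ * r3) - √2 * r * sqErr 1 2) := by ring
    _ ≤ _ := by gcongr

/-- The supremum of `-E(X) X ^ (a - 1 / 2)` over `1 ≤ X < 2`, where `E` is the error term, is
at most `A - B`. -/
lemma neg_powErr_le_powGap {a : ℝ} (ha : 1 / 2 < a) (ha1 : a ≠ 1) :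
    √2 * (1 / 2 - sqErr 1 2) - 2 ^ (a - 1 / 2) * (powErr 1 a 2 - 2 ^ (1 - a) * sqErr 1 2)
      ≤ powGap 1 a := by
  have hθ := abs_powErr_one_two_sub_le ha ha1
  have hG := powGap_one_eq ha1
  have hge := @powErr_one_two_ge a
  have hqt := @quot_two_le a
  have hRr : (2 : ℝ) ^ (a - 1 / 2) * 2 ^ (1 / 2 - a) = 1 := by
    rw [← Real.rpow_add two_pos]; ring_nf; simp
  have hr0 : 0 < (2 : ℝ) ^ (1 / 2 - a) := by positivity
  have hR0 : 0 < (2 : ℝ) ^ (a - 1 / 2) := by positivity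
  have hr1 : (2 : ℝ) ^ (1 / 2 - a) ≤ 1 := Real.rpow_le_one_of_one_le_of_nonpos (by norm_num)
    (by linarith)
  have hr2 : (2 : ℝ) ^ (1 / 2 - a) ≥ 1 - Real.log 2 * (a - 1 / 2) := by
    have := two_rpow_tangent (a - 1 / 2) 0
    simpa using this
  have h608 := @one_sub_two_rpow_le (a - 1)
  rw [neg_sub] at h608
  have hρ := ratio_nonneg ha
  have hρ' : a < 1 → |a - 1| / (a - 1 / 2) * (a - 1 / 2) ≤ 1 / 2 := fun h => by
    rw [div_mul_cancel₀ _ (by linarith), abs_of_neg (by linarith)]; linarith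
  obtain ⟨l1, l2⟩ := sqLead_one_bounds
  obtain ⟨e1, e2⟩ := sqErr_one_two_bounds
  obtain ⟨s1, s2⟩ := sqrt_two_bounds
  have hl1 := Real.log_two_gt_d9
  have hl2 := Real.log_two_lt_d9
  have hu0 : 0 < (2 : ℝ) ^ (1 - a) := by positivity
  have hu1 : a < 1 → 1 ≤ (2 : ℝ) ^ (1 - a) := fun h => Real.one_le_rpow (by norm_num) (by linarith)
  have hu2 : 1 < a → (2 : ℝ) ^ (1 - a) ≤ 1 := fun h =>
    Real.rpow_le_one_of_one_le_of_nonpos (by norm_num) (by linarith)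
  rw [hG]
  generalize |a - 1| / (a - 1 / 2) = ρ at *
  generalize (2 : ℝ) ^ (a - 1 / 2) = R at *
  generalize (2 : ℝ) ^ (1 / 2 - a) = r at *
  generalize (2 : ℝ) ^ (1 - a) = u at *
  generalize sqErr 1 2 = e at *
  generalize powErr 1 a 2 = E at *
  obtain ⟨θ, rfl⟩ : ∃ θ, E = θ + u * e := ⟨E - u * e, by ring⟩
  rw [add_sub_cancel_right] at *
  have hRθ : -(R * θ) ≤ 0.43 * ρ := by
    have h3 : R * (0.43 * ρ * r) = 0.43 * ρ := by
      calc R * (0.43 * ρ * r) = 0.43 * ρ * (R * r) := by ring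
        _ = _ := by rw [hRr, mul_one]
    rw [← h3, ← mul_neg]
    gcongr
    exact (neg_le_abs θ).trans hθ
  have hθr : θ = r * (R * θ) := by
    calc θ = (R * r) * θ := by rw [hRr, one_mul]
      _ = _ := by ring
  have hs : √2 * (1 / 2 - e) ≤ 0.6581 := by
    calc √2 * (1 / 2 - e) ≤ 1.41422 * (0.4653) := by
          gcongr
          · linarith
          · linarith
      _ ≤ _ := by norm_num
  have hue : u * e ≤ u * 0.0348 := by gcongr
  generalize R * θ = τ at *
  have hfin : ∀ M : ℝ, sqLead 1 * ((1 - u) / (a - 1)) ≤ M → -τ * (1 - r) ≤ 0.3419 + 0.4652 * u - M →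
      √2 * (1 / 2 - e) - τ ≤ 1 + u / 2 - sqLead 1 * ((1 - u) / (a - 1)) - (θ + u * e) := by
    intro M hM h
    rw [hθr]
    linarith
  -- For `a < 1` the factor `1 - r` makes up for the growth of `ρ` as `a` tends to `1 / 2`; for `a > 1`
  -- the bound `0.43 ρ` for `-τ` is too weak, and `powErr_one_two_ge` takes its place.
  rcases lt_or_gt_of_ne ha1 with h | h
  · have hq := hqt.2 h
    refine hfin (0.4214 * u) ?_ ?_
    · calc sqLead 1 * ((1 - u) / (a - 1)) ≤ sqLead 1 * (Real.log 2 * u) := by gcongr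
        _ ≤ 0.607927102 * (0.6931471808 * u) := by gcongr
        _ ≤ _ := by linarith
    · have h4 : -τ * (1 - r) ≤ 0.15 := by
        calc -τ * (1 - r) ≤ (0.43 * ρ) * (1 - r) := by gcongr
          _ ≤ 0.43 * ρ * (Real.log 2 * (a - 1 / 2)) := by gcongr; linarith
          _ = 0.43 * Real.log 2 * (ρ * (a - 1 / 2)) := by ring
          _ ≤ 0.43 * 0.6931471808 * (1 / 2) := by
              have := hρ' h
              have : 0 ≤ ρ * (a - 1 / 2) := mul_nonneg hρ (by linarith)
              gcongr
          _ ≤ _ := by norm_num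
      linarith [hu1 h]
  · have hq := h608 (by linarith)
    refine hfin (0.132 + 0.465 * u) ?_ ?_
    · have h5 : 0.608 * ((1 - u) / (a - 1)) ≤ 0.132 + 0.465 * u := by
        rw [← mul_div_assoc, div_le_iff₀ (by linarith)]; linarith
      have h6 : 0 ≤ (1 - u) / (a - 1) := div_nonneg (by linarith [hu2 h]) (by linarith)
      have h7 : sqLead 1 * ((1 - u) / (a - 1)) ≤ 0.608 * ((1 - u) / (a - 1)) := by
        gcongr; linarith
      linarith
    · have h5 := hge h
      have h6 : -τ * (1 - r) ≤ (0.43 * 0.373 + 0.0493) * 1 := by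
        gcongr
        · linarith
        · linarith
      linarith

/-- The range `1 ≤ X < 2` for `v = 1`, where the sum consists of the term at `1` only. The pointwise
bound for `sqErr` is not available here, so the error term is compared with its value at `2`. -/
lemma powErr_one_of_lt_two {a : ℝ} (ha : 1 / 2 < a) (ha1 : a ≠ 1) {X : ℝ} (h1 : 1 ≤ X)
    (h2 : X < 2) : |powErr 1 a X| * X ^ (a - 1 / 2)
      ≤ max (0.43 * (1 + |a - 1| / (a - 1 / 2))) |powGap 1 a| := by
  have hX : 0 < X := by linarith
  have hθ := abs_powErr_one_two_sub_le ha ha1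
  have hE : powErr 1 a X = powErr 1 a 2 - 2 ^ (1 - a) / 2
      + sqLead 1 * ((X ^ (1 - a) - 2 ^ (1 - a)) / (a - 1)) := by
    rw [powErr_eq_powGap 1 ha1, powErr_eq_powGap 1 ha1, sqSumPow_one_two,
      sqSumPow_one_of_lt_two a h1 h2, one_div_rpow_eq two_pos]
    ring
  obtain ⟨q1, q2⟩ := rpow_sub_rpow_le hX two_pos (a - 1)
  rw [neg_sub] at q1 q2
  have hlogX : Real.log X ≤ Real.log 2 := Real.log_le_log hX h2.le
  have hlogX0 := Real.log_nonneg h1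
  have hQ0 : 0 ≤ (X ^ (1 - a) - 2 ^ (1 - a)) / (a - 1) := by
    rcases lt_or_gt_of_ne ha1 with h | h
    · rw [← neg_div_neg_eq]
      refine div_nonneg ?_ (by linarith)
      have := Real.rpow_le_rpow hX.le h2.le (by linarith : 0 ≤ 1 - a)
      linarith
    · refine div_nonneg ?_ (by linarith)
      have := Real.rpow_le_rpow_of_nonpos hX h2.le (by linarith : 1 - a ≤ 0)
      linarith
  have hR := half_sub_rpow a
  have hRr : (2 : ℝ) ^ (a - 1 / 2) * 2 ^ (1 / 2 - a) = 1 := by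
    rw [← Real.rpow_add two_pos]; ring_nf; simp
  have hT0 : 0 < X ^ (a - 1 / 2) := Real.rpow_pos_of_pos hX _
  have hTR : X ^ (a - 1 / 2) ≤ 2 ^ (a - 1 / 2) :=
    Real.rpow_le_rpow hX.le h2.le (by linarith)
  have hTX : X ^ (a - 1 / 2) * X ^ (1 - a) = √X := by
    rw [← Real.rpow_add hX, Real.sqrt_eq_rpow]; ring_nf
  have hr0 : 0 < (2 : ℝ) ^ (1 / 2 - a) := by positivity
  have hr1 : (2 : ℝ) ^ (1 / 2 - a) ≤ 1 := Real.rpow_le_one_of_one_le_of_nonpos (by norm_num)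
    (by linarith)
  have hρ := ratio_nonneg ha
  obtain ⟨l1, l2⟩ := sqLead_one_bounds
  obtain ⟨e1, e2⟩ := sqErr_one_two_bounds
  obtain ⟨s1, s2⟩ := sqrt_two_bounds
  have hl1 := Real.log_two_gt_d9
  have hl2 := Real.log_two_lt_d9
  have hsX : √X * (Real.log 2 - Real.log X) ≤ Real.log 2 := by
    have h3 := Real.one_sub_inv_le_log_of_pos (Real.sqrt_pos.2 hX)
    rw [Real.log_sqrt hX.le] at h3
    have h4 : 1 ≤ √X := Real.one_le_sqrt.2 h1
    have h5 : √X * (1 - (√X)⁻¹) ≤ √X * (Real.log X / 2) := by gcongr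
    rw [mul_sub, mul_inv_cancel₀ (by linarith)] at h5
    have h6 : 0 ≤ (√X - 1) * (2 - Real.log 2) := mul_nonneg (by linarith) (by linarith)
    linarith
  rw [← abs_of_pos hT0, ← abs_mul, abs_le]
  set ρ := |a - 1| / (a - 1 / 2) with hρdef
  set Q := (X ^ (1 - a) - 2 ^ (1 - a)) / (a - 1) with hQ
  set R := (2 : ℝ) ^ (a - 1 / 2) with hRdef
  set r := (2 : ℝ) ^ (1 / 2 - a) with hrdef
  set T := X ^ (a - 1 / 2) with hTdef
  set u := (2 : ℝ) ^ (1 - a) with hu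
  set e := sqErr 1 2 with he
  set θ := powErr 1 a 2 - u * e with hθdef
  have hu0 : 0 < u := by rw [hu]; positivity
  have hE2 : powErr 1 a 2 = θ + u * e := by rw [hθdef]; ring
  rw [hE2] at hE
  rw [abs_le] at hθ
  have hR0 : 0 < R := hT0.trans_le hTR
  have hTr : T * r ≤ 1 := by rw [← hRr]; gcongr
  have hRθ : R * θ ≤ 0.43 * ρ ∧ -(0.43 * ρ) ≤ R * θ := by
    have h3 : R * (0.43 * ρ * r) = 0.43 * ρ := by
      calc R * (0.43 * ρ * r) = 0.43 * ρ * (R * r) := by ring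
        _ = _ := by rw [hRr, mul_one]
    constructor
    · rw [← h3]; gcongr; exact hθ.2
    · rw [← h3, ← mul_neg]; gcongr; exact hθ.1
  constructor
  · -- The lower bound: the maximum of `-E(X) X ^ (a - 1 / 2)` is approached as `X` tends to `2`.
    have hK : √2 * (1 / 2 - e) - R * θ ≤ |powGap 1 a| :=
      (neg_powErr_le_powGap ha ha1).trans (le_abs_self _)
    rcases le_or_gt 0 (u / 2 - u * e - θ) with h | h
    · have h3 : T * (u / 2 - u * e - θ) ≤ R * (u / 2 - u * e - θ) := by gcongr
      have h4 : R * (u / 2 - u * e - θ) = √2 * (1 / 2 - e) - R * θ := by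
        calc R * (u / 2 - u * e - θ) = (R * r) * (√2 * (1 / 2 - e)) - R * θ := by
              rw [← hR]; ring
          _ = _ := by rw [hRr, one_mul]
      have h5 : 0 ≤ T * (sqLead 1 * Q) := by
        have : 0 ≤ sqLead 1 := by linarith
        positivity
      have h6 := le_max_right (0.43 * (1 + ρ)) |powGap 1 a|
      have h7 : powErr 1 a X * T = T * (sqLead 1 * Q) - T * (u / 2 - u * e - θ) := by
        rw [hE]; ring
      rw [h7]
      linarith
    · have h3 : 0 ≤ powErr 1 a X * T := by
        rw [hE]
        have : 0 ≤ sqLead 1 * Q := mul_nonneg (by linarith) hQ0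
        have : 0 ≤ θ + u * e - u / 2 + sqLead 1 * Q := by linarith
        positivity
      have h4 := le_max_right (0.43 * (1 + ρ)) |powGap 1 a|
      have h5 := abs_nonneg (powGap 1 a)
      linarith
  · -- The upper bound: the contributions of `θ` and of the main term are estimated separately.
    refine le_max_of_le_left ?_
    have hTθ : T * θ ≤ 0.43 * ρ := by
      rcases le_or_gt 0 θ with h | h
      · exact (mul_le_mul_of_nonneg_right hTR h).trans hRθ.1
      · have : T * θ ≤ 0 := mul_nonpos_of_nonneg_of_nonpos hT0.le h.le
        have : 0 ≤ 0.43 * ρ := by positivity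
        linarith
    have hmain : T * (u * e - u / 2 + sqLead 1 * Q) ≤ 0.43 := by
      rcases lt_or_gt_of_ne ha1 with h | h
      · have h3 : Q ≤ Real.log 2 * u := by
          rw [hQ, div_le_iff_of_neg (by linarith)]
          have h6 : (a - 1) * (Real.log X * u) ≤ 0 :=
            mul_nonpos_of_nonpos_of_nonneg (by linarith) (by positivity)
          have h7 : (a - 1) * (Real.log 2 - Real.log X) * u
              = Real.log 2 * u * (a - 1) - (a - 1) * (Real.log X * u) := by ring
          linarith
        have h4 : sqLead 1 * Q ≤ 0.4214 * u := by
          calc sqLead 1 * Q ≤ sqLead 1 * (Real.log 2 * u) := by gcongr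
            _ ≤ 0.607927102 * (0.6931471808 * u) := by gcongr
            _ ≤ _ := by linarith
        have h6 : u * e ≤ u * 0.0348 := by gcongr
        have h5 : u * e - u / 2 + sqLead 1 * Q ≤ 0 := by linarith
        have := mul_nonpos_of_nonneg_of_nonpos hT0.le h5
        linarith
      · have h3 : Q ≤ (Real.log 2 - Real.log X) * X ^ (1 - a) := by
          rw [hQ, div_le_iff₀ (by linarith)]; linarith
        have h4 : T * Q ≤ Real.log 2 := by
          calc T * Q ≤ T * ((Real.log 2 - Real.log X) * X ^ (1 - a)) := by gcongr
            _ = (T * X ^ (1 - a)) * (Real.log 2 - Real.log X) := by ring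
            _ ≤ _ := by rw [hTX]; exact hsX
        have h5 : sqLead 1 * (T * Q) ≤ 0.43 := by
          calc sqLead 1 * (T * Q) ≤ sqLead 1 * Real.log 2 := by gcongr
            _ ≤ 0.607927102 * 0.6931471808 := by gcongr
            _ ≤ _ := by norm_num
        have h6 : T * (u * e - u / 2) ≤ 0 :=
          mul_nonpos_of_nonneg_of_nonpos hT0.le (by
            have h6 : u * e ≤ u * 0.0348 := by gcongr
            linarith)
        have h7 : T * (u * e - u / 2 + sqLead 1 * Q)
            = T * (u * e - u / 2) + sqLead 1 * (T * Q) := by ring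
        linarith
    have h7 : powErr 1 a X * T = T * θ + T * (u * e - u / 2 + sqLead 1 * Q) := by
      rw [hE]; ring
    rw [h7]
    linarith

/-! ### The constants for the squarefree integers coprime to `v` -/

lemma phiGen_half_one : phiGen (1 / 2) 1 = 1 := by simp [phiGen]

lemma phiGen_half_two : phiGen (1 / 2) 2 = √2 - 1 := by
  have h : (√2 : ℝ) ≠ 0 := by positivity
  rw [phiGen, Nat.prime_two.primeFactors, prod_singleton, ← Real.sqrt_eq_rpow]
  push_cast
  field_simp

lemma sqrt_div_phiGen_one : √((1 : ℕ) : ℝ) / phiGen (1 / 2) 1 = 1 := by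
  rw [phiGen_half_one]; simp

lemma sqrt_div_phiGen_two : √((2 : ℕ) : ℝ) / phiGen (1 / 2) 2 = 2 + √2 := by
  obtain ⟨s1, -⟩ := sqrt_two_bounds
  rw [phiGen_half_two]
  push_cast
  rw [div_eq_iff (by linarith)]
  nlinarith [Real.sq_sqrt (show (0 : ℝ) ≤ 2 by norm_num)]

lemma powErr_eq_neg_of_lt_one (v : ℕ) {a : ℝ} (ha1 : a ≠ 1) {X : ℝ} (hX : X < 1) : powErr v a X
    = -(powGap v a + sqLead v * ((1 - X ^ (1 - a)) / (a - 1))) := by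
  rw [powErr_eq_powGap v ha1, sqSumPow_of_lt_one v a hX, zero_sub]

/-- Partial summation from a pointwise bound for `sqErr`. -/
lemma abs_powErr_mul_le_of_sqErr {v : ℕ} (hv : v = 1 ∨ v = 2) {a : ℝ} (ha : 1 / 2 < a)
    (ha1 : a ≠ 1) {X D : ℝ} (hX : 1 ≤ X) (hD : ∀ t, X ≤ t → √t * |sqErr v t| ≤ D) :
    |powErr v a X| * X ^ (a - 1 / 2) ≤ D * (1 + |a - 1| / (a - 1 / 2)) := by
  have hX0 : 0 < X := by linarith
  have h1 := abs_powErr_sub_le hv ha ha1 hX hD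
  have h2 := hD X le_rfl
  have h3 : X ^ (1 - a) * X ^ (a - 1 / 2) = √X := by
    rw [← Real.rpow_add hX0, Real.sqrt_eq_rpow]; ring_nf
  have h4 : X ^ (1 / 2 - a) * X ^ (a - 1 / 2) = 1 := by
    rw [← Real.rpow_add hX0]; ring_nf; simp
  have h5 : |powErr v a X| ≤ X ^ (1 - a) * |sqErr v X|
      + D * (|a - 1| / (a - 1 / 2)) * X ^ (1 / 2 - a) := by
    have h6 := abs_add_le (powErr v a X - X ^ (1 - a) * sqErr v X) (X ^ (1 - a) * sqErr v X)
    rw [sub_add_cancel, abs_mul, abs_of_pos (Real.rpow_pos_of_pos hX0 _)] at h6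
    linarith
  calc |powErr v a X| * X ^ (a - 1 / 2) ≤ (X ^ (1 - a) * |sqErr v X|
      + D * (|a - 1| / (a - 1 / 2)) * X ^ (1 / 2 - a)) * X ^ (a - 1 / 2) := by gcongr
    _ = (X ^ (1 - a) * X ^ (a - 1 / 2)) * |sqErr v X|
        + D * (|a - 1| / (a - 1 / 2)) * (X ^ (1 / 2 - a) * X ^ (a - 1 / 2)) := by ring
    _ = √X * |sqErr v X| + D * (|a - 1| / (a - 1 / 2)) := by rw [h3, h4, mul_one]
    _ ≤ _ := by linarith

lemma exp_neg_one_le : Real.exp (-1) ≤ 0.36788 := by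
  rw [Real.exp_neg, inv_le_comm₀ (Real.exp_pos _) (by norm_num)]
  have := Real.exp_one_gt_d9
  norm_num at *
  linarith

lemma exp_neg_const_le : Real.exp (-1.04) ≤ 0.3535 := by
  have h : Real.exp (-1.04) = Real.exp (-1) * Real.exp (-0.04) := by
    rw [← Real.exp_add]; norm_num
  have h2 : Real.exp (-0.04) ≤ 1 / 1.0408 := by
    rw [Real.exp_neg, ← one_div]
    have := Real.quadratic_le_exp_of_nonneg (show (0 : ℝ) ≤ 0.04 by norm_num)
    gcongr
    norm_num at *
    linarith
  rw [h]
  calc Real.exp (-1) * Real.exp (-0.04) ≤ 0.36788 * (1 / 1.0408) := by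
        gcongr
        exact exp_neg_one_le
    _ ≤ _ := by norm_num

lemma abs_powErr_one_le {a : ℝ} (ha : 1 / 2 < a) (ha1 : a ≠ 1) {X : ℝ} (hX : 0 < X) :
    |powErr 1 a X| * X ^ (a - 1 / 2)
      ≤ max (0.43 * (1 + |a - 1| / (a - 1 / 2))) |powGap 1 a| := by
  obtain ⟨l1, l2⟩ := sqLead_one_bounds
  rcases lt_or_ge X 1 with h | h
  · rw [powErr_eq_neg_of_lt_one 1 ha1 h, abs_neg]
    have he := exp_neg_one_le
    have he' := exp_neg_const_le
    rcases lt_or_gt_of_ne ha1 with h1 | h1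
    · refine small_range_of_lt_one (m := 1.04) ha h1 hX h.le (by linarith)
        (powGap_one_ge_of_lt ha h1) (by linarith) ?_ ?_
      · nlinarith [Real.exp_pos (-1.04)]
      · nlinarith [Real.exp_pos (-1)]
    · refine (small_range_of_one_lt h1 hX h.le (by linarith) ?_).trans
        (le_max_of_le_right (le_abs_self _))
      refine le_trans ?_ (powGap_one_ge_of_gt h1)
      nlinarith [Real.exp_pos (-1)]
  rcases lt_or_ge X 2 with h2 | h2
  · exact powErr_one_of_lt_two ha ha1 h h2
  · exact le_max_of_le_left (abs_powErr_mul_le_of_sqErr (Or.inl rfl) ha ha1 h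
      fun t ht => sqErr_one_le (h2.trans ht))

lemma powGap_two_ge {a : ℝ} (ha : 1 / 2 < a) (ha1 : a ≠ 1) :
    0.789 - 0.4097 * (|a - 1| / (a - 1 / 2)) ≤ powGap 2 a := by
  have h1 := abs_powErr_sub_le (Or.inr rfl) ha ha1 le_rfl fun t ht => sqErr_two_le ht
  have h2 : sqErr 2 1 = 1 - (sqLead 2 * Real.log 1 + sqConst 2) :=
    sqErr_eq_of_floor (n := 1) (by simp) (by simp [sqc_two_one])
  have h3 : powErr 2 a 1 = 1 - powGap 2 a := by
    have : sqSumPow 2 a 1 = 1 := by simp [sqSumPow, sqc_two_one]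
    rw [powErr_eq_powGap 2 ha1, this]; simp
  have hc := sqConst_two_bounds
  rw [Real.one_rpow, Real.one_rpow, one_mul, mul_one, h2, h3, Real.log_one] at h1
  rw [abs_le] at h1 hc
  linarith

lemma abs_powErr_two_le {a : ℝ} (ha : 1 / 2 < a) (ha1 : a ≠ 1) {X : ℝ} (hX : 0 < X) :
    |powErr 2 a X| * X ^ (a - 1 / 2)
      ≤ max (0.4097 * (1 + |a - 1| / (a - 1 / 2))) |powGap 2 a| := by
  obtain ⟨l1, l2⟩ := sqLead_two_bounds
  rcases lt_or_ge X 1 with h | h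
  · rw [powErr_eq_neg_of_lt_one 2 ha1 h, abs_neg]
    have he := exp_neg_one_le
    have he' := exp_neg_const_le
    have hg := powGap_two_ge ha ha1
    rcases lt_or_gt_of_ne ha1 with h1 | h1
    · refine small_range_of_lt_one (m := 0.789) ha h1 hX h.le (by linarith)
        hg (by linarith) ?_ ?_
      · nlinarith [Real.exp_pos (-1.04)]
      · nlinarith [Real.exp_pos (-1)]
    · refine (small_range_of_one_lt h1 hX h.le (by linarith) ?_).trans
        (le_max_of_le_right (le_abs_self _))
      refine le_trans ?_ hg
      have := ratio_lt_one h1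
      nlinarith [Real.exp_pos (-1)]
  · exact le_max_of_le_left (abs_powErr_mul_le_of_sqErr (Or.inr rfl) ha ha1 h
      fun t ht => sqErr_two_le (h.trans ht))

/-- The real value of `kap`. -/
def kapR (v : ℕ) (a : ℝ) : ℝ := if v = 2 then 1 + 1 / 2 ^ a else 1

lemma kapR_pos (v : ℕ) (a : ℝ) : 0 < kapR v a := by
  unfold kapR; split_ifs <;> positivity

lemma kap_ofReal (v : ℕ) (a : ℝ) : kap v a = (kapR v a : ℂ) := by
  unfold kap kapR
  split_ifs
  · push_cast
    rw [Complex.ofReal_cpow zero_le_two]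
    norm_num
  · simp

lemma rpow_div_kappaGen {v : ℕ} (hv : v = 1 ∨ v = 2) (a : ℝ) :
    (v : ℝ) ^ a / kappaGen a v = 1 / kapR v a := by
  rcases hv with rfl | rfl
  · simp [kappaGen, kapR]
  · have : (2 : ℝ) ^ a ≠ 0 := by positivity
    rw [kappaGen, Nat.prime_two.primeFactors, prod_singleton, kapR, if_pos rfl]
    push_cast
    rw [div_mul_eq_div_div, div_self this]

lemma zetaReal_pos {a : ℝ} (ha : 1 < a) : 0 < zetaReal a :=
  riemannZeta_re_pos_of_one_lt ha

/-- The real form of `sqPoly_mul`. -/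
lemma sqPolyR_mul {v : ℕ} (hv : v = 1 ∨ v = 2) {a : ℝ} (ha : 1 / 2 < a) (ha1 : a ≠ 1) :
    sqPolyR v a * (zetaReal (2 * a) * kapR v a) = (a - 1) * zetaReal a := by
  have h := sqPoly_mul hv (s := (a : ℂ)) (by simpa using ha)
  have hz : riemannZeta (2 * (a : ℂ)) = (zetaReal (2 * a) : ℂ) := by
    apply Complex.ext
    · rw [zetaReal, Complex.ofReal_re]; push_cast; rfl
    · rw [Complex.ofReal_im]
      exact_mod_cast riemannZeta_im_eq_zero_of_one_lt (x := 2 * a) (by linarith)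
  have h1 : riemannZeta₁ a = ((a - 1 : ℝ) : ℂ) * riemannZeta a := by
    have hne : (a : ℂ) - 1 ≠ 0 := by
      rw [sub_ne_zero]; exact_mod_cast ha1
    rw [riemannZeta_eq_inv_sub_mul (by exact_mod_cast ha1)]
    push_cast
    rw [← mul_assoc, mul_inv_cancel₀ hne, one_mul]
  rw [sqPoly_ofReal, kap_ofReal, hz, h1] at h
  have := congrArg Complex.re h
  rw [← Complex.ofReal_mul, ← Complex.ofReal_mul, Complex.ofReal_re, Complex.re_ofReal_mul] at this
  exact this

lemma sqLead_eq {v : ℕ} (hv : v = 1 ∨ v = 2) :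
    sqLead v = v / kappaGen 1 v * (6 / Real.pi ^ 2) := by
  have := rpow_div_kappaGen hv 1
  rw [Real.rpow_one] at this
  rw [this]
  rcases hv with rfl | rfl
  · rw [sqLead, mucC_mucD_one.1]; simp [kapR]
  · rw [sqLead, mucC_mucD_two.1]; norm_num [kapR]; ring

/-- `A - B` is the quantity in the second entry of the maximum in `constE`. -/
lemma powGap_eq {v : ℕ} (hv : v = 1 ∨ v = 2) {a : ℝ} (ha : 1 / 2 < a) (ha1 : a ≠ 1) :
    powGap v a = (v : ℝ) ^ a / kappaGen a v * (zetaReal a / zetaReal (2 * a))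
      - v / kappaGen 1 v * (6 / ((a - 1) * Real.pi ^ 2)) := by
  have h := sqPolyR_mul hv ha ha1
  have h1 := kapR_pos v a
  have h2 := zetaReal_pos (a := 2 * a) (by linarith)
  have h3 : a - 1 ≠ 0 := sub_ne_zero.2 ha1
  have h4 : sqPolyR v a / (a - 1) = 1 / kapR v a * (zetaReal a / zetaReal (2 * a)) := by
    rw [div_mul_div_comm, one_mul, div_eq_div_iff h3 (by positivity)]
    linarith
  rw [powGap, sub_div, rpow_div_kappaGen hv, h4, sqLead_eq hv]
  congr 1
  field_simp

/-- The constant in the base case: the bound for the error in the sum over the squarefree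
integers coprime to `v`. -/
def baseW (a : ℝ) (v : ℕ) : ℝ := constE a v * (√(v : ℝ) / phiGen (1 / 2) v)

/-- The sum of `ℓ ^ (-a)` over the squarefree `ℓ ≤ X` coprime to `v`, for `a ≠ 1`. -/
theorem abs_powErr_le {v : ℕ} (hv : v = 1 ∨ v = 2) {a : ℝ} (ha : 1 / 2 < a) (ha1 : a ≠ 1) {X : ℝ}
    (hX : 0 < X) : |powErr v a X| * X ^ (a - 1 / 2) ≤ baseW a v := by
  have hC : 0 < √(v : ℝ) / phiGen (1 / 2) v := by
    rcases hv with rfl | rfl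
    · rw [sqrt_div_phiGen_one]; norm_num
    · rw [sqrt_div_phiGen_two]; positivity
  have hE1 : constD v * (1 + |a - 1| / (a - 1 / 2)) * (√(v : ℝ) / phiGen (1 / 2) v)
      ≤ baseW a v := by
    rw [baseW, constE, if_neg ha1]
    gcongr
    exact le_max_left _ _
  have hE2 : |powGap v a| ≤ baseW a v := by
    rw [baseW, constE, if_neg ha1, powGap_eq hv ha ha1, ← div_le_iff₀ hC]
    refine le_trans (le_of_eq ?_) ((le_max_left _ _).trans (le_max_right _ _))
    rw [div_div_eq_mul_div, mul_comm, mul_div_right_comm]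
  have hρ := ratio_nonneg ha
  -- The first two entries of the maximum in `constE` are enough.
  rcases hv with rfl | rfl
  · refine (abs_powErr_one_le ha ha1 hX).trans (max_le ?_ hE2)
    refine le_trans ?_ hE1
    rw [sqrt_div_phiGen_one, constD]
    simp
  · refine (abs_powErr_two_le ha ha1 hX).trans (max_le ?_ hE2)
    refine le_trans ?_ hE1
    rw [sqrt_div_phiGen_two, constD, if_neg (by norm_num), mul_right_comm]
    gcongr
    have := sqrt_two_bounds.1
    linarith

lemma abs_sqErr_mul_le_of_lt_one {v : ℕ} {W : ℝ} (hl : 0 ≤ sqLead v)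
    (hc : 0 ≤ sqConst v) (h1 : sqConst v ≤ W) (h2 : 2 * sqLead v * Real.exp (-1) ≤ W) {X : ℝ}
    (hX : 0 < X) (hX1 : X < 1) : √X * |sqErr v X| ≤ W := by
  have hs : sqErr v X = -(sqLead v * Real.log X + sqConst v) := by
    have := sqErr_eq_of_floor (v := v) (X := X) (c := 0) (n := 0) (Nat.floor_eq_zero.2 hX1)
      (by simp)
    rw [this, zero_sub]
  have h3 : √X * -Real.log X ≤ 2 * Real.exp (-1) := by
    have := mul_neg_log_le (Real.sqrt_pos.2 hX)
    rw [Real.log_sqrt hX.le] at this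
    linarith
  have h4 : √X ≤ 1 := by rw [Real.sqrt_le_one]; exact hX1.le
  have h5 : 0 < √X := Real.sqrt_pos.2 hX
  have h6 : 0 ≤ -Real.log X := by
    have := Real.log_nonpos hX.le hX1.le
    linarith
  rw [hs, abs_neg, show √X * |sqLead v * Real.log X + sqConst v| = |√X * (sqLead v * Real.log X + sqConst v)| by
    rw [abs_mul, abs_of_pos h5], abs_le]
  have h7 : √X * sqConst v ≤ sqConst v := mul_le_of_le_one_left hc h4
  have h8 : sqLead v * (√X * -Real.log X) ≤ sqLead v * (2 * Real.exp (-1)) := by gcongr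
  have h9 : 0 ≤ sqLead v * (√X * -Real.log X) := by positivity
  have h10 : 0 ≤ √X * sqConst v := by positivity
  have e : √X * (sqLead v * Real.log X + sqConst v)
      = √X * sqConst v - sqLead v * (√X * -Real.log X) := by ring
  rw [e]
  constructor <;> linarith

/-- The sum of `1 / ℓ` over the squarefree `ℓ ≤ X` coprime to `v`. -/
theorem abs_sqErr_le_baseW {v : ℕ} (hv : v = 1 ∨ v = 2) {X : ℝ} (hX : 0 < X) :
    √X * |sqErr v X| ≤ baseW 1 v := by
  have he := exp_neg_one_le
  have he0 := Real.exp_pos (-1)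
  have hW : baseW 1 v = if v = 1 then 1.044 else 0.232 * (2 + √2) := by
    rw [baseW, constE, if_pos rfl]
    rcases hv with rfl | rfl
    · rw [sqrt_div_phiGen_one]; simp
    · rw [sqrt_div_phiGen_two]; simp
  rw [hW]
  rcases lt_or_ge X 1 with h | h
  · rcases hv with rfl | rfl
    · obtain ⟨l1, l2⟩ := sqLead_one_bounds
      have hc := sqConst_one_bounds
      rw [abs_le] at hc
      rw [if_pos rfl]
      exact abs_sqErr_mul_le_of_lt_one (by linarith) (by linarith) (by linarith)
        (by nlinarith) hX h
    · obtain ⟨l1, l2⟩ := sqLead_two_bounds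
      have hc := sqConst_two_bounds
      have hs := sqrt_two_bounds.1
      rw [abs_le] at hc
      rw [if_neg (by norm_num)]
      exact abs_sqErr_mul_le_of_lt_one (by linarith) (by linarith) (by linarith)
        (by nlinarith) hX h
  · refine (abs_sqErr_le_of_one_le hv h).trans ?_
    have := sqrt_two_bounds.1
    split_ifs <;> linarith

/-! ### Convolution with an absolutely convergent factor -/

/-- The arithmetic function `n ↦ f(n) / n ^ a`. -/
def wt (f : ArithmeticFunction ℂ) (a : ℝ) : ArithmeticFunction ℂ :=
  ⟨fun n => f n / (((n : ℝ) ^ a : ℝ) : ℂ), by simp⟩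

lemma wt_apply (f : ArithmeticFunction ℂ) (a : ℝ) (n : ℕ) :
    wt f a n = f n / (((n : ℝ) ^ a : ℝ) : ℂ) := rfl

lemma wt_mul (f g : ArithmeticFunction ℂ) (a : ℝ) : wt (f * g) a = wt f a * wt g a := by
  ext n
  rw [wt_apply, ArithmeticFunction.mul_apply, ArithmeticFunction.mul_apply, sum_div]
  refine sum_congr rfl fun x hx => ?_
  rw [wt_apply, wt_apply, ← (Nat.mem_divisorsAntidiagonal.1 hx).1, div_mul_div_comm]
  push_cast [Real.mul_rpow]
  rw [Real.mul_rpow (Nat.cast_nonneg _) (Nat.cast_nonneg _)]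
  push_cast; rfl

/-- The sum of `f(n) / n ^ a` over `n ≤ X`. -/
def sumPow (f : ArithmeticFunction ℂ) (a X : ℝ) : ℂ := ∑ n ∈ Ioc 0 ⌊X⌋₊, wt f a n

lemma hasSum_sumPow_mul (f g : ArithmeticFunction ℂ) (a X : ℝ) :
    HasSum (fun d : ℕ => wt f a d * sumPow g a (X / d)) (sumPow (f * g) a X) := by
  have h : ∀ d ∉ Ioc 0 ⌊X⌋₊, wt f a d * sumPow g a (X / d) = 0 := by
    intro d hd
    rcases Nat.eq_zero_or_pos d with rfl | hd0
    · simp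
    · have h1 : ⌊X⌋₊ < d := by
        by_contra h2
        exact hd (mem_Ioc.2 ⟨hd0, by omega⟩)
      rw [sumPow, Nat.floor_div_natCast, Nat.div_eq_of_lt h1]
      simp
  convert! hasSum_sum_of_ne_finset_zero (L := SummationFilter.unconditional _) h using 1
  rw [sumPow, wt_mul, ArithmeticFunction.sum_Ioc_mul_eq_sum_sum]
  simp_rw [sumPow, Nat.floor_div_natCast]

/-- If `∑ g(m) m ^ (-a)` over `m ≤ X` is `M X` up to `W X ^ (1 / 2 - a)` for every `X > 0`, the
same sum for `f * g` is `∑ f(d) d ^ (-a) M(X / d)` up to `W ∑ |f(d)| d ^ (-1 / 2)` times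
`X ^ (1 / 2 - a)`. -/
lemma norm_sumPow_mul_sub_le {f g : ArithmeticFunction ℂ} {a W : ℝ} {M : ℝ → ℂ}
    (hf : LSeriesSummable f (1 / 2))
    (hM : ∀ X : ℝ, 0 < X → ‖sumPow g a X - M X‖ * X ^ (a - 1 / 2) ≤ W) {X : ℝ} (hX : 0 < X)
    {S : ℂ} (hS : HasSum (fun d : ℕ => wt f a d * M (X / d)) S) :
    ‖sumPow (f * g) a X - S‖ * X ^ (a - 1 / 2) ≤ W * ∑' d, ‖LSeries.term f (1 / 2) d‖ := by
  have hT : 0 < X ^ (a - 1 / 2) := Real.rpow_pos_of_pos hX _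
  have h1 := ((hasSum_sumPow_mul f g a X).sub hS).mul_right ((X ^ (a - 1 / 2) : ℝ) : ℂ)
  have h2 := hf.norm.hasSum.mul_left W
  have h3 := h1.norm_le_of_bounded h2 fun d => ?_
  · rwa [norm_mul, Complex.norm_real, Real.norm_of_nonneg hT.le] at h3
  · rcases Nat.eq_zero_or_pos d with rfl | hd
    · simp
    have hd' : (0 : ℝ) < d := by exact_mod_cast hd
    have hre : (1 / 2 : ℂ).re = 1 / 2 := by norm_num
    have h4 := hM (X / d) (by positivity)
    have h5 : X ^ (a - 1 / 2) = (d : ℝ) ^ (a - 1 / 2) * (X / d) ^ (a - 1 / 2) := by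
      rw [← Real.mul_rpow hd'.le (by positivity), mul_div_cancel₀ _ hd'.ne']
    have h6 : (d : ℝ) ^ (a - 1 / 2) / (d : ℝ) ^ a = 1 / (d : ℝ) ^ (1 / 2 : ℝ) := by
      rw [Real.rpow_sub hd']; field_simp
    rw [← mul_sub, norm_mul, norm_mul, Complex.norm_real, Real.norm_of_nonneg hT.le, wt_apply,
      norm_div, Complex.norm_real, Real.norm_of_nonneg (by positivity), LSeries.norm_term_eq,
      if_neg hd.ne', hre, h5]
    calc ‖f d‖ / (d : ℝ) ^ a * ‖sumPow g a (X / d) - M (X / d)‖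
          * ((d : ℝ) ^ (a - 1 / 2) * (X / d) ^ (a - 1 / 2))
        = ‖f d‖ * ((d : ℝ) ^ (a - 1 / 2) / (d : ℝ) ^ a)
          * (‖sumPow g a (X / d) - M (X / d)‖ * (X / d) ^ (a - 1 / 2)) := by ring
      _ = (‖f d‖ / (d : ℝ) ^ (1 / 2 : ℝ))
          * (‖sumPow g a (X / d) - M (X / d)‖ * (X / d) ^ (a - 1 / 2)) := by
          rw [h6]; ring
      _ ≤ (‖f d‖ / (d : ℝ) ^ (1 / 2 : ℝ)) * W := by gcongr
      _ = _ := by ring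

/-! ### Reduction to the squarefree integers coprime to `2` -/

/-- `mulExt a` as an arithmetic function. -/
def mulArith (a : ℕ → ℕ → ℂ) : ArithmeticFunction ℂ := ⟨mulExt a, mulExt_zero a⟩

lemma mulArith_apply (a : ℕ → ℕ → ℂ) (n : ℕ) : mulArith a n = mulExt a n := rfl

lemma isMultiplicative_mulArith (a : ℕ → ℕ → ℂ) : (mulArith a).IsMultiplicative :=
  ⟨mulExt_one a, fun h => mulExt_mul a h⟩

/-- The values at the prime powers of the function `μ ^ 2 F`, where `F` is extended
multiplicatively from the primes. -/
def sqPow (F : ℕ → ℂ) (p k : ℕ) : ℂ := if k = 1 then F p else 0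

/-- The arithmetic function with the values `1` at `1` and `z` at `2`, zero elsewhere. -/
def oneTwo (z : ℂ) : ArithmeticFunction ℂ :=
  ⟨fun n => if n = 1 then 1 else if n = 2 then z else 0, by simp⟩

lemma oneTwo_apply (z : ℂ) (n : ℕ) :
    oneTwo z n = if n = 1 then 1 else if n = 2 then z else 0 := rfl

lemma isMultiplicative_oneTwo (z : ℂ) : (oneTwo z).IsMultiplicative := by
  refine ⟨rfl, fun {m n} h => ?_⟩
  rcases eq_or_ne m 1 with rfl | hm
  · simp [oneTwo_apply]
  rcases eq_or_ne n 1 with rfl | hn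
  · simp [oneTwo_apply]
  have h1 : m * n ≠ 1 := fun h => hm (Nat.eq_one_of_mul_eq_one_right h)
  have h2 : m * n ≠ 2 := fun h2 => by
    rcases (Nat.dvd_prime Nat.prime_two).1 (Dvd.intro n h2) with h3 | h3
    · exact hm h3
    · subst h3; exact hn (by omega)
  rw [oneTwo_apply, oneTwo_apply, oneTwo_apply, if_neg h1, if_neg h2, if_neg hm, if_neg hn]
  by_cases h3 : m = 2
  · subst h3
    have : n ≠ 2 := by rintro rfl; simp at h
    simp [this]
  · simp [h3]

/-- The indicator function of the squarefree integers coprime to `v`. -/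
def sqcArith (v : ℕ) : ArithmeticFunction ℂ := ⟨fun n => (sqc v n : ℂ), by simp [sqc]⟩

lemma sqcArith_apply (v n : ℕ) : sqcArith v n = (sqc v n : ℂ) := rfl

lemma isMultiplicative_sqcArith (v : ℕ) : (sqcArith v).IsMultiplicative := by
  refine ⟨by simp [sqcArith_apply, sqc, copr], fun h => ?_⟩
  rw [sqcArith_apply, sqcArith_apply, sqcArith_apply, sqc_mul h]
  push_cast; rfl

lemma mul_apply_prime_pow (f g : ArithmeticFunction ℂ) {p : ℕ} (hp : p.Prime) (k : ℕ) :
    (f * g) (p ^ k) = ∑ i ∈ range (k + 1), f (p ^ i) * g (p ^ (k - i)) := by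
  rw [ArithmeticFunction.mul_apply, Nat.sum_divisorsAntidiagonal (fun a b => f a * g b),
    Nat.sum_divisors_prime_pow hp]
  refine sum_congr rfl fun i hi => ?_
  rw [Nat.pow_div (by rw [mem_range] at hi; omega) hp.pos]

/-- At odd primes `oneTwo z * sqcArith 2` is the indicator function of the squarefree integers, at
`2` it has the value `z`. -/
lemma oneTwo_mul_sqcArith_prime_pow (z : ℂ) {p : ℕ} (hp : p.Prime) {k : ℕ} (hk : k ≠ 0) :
    (oneTwo z * sqcArith 2) (p ^ k) = if k = 1 then (if p = 2 then z else 1) else 0 := by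
  rw [mul_apply_prime_pow _ _ hp]
  obtain ⟨j, rfl⟩ := Nat.exists_eq_succ_of_ne_zero hk
  rw [Nat.succ_eq_add_one, sum_range_succ', sum_range_succ']
  have h0 : ∀ i, oneTwo z (p ^ (i + 1 + 1)) = 0 := fun i => by
    have h1 : 2 ^ 2 ≤ p ^ (i + 1 + 1) :=
      (Nat.pow_le_pow_left hp.two_le 2).trans (Nat.pow_le_pow_right hp.pos (by omega))
    rw [oneTwo_apply, if_neg (by omega), if_neg (by omega)]
  simp only [h0, zero_mul, sum_const_zero, zero_add, pow_one, pow_zero, tsub_zero,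
    Nat.add_sub_cancel]
  have h1 : oneTwo z 1 = 1 := rfl
  have hs : ∀ i, i ≠ 0 → sqcArith 2 (p ^ i) = if i = 1 ∧ p.Coprime 2 then 1 else 0 := fun i hi => by
    rw [sqcArith_apply, sqc_prime_pow 2 hp hi]; split_ifs <;> simp
  rw [h1, one_mul, hs _ (Nat.succ_ne_zero j), oneTwo_apply, if_neg hp.ne_one]
  rcases eq_or_ne p 2 with rfl | hp2
  · rcases Nat.eq_zero_or_pos j with rfl | hj
    · simp [(isMultiplicative_sqcArith 2).map_one]
    · simp [hs j hj.ne', hj.ne']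
  · simp [hp2, hp.odd_of_ne_two hp2]

/-- The function `μ ^ 2 F` is the convolution of the function `g` of the generalized convolution
method with a function that differs from `μ ^ 2` only at the even integers. -/
lemma mulArith_sqPow_eq (F : ℕ → ℂ) :
    mulArith (sqPow F) = mulArith (gPow F) * (oneTwo (F 2) * sqcArith 2) := by
  have hu := (isMultiplicative_oneTwo (F 2)).mul (isMultiplicative_sqcArith 2)
  rw [ArithmeticFunction.IsMultiplicative.eq_iff_eq_on_prime_powers _
    (isMultiplicative_mulArith _) _ ((isMultiplicative_mulArith _).mul hu)]
  intro p k hp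
  rcases Nat.eq_zero_or_pos k with rfl | hk
  · rw [pow_zero, (isMultiplicative_mulArith _).map_one,
      ((isMultiplicative_mulArith _).mul hu).map_one]
  have hg : ∀ i, i ≠ 0 → mulArith (gPow F) (p ^ i) = gPow F p i := fun i hi =>
    mulExt_prime_pow _ hp hi
  have hv : ∀ i, i ≠ 0 → (oneTwo (F 2) * sqcArith 2) (p ^ i)
      = if i = 1 then (if p = 2 then F 2 else 1) else 0 := fun i hi =>
    oneTwo_mul_sqcArith_prime_pow (F 2) hp hi
  rw [mul_apply_prime_pow _ _ hp, mulArith_apply, mulExt_prime_pow _ hp hk.ne', sqPow]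
  generalize hU : oneTwo (F 2) * sqcArith 2 = U at *
  rcases eq_or_ne p 2 with rfl | hp2
  · rw [sum_range_succ', sum_eq_zero fun i _ => by rw [hg _ (by omega), gPow, if_pos rfl, zero_mul],
      pow_zero, (isMultiplicative_mulArith _).map_one, tsub_zero, hv k hk.ne', if_pos rfl]
    simp
  · obtain ⟨j, rfl⟩ : ∃ j, k = j + 1 := ⟨k - 1, by omega⟩
    rw [sum_range_succ, sum_range_succ, sum_eq_zero fun i hi => by
      rw [mem_range] at hi
      rw [hv (j + 1 - i) (by omega), if_neg (by omega), mul_zero]]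
    rw [Nat.sub_self, pow_zero, hu.map_one, hg (j + 1) (by omega), show j + 1 - j = 1 by omega,
      hv 1 one_ne_zero, if_pos rfl, if_neg hp2, zero_add, mul_one, mul_one]
    rcases Nat.eq_zero_or_pos j with rfl | hj
    · rw [pow_zero, (isMultiplicative_mulArith (gPow F)).map_one]
      simp [gPow, hp2]
    · obtain ⟨i, rfl⟩ : ∃ i, j = i + 1 := ⟨j - 1, by omega⟩
      rw [hg (i + 1) (by omega), gPow, gPow, if_neg hp2, if_neg hp2, if_neg (by omega)]
      simp [pow_succ]

lemma sumPow_sqcArith (v : ℕ) (a X : ℝ) : sumPow (sqcArith v) a X = (sqSumPow v a X : ℂ) := by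
  rw [sumPow, sqSumPow]
  push_cast
  refine sum_congr rfl fun n _ => ?_
  rw [wt_apply, sqcArith_apply]

lemma sumPow_oneTwo_mul (z : ℂ) (a X : ℝ) : sumPow (oneTwo z * sqcArith 2) a X
    = (sqSumPow 2 a X : ℂ) + z / ((2 ^ a : ℝ) : ℂ) * (sqSumPow 2 a (X / 2) : ℂ) := by
  have h := hasSum_sumPow_mul (oneTwo z) (sqcArith 2) a X
  have h0 : ∀ d ∉ ({1, 2} : Finset ℕ), wt (oneTwo z) a d * sumPow (sqcArith 2) a (X / d) = 0 := by
    intro d hd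
    rw [mem_insert, mem_singleton, not_or] at hd
    rw [wt_apply, oneTwo_apply, if_neg hd.1, if_neg hd.2, zero_div, zero_mul]
  rw [← h.tsum_eq, tsum_eq_sum h0, sum_pair (by norm_num), sumPow_sqcArith, sumPow_sqcArith,
    wt_apply, wt_apply, oneTwo_apply, oneTwo_apply]
  simp

/-! ### Relation between the squarefree integers and the odd squarefree integers -/

lemma sqcArith_one : sqcArith 1 = oneTwo 1 * sqcArith 2 := by
  rw [ArithmeticFunction.IsMultiplicative.eq_iff_eq_on_prime_powers _
    (isMultiplicative_sqcArith 1) _ ((isMultiplicative_oneTwo 1).mul (isMultiplicative_sqcArith 2))]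
  intro p k hp
  rcases Nat.eq_zero_or_pos k with rfl | hk
  · rw [pow_zero, (isMultiplicative_sqcArith 1).map_one,
      ((isMultiplicative_oneTwo 1).mul (isMultiplicative_sqcArith 2)).map_one]
  · rw [oneTwo_mul_sqcArith_prime_pow 1 hp hk.ne', sqcArith_apply, sqc_prime_pow 1 hp hk.ne']
    by_cases h : k = 1 <;> simp [h]

lemma sqSumPow_one_eq (a X : ℝ) :
    sqSumPow 1 a X = sqSumPow 2 a X + 1 / 2 ^ a * sqSumPow 2 a (X / 2) := by
  have h := sumPow_oneTwo_mul 1 a X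
  rw [← sqcArith_one, sumPow_sqcArith] at h
  exact_mod_cast h

lemma sqPoly_one (v : ℕ) : sqPoly v 1 = sqLead v := by simp [sqPoly]

lemma sqPoly_one_eq {s : ℂ} (hs : 1 / 2 < s.re) : sqPoly 1 s = sqPoly 2 s * (1 + 1 / 2 ^ s) := by
  have h1 := sqPoly_mul (Or.inl rfl) hs
  rw [← sqPoly_mul (Or.inr rfl) hs] at h1
  have hz : riemannZeta (2 * s) ≠ 0 := riemannZeta_ne_zero_of_one_lt_re (by simp; linarith)
  apply mul_right_cancel₀ hz
  simp only [kap, if_true, (by norm_num : ¬ (1 = 2)), if_false, mul_one] at h1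
  rw [h1]; ring

lemma hasDerivAt_sqPoly_one {v : ℕ} (hv : v = 1 ∨ v = 2) :
    HasDerivAt (sqPoly v) (sqConst v) 1 := by
  have h := (differentiableAt_sqMellin hv (s := 1) (by norm_num)).hasDerivAt
  have h1 : HasDerivAt (fun s : ℂ => s - 1) 1 1 := (hasDerivAt_id _).sub_const _
  have := ((h1.const_mul (sqConst v : ℂ)).const_add (sqLead v : ℂ)).add ((h1.pow 2).mul h)
  convert! this using 1
  simp

lemma hasDerivAt_one_add_div_two_cpow (z : ℂ) : HasDerivAt (fun s : ℂ => 1 + z / 2 ^ s)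
    (-(z * (Real.log 2 : ℂ) / 2)) 1 := by
  have h := ((hasDerivAt_id (1 : ℂ)).neg.const_cpow (c := 2) (Or.inl two_ne_zero)).const_mul z
  have h2 := h.const_add (1 : ℂ)
  have e : (fun s : ℂ => 1 + z / 2 ^ s) = fun s => 1 + z * 2 ^ (-id s) := by
    funext s; rw [id, Complex.cpow_neg]; rfl
  rw [e]
  convert! h2 using 1
  rw [Complex.ofReal_log two_pos.le]
  simp [Complex.cpow_neg]
  ring

lemma sqLead_one_eq : sqLead 1 = 3 / 2 * sqLead 2 := by
  have h := sqPoly_one_eq (s := 1) (by norm_num)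
  rw [sqPoly_one, sqPoly_one, Complex.cpow_one] at h
  have h2 : (sqLead 1 : ℂ) = ((3 / 2 * sqLead 2 : ℝ) : ℂ) := by rw [h]; push_cast; ring
  exact_mod_cast h2

/-- Comparison of the derivatives at `1` in `sqPoly_one_eq`. -/
lemma sqConst_one_eq : sqConst 1 = 3 / 2 * sqConst 2 - Real.log 2 / 2 * sqLead 2 := by
  have h1 := hasDerivAt_sqPoly_one (Or.inl rfl : 1 = 1 ∨ 1 = 2)
  have h2 := (hasDerivAt_sqPoly_one (Or.inr rfl : 2 = 1 ∨ 2 = 2)).mul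
    (hasDerivAt_one_add_div_two_cpow 1)
  have h3 := h2.congr_of_eventuallyEq (f₁ := sqPoly 1) (by
    filter_upwards [isOpen_re_gt_half.mem_nhds (show (1 : ℂ) ∈ {s : ℂ | 1 / 2 < s.re} by norm_num)]
      with s hs using sqPoly_one_eq hs)
  have h := h1.unique h3
  rw [sqPoly_one, Complex.cpow_one] at h
  have h4 : (sqConst 1 : ℂ) = ((3 / 2 * sqConst 2 - Real.log 2 / 2 * sqLead 2 : ℝ) : ℂ) := by
    rw [h]; push_cast; ring
  exact_mod_cast h4

lemma two_rpow_mul_half {a X : ℝ} (hX : 0 < X) :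
    1 / 2 ^ a * (X / 2) ^ (1 - a) = X ^ (1 - a) / 2 := by
  have h : (2 : ℝ) ^ a * 2 ^ (1 - a) = 2 := by rw [← Real.rpow_add two_pos]; ring_nf; simp
  have h1 : (2 : ℝ) ^ a ≠ 0 := by positivity
  have h2 : (2 : ℝ) ^ (1 - a) ≠ 0 := by positivity
  rw [Real.div_rpow hX.le two_pos.le]
  field_simp
  linear_combination -h

lemma powErr_one_eq {a : ℝ} (ha : 1 / 2 < a) (ha1 : a ≠ 1) {X : ℝ} (hX : 0 < X) :
    powErr 1 a X = powErr 2 a X + 1 / 2 ^ a * powErr 2 a (X / 2) := by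
  have h1 : sqPolyR 1 a = sqPolyR 2 a * (1 + 1 / 2 ^ a) := by
    have h := sqPolyR_mul (Or.inl rfl : 1 = 1 ∨ 1 = 2) ha ha1
    rw [← sqPolyR_mul (Or.inr rfl : 2 = 1 ∨ 2 = 2) ha ha1] at h
    apply mul_right_cancel₀ (zetaReal_pos (a := 2 * a) (by linarith)).ne'
    simp only [kapR, if_true, (by norm_num : ¬ (1 = 2)), if_false, mul_one] at h
    rw [h]; ring
  have h2 := two_rpow_mul_half (a := a) hX
  rw [powErr, powErr, powErr, sqSumPow_one_eq, h1, sqLead_one_eq]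
  have h3 : a - 1 ≠ 0 := sub_ne_zero.2 ha1
  rw [← sub_eq_zero]
  have : ∀ P L U V t : ℝ, t * U = V / 2 → (P * (1 + t) - 3 / 2 * L * V) / (a - 1)
      = (P - L * V) / (a - 1) + t * ((P - L * U) / (a - 1)) := by
    intro P L U V t h
    field_simp
    linear_combination 2 * L * h
  rw [this _ _ _ _ _ h2]
  ring

lemma sqErr_eq_sqSumPow (v : ℕ) (X : ℝ) :
    sqErr v X = sqSumPow v 1 X - (sqLead v * Real.log X + sqConst v) := by
  simp [sqErr, sqSumPow, sqSum]

lemma sqErr_one_eq {X : ℝ} (hX : 0 < X) : sqErr 1 X = sqErr 2 X + 1 / 2 * sqErr 2 (X / 2) := by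
  rw [sqErr_eq_sqSumPow, sqErr_eq_sqSumPow, sqErr_eq_sqSumPow, sqSumPow_one_eq, sqLead_one_eq,
    sqConst_one_eq, Real.log_div hX.ne' two_ne_zero, Real.rpow_one]
  ring

/-- The constant in the error term for the sum over `μ ^ 2`, modified by the factor `z` at the even
integers. -/
def errW (a : ℝ) (q : ℕ) (z : ℂ) : ℝ :=
  if 2 ∣ q then baseW a 2 else baseW a 1 + ‖z - 1‖ * baseW a 2 / √2

/-- The error term for the function with the value `z` at `2` is `E₁` plus `z - 1` times the
contribution `E₂ (X / 2) / 2 ^ a` of the even integers; it is `E₂` when `q` is even. -/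
lemma norm_twist_le {a : ℝ} {E₁ E₂ : ℝ → ℝ} {W₁ W₂ : ℝ}
    (h : ∀ X : ℝ, 0 < X → E₁ X = E₂ X + 1 / 2 ^ a * E₂ (X / 2))
    (h1 : ∀ X : ℝ, 0 < X → |E₁ X| * X ^ (a - 1 / 2) ≤ W₁)
    (h2 : ∀ X : ℝ, 0 < X → |E₂ X| * X ^ (a - 1 / 2) ≤ W₂) {q : ℕ} {z : ℂ}
    (hz : 2 ∣ q → z = 0) {X : ℝ} (hX : 0 < X) :
    ‖(E₂ X : ℂ) + z / ((2 ^ a : ℝ) : ℂ) * (E₂ (X / 2) : ℂ)‖ * X ^ (a - 1 / 2)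
      ≤ if 2 ∣ q then W₂ else W₁ + ‖z - 1‖ * W₂ / √2 := by
  have hT : 0 < X ^ (a - 1 / 2) := Real.rpow_pos_of_pos hX _
  split_ifs with hq
  · rw [hz hq, zero_div, zero_mul, add_zero, Complex.norm_real]
    exact h2 X hX
  have e : (E₂ X : ℂ) + z / ((2 ^ a : ℝ) : ℂ) * (E₂ (X / 2) : ℂ)
      = (E₁ X : ℂ) + (z - 1) * ((1 / 2 ^ a * E₂ (X / 2) : ℝ) : ℂ) := by
    rw [h X hX]; push_cast; ring
  have h3 : |1 / 2 ^ a * E₂ (X / 2)| * X ^ (a - 1 / 2) ≤ W₂ / √2 := by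
    have h4 := h2 (X / 2) (by positivity)
    have h5 : 1 / 2 ^ a * X ^ (a - 1 / 2) = (X / 2) ^ (a - 1 / 2) / √2 := by
      rw [Real.div_rpow hX.le two_pos.le, div_div, Real.sqrt_eq_rpow, ← Real.rpow_add two_pos,
        sub_add_cancel, one_div_mul_eq_div]
    calc |1 / 2 ^ a * E₂ (X / 2)| * X ^ (a - 1 / 2)
        = |E₂ (X / 2)| * (1 / 2 ^ a * X ^ (a - 1 / 2)) := by
          rw [abs_mul, abs_of_pos (by positivity : (0 : ℝ) < 1 / 2 ^ a)]; ring
      _ = |E₂ (X / 2)| * (X / 2) ^ (a - 1 / 2) / √2 := by rw [h5]; ring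
      _ ≤ _ := by gcongr
  calc ‖(E₂ X : ℂ) + z / ((2 ^ a : ℝ) : ℂ) * (E₂ (X / 2) : ℂ)‖ * X ^ (a - 1 / 2)
      ≤ (|E₁ X| + ‖z - 1‖ * |1 / 2 ^ a * E₂ (X / 2)|) * X ^ (a - 1 / 2) := by
        rw [e]
        gcongr
        refine (norm_add_le _ _).trans (le_of_eq ?_)
        rw [norm_mul, Complex.norm_real, Complex.norm_real]; rfl
    _ = |E₁ X| * X ^ (a - 1 / 2) + ‖z - 1‖ * (|1 / 2 ^ a * E₂ (X / 2)| * X ^ (a - 1 / 2)) := by ring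
    _ ≤ W₁ + ‖z - 1‖ * (W₂ / √2) := by
        gcongr
        exact h1 X hX
    _ = _ := by ring

/-! ### Averages of squarefree-supported multiplicative functions -/

/-- The Dirichlet series of `h`, times the Euler factors `1 - p ^ (-s)` at the primes `p ∣ q`. -/
def kFun (F : ℕ → ℂ) (q : ℕ) (s : ℂ) : ℂ := phiFac q s * LSeries (mulExt (hPow F q)) s

lemma abscissa_lt_of_summable {f : ℕ → ℂ} {s₀ s : ℂ} (h : LSeriesSummable f s₀)
    (hs : s₀.re < s.re) : LSeries.abscissaOfAbsConv f < s.re :=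
  h.abscissaOfAbsConv_le.trans_lt (by exact_mod_cast hs)

lemma hasDerivAt_lseries_hPow {F : ℕ → ℂ}
    (hF : Summable fun p : Nat.Primes => ‖F p - 1‖ / √((p : ℕ) : ℝ)) (q : ℕ) {s : ℂ}
    (hs : 1 / 2 < s.re) : HasDerivAt (LSeries (mulExt (hPow F q)))
      (-LSeries (LSeries.logMul (mulExt (hPow F q))) s) s := by
  refine LSeries_hasDerivAt (abscissa_lt_of_summable (s₀ := ((1 / 2 + s.re) / 2 : ℝ))
    (lseriesSummable_hPow hF q ?_) ?_) <;> rw [Complex.ofReal_re] <;> linarith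

lemma differentiableAt_phiFac (q : ℕ) (s : ℂ) : DifferentiableAt ℂ (phiFac q) s := by
  have : phiFac q = ∏ p ∈ q.primeFactors, fun s : ℂ => 1 - 1 / (p : ℂ) ^ s := by
    funext s; rw [phiFac, prod_apply]
  rw [this]
  refine DifferentiableAt.finsetProd fun p hp => ?_
  have h0 : (p : ℂ) ≠ 0 := by exact_mod_cast (Nat.prime_of_mem_primeFactors hp).ne_zero
  refine (differentiableAt_const _).sub ((differentiableAt_const _).div
    (differentiableAt_id.const_cpow (Or.inl h0)) ?_)
  simp [Complex.cpow_eq_zero_iff, h0]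

lemma differentiableAt_kFun {F : ℕ → ℂ}
    (hF : Summable fun p : Nat.Primes => ‖F p - 1‖ / √((p : ℕ) : ℝ)) (q : ℕ) {s : ℂ}
    (hs : 1 / 2 < s.re) : DifferentiableAt ℂ (kFun F q) s :=
  (differentiableAt_phiFac q s).mul (hasDerivAt_lseries_hPow hF q hs).differentiableAt

/-- `s - 1` times the Dirichlet series of `oneTwo z * sqcArith 2`. -/
def twistPoly (z s : ℂ) : ℂ := sqPoly 2 s * (1 + z / 2 ^ s)

lemma twistPoly_one (z : ℂ) : twistPoly z 1 = sqLead 2 * (1 + z / 2) := by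
  rw [twistPoly, sqPoly_one, Complex.cpow_one]

lemma hasDerivAt_twistPoly_one (z : ℂ) : HasDerivAt (twistPoly z)
    (sqConst 2 * (1 + z / 2) - sqLead 2 * (z * (Real.log 2 : ℂ) / 2)) 1 := by
  convert! (hasDerivAt_sqPoly_one (Or.inr rfl : 2 = 1 ∨ 2 = 2)).mul
    (hasDerivAt_one_add_div_two_cpow z) using 1
  rw [Complex.cpow_one, sqPoly_one]
  ring

/-- The factorization behind the main terms: two expressions for `s - 1` times the Dirichlet series
of `μ ^ 2 F`. On the left it is convolved from `g` and `oneTwo (F 2) * sqcArith 2`, on the right from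
`h` and the integers coprime to `q`. -/
lemma lseries_gPow_mul_poly {F : ℕ → ℂ}
    (hF : Summable fun p : Nat.Primes => ‖F p - 1‖ / √((p : ℕ) : ℝ)) {q : ℕ} (hq : 0 < q)
    (hFq : ∀ p, p.Prime → p ∣ q → F p = 0) {s : ℂ} (hs : 1 / 2 < s.re) :
    LSeries (mulExt (gPow F)) s * twistPoly (F 2) s
      = riemannZeta₁ s * kFun F q s := by
  have h1 := lseries_gPow_mul hF hq hFq hs
  have h2 := sqPoly_mul (Or.inr rfl : 2 = 1 ∨ 2 = 2) hs
  rw [kap, if_pos rfl] at h2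
  rw [← h2, kFun, twistPoly]
  linear_combination sqPoly 2 s * h1

lemma wt_mulArith (b : ℕ → ℕ → ℂ) (a : ℝ) (d : ℕ) :
    wt (mulArith b) a d = LSeries.term (mulExt b) (a : ℂ) d := by
  rcases Nat.eq_zero_or_pos d with rfl | hd
  · simp
  · rw [wt_apply, LSeries.term_of_ne_zero hd.ne', Complex.ofReal_cpow (Nat.cast_nonneg _)]
    rfl

lemma coe_mulArith (b : ℕ → ℕ → ℂ) : ⇑(mulArith b) = mulExt b := rfl

lemma norm_sumPow_mulArith_mul_sub_le {b : ℕ → ℕ → ℂ} {g : ArithmeticFunction ℂ} {a W : ℝ}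
    {M : ℝ → ℂ} (hf : LSeriesSummable (mulExt b) (1 / 2))
    (hM : ∀ X : ℝ, 0 < X → ‖sumPow g a X - M X‖ * X ^ (a - 1 / 2) ≤ W) {X : ℝ} (hX : 0 < X)
    {S : ℂ} (hS : HasSum (fun d : ℕ => LSeries.term (mulExt b) (a : ℂ) d * M (X / d)) S) :
    ‖sumPow (mulArith b * g) a X - S‖ * X ^ (a - 1 / 2)
      ≤ W * ∑' d, ‖LSeries.term (mulExt b) (1 / 2) d‖ := by
  rw [← coe_mulArith] at hf ⊢
  simp_rw [← wt_mulArith] at hS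
  exact norm_sumPow_mul_sub_le hf hM hX hS

section

variable {F : ℕ → ℂ} {q : ℕ}

lemma sumPow_oneTwo_mul_sub (z : ℂ) {a : ℝ} {X : ℝ} (hX : 0 < X) :
    sumPow (oneTwo z * sqcArith 2) a X - (twistPoly z a / (a - 1)
        - twistPoly z 1 / (a - 1) * ((X ^ (1 - a) : ℝ) : ℂ))
      = (powErr 2 a X : ℂ) + z / ((2 ^ a : ℝ) : ℂ) * (powErr 2 a (X / 2) : ℂ) := by
  have h : 1 / ((2 ^ a : ℝ) : ℂ) * (((X / 2) ^ (1 - a) : ℝ) : ℂ)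
      = ((X ^ (1 - a) : ℝ) : ℂ) / 2 := by
    exact_mod_cast congrArg (fun x : ℝ => (x : ℂ)) (two_rpow_mul_half (a := a) hX)
  have h2 : (2 : ℂ) ^ (a : ℂ) = ((2 ^ a : ℝ) : ℂ) := by
    rw [Complex.ofReal_cpow two_pos.le]; norm_num
  rw [twistPoly_one, twistPoly, sqPoly_ofReal, sumPow_oneTwo_mul, powErr, powErr, h2]
  simp only [Complex.ofReal_sub, Complex.ofReal_div, Complex.ofReal_mul, Complex.ofReal_one]
  linear_combination -((sqLead 2 : ℂ) * z / (a - 1)) * h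

lemma sumPow_oneTwo_mul_one_sub (z : ℂ) {X : ℝ} (hX : 0 < X) :
    sumPow (oneTwo z * sqcArith 2) 1 X - (twistPoly z 1 * (Real.log X : ℂ)
        + (sqConst 2 * (1 + z / 2) - sqLead 2 * (z * (Real.log 2 : ℂ) / 2)))
      = (sqErr 2 X : ℂ) + z / ((2 ^ (1 : ℝ) : ℝ) : ℂ) * (sqErr 2 (X / 2) : ℂ) := by
  rw [sumPow_oneTwo_mul, sqErr_eq_sqSumPow, sqErr_eq_sqSumPow, twistPoly_one,
    Real.log_div hX.ne' two_ne_zero, Real.rpow_one]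
  simp only [Complex.ofReal_sub, Complex.ofReal_add, Complex.ofReal_mul, Complex.ofReal_ofNat]
  ring

lemma hasSum_term_gPow_mul
    (hF : Summable fun p : Nat.Primes => ‖F p - 1‖ / √((p : ℕ) : ℝ)) (hq : 0 < q)
    (hFq : ∀ p, p.Prime → p ∣ q → F p = 0) {s : ℂ} (hs : 1 / 2 < s.re) :
    HasSum (fun d => LSeries.term (mulExt (gPow F)) s d * twistPoly (F 2) s)
      (riemannZeta₁ s * kFun F q s) := by
  rw [← lseries_gPow_mul_poly hF hq hFq hs]
  exact (lseriesSummable_gPow hF hs.le).LSeriesHasSum.mul_right _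

/-- The general estimate for `a ≠ 1`. The error is the one of the base case, multiplied by
`∑ |g(d)| d ^ (-1 / 2)`, and the main terms are summed by `hasSum_term_gPow_mul`. -/
lemma norm_sumPow_sub_le_of_ne_one
    (hF : Summable fun p : Nat.Primes => ‖F p - 1‖ / √((p : ℕ) : ℝ)) (hq : 0 < q)
    (hFq : ∀ p, p.Prime → p ∣ q → F p = 0) {a : ℝ} (ha : 1 / 2 < a) (ha1 : a ≠ 1) {X : ℝ}
    (hX : 0 < X) :
    ‖sumPow (mulArith (sqPow F)) a X - (riemannZeta a * kFun F q a
        - kFun F q 1 / (a - 1) * ((X ^ (1 - a) : ℝ) : ℂ))‖ * X ^ (a - 1 / 2)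
      ≤ errW a q (F 2) * ∑' d, ‖LSeries.term (mulExt (gPow F)) (1 / 2) d‖ := by
  have hre : (1 / 2 : ℂ).re = 1 / 2 := by norm_num
  have hac : (a : ℂ) - 1 ≠ 0 := sub_ne_zero.2 (by exact_mod_cast ha1)
  have hM : ∀ X : ℝ, 0 < X → ‖sumPow (oneTwo (F 2) * sqcArith 2) a X
      - (twistPoly (F 2) a / (a - 1) - twistPoly (F 2) 1 / (a - 1) * ((X ^ (1 - a) : ℝ) : ℂ))‖ * X ^ (a - 1 / 2)
      ≤ errW a q (F 2) := by
    intro X hX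
    rw [sumPow_oneTwo_mul_sub (F 2) hX]
    exact norm_twist_le (E₁ := powErr 1 a) (fun X hX => powErr_one_eq ha ha1 hX)
      (fun X hX => abs_powErr_le (Or.inl rfl) ha ha1 hX)
      (fun X hX => abs_powErr_le (Or.inr rfl) ha ha1 hX) (hFq 2 Nat.prime_two) hX
  rw [mulArith_sqPow_eq]
  refine norm_sumPow_mulArith_mul_sub_le (M := fun X => twistPoly (F 2) a / (a - 1)
    - twistPoly (F 2) 1 / (a - 1) * ((X ^ (1 - a) : ℝ) : ℂ)) (lseriesSummable_gPow hF hre.ge) hM hX ?_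
  have h1 := (hasSum_term_gPow_mul hF hq hFq (s := a) (by simpa using ha)).div_const ((a : ℂ) - 1)
  have h2 := (hasSum_term_gPow_mul hF hq hFq (s := 1) (by norm_num)).mul_right (((X ^ (1 - a) : ℝ) : ℂ) / (a - 1))
  convert! h1.sub h2 using 1
  · funext d
    rcases Nat.eq_zero_or_pos d with rfl | hd
    · simp
    have hd' : (0 : ℝ) < d := by exact_mod_cast hd
    have hdc : (d : ℂ) ≠ 0 := by exact_mod_cast hd.ne'
    have h3 : (((X / d) ^ (1 - a) : ℝ) : ℂ) / (((d : ℝ) ^ a : ℝ) : ℂ)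
        = ((X ^ (1 - a) : ℝ) : ℂ) / d := by
      have h4 : (X / d) ^ (1 - a) / (d : ℝ) ^ a = X ^ (1 - a) / d := by
        rw [Real.div_rpow hX.le hd'.le, div_div, ← Real.rpow_add hd', sub_add_cancel,
          Real.rpow_one]
      exact_mod_cast congrArg (fun x : ℝ => (x : ℂ)) h4
    rw [LSeries.term_of_ne_zero hd.ne', LSeries.term_of_ne_zero hd.ne',
      Complex.cpow_one]
    rw [Complex.ofReal_cpow hd'.le, Complex.ofReal_natCast] at h3
    linear_combination -(mulExt (gPow F) d * twistPoly (F 2) 1 / (a - 1)) * h3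
  · rw [riemannZeta₁_one, riemannZeta_eq_inv_sub_mul (by exact_mod_cast ha1)]
    ring

/-- The constant term in the logarithmic average of `μ ^ 2 F`. -/
def kConst (F : ℕ → ℂ) (q : ℕ) : ℂ :=
  (Real.eulerMascheroniConstant : ℂ) * kFun F q 1 + deriv (kFun F q) 1

/-- The general estimate for `a = 1`. The constant term comes from the derivatives at `1` of the two
sides of `lseries_gPow_mul_poly`. -/
lemma norm_sumPow_one_sub_le
    (hF : Summable fun p : Nat.Primes => ‖F p - 1‖ / √((p : ℕ) : ℝ)) (hq : 0 < q)
    (hFq : ∀ p, p.Prime → p ∣ q → F p = 0) {X : ℝ} (hX : 0 < X) :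
    ‖sumPow (mulArith (sqPow F)) 1 X - (kFun F q 1 * (Real.log X : ℂ) + kConst F q)‖ * √X
      ≤ errW 1 q (F 2) * ∑' d, ‖LSeries.term (mulExt (gPow F)) (1 / 2) d‖ := by
  have hre : (1 / 2 : ℂ).re = 1 / 2 := by norm_num
  have h1re : 1 / 2 < (1 : ℂ).re := by norm_num
  have hP' := hasDerivAt_twistPoly_one (F 2)
  have hsq : ∀ X : ℝ, √X = X ^ (1 - 1 / 2 : ℝ) := fun X => by rw [Real.sqrt_eq_rpow]; norm_num
  have hM : ∀ X : ℝ, 0 < X → ‖sumPow (oneTwo (F 2) * sqcArith 2) 1 X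
      - (twistPoly (F 2) 1 * (Real.log X : ℂ)
      + (sqConst 2 * (1 + F 2 / 2) - sqLead 2 * (F 2 * (Real.log 2 : ℂ) / 2)))‖
        * X ^ (1 - 1 / 2 : ℝ) ≤ errW 1 q (F 2) := by
    intro X hX
    rw [sumPow_oneTwo_mul_one_sub (F 2) hX]
    refine norm_twist_le (a := 1) (E₁ := sqErr 1) (fun X hX => ?_) (fun X hX => ?_)
      (fun X hX => ?_) (hFq 2 Nat.prime_two) hX
    · rw [sqErr_one_eq hX, Real.rpow_one]
    · rw [← hsq, mul_comm]; exact abs_sqErr_le_baseW (Or.inl rfl) hX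
    · rw [← hsq, mul_comm]; exact abs_sqErr_le_baseW (Or.inr rfl) hX
  have hG := lseriesSummable_gPow hF hre.ge
  have hab := abscissa_lt_of_summable hG (s := 1) (by norm_num)
  have hGd := LSeries_hasDerivAt hab
  have hK := (differentiableAt_kFun hF q h1re).hasDerivAt
  have hZ := (differentiable_riemannZeta₁ 1).hasDerivAt
  have hder := (hGd.mul hP').unique ((hZ.mul hK).congr_of_eventuallyEq (by
    filter_upwards [isOpen_re_gt_half.mem_nhds h1re] with s hs
    exact lseries_gPow_mul_poly hF hq hFq hs))
  have hval := lseries_gPow_mul_poly hF hq hFq h1re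
  rw [riemannZeta₁_one, one_mul] at hval
  rw [riemannZeta₁_one, deriv_riemannZeta₁_one, one_mul] at hder
  rw [mulArith_sqPow_eq, hsq]
  refine norm_sumPow_mulArith_mul_sub_le (M := fun X => twistPoly (F 2) 1 * (Real.log X : ℂ)
    + (sqConst 2 * (1 + F 2 / 2) - sqLead 2 * (F 2 * (Real.log 2 : ℂ) / 2))) hG hM hX ?_
  have h1 := (lseriesSummable_gPow hF h1re.le).LSeriesHasSum.mul_right
    (twistPoly (F 2) 1 * (Real.log X : ℂ)
      + (sqConst 2 * (1 + F 2 / 2) - sqLead 2 * (F 2 * (Real.log 2 : ℂ) / 2)))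
  have h2 := (LSeriesSummable_logMul_of_lt_re hab).LSeriesHasSum.mul_right (twistPoly (F 2) 1)
  convert! h1.sub h2 using 1
  · funext d
    rcases Nat.eq_zero_or_pos d with rfl | hd
    · simp
    have hd' : (0 : ℝ) < d := by exact_mod_cast hd
    rw [LSeries.term_of_ne_zero (f := LSeries.logMul _) hd.ne', LSeries.logMul,
      Complex.ofReal_one, LSeries.term_of_ne_zero hd.ne', Real.log_div hX.ne' hd'.ne',
      ← Complex.natCast_log]
    push_cast
    ring
  · rw [kConst, ← hval]
    rw [← hval] at hder
    linear_combination -hder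

end

/-! ### From the logarithmic average to smaller exponents -/

lemma norm_integral_rpow_mul_le {φ : ℝ → ℂ} {b W Y X : ℝ} (hb : 0 ≤ b) (hY : 0 < Y) (hX : Y ≤ X)
    (h : ∀ t, 0 < t → t ≤ X → ‖φ t‖ * √t ≤ W) :
    ‖∫ t in Y..X, (b : ℂ) * ((t ^ (b - 1) : ℝ) : ℂ) * φ t‖
      ≤ ∫ t in Y..X, b * W * t ^ (b - 1 - 1 / 2) := by
  refine intervalIntegral.norm_integral_le_of_norm_le hX (MeasureTheory.ae_of_all _ fun t ht => ?_) ?_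
  · have ht0 : 0 < t := hY.trans ht.1
    have h1 : t ^ (b - 1) = t ^ (b - 1 - 1 / 2) * √t := by
      rw [Real.sqrt_eq_rpow, ← Real.rpow_add ht0, sub_add_cancel]
    rw [norm_mul, norm_mul, Complex.norm_real, Complex.norm_real, Real.norm_of_nonneg hb,
      Real.norm_of_nonneg (Real.rpow_nonneg ht0.le _), h1]
    calc b * (t ^ (b - 1 - 1 / 2) * √t) * ‖φ t‖
        = b * t ^ (b - 1 - 1 / 2) * (‖φ t‖ * √t) := by ring
      _ ≤ b * t ^ (b - 1 - 1 / 2) * W := by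
          have := h t ht0 ht.2
          gcongr
      _ = _ := by ring
  · refine ContinuousOn.intervalIntegrable_of_Icc hX (continuousOn_const.mul ?_)
    exact ContinuousOn.rpow_const continuousOn_id fun t ht => Or.inl (hY.trans_le ht.1).ne'

lemma integral_rpow_sub_half {b W Y X : ℝ} (hb : 1 / 2 < b) :
    ∫ t in Y..X, b * W * t ^ (b - 1 - 1 / 2)
      = b / (b - 1 / 2) * W * (X ^ (b - 1 / 2) - Y ^ (b - 1 / 2)) := by
  rw [intervalIntegral.integral_const_mul, integral_rpow (Or.inl (by linarith))]
  have h : b - 1 - 1 / 2 + 1 = b - 1 / 2 := by ring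
  have h0 : b - 1 / 2 ≠ 0 := by linarith
  rw [h]
  field_simp

/-- The sum of `c(n) n ^ (1 / 2)`. -/
lemma norm_sum_mul_sqrt_sub_le {c : ℕ → ℂ} {K k : ℂ} {W : ℝ}
    (hW : ∀ X : ℝ, 0 < X → ‖errC c K k X‖ * √X ≤ W) {X : ℝ} (hX : 1 ≤ X) :
    ‖∑ n ∈ Ioc 0 ⌊X⌋₊, c n * (((n : ℝ) ^ (1 / 2 : ℝ) : ℝ) : ℂ)
        - K / (1 / 2 : ℝ) * ((X ^ (1 / 2 : ℝ) : ℝ) : ℂ)‖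
      ≤ ‖k - K / (1 / 2 : ℝ)‖ + W * (1 + 1 / 2 * Real.log X) := by
  have hX0 : 0 < X := by linarith
  have h1 := norm_integral_rpow_mul_le (b := 1 / 2) (by norm_num) one_pos hX
    (fun t ht _ => hW t ht)
  have h2 : ∫ t in (1 : ℝ)..X, 1 / 2 * W * t ^ (1 / 2 - 1 - 1 / 2 : ℝ)
      = W * (1 / 2 * Real.log X) := by
    have h3 : ∀ t ∈ Set.uIcc 1 X, t ^ (1 / 2 - 1 - 1 / 2 : ℝ) = t⁻¹ := fun t ht => by
      rw [← Real.rpow_neg_one]; norm_num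
    rw [intervalIntegral.integral_const_mul, intervalIntegral.integral_congr h3,
      integral_inv_of_pos one_pos hX0, div_one]
    ring
  rw [h2] at h1
  rw [sum_mul_rpow_eq c K k (by norm_num : (1 / 2 : ℝ) ≠ 0) hX]
  generalize (∫ t in (1 : ℝ)..X, ((1 / 2 : ℝ) : ℂ) * ((t ^ (1 / 2 - 1 : ℝ) : ℝ) : ℂ)
    * errC c K k t) = I at *
  have h4 : ‖((X ^ (1 / 2 : ℝ) : ℝ) : ℂ) * errC c K k X‖ ≤ W := by
    rw [norm_mul, Complex.norm_real, Real.norm_of_nonneg (by positivity), ← Real.sqrt_eq_rpow,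
      mul_comm]
    exact hW X hX0
  generalize ((X ^ (1 / 2 : ℝ) : ℝ) : ℂ) * errC c K k X = E at *
  generalize K / ((1 / 2 : ℝ) : ℂ) * ((X ^ (1 / 2 : ℝ) : ℝ) : ℂ) = L at *
  calc ‖E + L + (k - K / (1 / 2 : ℝ)) - I - L‖ = ‖E + (k - K / (1 / 2 : ℝ)) - I‖ := by
        congr 1; ring
    _ ≤ ‖E‖ + ‖k - K / (1 / 2 : ℝ)‖ + ‖I‖ :=
        (norm_sub_le _ _).trans (by gcongr; exact norm_add_le _ _)
    _ ≤ _ := by linarith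

/-- The antiderivative of `b t ^ (b - 1) (K log t + k)` that vanishes at `0`. -/
def antiLog (K k : ℂ) (b X : ℝ) : ℂ :=
  ((X ^ b : ℝ) : ℂ) * (K * (Real.log X : ℂ) + k) - K / b * ((X ^ b : ℝ) : ℂ)

lemma tendsto_antiLog (K k : ℂ) {b : ℝ} (hb : 0 < b) :
    Tendsto (antiLog K k b) (𝓝[>] 0) (𝓝 0) := by
  have h1 : Tendsto (fun X : ℝ => ((X ^ b : ℝ) : ℂ)) (𝓝[>] 0) (𝓝 0) := by
    have := (Real.continuousAt_rpow_const 0 b (Or.inr hb.le)).tendsto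
    rw [Real.zero_rpow hb.ne'] at this
    exact_mod_cast (Complex.continuous_ofReal.tendsto 0).comp (this.mono_left nhdsWithin_le_nhds)
  have h2 : Tendsto (fun X : ℝ => ((Real.log X * X ^ b : ℝ) : ℂ)) (𝓝[>] 0) (𝓝 0) := by
    exact_mod_cast (Complex.continuous_ofReal.tendsto 0).comp
      (tendsto_log_mul_rpow_nhdsGT_zero hb)
  have h3 := (h2.const_mul K).add (h1.const_mul (k - K / b))
  rw [mul_zero, mul_zero, add_zero] at h3
  refine h3.congr fun X => ?_
  rw [antiLog]
  push_cast; ring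

/-- For `t < 1` the sum is empty and its error term is `-(K log t + k)`, so the hypothesis is a case
of the bound for the error term. -/
lemma norm_antiLog_le {K k : ℂ} {b W : ℝ} (hb : 1 / 2 < b) {X : ℝ} (hX : 0 < X)
    (h : ∀ t, 0 < t → t ≤ X → ‖K * (Real.log t : ℂ) + k‖ * √t ≤ W) :
    ‖antiLog K k b X‖ ≤ b / (b - 1 / 2) * W * X ^ (b - 1 / 2) := by
  have hW : 0 ≤ W := le_trans (by positivity) (h X hX le_rfl)
  have hb' : 0 ≤ b / (b - 1 / 2) := div_nonneg (by linarith) (by linarith)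
  have h1 : Tendsto (fun Y => ‖antiLog K k b X - antiLog K k b Y‖) (𝓝[>] 0)
      (𝓝 ‖antiLog K k b X - 0‖) := ((tendsto_antiLog K k (by linarith)).const_sub _).norm
  rw [sub_zero] at h1
  refine le_of_tendsto h1 ?_
  filter_upwards [Ioc_mem_nhdsGT hX] with Y hY
  have h2 := norm_integral_rpow_mul_le (b := b) (by linarith) hY.1 hY.2 h
  rw [integral_rpow_mul_log K k (by linarith) hY.1 hY.2, integral_rpow_sub_half hb] at h2
  refine h2.trans ?_
  have := Real.rpow_nonneg hY.1.le (b - 1 / 2)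
  gcongr
  linarith

/-- The sum of `c(n) n ^ b` for `b > 1 / 2`. -/
lemma norm_sum_mul_rpow_sub_le {c : ℕ → ℂ} {K k : ℂ} {b W : ℝ} (hb : 1 / 2 < b)
    (hW : ∀ X : ℝ, 0 < X → ‖errC c K k X‖ * √X ≤ W) {X : ℝ} (hX : 0 < X) :
    ‖∑ n ∈ Ioc 0 ⌊X⌋₊, c n * (((n : ℝ) ^ b : ℝ) : ℂ) - K / b * ((X ^ b : ℝ) : ℂ)‖
      ≤ (1 + b / (b - 1 / 2)) * W * X ^ (b - 1 / 2) := by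
  have hXb : X ^ b = X ^ (b - 1 / 2) * √X := by
    rw [Real.sqrt_eq_rpow, ← Real.rpow_add hX, sub_add_cancel]
  have hT : 0 < X ^ (b - 1 / 2) := Real.rpow_pos_of_pos hX _
  have hE : ‖((X ^ b : ℝ) : ℂ) * errC c K k X‖ ≤ W * X ^ (b - 1 / 2) := by
    rw [norm_mul, Complex.norm_real, Real.norm_of_nonneg (by positivity), hXb, mul_assoc,
      mul_comm √X, mul_comm W]
    have := hW X hX
    gcongr
  have hlog : ∀ t : ℝ, t < 1 → errC c K k t = -(K * (Real.log t : ℂ) + k) := fun t ht => by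
    rw [errC, Nat.floor_eq_zero.2 ht]; simp
  have hlog' : ∀ t : ℝ, 0 < t → t < 1 → ‖K * (Real.log t : ℂ) + k‖ * √t ≤ W := fun t ht h => by
    rw [← norm_neg, ← hlog t h]; exact hW t ht
  rcases lt_or_ge X 1 with h | h
  · have h1 := norm_antiLog_le hb hX (K := K) (k := k) (W := W)
      fun t ht htX => hlog' t ht (htX.trans_lt h)
    have e : ∑ n ∈ Ioc 0 ⌊X⌋₊, c n * (((n : ℝ) ^ b : ℝ) : ℂ) - K / b * ((X ^ b : ℝ) : ℂ)
        = antiLog K k b X + ((X ^ b : ℝ) : ℂ) * errC c K k X := by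
      rw [hlog X h, Nat.floor_eq_zero.2 h, antiLog]; simp; ring
    rw [e]
    refine (norm_add_le _ _).trans ?_
    linarith
  · have h1 : ‖antiLog K k b 1‖ ≤ b / (b - 1 / 2) * W := by
      have h2 : Tendsto (fun X : ℝ => ‖antiLog K k b X‖) (𝓝[<] 1) (𝓝 ‖antiLog K k b 1‖) := by
        have h3 : ContinuousAt (antiLog K k b) 1 := by
          have := (hasDerivAt_rpow_mul_log K k (b := b) (by linarith) one_pos).continuousAt
          exact this
        exact h3.norm.tendsto.mono_left nhdsWithin_le_nhds
      have h4 : Tendsto (fun X : ℝ => b / (b - 1 / 2) * W * X ^ (b - 1 / 2)) (𝓝[<] 1)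
          (𝓝 (b / (b - 1 / 2) * W * 1 ^ (b - 1 / 2))) :=
        ((Real.continuousAt_rpow_const 1 _ (Or.inl one_ne_zero)).tendsto.mono_left
          nhdsWithin_le_nhds).const_mul _
      rw [Real.one_rpow, mul_one] at h4
      refine le_of_tendsto_of_tendsto h2 h4 ?_
      filter_upwards [Ioo_mem_nhdsLT zero_lt_one] with Y hY
      exact norm_antiLog_le hb hY.1 fun t ht htX => hlog' t ht (htX.trans_lt hY.2)
    have h2 := norm_integral_rpow_mul_le (b := b) (by linarith) one_pos h (fun t ht _ => hW t ht)
    rw [integral_rpow_sub_half hb, Real.one_rpow] at h2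
    rw [sum_mul_rpow_eq c K k (by linarith : b ≠ 0) h]
    generalize (∫ t in (1 : ℝ)..X, (b : ℂ) * ((t ^ (b - 1) : ℝ) : ℂ) * errC c K k t) = I at *
    have h3 : antiLog K k b 1 = k - K / b := by simp [antiLog]
    rw [h3] at h1
    generalize ((X ^ b : ℝ) : ℂ) * errC c K k X = E at *
    generalize K / (b : ℂ) * ((X ^ b : ℝ) : ℂ) = L at *
    calc ‖E + L + (k - K / b) - I - L‖ = ‖E + (k - K / b) - I‖ := by congr 1; ring
      _ ≤ ‖E‖ + ‖k - K / b‖ + ‖I‖ := (norm_sub_le _ _).trans (by gcongr; exact norm_add_le _ _)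
      _ ≤ _ := by linarith

/-! ### The logarithmic derivative of the Euler product -/

/-- The inclusion of the primes not dividing `q` into the primes. -/
def toPrimes {q : ℕ} (p : PrimesNotDvd q) : Nat.Primes := ⟨p.1, p.2.1⟩

lemma toPrimes_injective (q : ℕ) : Function.Injective (toPrimes (q := q)) := fun _ _ h =>
  Subtype.ext (congrArg (fun x : Nat.Primes => (x : ℕ)) h)

lemma mem_range_toPrimes {q : ℕ} {p : Nat.Primes} (hp : p ∉ Set.range (toPrimes (q := q))) :
    (p : ℕ) ∣ q := by
  by_contra h
  exact hp ⟨⟨p, p.2, h⟩, rfl⟩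

/-- The Euler factor of `h` at a prime, written as a perturbation of `1`. -/
def hDev (F : ℕ → ℂ) (p : ℕ) (s : ℂ) : ℂ := (F p - 1) / (p : ℂ) ^ s - F p / ((p : ℂ) ^ s) ^ 2

lemma one_add_hDev (F : ℕ → ℂ) {p : ℕ} (hp : p ≠ 0) (s : ℂ) :
    1 + hDev F p s = (1 - 1 / (p : ℂ) ^ s) * (1 + F p / (p : ℂ) ^ s) := by
  have h : (p : ℂ) ^ s ≠ 0 := by simp [Complex.cpow_eq_zero_iff, hp]
  rw [hDev]
  field_simp
  ring

lemma norm_hDev_le (F : ℕ → ℂ) {p : ℕ} (hp : p.Prime) {σ₀ : ℝ} {s : ℂ} (h0 : 1 / 2 ≤ σ₀)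
    (hs : σ₀ ≤ s.re) :
    ‖hDev F p s‖ ≤ 2 * (‖F p - 1‖ / √(p : ℝ)) + 1 / (p : ℝ) ^ (2 * σ₀) := by
  refine le_trans ?_ (norm_div_add_norm_div_sq_le (F p) hp h0 hs)
  refine (norm_sub_le _ _).trans (le_of_eq ?_)
  rw [norm_div, norm_div, norm_pow, Complex.norm_natCast_cpow_of_pos hp.pos]

section

variable {F : ℕ → ℂ} (q : ℕ)

lemma summable_comp_toPrimes {E : Type*} [NormedAddCommGroup E] [CompleteSpace E]
    {u : Nat.Primes → E} (h : Summable u) :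
    Summable fun p : PrimesNotDvd q => u (toPrimes p) :=
  h.comp_injective (toPrimes_injective q)

lemma hasProd_one_add_hDev
    (hF : Summable fun p : Nat.Primes => ‖F p - 1‖ / √((p : ℕ) : ℝ)) {s : ℂ}
    (hs : 1 / 2 < s.re) :
    HasProd (fun p : PrimesNotDvd q => 1 + hDev F p.1 s) (LSeries (mulExt (hPow F q)) s) := by
  have h := hasProd_hPow hF q hs
  rw [← (toPrimes_injective q).hasProd_iff] at h
  · convert! h using 1
    funext p
    rw [one_add_hDev F p.2.1.ne_zero, Function.comp_apply, hFac]
    exact (if_neg p.2.2).symm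
  · intro p hp
    rw [hFac, if_pos (mem_range_toPrimes hp)]

/-- The terms of the logarithmic derivative at `1` of the Euler product of `h`. -/
def logTermF (F : ℕ → ℂ) (q : ℕ) (p : PrimesNotDvd q) : ℂ :=
  (Real.log p.1 : ℂ) * ((p.1 : ℂ) - ((p.1 : ℂ) - 2) * F p.1) / (((p.1 : ℂ) + F p.1) * ((p.1 : ℂ) - 1))

lemma hasDerivAt_natCast_cpow {p : ℕ} (hp : p ≠ 0) (s : ℂ) :
    HasDerivAt (fun s : ℂ => (p : ℂ) ^ s) ((p : ℂ) ^ s * (Real.log p : ℂ)) s := by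
  have h0 : (p : ℂ) ≠ 0 := by exact_mod_cast hp
  have h := (hasDerivAt_id s).const_cpow (c := (p : ℂ)) (Or.inl h0)
  rw [Complex.ofReal_log (Nat.cast_nonneg _)]
  simpa using h

lemma hasDerivAt_hDev (F : ℕ → ℂ) {p : ℕ} (hp : p ≠ 0) (s : ℂ) : HasDerivAt (hDev F p)
    (-(F p - 1) * (Real.log p : ℂ) / (p : ℂ) ^ s
      + 2 * F p * (Real.log p : ℂ) / ((p : ℂ) ^ s) ^ 2) s := by
  have h : (p : ℂ) ^ s ≠ 0 := by simp [Complex.cpow_eq_zero_iff, hp]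
  have h1 := hasDerivAt_natCast_cpow hp s
  have h2 := ((hasDerivAt_const s (F p - 1)).div h1 h).sub
    ((hasDerivAt_const s (F p)).div (h1.pow 2) (pow_ne_zero 2 h))
  convert! h2 using 1
  simp
  field_simp
  ring

lemma logDeriv_one_add_hDev {p : PrimesNotDvd q} (hne : F p.1 ≠ -(p.1 : ℂ)) :
    logDeriv (fun s => 1 + hDev F p.1 s) 1 = logTermF F q p := by
  have hp := p.2.1
  have h0 : (p.1 : ℂ) ≠ 0 := by exact_mod_cast hp.ne_zero
  have h1 : (p.1 : ℂ) - 1 ≠ 0 := sub_ne_zero.2 (by exact_mod_cast hp.ne_one)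
  have h2 : (p.1 : ℂ) + F p.1 ≠ 0 := fun h => hne (by linear_combination h)
  rw [logDeriv_apply, ((hasDerivAt_hDev F hp.ne_zero 1).const_add 1).deriv,
    one_add_hDev F hp.ne_zero, logTermF, Complex.cpow_one]
  field_simp
  ring

/-- The terms are summable because `log x` is at most `2 √x`. -/
lemma norm_logTermF_le {p : PrimesNotDvd q} (hp16 : 16 ≤ p.1) (hF1 : ‖F p.1 - 1‖ / √(p.1 : ℝ) ≤ 1) :
    ‖logTermF F q p‖ ≤ 24 * (‖F p.1 - 1‖ / √(p.1 : ℝ)) + 16 * (1 / (p.1 : ℝ) ^ (3 / 2 : ℝ)) := by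
  have hx : (16 : ℝ) ≤ p.1 := by exact_mod_cast hp16
  rw [logTermF]
  generalize F p.1 = z at *
  have hc : ((p.1 : ℕ) : ℂ) = ((p.1 : ℝ) : ℂ) := by simp
  rw [hc]
  generalize (p.1 : ℝ) = x at *
  have hx0 : 0 < x := by linarith
  have hs0 : 0 < √x := Real.sqrt_pos.2 hx0
  have hs : √x * √x = x := Real.mul_self_sqrt hx0.le
  have hs4 : 4 ≤ √x := Real.le_sqrt_of_sq_le (by linarith)
  have hx32 : x ^ (3 / 2 : ℝ) = x * √x := by
    rw [Real.sqrt_eq_rpow, ← Real.rpow_one_add' hx0.le (by norm_num)]; norm_num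
  have hlog : Real.log x ≤ 2 * √x := by
    have := Real.log_le_sub_one_of_pos hs0
    rw [Real.log_sqrt hx0.le] at this
    linarith
  have hlog0 : 0 ≤ Real.log x := Real.log_nonneg (by linarith)
  rw [div_le_one hs0] at hF1
  set w := ‖z - 1‖ with hw
  have hw0 : 0 ≤ w := norm_nonneg _
  have hz : ‖z‖ ≤ w + 1 := by simpa using norm_add_le (z - 1) 1
  have h1 : x / 2 ≤ ‖(x : ℂ) + z‖ := by
    have h2 := norm_sub_le_norm_add (x : ℂ) z
    rw [Complex.norm_real, Real.norm_of_nonneg hx0.le] at h2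
    nlinarith
  have h2 : x / 2 ≤ ‖(x : ℂ) - 1‖ := by
    have h2 := norm_sub_norm_le (x : ℂ) 1
    rw [Complex.norm_real, Real.norm_of_nonneg hx0.le, norm_one] at h2
    linarith
  have h3 : ‖(x : ℂ) - ((x : ℂ) - 2) * z‖ ≤ 2 + 3 * x * w := by
    have e : (x : ℂ) - ((x : ℂ) - 2) * z = 2 * z - x * (z - 1) := by ring
    rw [e]
    refine (norm_sub_le _ _).trans ?_
    rw [norm_mul, norm_mul, Complex.norm_real, Real.norm_of_nonneg hx0.le, Complex.norm_ofNat]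
    nlinarith
  rw [norm_div, norm_mul, norm_mul, Complex.norm_real, Real.norm_of_nonneg hlog0, hx32]
  calc Real.log x * ‖(x : ℂ) - ((x : ℂ) - 2) * z‖ / (‖(x : ℂ) + z‖ * ‖(x : ℂ) - 1‖)
      ≤ (2 * √x) * (2 + 3 * x * w) / ((x / 2) * (x / 2)) := by gcongr
    _ = 24 * (w / √x) + 16 * (1 / (x * √x)) := by
        have e : (2 * √x) * (2 + 3 * x * w) / ((x / 2) * (x / 2))
            = 24 * (w * √x / x) + 16 * (√x / (x * x)) := by field_simp; ring
        have e1 : √x / x = 1 / √x := by rw [div_eq_div_iff hx0.ne' hs0.ne', one_mul, hs]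
        have e2 : w * √x / x = w / √x := by rw [mul_div_assoc, e1]; ring
        have e3 : √x / (x * x) = 1 / (x * √x) := by
          rw [div_mul_eq_div_div, e1, div_div, mul_comm]
        rw [e, e2, e3]

lemma summable_logTermF (hF : Summable fun p : Nat.Primes => ‖F p - 1‖ / √((p : ℕ) : ℝ)) :
    Summable (logTermF F q) := by
  have h1 : Summable fun p : PrimesNotDvd q => ‖F p.1 - 1‖ / √(p.1 : ℝ) :=
    summable_comp_toPrimes q hF
  have h2 : Summable fun p : PrimesNotDvd q => 1 / (p.1 : ℝ) ^ (3 / 2 : ℝ) :=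
    summable_comp_toPrimes q (summable_primes_rpow_inv (by norm_num : (1 : ℝ) < 3 / 2))
  refine Summable.of_norm_bounded_eventually ((h1.mul_left 24).add (h2.mul_left 16)) ?_
  have h3 : ∀ᶠ p : PrimesNotDvd q in cofinite, ‖F p.1 - 1‖ / √(p.1 : ℝ) < 1 :=
    h1.tendsto_cofinite_zero.eventually (gt_mem_nhds one_pos)
  have h4 : ∀ᶠ p : PrimesNotDvd q in cofinite, 16 ≤ p.1 := by
    have : Tendsto (fun p : PrimesNotDvd q => p.1) cofinite atTop := by
      rw [← Nat.cofinite_eq_atTop]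
      exact Subtype.val_injective.tendsto_cofinite
    exact this.eventually_ge_atTop 16
  filter_upwards [h3, h4] with p hp hp'
  exact norm_logTermF_le q hp' hp.le

lemma summable_norm_hDev (hF : Summable fun p : Nat.Primes => ‖F p - 1‖ / √((p : ℕ) : ℝ))
    {s : ℂ} (hs : 1 / 2 < s.re) : Summable fun p : PrimesNotDvd q => ‖hDev F p.1 s‖ :=
  ((summable_comp_toPrimes q ((hF.mul_left 2).add
    (summable_primes_rpow_inv (by linarith : 1 < 2 * s.re))))).of_nonneg_of_le
    (fun _ => norm_nonneg _) fun p => norm_hDev_le F p.2.1 hs.le le_rfl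

/-- An absolutely convergent product of nonzero factors does not vanish. -/
lemma lseries_hPow_one_ne_zero (hF : Summable fun p : Nat.Primes => ‖F p - 1‖ / √((p : ℕ) : ℝ))
    (hne : ∀ p : PrimesNotDvd q, F p.1 ≠ -(p.1 : ℂ)) : LSeries (mulExt (hPow F q)) 1 ≠ 0 := by
  have h1re : 1 / 2 < (1 : ℂ).re := by norm_num
  rw [← (hasProd_one_add_hDev q hF h1re).tprod_eq]
  refine tprod_one_add_ne_zero_of_summable (fun p => ?_) (summable_norm_hDev q hF h1re)
  have h0 : (p.1 : ℂ) ≠ 0 := by exact_mod_cast p.2.1.ne_zero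
  rw [one_add_hDev F p.2.1.ne_zero, Complex.cpow_one]
  refine mul_ne_zero ?_ ?_
  · rw [sub_ne_zero, ne_comm, Ne, div_eq_one_iff_eq h0]
    exact_mod_cast p.2.1.ne_one.symm
  · intro h
    apply hne p
    field_simp at h
    linear_combination h

/-- The product can be differentiated logarithmically because it converges locally uniformly. -/
lemma deriv_lseries_hPow_one (hF : Summable fun p : Nat.Primes => ‖F p - 1‖ / √((p : ℕ) : ℝ))
    (hne : ∀ p : PrimesNotDvd q, F p.1 ≠ -(p.1 : ℂ)) :
    deriv (LSeries (mulExt (hPow F q))) 1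
      = LSeries (mulExt (hPow F q)) 1 * ∑' p : PrimesNotDvd q, logTermF F q p := by
  have h1re : 1 / 2 < (1 : ℂ).re := by norm_num
  have hL := lseries_hPow_one_ne_zero q hF hne
  have hopen : IsOpen {s : ℂ | 3 / 4 < s.re} := isOpen_lt continuous_const Complex.continuous_re
  have h1 : (1 : ℂ) ∈ {s : ℂ | 3 / 4 < s.re} := by norm_num
  have hne' : ∀ p : PrimesNotDvd q, 1 + hDev F p.1 1 ≠ 0 := by
    have h := hL
    rw [← (hasProd_one_add_hDev q hF h1re).tprod_eq] at h
    intro p hp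
    exact h (tprod_of_exists_eq_zero ⟨p, hp⟩)
  have hd : ∀ p : PrimesNotDvd q, Differentiable ℂ (hDev F p.1) := fun p s =>
    (hasDerivAt_hDev F p.2.1.ne_zero s).differentiableAt
  have hsum : Summable fun p : PrimesNotDvd q =>
      2 * (‖F p.1 - 1‖ / √(p.1 : ℝ)) + 1 / (p.1 : ℝ) ^ (2 * (3 / 4) : ℝ) :=
    summable_comp_toPrimes q ((hF.mul_left 2).add
      (summable_primes_rpow_inv (by norm_num : (1 : ℝ) < 2 * (3 / 4))))
  have hm := Summable.multipliableLocallyUniformlyOn_one_add hopen hsum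
    (f := fun (p : PrimesNotDvd q) s => hDev F p.1 s)
    (Eventually.of_forall fun p s hs => norm_hDev_le F p.2.1 (by norm_num) (le_of_lt hs))
    fun p => (hd p).continuous.continuousOn
  have key := logDeriv_tprod_eq_tsum hopen h1 hne'
    (fun p => ((hd p).const_add 1).differentiableOn) ?_ hm ?_
  · have he : (fun s => ∏' p : PrimesNotDvd q, (1 + hDev F p.1 s))
        =ᶠ[𝓝 1] LSeries (mulExt (hPow F q)) := by
      filter_upwards [isOpen_re_gt_half.mem_nhds h1re] with s hs
      exact (hasProd_one_add_hDev q hF hs).tprod_eq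
    rw [logDeriv_apply, he.deriv_eq, he.eq_of_nhds, div_eq_iff hL] at key
    rw [key, mul_comm]
    congr 1
    exact tsum_congr fun p => logDeriv_one_add_hDev q (hne p)
  · exact (summable_logTermF q hF).congr fun p => (logDeriv_one_add_hDev q (hne p)).symm
  · rwa [(hasProd_one_add_hDev q hF h1re).tprod_eq]

lemma one_sub_inv_prime_ne_zero {p : ℕ} (hp : p.Prime) : 1 - 1 / (p : ℂ) ≠ 0 := by
  have h0 : (p : ℂ) ≠ 0 := by exact_mod_cast hp.ne_zero
  rw [sub_ne_zero, ne_comm, Ne, div_eq_one_iff_eq h0]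
  exact_mod_cast hp.ne_one.symm

lemma phiFac_one_ne_zero : phiFac q 1 ≠ 0 := by
  rw [phiFac, prod_ne_zero_iff]
  intro p hp
  rw [Complex.cpow_one]
  exact one_sub_inv_prime_ne_zero (Nat.prime_of_mem_primeFactors hp)

lemma deriv_phiFac_one : deriv (phiFac q) 1 = phiFac q 1 * (logSumDvd q : ℂ) := by
  have hd : ∀ p ∈ q.primeFactors, HasDerivAt (fun s : ℂ => 1 - 1 / (p : ℂ) ^ s)
      ((Real.log p : ℂ) / p) 1 := by
    intro p hp
    have hp0 := (Nat.prime_of_mem_primeFactors hp).ne_zero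
    have h0 : (p : ℂ) ≠ 0 := by exact_mod_cast hp0
    have h := ((hasDerivAt_const (1 : ℂ) (1 : ℂ)).div (hasDerivAt_natCast_cpow hp0 1)
      (by simpa using h0)).const_sub 1
    convert! h using 1
    rw [Complex.cpow_one]
    field_simp
    ring
  have h1 : logDeriv (fun s : ℂ => ∏ p ∈ q.primeFactors, (1 - 1 / (p : ℂ) ^ s)) 1
      = (logSumDvd q : ℂ) := by
    rw [logDeriv_prod]
    · rw [logSumDvd]
      push_cast
      refine sum_congr rfl fun p hp => ?_
      have hp' := Nat.prime_of_mem_primeFactors hp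
      have h0 : (p : ℂ) ≠ 0 := by exact_mod_cast hp'.ne_zero
      have h1 := one_sub_inv_prime_ne_zero hp'
      rw [logDeriv_apply, (hd p hp).deriv, Complex.cpow_one]
      have h2 : (p : ℂ) - 1 ≠ 0 := sub_ne_zero.2 (by exact_mod_cast hp'.ne_one)
      field_simp
      exact (Complex.natCast_log (n := p)).symm ▸ rfl
    · intro p hp
      rw [Complex.cpow_one]
      exact one_sub_inv_prime_ne_zero (Nat.prime_of_mem_primeFactors hp)
    · exact fun p hp => (hd p hp).differentiableAt
  rw [logDeriv_apply] at h1
  have h2 := phiFac_one_ne_zero q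
  change deriv (phiFac q) 1 / phiFac q 1 = _ at h1
  rw [← h1, mul_div_cancel₀ _ h2]

lemma kConst_eq (hF : Summable fun p : Nat.Primes => ‖F p - 1‖ / √((p : ℕ) : ℝ)) : kConst F q
    = kFun F q 1 * (Real.eulerMascheroniConstant + logSumDvd q)
      + phiFac q 1 * deriv (LSeries (mulExt (hPow F q))) 1 := by
  have h := (differentiableAt_phiFac q 1).hasDerivAt.mul
    (hasDerivAt_lseries_hPow hF q (by norm_num : 1 / 2 < (1 : ℂ).re)).differentiableAt.hasDerivAt
  have h2 : HasDerivAt (kFun F q) _ 1 := h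
  rw [kConst, h2.deriv, deriv_phiFac_one, kFun]
  ring

lemma kConst_of_ne (hF : Summable fun p : Nat.Primes => ‖F p - 1‖ / √((p : ℕ) : ℝ))
    (hne : ∀ p : PrimesNotDvd q, F p.1 ≠ -(p.1 : ℂ)) : kConst F q
    = kFun F q 1 * ((∑' p : PrimesNotDvd q, logTermF F q p)
      + Real.eulerMascheroniConstant + logSumDvd q) := by
  rw [kConst_eq q hF, deriv_lseries_hPow_one q hF hne, kFun]
  ring

/-- If `F p = -p` for some `p ∤ q`, the Euler factor of `h` at `p` vanishes at `1`, and the logarithmic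
derivative is not available. -/
lemma kFun_one_of_eq (hF : Summable fun p : Nat.Primes => ‖F p - 1‖ / √((p : ℕ) : ℝ))
    (he : ∃ p : PrimesNotDvd q, F p.1 = -(p.1 : ℂ)) : kFun F q 1 = 0 := by
  obtain ⟨p, hp⟩ := he
  have h0 : (p.1 : ℂ) ≠ 0 := by exact_mod_cast p.2.1.ne_zero
  rw [kFun, ← (hasProd_one_add_hDev q hF (by norm_num : 1 / 2 < (1 : ℂ).re)).tprod_eq,
    tprod_of_exists_eq_zero ⟨p, ?_⟩, mul_zero]
  rw [one_add_hDev F p.2.1.ne_zero, Complex.cpow_one, hp, neg_div, div_self h0]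
  ring

lemma kConst_of_eq (hF : Summable fun p : Nat.Primes => ‖F p - 1‖ / √((p : ℕ) : ℝ))
    (he : ∃ p : PrimesNotDvd q, F p.1 = -(p.1 : ℂ)) : kConst F q
    = -(phiFac q 1 * LSeries (LSeries.logMul (mulExt (hPow F q))) 1) := by
  rw [kConst_eq q hF, kFun_one_of_eq q hF he,
    (hasDerivAt_lseries_hPow hF q (by norm_num : 1 / 2 < (1 : ℂ).re)).deriv]
  ring

end

/-! ### The normalized function and the constants of the theorem -/

/-- The values at the primes of the normalized function `p ↦ f(p) p ^ α`, set to `0` at the primes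
dividing `q`. -/
def liftF (f : ArithmeticFunction ℂ) (α : ℝ) (q p : ℕ) : ℂ :=
  if p ∣ q then 0 else f p * (((p : ℝ) ^ α : ℝ) : ℂ)

lemma liftF_of_dvd (f : ArithmeticFunction ℂ) (α : ℝ) {q p : ℕ} (h : p ∣ q) :
    liftF f α q p = 0 := if_pos h

lemma liftF_of_not_dvd (f : ArithmeticFunction ℂ) (α : ℝ) {q p : ℕ} (h : ¬ p ∣ q) :
    liftF f α q p = f p * (((p : ℝ) ^ α : ℝ) : ℂ) := if_neg h

lemma norm_liftF_sub_one (f : ArithmeticFunction ℂ) (α : ℝ) {q p : ℕ} (h : ¬ p ∣ q) :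
    ‖liftF f α q p - 1‖ = dev f α p := by
  rw [liftF_of_not_dvd f α h, dev]

section

variable {q : ℕ} {α β : ℝ} {f : ArithmeticFunction ℂ}

lemma eventually_not_dvd (hq : 0 < q) : ∀ᶠ p : Nat.Primes in cofinite, ¬ (p : ℕ) ∣ q := by
  have h : Tendsto (fun p : Nat.Primes => (p : ℕ)) cofinite atTop := by
    rw [← Nat.cofinite_eq_atTop]
    exact Subtype.val_injective.tendsto_cofinite
  filter_upwards [h.eventually_gt_atTop q] with p hp hd
  exact absurd (Nat.le_of_dvd hq hd) (by omega)

lemma summable_dev (hq : 0 < q) (hαβ : 1 / 2 < β - α)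
    (hfp : ∃ K : ℝ, ∀ p : ℕ, p.Prime → p.Coprime q →
      ‖f p - ((1 / (p : ℝ) ^ α : ℝ) : ℂ)‖ ≤ K * (1 / (p : ℝ) ^ β)) :
    Summable fun p : Nat.Primes => dev f α p / √((p : ℕ) : ℝ) := by
  obtain ⟨K, hK⟩ := hfp
  refine Summable.of_norm_bounded_eventually ((summable_primes_rpow_inv
    (by linarith : 1 < β - α + 1 / 2)).mul_left K) ?_
  filter_upwards [eventually_not_dvd hq] with p hp
  obtain ⟨p, hpp⟩ := p
  change ¬ p ∣ q at hp
  change ‖dev f α p / √(p : ℝ)‖ ≤ K * (1 / (p : ℝ) ^ (β - α + 1 / 2))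
  have hp0 : (0 : ℝ) < p := by exact_mod_cast hpp.pos
  have h1 := hK p hpp ((Nat.Prime.coprime_iff_not_dvd hpp).2 hp)
  have h2 : (p : ℝ) ^ α ≠ 0 := (Real.rpow_pos_of_pos hp0 _).ne'
  have h3 : dev f α p = ‖f p - ((1 / (p : ℝ) ^ α : ℝ) : ℂ)‖ * (p : ℝ) ^ α := by
    rw [dev, ← Real.norm_of_nonneg (Real.rpow_nonneg hp0.le α), ← Complex.norm_real, ← norm_mul,
      sub_mul, ← Complex.ofReal_mul, Complex.norm_real, Real.norm_of_nonneg (by positivity),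
      one_div_mul_cancel h2, Complex.ofReal_one]
  have h4 : (p : ℝ) ^ (β - α + 1 / 2) = (p : ℝ) ^ β / (p : ℝ) ^ α * √(p : ℝ) := by
    rw [Real.rpow_add hp0, Real.rpow_sub hp0, Real.sqrt_eq_rpow]
  rw [Real.norm_of_nonneg (show 0 ≤ dev f α p / √(p : ℝ) from
    div_nonneg (norm_nonneg _) (Real.sqrt_nonneg _)), h3, h4]
  calc ‖f p - ((1 / (p : ℝ) ^ α : ℝ) : ℂ)‖ * (p : ℝ) ^ α / √(p : ℝ)
      ≤ K * (1 / (p : ℝ) ^ β) * (p : ℝ) ^ α / √(p : ℝ) := by gcongr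
    _ = _ := by
      field_simp

lemma summable_liftF (hq : 0 < q) (hd : Summable fun p : Nat.Primes => dev f α p / √((p : ℕ) : ℝ)) :
    Summable fun p : Nat.Primes => ‖liftF f α q p - 1‖ / √((p : ℕ) : ℝ) := by
  refine (summable_congr_cofinite ?_).2 hd
  filter_upwards [eventually_not_dvd hq] with p hp
  rw [norm_liftF_sub_one f α hp]

lemma multipliable_factorP
    (hd : Summable fun p : Nat.Primes => dev f α p / √((p : ℕ) : ℝ)) :
    Multipliable (factorP f α) := by
  have h0 : ∀ p : ℕ, 0 ≤ dev f α p := fun p => norm_nonneg _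
  have h : Summable fun p : Nat.Primes => dev f α p / (√((p : ℕ) : ℝ) - 1) := by
    refine (hd.mul_left 4).of_nonneg_of_le (fun p => ?_) fun p => ?_
    · exact div_nonneg (h0 p) (by linarith [one_lt_sqrt_prime p.2])
    · have h1 := one_lt_sqrt_prime p.2
      have h2 := sqrt_prime_sub_one_ge p.2
      have h3 : 4 * (dev f α p / √((p : ℕ) : ℝ)) = dev f α p / (√((p : ℕ) : ℝ) / 4) := by
        field_simp
      rw [h3]
      exact div_le_div_of_nonneg_left (h0 p) (by linarith) h2
  exact Real.multipliable_one_add_of_summable h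

/-- The quotient of the Euler factor at `2` of the product in `prodDvd * prodP` by the one in the
sum of the `|g(d)| d ^ (-1 / 2)`. -/
def facTwo (f : ArithmeticFunction ℂ) (α : ℝ) (q : ℕ) : ℝ :=
  if 2 ∣ q then √2 / (√2 - 1) else (√2 - 1 + dev f α 2) / (√2 - 1)

/-- Comparison factor by factor: at `p ∣ q` the product of the two factors on the left is
`√p / (√p - 1)`, which is the factor of `g` there because `liftF` vanishes at `p`. The prime `2`
is left to `facTwo`. -/
lemma prodDvd_mul_prodP (hq : 0 < q)
    (hd : Summable fun p : Nat.Primes => dev f α p / √((p : ℕ) : ℝ)) :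
    prodDvd f α q * prodP f α
      = facTwo f α q * ∑' d, ‖LSeries.term (mulExt (gPow (liftF f α q))) (1 / 2) d‖ := by
  have hG := hasProd_norm_gPow (summable_liftF hq hd)
  generalize ∑' d, ‖LSeries.term (mulExt (gPow (liftF f α q))) (1 / 2) d‖ = G at *
  have hc := hasProd_ite_dvd hq
    fun p => 1 + (1 - dev f α p) / (√(p : ℝ) - 1 + dev f α p)
  have hP := (multipliable_factorP hd).hasProd
  have h2 := hasProd_ite_dvd (q := 2) two_pos fun _ => facTwo f α q
  rw [Nat.prime_two.primeFactors, prod_singleton] at h2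
  have h0 : ∀ p : ℕ, 0 ≤ dev f α p := fun p => norm_nonneg _
  refine (hc.mul hP).unique ?_
  convert! h2.mul hG using 1
  funext p
  obtain ⟨p, hp⟩ := p
  change (if p ∣ q then 1 + (1 - dev f α p) / (√(p : ℝ) - 1 + dev f α p) else 1)
      * (1 + dev f α p / (√(p : ℝ) - 1))
    = (if p ∣ 2 then facTwo f α q else 1)
      * (if p = 2 then 1 else 1 + ‖liftF f α q p - 1‖ / (√(p : ℝ) - 1))
  have h1 : √(p : ℝ) - 1 ≠ 0 := by linarith [one_lt_sqrt_prime hp]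
  have h3 : √(p : ℝ) - 1 + dev f α p ≠ 0 := by linarith [one_lt_sqrt_prime hp, h0 p]
  have h4 : (if p ∣ q then 1 + (1 - dev f α p) / (√(p : ℝ) - 1 + dev f α p) else 1)
      * (1 + dev f α p / (√(p : ℝ) - 1))
      = if p ∣ q then √(p : ℝ) / (√(p : ℝ) - 1)
        else (√(p : ℝ) - 1 + dev f α p) / (√(p : ℝ) - 1) := by
    split_ifs <;> field_simp
    ring
  rw [h4]
  rcases eq_or_ne p 2 with rfl | hp2
  · rw [if_pos dvd_rfl, if_pos rfl, mul_one, facTwo]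
    norm_num
  · rw [if_neg fun h => hp2 ((Nat.prime_dvd_prime_iff_eq hp Nat.prime_two).1 h), if_neg hp2,
      one_mul]
    split_ifs with h
    · rw [liftF_of_dvd f α h, zero_sub, norm_neg, norm_one]
      field_simp
      ring
    · rw [norm_liftF_sub_one f α h]
      field_simp

lemma errW_liftF (a : ℝ) :
    errW a q (liftF f α q 2) = weight a f α q * facTwo f α q := by
  have hs := sqrt_two_bounds.1
  have hs1 : √2 - 1 ≠ 0 := by linarith
  have h0 : 0 ≤ dev f α 2 := norm_nonneg _
  rw [errW, weight, facTwo]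
  split_ifs with h
  · rw [baseW, phiGen_half_two]
    push_cast; rfl
  · have h3 : √2 - 1 + dev f α 2 ≠ 0 := by linarith
    have hs2 : (0 : ℝ) < √2 := by positivity
    rw [norm_liftF_sub_one f α h, baseW, baseW, sqrt_div_phiGen_one, phiGen_half_two]
    push_cast
    field_simp

/-- The constant in the error term, as it results from the reduction. -/
lemma errW_mul_tsum (hq : 0 < q) (hd : Summable fun p : Nat.Primes => dev f α p / √((p : ℕ) : ℝ))
    (a : ℝ) :
    errW a q (liftF f α q 2) * ∑' d, ‖LSeries.term (mulExt (gPow (liftF f α q))) (1 / 2) d‖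
      = prodDvd f α q * weight a f α q * prodP f α := by
  rw [errW_liftF, mul_assoc, ← prodDvd_mul_prodP hq hd]
  ring

end

section

variable (f : ArithmeticFunction ℂ) (α : ℝ) {q : ℕ}

/-! ### The products and series of the theorem in terms of `liftF` -/

lemma eulerFactorH_eq (s : ℝ) (p : PrimesNotDvd q) :
    eulerFactorH f α q s p = 1 + hDev (liftF f α q) p.1 ((s + α : ℝ) : ℂ) := by
  have hp0 : (0 : ℝ) < p.1 := by exact_mod_cast p.2.1.pos
  have h1 : (((p.1 : ℝ) ^ (2 * s + α) : ℝ) : ℂ)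
      = (((p.1 : ℝ) ^ (s + α) : ℝ) : ℂ) ^ 2 / (((p.1 : ℝ) ^ α : ℝ) : ℂ) := by
    have h2 : (p.1 : ℝ) ^ (2 * s + α) = ((p.1 : ℝ) ^ (s + α)) ^ 2 / (p.1 : ℝ) ^ α := by
      rw [← Real.rpow_natCast, ← Real.rpow_mul hp0.le, ← Real.rpow_sub hp0]
      congr 1; push_cast; ring
    rw [h2]; push_cast; rfl
  have h3 : ((p.1 : ℕ) : ℂ) ^ ((s + α : ℝ) : ℂ) = (((p.1 : ℝ) ^ (s + α) : ℝ) : ℂ) := by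
    rw [Complex.ofReal_cpow hp0.le]; simp
  have h4 : (((p.1 : ℝ) ^ (s + α) : ℝ) : ℂ) ≠ 0 := by
    exact_mod_cast (Real.rpow_pos_of_pos hp0 _).ne'
  rw [eulerFactorH, hDev, h1, h3, liftF_of_not_dvd f α p.2.2, div_div_eq_mul_div]
  ring

lemma eulerFactorH'_eq (p : PrimesNotDvd q) :
    eulerFactorH' f α q p = 1 + hDev (liftF f α q) p.1 1 := by
  have hp0 : (0 : ℝ) < p.1 := by exact_mod_cast p.2.1.pos
  have hc : (p.1 : ℂ) ≠ 0 := by exact_mod_cast p.2.1.ne_zero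
  have h1 : (((p.1 : ℝ) ^ (1 - α) : ℝ) : ℂ) = p.1 / (((p.1 : ℝ) ^ α : ℝ) : ℂ) := by
    rw [Real.rpow_sub hp0, Real.rpow_one]; push_cast; rfl
  have h2 : (((p.1 : ℝ) ^ (2 - α) : ℝ) : ℂ) = p.1 ^ 2 / (((p.1 : ℝ) ^ α : ℝ) : ℂ) := by
    rw [Real.rpow_sub hp0, Real.rpow_ofNat]; push_cast; rfl
  have h3 : (((p.1 : ℝ) ^ α : ℝ) : ℂ) ≠ 0 := by
    exact_mod_cast (Real.rpow_pos_of_pos hp0 _).ne'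
  rw [eulerFactorH', hDev, h1, h2, Complex.cpow_one, liftF_of_not_dvd f α p.2.2]
  field_simp
  ring

lemma hCoeff_eq {d : ℕ} (hd : d ≠ 0) : hCoeff f α q d = mulExt (hPow (liftF f α q) q) d := by
  rw [hCoeff, mulExt, if_neg hd]
  split_ifs with h
  · refine Finsupp.prod_congr fun p hp => ?_
    have hp' := Nat.prime_of_mem_primeFactors hp
    have hpq : ¬ p ∣ q := fun h2 =>
      hp'.one_lt.ne' (Nat.eq_one_of_dvd_coprimes h (Nat.dvd_of_mem_primeFactors hp) h2)
    rw [hPow, if_neg hpq, liftF_of_not_dvd f α hpq]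
  · obtain ⟨p, hp, hpd, hpq⟩ := Nat.Prime.not_coprime_iff_dvd.1 h
    refine (prod_eq_zero (Nat.mem_primeFactors.2 ⟨hp, hpd, hd⟩) ?_).symm
    rw [hPow, if_pos hpq]

lemma logTerm_eq (d : ℕ) : logTerm f α q d
    = LSeries.term (LSeries.logMul (mulExt (hPow (liftF f α q) q))) 1 d := by
  rcases eq_or_ne d 0 with rfl | hd
  · simp [logTerm]
  · rw [logTerm, hCoeff_eq f α hd, LSeries.term_of_ne_zero hd, LSeries.logMul, Complex.cpow_one,
      ← Complex.natCast_log, mul_comm (mulExt _ d)]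

lemma termT_eq (p : PrimesNotDvd q) : termT f q p = logTermF (liftF f 1 q) q p := by
  have hc : (p.1 : ℂ) ≠ 0 := by exact_mod_cast p.2.1.ne_zero
  rw [termT, logTermF, liftF_of_not_dvd f 1 p.2.2, Real.rpow_one, Complex.ofReal_natCast]
  have e1 : (Real.log p.1 : ℂ) * ((p.1 : ℂ) - ((p.1 : ℂ) - 2) * (f p.1 * p.1))
      = p.1 * ((Real.log p.1 : ℂ) * (1 - ((p.1 : ℂ) - 2) * f p.1)) := by ring
  have e2 : ((p.1 : ℂ) + f p.1 * p.1) * ((p.1 : ℂ) - 1)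
      = p.1 * ((f p.1 + 1) * ((p.1 : ℂ) - 1)) := by ring
  rw [e1, e2, mul_div_mul_left _ _ hc]

lemma sqrt_natCast_mul_self (n : ℕ) : (√(n : ℝ) : ℂ) * (√(n : ℝ) : ℂ) = n := by
  rw [← Complex.ofReal_mul, Real.mul_self_sqrt (Nat.cast_nonneg _), Complex.ofReal_natCast]

lemma sqrt_prime_ne_zero (p : PrimesNotDvd q) : (√(p.1 : ℝ) : ℂ) ≠ 0 := by
  have : (0 : ℝ) < p.1 := by exact_mod_cast p.2.1.pos
  exact_mod_cast (Real.sqrt_pos.2 this).ne'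

lemma liftF_half (p : PrimesNotDvd q) :
    liftF f (1 / 2) q p.1 = f p.1 * (√(p.1 : ℝ) : ℂ) := by
  rw [liftF_of_not_dvd f _ p.2.2, Real.sqrt_eq_rpow]

lemma termC_eq (p : PrimesNotDvd q) : termC f q p = logTermF (liftF f (1 / 2) q) q p := by
  have hc := sqrt_prime_ne_zero p
  have hs := sqrt_natCast_mul_self p.1
  rw [termC, logTermF, liftF_half]
  have e1 : (Real.log p.1 : ℂ) * ((p.1 : ℂ) - ((p.1 : ℂ) - 2) * (f p.1 * (√(p.1 : ℝ) : ℂ)))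
      = (√(p.1 : ℝ) : ℂ)
        * ((Real.log p.1 : ℂ) * ((√(p.1 : ℝ) : ℂ) - ((p.1 : ℂ) - 2) * f p.1)) := by
    linear_combination -(Real.log p.1 : ℂ) * hs
  have e2 : ((p.1 : ℂ) + f p.1 * (√(p.1 : ℝ) : ℂ)) * ((p.1 : ℂ) - 1)
      = (√(p.1 : ℝ) : ℂ) * ((f p.1 + (√(p.1 : ℝ) : ℂ)) * ((p.1 : ℂ) - 1)) := by
    linear_combination -((p.1 : ℂ) - 1) * hs
  rw [e1, e2, mul_div_mul_left _ _ hc]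

lemma liftF_one_eq_iff (p : PrimesNotDvd q) :
    liftF f 1 q p.1 = -(p.1 : ℂ) ↔ f p.1 = -1 := by
  have hc : (p.1 : ℂ) ≠ 0 := by exact_mod_cast p.2.1.ne_zero
  rw [liftF_of_not_dvd f 1 p.2.2, Real.rpow_one, Complex.ofReal_natCast]
  constructor
  · intro h
    apply mul_right_cancel₀ hc
    linear_combination h
  · intro h
    rw [h]; ring

lemma liftF_half_eq_iff (p : PrimesNotDvd q) :
    liftF f (1 / 2) q p.1 = -(p.1 : ℂ) ↔ f p.1 = -(√(p.1 : ℝ) : ℂ) := by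
  have hc := sqrt_prime_ne_zero p
  have hs := sqrt_natCast_mul_self p.1
  rw [liftF_half]
  constructor
  · intro h
    apply mul_right_cancel₀ hc
    linear_combination h + hs
  · intro h
    rw [h]; linear_combination -hs

lemma phiFac_one_eq (hq : 0 < q) : phiFac q 1 = (q.totient : ℂ) / (q : ℂ) := by
  have hc : (q : ℂ) ≠ 0 := by exact_mod_cast hq.ne'
  have h := Nat.totient_eq_mul_prod_factors q
  have h2 := congrArg (fun x : ℚ => (x : ℂ)) h
  push_cast at h2
  rw [h2, mul_div_cancel_left₀ _ hc, phiFac]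
  exact prod_congr rfl fun p _ => by rw [Complex.cpow_one, one_div]

lemma phiFac_ofReal (hq : 0 < q) (a : ℝ) :
    phiFac q a = (phiGen a q : ℂ) / (((q : ℝ) ^ a : ℝ) : ℂ) := by
  have hc : (((q : ℝ) ^ a : ℝ) : ℂ) ≠ 0 := by
    exact_mod_cast (Real.rpow_pos_of_pos (by exact_mod_cast hq) _).ne'
  rw [phiGen, Complex.ofReal_mul, mul_div_cancel_left₀ _ hc, phiFac, Complex.ofReal_prod]
  refine prod_congr rfl fun p _ => ?_
  push_cast
  rw [Complex.ofReal_cpow (Nat.cast_nonneg _), Complex.ofReal_natCast]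

/-- On the integers coprime to `q`, the function `μ ^ 2 f` is multiplicative with the value
`liftF f α q p / p ^ α` at a prime `p`. -/
lemma sqfreeSum_eq (hf : f.IsMultiplicative) (X : ℝ) :
    sqfreeSum f q X = sumPow (mulArith (sqPow (liftF f α q))) α X := by
  let u : ℕ → ℂ := fun n => if n.Coprime q then
    ((ArithmeticFunction.moebius n : ℤ) : ℂ) ^ 2 * f n * (((n : ℝ) ^ α : ℝ) : ℂ) else 0
  have hu : ∀ n, n ≠ 0 → u n = mulExt (sqPow (liftF f α q)) n := by
    intro n hn
    refine eq_mulExt (f := u) ?_ ?_ ?_ hn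
    · simp [u, hf.map_one]
    · intro m n h
      simp only [u, Nat.coprime_mul_iff_left]
      by_cases h1 : m.Coprime q
      · by_cases h2 : n.Coprime q
        · rw [if_pos ⟨h1, h2⟩, if_pos h1, if_pos h2,
            ArithmeticFunction.isMultiplicative_moebius.map_mul_of_coprime h,
            hf.map_mul_of_coprime h]
          push_cast
          rw [Real.mul_rpow (Nat.cast_nonneg _) (Nat.cast_nonneg _)]
          push_cast; ring
        · rw [if_neg fun h => h2 h.2, if_neg h2, mul_zero]
      · rw [if_neg fun h => h1 h.1, if_neg h1, zero_mul]
    · intro p k hp hk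
      simp only [u, sqPow]
      by_cases h1 : k = 1
      · subst h1
        rw [if_pos rfl, pow_one, ArithmeticFunction.moebius_apply_prime hp]
        by_cases h2 : p ∣ q
        · rw [liftF_of_dvd f α h2, if_neg fun h => (hp.coprime_iff_not_dvd.1 h) h2]
        · rw [liftF_of_not_dvd f α h2, if_pos (hp.coprime_iff_not_dvd.2 h2)]
          push_cast; ring
      · rw [ArithmeticFunction.moebius_apply_prime_pow hp hk, if_neg h1, if_neg h1]
        simp
  rw [sqfreeSum, sum_filter, sumPow]
  refine sum_congr (by ext; simp [Nat.one_le_iff_ne_zero, Nat.pos_iff_ne_zero]) fun n hn => ?_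
  have hn0 : n ≠ 0 := by
    have := (mem_Ioc.1 hn).1
    omega
  have h0 : (((n : ℝ) ^ α : ℝ) : ℂ) ≠ 0 := by
    exact_mod_cast (Real.rpow_pos_of_pos (by exact_mod_cast Nat.pos_of_ne_zero hn0) _).ne'
  rw [wt_apply, mulArith_apply, ← hu n hn0]
  simp only [u]
  split_ifs
  · rw [mul_div_cancel_right₀ _ h0]
  · rw [zero_div]

/-- The sum with exponent `α` in terms of the logarithmic one. -/
lemma sumPow_eq_sum_wt_one (g : ArithmeticFunction ℂ) (X : ℝ) : sumPow g α X
    = ∑ n ∈ Ioc 0 ⌊X⌋₊, wt g 1 n * (((n : ℝ) ^ (1 - α) : ℝ) : ℂ) := by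
  refine sum_congr rfl fun n hn => ?_
  have hn0 : (0 : ℝ) < n := by exact_mod_cast (mem_Ioc.1 hn).1
  have hc : (n : ℂ) ≠ 0 := by exact_mod_cast (mem_Ioc.1 hn).1.ne'
  rw [wt_apply, wt_apply, Real.rpow_sub hn0, Real.rpow_one]
  push_cast
  field_simp

end

section

variable {f : ArithmeticFunction ℂ} {α : ℝ} {q : ℕ}

/-! ### The main terms of the theorem -/

lemma hasProd_eulerFactorH (hq : 0 < q)
    (hd : Summable fun p : Nat.Primes => dev f α p / √((p : ℕ) : ℝ)) {s : ℝ}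
    (hs : 1 / 2 < s + α) :
    HasProd (eulerFactorH f α q s) (LSeries (mulExt (hPow (liftF f α q) q)) ((s + α : ℝ) : ℂ)) := by
  simp_rw [show eulerFactorH f α q s = _ from funext (eulerFactorH_eq f α s)]
  exact hasProd_one_add_hDev q (summable_liftF hq hd) (by rwa [Complex.ofReal_re])

lemma hasProd_eulerFactorH' (hq : 0 < q)
    (hd : Summable fun p : Nat.Primes => dev f α p / √((p : ℕ) : ℝ)) :
    HasProd (eulerFactorH' f α q) (LSeries (mulExt (hPow (liftF f α q) q)) 1) := by
  simp_rw [show eulerFactorH' f α q = _ from funext (eulerFactorH'_eq f α)]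
  exact hasProd_one_add_hDev q (summable_liftF hq hd) (by norm_num)

/-- The coefficient of the main terms for `α ≤ 1 / 2`; the product `eulerH' f α q` is the value at `1` of
the Dirichlet series of `h`. -/
lemma eulerH'_mul_totient (hq : 0 < q)
    (hd : Summable fun p : Nat.Primes => dev f α p / √((p : ℕ) : ℝ)) :
    eulerH' f α q * (q.totient : ℂ) / (q : ℂ) = kFun (liftF f α q) q 1 := by
  rw [kFun, ← (hasProd_eulerFactorH' hq hd).tprod_eq, phiFac_one_eq hq, eulerH']
  ring

lemma summable_logTerm (hq : 0 < q)
    (hd : Summable fun p : Nat.Primes => dev f α p / √((p : ℕ) : ℝ)) :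
    Summable (logTerm f α q) := by
  have h := LSeriesSummable_logMul_of_lt_re (s := 1) (abscissa_lt_of_summable
    (lseriesSummable_hPow (summable_liftF hq hd) q (s := (3 / 4 : ℝ))
      (by rw [Complex.ofReal_re]; norm_num)) (by rw [Complex.ofReal_re]; norm_num))
  exact h.congr fun d => (logTerm_eq f α d).symm

lemma tsum_logTerm :
    ∑' d, logTerm f α q d = LSeries (LSeries.logMul (mulExt (hPow (liftF f α q) q))) 1 :=
  tsum_congr fun d => logTerm_eq f α d

lemma liftF_eq_zero (p : ℕ) (_ : p.Prime) (h : p ∣ q) : liftF f α q p = 0 := liftF_of_dvd f α h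

lemma mainTerm_of_ne_one (hq : 0 < q)
    (hd : Summable fun p : Nat.Primes => dev f α p / √((p : ℕ) : ℝ)) (hα : 1 / 2 < α)
    (hα1 : α ≠ 1) {X : ℝ} (hX : 0 < X) :
    mainTerm f α q X = riemannZeta α * kFun (liftF f α q) q α
      - kFun (liftF f α q) q 1 / (α - 1) * ((X ^ (1 - α) : ℝ) : ℂ) := by
  have h1 := (hasProd_eulerFactorH hq hd (s := 0) (by linarith)).tprod_eq
  have h2 := (hasProd_eulerFactorH hq hd (s := 1 - α) (by linarith)).tprod_eq
  rw [zero_add] at h1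
  rw [sub_add_cancel, Complex.ofReal_one] at h2
  have h3 : ((X ^ (1 - α) : ℝ) : ℂ) = 1 / ((X ^ (α - 1) : ℝ) : ℂ) := by
    rw [← neg_sub α 1, Real.rpow_neg hX.le]; push_cast; rw [one_div]
  rw [mainTerm, if_neg hα1, kFun, kFun, ← h1, ← h2, phiFac_one_eq hq, phiFac_ofReal hq, h3,
    eulerH, eulerH]
  generalize (α : ℂ) - 1 = t
  ring

lemma mainTerm_one (hq : 0 < q)
    (hd : Summable fun p : Nat.Primes => dev f 1 p / √((p : ℕ) : ℝ)) {X : ℝ} :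
    mainTerm f 1 q X = kFun (liftF f 1 q) q 1 * (Real.log X : ℂ) + kConst (liftF f 1 q) q := by
  have hF := summable_liftF hq hd
  rw [mainTerm, if_pos rfl]
  split_ifs with h
  · have h' : ∃ p : PrimesNotDvd q, liftF f 1 q p.1 = -(p.1 : ℂ) := by
      obtain ⟨p, hp⟩ := h
      exact ⟨p, (liftF_one_eq_iff f p).2 hp⟩
    rw [kFun_one_of_eq q hF h', kConst_of_eq q hF h', tsum_logTerm, phiFac_one_eq hq]
    ring
  · have h' : ∀ p : PrimesNotDvd q, liftF f 1 q p.1 ≠ -(p.1 : ℂ) := fun p hp =>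
      h ⟨p, (liftF_one_eq_iff f p).1 hp⟩
    have h1 := (hasProd_eulerFactorH hq hd (s := 0) (by norm_num)).tprod_eq
    rw [zero_add, Complex.ofReal_one] at h1
    rw [kConst_of_ne q hF h', kFun, ← h1, phiFac_one_eq hq, eulerH,
      tsum_congr fun p => termT_eq f p]
    ring

lemma constC_eq (hq : 0 < q)
    (hd : Summable fun p : Nat.Primes => dev f (1 / 2) p / √((p : ℕ) : ℝ)) :
    constC f q = ‖kConst (liftF f (1 / 2) q) q - kFun (liftF f (1 / 2) q) q 1 / (1 / 2 : ℝ)‖ := by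
  have hF := summable_liftF hq hd
  rw [constC]
  split_ifs with h
  · have h' : ∃ p : PrimesNotDvd q, liftF f (1 / 2) q p.1 = -(p.1 : ℂ) := by
      obtain ⟨p, hp⟩ := h
      exact ⟨p, (liftF_half_eq_iff f p).2 hp⟩
    rw [kFun_one_of_eq q hF h', kConst_of_eq q hF h', tsum_logTerm, phiFac_one_eq hq, zero_div,
      sub_zero, norm_neg]
  · have h' : ∀ p : PrimesNotDvd q, liftF f (1 / 2) q p.1 ≠ -(p.1 : ℂ) := fun p hp =>
      h ⟨p, (liftF_half_eq_iff f p).1 hp⟩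
    rw [kConst_of_ne q hF h', eulerH'_mul_totient hq hd, tsum_congr fun p => termC_eq f p]
    congr 1
    push_cast
    ring

/-- The estimate for `α > 1 / 2`. -/
lemma norm_sqfreeSum_sub_mainTerm_le (hq : 0 < q) (hf : f.IsMultiplicative)
    (hd : Summable fun p : Nat.Primes => dev f α p / √((p : ℕ) : ℝ)) (hα : 1 / 2 < α) {X : ℝ}
    (hX : 0 < X) : ‖sqfreeSum f q X - mainTerm f α q X‖
      ≤ prodDvd f α q * (weight α f α q * prodP f α / X ^ (α - 1 / 2)) := by
  have hF := summable_liftF hq hd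
  rw [← mul_div_assoc, le_div_iff₀ (Real.rpow_pos_of_pos hX _), ← mul_assoc, sqfreeSum_eq f α hf,
    ← errW_mul_tsum hq hd]
  rcases eq_or_ne α 1 with rfl | hα1
  · rw [mainTerm_one hq hd]
    have h := norm_sumPow_one_sub_le hF hq liftF_eq_zero hX
    rw [Real.sqrt_eq_rpow] at h
    rwa [show (1 : ℝ) - 1 / 2 = 1 / 2 by norm_num]
  · rw [mainTerm_of_ne_one hq hd hα hα1 hX]
    exact norm_sumPow_sub_le_of_ne_one hF hq liftF_eq_zero hα hα1 hX

/-- The estimate with exponent `1`, in the form that partial summation requires. -/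
lemma norm_errC_le (hq : 0 < q)
    (hd : Summable fun p : Nat.Primes => dev f α p / √((p : ℕ) : ℝ)) {X : ℝ} (hX : 0 < X) :
    ‖errC (wt (mulArith (sqPow (liftF f α q))) 1) (kFun (liftF f α q) q 1)
        (kConst (liftF f α q) q) X‖ * √X
      ≤ prodDvd f α q * weight 1 f α q * prodP f α := by
  rw [← errW_mul_tsum hq hd]
  exact norm_sumPow_one_sub_le (summable_liftF hq hd) hq liftF_eq_zero hX

lemma mainTerm'_eq (hq : 0 < q)
    (hd : Summable fun p : Nat.Primes => dev f α p / √((p : ℕ) : ℝ)) (X : ℝ) :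
    mainTerm' f α q X
      = kFun (liftF f α q) q 1 / ((1 - α : ℝ) : ℂ) * ((X ^ (1 - α) : ℝ) : ℂ) := by
  rw [mainTerm', ← eulerH'_mul_totient hq hd]
  push_cast
  rw [div_div, mul_comm (1 - (α : ℂ))]

end

end

end SquarefreeAverage

theorem theorem4p4 (q : ℕ) (hq : 0 < q) (α β : ℝ) (hβ : α < β) (hαβ : 1 / 2 < β - α)
    (f : ArithmeticFunction ℂ) (hf : f.IsMultiplicative)
    (hfp : ∃ K : ℝ, ∀ p : ℕ, p.Prime → p.Coprime q →
      ‖f p - ((1 / (p : ℝ) ^ α : ℝ) : ℂ)‖ ≤ K * (1 / (p : ℝ) ^ β)) :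
    -- convergence of the product `P_α`
    Multipliable (factorP f α) ∧
    -- part (A)
    (1 / 2 < α →
      -- convergence of the products and series in the main term
      Multipliable (eulerFactorH f α q 0) ∧
      Multipliable (eulerFactorH f α q (1 - α)) ∧
      (α = 1 → Summable (logTerm f 1 q)) ∧
      (α = 1 → (∀ p : PrimesNotDvd q, f p.1 ≠ -1) → Summable (termT f q)) ∧
      -- the estimate
      ∀ X : ℝ, 0 < X →
        ‖sqfreeSum f q X - mainTerm f α q X‖ ≤
          prodDvd f α q * (weight α f α q * prodP f α / X ^ (α - 1 / 2))) ∧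
    -- part (B)
    (α < 1 / 2 →
      Multipliable (eulerFactorH' f α q) ∧
      ∀ X : ℝ, 0 < X →
        ‖sqfreeSum f q X - mainTerm' f α q X‖ ≤
          prodDvd f α q * (1 + (2 - 2 * α) / (1 - 2 * α)) * weight 1 f α q * prodP f α
            * X ^ (1 / 2 - α)) ∧
    -- part (C)
    (α = 1 / 2 →
      Multipliable (eulerFactorH' f α q) ∧
      Summable (logTerm f α q) ∧
      ((∀ p : PrimesNotDvd q, f p.1 ≠ -(√(p.1 : ℝ) : ℂ)) → Summable (termC f q)) ∧
      ∀ X : ℝ, 1 ≤ X →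
        ‖sqfreeSum f q X - mainTerm' f α q X‖ ≤
          constC f q + prodDvd f α q * weight 1 f α q * prodP f α
            * (1 + 1 / 2 * Real.log X)) := by
  have hd := summable_dev hq hαβ hfp
  have hF := summable_liftF hq hd
  refine ⟨multipliable_factorP hd, fun hα => ⟨?_, ?_, ?_, ?_, ?_⟩, fun hα => ⟨?_, ?_⟩,
    fun hα => ⟨?_, ?_, ?_, ?_⟩⟩
  · exact (hasProd_eulerFactorH hq hd (by linarith)).multipliable
  · exact (hasProd_eulerFactorH hq hd (by linarith)).multipliable
  · rintro rfl
    exact summable_logTerm hq hd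
  · rintro rfl -
    exact (summable_logTermF q hF).congr fun p => (termT_eq f p).symm
  · intro X hX
    exact norm_sqfreeSum_sub_mainTerm_le hq hf hd hα hX
  · exact (hasProd_eulerFactorH' hq hd).multipliable
  · intro X hX
    -- partial summation from the exponent `1` to the exponent `α = 1 - b`
    have h := norm_sum_mul_rpow_sub_le (b := 1 - α) (by linarith)
      (fun X hX => norm_errC_le hq hd hX) hX
    rw [← sumPow_eq_sum_wt_one, ← mainTerm'_eq hq hd, ← sqfreeSum_eq f α hf] at h
    have e1 : (1 - α) / (1 - α - 1 / 2) = (2 - 2 * α) / (1 - 2 * α) := by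
      rw [div_eq_div_iff (by linarith) (by linarith)]
      ring
    have e2 : 1 - α - 1 / 2 = 1 / 2 - α := by ring
    rw [e1, e2] at h
    refine h.trans (le_of_eq ?_)
    ring
  · exact (hasProd_eulerFactorH' hq hd).multipliable
  · exact summable_logTerm hq hd
  · intro _
    subst hα
    exact (summable_logTermF q hF).congr fun p => (termC_eq f p).symm
  · intro X hX
    subst hα
    have h := norm_sum_mul_sqrt_sub_le (fun X hX => norm_errC_le hq hd hX) hX
    have e : (1 : ℝ) - 1 / 2 = 1 / 2 := by norm_num
    have e1 := sumPow_eq_sum_wt_one (1 / 2) (mulArith (sqPow (liftF f (1 / 2) q))) X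
    have e2 := mainTerm'_eq hq hd X
    rw [e] at e1 e2
    rw [← e1, ← e2, ← sqfreeSum_eq f (1 / 2) hf, ← constC_eq hq hd] at h
    exact h
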